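/- **Setting.** A target sample $y^{(0)}=X^{(0)}\beta^{(0)}+\epsilon^{(0)}$ of size $n_T$ and $K\ge 1$ source samples $y^{(k)}=X^{(k)}\beta^{(k)}+\epsilon^{(k)}$ of size $n_S$ are observed, with $p\ge 2$ covariates; $N=Kn_S+n_T$. For some integer $s\ge 1$ and numbers $h_k$, $\|\beta^{(0)}\|_0\le s$ and $\|\beta^{(k)}-\beta^{(0)}\|_1\le h_k$ for $1\le k\le K$; put $\bar h=\frac{n_S}{N}\sum_{k=1}^K h_k$. For every $0\le k\le K$ the rows of $X^{(k)}$ are independent, centered, sub-Gaussian with a fixed variance proxy $L$ in every unit direction, and have a covariance matrix $\Sigma^{(k)}$ with eigenvalues in $[1/c,c]$. All the noise variables $\epsilon^{(k)}_i$ $(0\le k\le K)$ are mutually independent centered Gaussians with variances at most $V$, and are independent of the designs. **Estimator.** With parameters $\tilde\lambda_k,\mu_k,\lambda_0,a_k,\tilde\lambda>0$: (i) each source $k$ computes a lasso $\hat\beta^{(k)}_L\in\arg\min_b\{\frac1{2n_S}\|y^{(k)}-X^{(k)}b\|_2^2+\tilde\lambda_k\|b\|_1\}$, a matrix $\hat\Theta^{(k)}$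 whose $j$-th row minimizes $\theta^\top\hat\Sigma^{(k)}\theta$ subject to $\|\hat\Sigma^{(k)}\theta-e_j\|_\infty\le\mu_k$, where $\hat\Sigma^{(k)}=X^{(k)\top}X^{(k)}/n_S$, and $\tilde\beta^{(k)}=\hat\beta^{(k)}_L+\frac1{n_S}\hat\Theta^{(k)}X^{(k)\top}(y^{(k)}-X^{(k)}\hat\beta^{(k)}_L)$; (ii) the target node takes a minimizer $(\hat b^{(0)},\dots,\hat b^{(K)})$ of $\frac1{2N}\sum_{k=1}^K n_S\|\tilde\beta^{(k)}-b^{(k)}\|_2^2+\frac1{2N}\|y^{(0)}-X^{(0)}b^{(0)}\|_2^2+\lambda_0\big(\|b^{(0)}\|_1+\sum_{k=1}^K a_k\|b^{(k)}-b^{(0)}\|_1\big)$ and puts $\hat w=\frac{n_S}{N}\sum_{k=1}^K\hat b^{(k)}+\frac{n_T}{N}\hat b^{(0)}$; (iii) it takes $\hat\delta\in\arg\min_\delta\{\frac1{2n_T}\|y^{(0)}-X^{(0)}\hat w-X^{(0)}\delta\|_2^2+\tilde\lambda\|\delta\|_1\}$ and outputs $\hat\beta_D=\hat w+\hat\delta$.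 **Tuning.** Let $A$ be the condition $s\log p/n_S\ge\bar h\sqrt{\log p/n_T}$, $\delta_k=\frac{s\log p}{N}+\frac{n_S}{N}\sqrt{\frac{\log p}{n_S}}\,h_k$ and $\delta_0=\frac{Ks\log p}{N}+\sqrt{\frac{\log p}{n_S}}\,\bar h$. For constants $c_0,c_1$ take $\tilde\lambda_k=\mu_k=c_1\sqrt{\log p/n_S}$, $\tilde\lambda=c_1\sqrt{\log p/n_T}$, $$\lambda_0=c_0\Big(\sqrt{\tfrac{\log p}{N}}\,1_A+\sqrt{\tfrac{\log p}{n_S}}\,1_{A^c}+\delta_0\Big),\qquad a_k\lambda_0=c_0\Big(8\vee\frac{\bar h}{h_k}\Big)\Big(\sqrt{\tfrac{n_S}{N}\tfrac{\log p}{N}}+\delta_k\Big),$$ where $8\vee(\bar h/h_k)$ is read as $8$ if all the $h_k$ are $0$. **Theorem.** For all $c,L,V$ and all $\kappa_1,\kappa_2,\kappa_3>0$ there are positive constants $\varepsilon,c_0,c_1,C,c_2,c_3$ such that the following holds for all $K,p,n_T,n_S,s,(h_k)$ and all models as above. If $n_T\le n_S$, $Ks^2\log p\le\varepsilon n_S$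 (that is, $n_S\gg Ks^2\log p$), $n_S\ge\kappa_1(\bar h^2\vee K^2)s\log p$, $h_k\le\kappa_2\bar h$ and $\bar h\le\kappa_2h_k$ for all $k$, $n_T\ge\kappa_3 s\log p$, and $\bar h\sqrt{\log p/n_T}\le\varepsilon$ (that is, $\bar h\sqrt{\log p/n_T}=o(1)$), then, except on an event of probability at most $c_2\exp(-c_3\log p)$, the D-TransFusion estimator exists and every version of it (every choice of minimizers) satisfies $$\|\hat\beta_D-\beta^{(0)}\|_2^2\le C\Big(\frac{s\log p}{N}+\sqrt{\frac{\log p}{n_T}}\,\bar h\Big).$$ -/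

import Mathlib

open MeasureTheory ProbabilityTheory
open scoped Matrix NNReal ENNReal

noncomputable section

namespace DTransFusion

/-! ### Vectors and the lasso -/

/-- The `ℓ₁` norm of a vector. -/
def l1 {p : ℕ} (v : Fin p → ℝ) : ℝ := ∑ j, |v j|

/-- The squared Euclidean norm of a vector. -/
def sqNorm {m : ℕ} (v : Fin m → ℝ) : ℝ := ∑ j, v j ^ 2

/-- The number of nonzero entries of a vector. -/
def l0 {p : ℕ} (v : Fin p → ℝ) : ℕ := Set.ncard {j | v j ≠ 0}

/-- The lasso objective `‖y - X b‖₂² / (2 n) + lam ‖b‖₁`. -/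
def lassoObj {n p : ℕ} (X : Matrix (Fin n) (Fin p) ℝ) (y : Fin n → ℝ) (lam : ℝ)
    (b : Fin p → ℝ) : ℝ :=
  1 / (2 * (n : ℝ)) * sqNorm (y - X *ᵥ b) + lam * l1 b

/-- `b` is a global minimizer of the lasso objective. -/
def IsLasso {n p : ℕ} (X : Matrix (Fin n) (Fin p) ℝ) (y : Fin n → ℝ) (lam : ℝ)
    (b : Fin p → ℝ) : Prop :=
  IsMinOn (lassoObj X y lam) Set.univ b

/-! ### The debiased lasso computed by a source node -/

/-- The sample covariance matrix `Xᵀ X / n`. -/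
def sampleCov {n p : ℕ} (X : Matrix (Fin n) (Fin p) ℝ) : Matrix (Fin p) (Fin p) ℝ :=
  (1 / (n : ℝ)) • (Xᵀ * X)

/-- The constraint `‖S θ - e_j‖_∞ ≤ mu`. -/
def debiasFeasible {p : ℕ} (S : Matrix (Fin p) (Fin p) ℝ) (mu : ℝ) (j : Fin p) :
    Set (Fin p → ℝ) :=
  {θ | ∀ i, |(S *ᵥ θ) i - (Pi.single j 1 : Fin p → ℝ) i| ≤ mu}

/-- `Θ` is an approximate inverse of `S`: its `j`-th row minimizes `θᵀ S θ` subject to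
`‖S θ - e_j‖_∞ ≤ mu`, for every `j`. -/
def IsApproxInverse {p : ℕ} (S : Matrix (Fin p) (Fin p) ℝ) (mu : ℝ)
    (Θ : Matrix (Fin p) (Fin p) ℝ) : Prop :=
  ∀ j, Θ j ∈ debiasFeasible S mu j ∧
    IsMinOn (fun θ : Fin p → ℝ => θ ⬝ᵥ (S *ᵥ θ)) (debiasFeasible S mu j) (Θ j)

/-- `bt` is a debiased lasso estimator, with lasso parameter `lam` and constraint parameter
`mu`: `bt = bL + Θ Xᵀ (y - X bL) / n`. -/
def IsDebiasedLasso {n p : ℕ} (X : Matrix (Fin n) (Fin p) ℝ) (y : Fin n → ℝ) (lam mu : ℝ)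
    (bt : Fin p → ℝ) : Prop :=
  ∃ (bL : Fin p → ℝ) (Θ : Matrix (Fin p) (Fin p) ℝ),
    IsLasso X y lam bL ∧ IsApproxInverse (sampleCov X) mu Θ ∧
      bt = bL + (1 / (n : ℝ)) • (Θ *ᵥ (Xᵀ *ᵥ (y - X *ᵥ bL)))

/-! ### The two-step distributed estimator -/

/-- The total sample size `N = K n_S + n_T`. -/
def total (K nT nS : ℕ) : ℝ := (K : ℝ) * nS + nT

/-- The objective of the first step, as a function of
`b = (b⁽⁰⁾, (b⁽¹⁾, …, b⁽ᴷ⁾))`: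
`∑ₖ ‖√n_S (b̃⁽ᵏ⁾ - b⁽ᵏ⁾)‖₂² / (2N) + ‖y⁽⁰⁾ - X⁽⁰⁾ b⁽⁰⁾‖₂² / (2N)
  + lam₀ (‖b⁽⁰⁾‖₁ + ∑ₖ aₖ ‖b⁽ᵏ⁾ - b⁽⁰⁾‖₁)`. -/
def fusedObj {K p nT : ℕ} (nS : ℕ) (X0 : Matrix (Fin nT) (Fin p) ℝ) (y0 : Fin nT → ℝ)
    (bt : Fin K → Fin p → ℝ) (lam0 : ℝ) (a : Fin K → ℝ)
    (b : (Fin p → ℝ) × (Fin K → Fin p → ℝ)) : ℝ :=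
  1 / (2 * total K nT nS) * ∑ k, sqNorm (√(nS : ℝ) • (bt k - b.2 k))
    + 1 / (2 * total K nT nS) * sqNorm (y0 - X0 *ᵥ b.1)
    + lam0 * (l1 b.1 + ∑ k, a k * l1 (b.2 k - b.1))

/-- The first-step estimator `(n_S/N) ∑ₖ b⁽ᵏ⁾ + (n_T/N) b⁽⁰⁾`. -/
def weightedAvg {K p : ℕ} (nT nS : ℕ) (b : (Fin p → ℝ) × (Fin K → Fin p → ℝ)) : Fin p → ℝ :=
  ((nS : ℝ) / total K nT nS) • ∑ k, b.2 k + ((nT : ℝ) / total K nT nS) • b.1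

/-- `out` is an output of the two-step distributed procedure on the target sample `(X0, y0)` and
the source samples `(X k, y k)`, with parameters `lamS` (lasso on the source nodes), `mu`
(approximate inverses on the source nodes), `lam0`, `a` (fused step) and `lamT`
(correction on the target sample). -/
def IsOutput {K p nT nS : ℕ} (X0 : Matrix (Fin nT) (Fin p) ℝ) (y0 : Fin nT → ℝ)
    (X : Fin K → Matrix (Fin nS) (Fin p) ℝ) (y : Fin K → Fin nS → ℝ)
    (lamS mu lam0 : ℝ) (a : Fin K → ℝ) (lamT : ℝ) (out : Fin p → ℝ) : Prop :=
  ∃ (bt : Fin K → Fin p → ℝ) (b : (Fin p → ℝ) × (Fin K → Fin p → ℝ)) (δ : Fin p → ℝ),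
    (∀ k, IsDebiasedLasso (X k) (y k) lamS mu (bt k)) ∧
    IsMinOn (fusedObj nS X0 y0 bt lam0 a) Set.univ b ∧
    IsLasso X0 (y0 - X0 *ᵥ weightedAvg nT nS b) lamT δ ∧
    out = weightedAvg nT nS b + δ

/-! ### Tuning parameters -/

/-- `h̄ = (n_S/N) ∑ₖ hₖ`. -/
def hbar {K : ℕ} (nT nS : ℕ) (h : Fin K → ℝ) : ℝ :=
  (nS : ℝ) / total K nT nS * ∑ k, h k

/-- `δₖ = s log p / N + (n_S/N) √(log p / n_S) hₖ`. -/
def deltaS {K : ℕ} (p nT nS s : ℕ) (h : Fin K → ℝ) (k : Fin K) : ℝ :=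
  s * Real.log p / total K nT nS + (nS : ℝ) / total K nT nS * √(Real.log p / nS) * h k

/-- `δ₀ = K s log p / N + √(log p / n_S) h̄`. -/
def deltaT {K : ℕ} (p nT nS s : ℕ) (h : Fin K → ℝ) : ℝ :=
  K * s * Real.log p / total K nT nS + √(Real.log p / nS) * hbar nT nS h

/-- The condition `A = {s log p / n_S ≥ h̄ √(log p / n_T)}`. -/
def condA {K : ℕ} (p nT nS s : ℕ) (h : Fin K → ℝ) : Prop :=
  hbar nT nS h * √(Real.log p / nT) ≤ s * Real.log p / nS

open Classical in
/-- `lam₀ = c₀ (√(log p / N) 1_A + √(log p / n_S) 1_{Aᶜ} + δ₀)`. -/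
def tuneLam {K : ℕ} (c₀ : ℝ) (p nT nS s : ℕ) (h : Fin K → ℝ) : ℝ :=
  c₀ * ((if condA p nT nS s h then √(Real.log p / total K nT nS) else √(Real.log p / nS))
    + deltaT p nT nS s h)

/-- The weight `aₖ`, determined by
`aₖ lam₀ = c₀ max(8, h̄/hₖ) (√((n_S/N) (log p / N)) + δₖ)`. If `hₖ = 0`, the theorem is only
concerned with the case `h̄ = 0`, and then the maximum is read as `8`. -/
def tuneWeight {K : ℕ} (c₀ : ℝ) (p nT nS s : ℕ) (h : Fin K → ℝ) (k : Fin K) : ℝ :=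
  c₀ * max 8 (hbar nT nS h / h k)
      * (√((nS : ℝ) / total K nT nS * (Real.log p / total K nT nS)) + deltaS p nT nS s h k)
    / tuneLam c₀ p nT nS s h

/-! ### Distributional assumptions -/

/-- The rows of the random `n × p` design `x` are independent, centered, sub-Gaussian with
variance proxy `L` in every direction, and have covariance matrix `S`, whose eigenvalues lie in
`[1/c, c]`. -/
structure SubGaussianDesign {Ω : Type*} [MeasurableSpace Ω] (μ : Measure Ω) {n p : ℕ}
    (x : Ω → Fin n → Fin p → ℝ) (S : Matrix (Fin p) (Fin p) ℝ) (L : ℝ≥0) (c : ℝ) : Prop where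
  measurable : Measurable x
  indep : iIndepFun (fun (i : Fin n) (ω : Ω) => x ω i) μ
  subGaussian : ∀ (i : Fin n) (u : Fin p → ℝ), sqNorm u = 1 →
    HasSubgaussianMGF (fun ω => x ω i ⬝ᵥ u) L μ
  mean_zero : ∀ i j, ∫ ω, x ω i j ∂μ = 0
  covariance_eq : ∀ i j l, covariance (fun ω => x ω i j) (fun ω => x ω i l) μ = S j l
  eigenvalues_mem : ∀ r ∈ spectrum ℝ S, 1 / c ≤ r ∧ r ≤ c

/-- The noise variables of all tasks are mutually independent centered Gaussians, with variances
at most `V`, and the noise is independent of the designs. -/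
structure GaussianErrors {Ω : Type*} [MeasurableSpace Ω] (μ : Measure Ω) {K p nT nS : ℕ}
    (x0 : Ω → Fin nT → Fin p → ℝ) (x : Fin K → Ω → Fin nS → Fin p → ℝ)
    (e0 : Ω → Fin nT → ℝ) (e : Fin K → Ω → Fin nS → ℝ) (V : ℝ≥0) : Prop where
  measurable_target : Measurable e0
  measurable_source : ∀ k, Measurable (e k)
  law_target : ∀ i, ∃ v : ℝ≥0, v ≤ V ∧ HasLaw (fun ω => e0 ω i) (gaussianReal 0 v) μ
  law_source : ∀ k i, ∃ v : ℝ≥0, v ≤ V ∧ HasLaw (fun ω => e k ω i) (gaussianReal 0 v) μ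
  indep : iIndepFun (β := fun _ : Fin nT ⊕ (Fin K × Fin nS) => ℝ)
    (Sum.elim (fun (i : Fin nT) (ω : Ω) => e0 ω i)
      (fun (ki : Fin K × Fin nS) (ω : Ω) => e ki.1 ω ki.2)) μ
  indep_design : IndepFun (fun ω => (e0 ω, fun k => e k ω)) (fun ω => (x0 ω, fun k => x k ω)) μ

end DTransFusion

end

noncomputable section

namespace DTransFusion

/-! ### Elementary facts on `ℓ₁` and `ℓ₂` norms -/

/-! Write w = n_S/N, d_k = β⁽ᵏ⁾ − β⁽⁰⁾, ζ_k = β̃⁽ᵏ⁾ − β⁽ᵏ⁾ and g = h̄. The fused step pools all N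
observations, so that ŵ is β⁽⁰⁾ + w ∑ d_k plus an error at the pooled rate. The bias w ∑ d_k has ℓ₁
norm at most g, and the last lasso removes it on the target sample at the price g √(log p / n_T).

Clipping. The fusion penalty λ₀a_k is calibrated to noise of size √(log p / n_S), whereas the
maximum over all Kp entries of the ζ_k is of order √(log(pK) / n_S), and K need not be polynomial in
p. So wζ_k is split into its truncation ρ_k at level λ₀a_k and an excess. In `fused_basic` the
minimizer is compared with a competitor that carries the excess along; by `clip_subgradient` the
excess then does no harm to the fusion penalty, which still pays (λ₀a_k − |ρ_kj|) |D_kj| for the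
contrast errors D_k.

Averaging. The quadratic loss sees the target error Δ₀ alone with the small weight n_T/N, so the
usual cone argument for Δ₀ would only give the rate of the target sample. `fused_error` runs it for
a coordinatewise weighted average u of the errors of all tasks: Jensen bounds ‖u‖₂² by the whole
quadratic loss, and ‖u − Δ₀‖₁ is charged to the fusion penalty. This needs averaging weights which
sum to 1, are comparable to n_S/N and n_T/N, and stay below a_k with some margin.
`exists_base_weights` finds them by mixing w with w h_k/g, and `exists_weights` deletes the few
pairs (k, j) whose noise eats up the margin.

Rates. `two_step_error` distinguishes g ≤ s √(log p / n_T), where the first step is already accurate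
and the correction only removes w ∑ d_k (`correction_error`), from g > s √(log p / n_T), where s log
p / n_T is below the target rate and the correction is a lasso for the approximately sparse vector
β⁽⁰⁾ − ŵ (`correction_error_sparse`).

Noise. The vector Xθ/n attached to a row θ of the approximate inverse does not depend on the chosen
minimizer and is a measurable function of the design (`measurable_debiasDir`). By independence the
designs can be frozen, and `noiseBound_of_fixed` treats Gaussian noise in fixed directions: the
clipped sums are sub-Gaussian because clipping is odd, the excess is controlled by its second
moment, and the bad pairs are counted by Markov's inequality.

Designs. For the target, Bernstein's inequality at sums of m signed basis vectors and Maurey's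
empirical method give restricted eigenvalues with an error (log p / n_T) ‖v‖₁²
(`SubGaussianDesign.restrictedBound_tail`). For the sources there are two regimes. If K ≤ p¹⁰, then
log(pK) is of order log p, all errors are small and nothing is clipped. If K > p¹⁰, then n_S ≥ κ₁K²
log p is so large compared with p that the source designs are well conditioned and the debiasing
bias is negligible; only the noise has to be clipped. The second regime needs p above a constant;
for smaller p the probability bound exceeds 1. -/

/-- The `ℓ₁` norm of the restriction of a vector to a set of coordinates. -/
def l1On {p : ℕ} (S : Finset (Fin p)) (v : Fin p → ℝ) : ℝ := ∑ j ∈ S, |v j|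

lemma l1_nonneg {p : ℕ} (v : Fin p → ℝ) : 0 ≤ l1 v := Finset.sum_nonneg fun _ _ => abs_nonneg _

lemma l1On_nonneg {p : ℕ} (S : Finset (Fin p)) (v : Fin p → ℝ) : 0 ≤ l1On S v :=
  Finset.sum_nonneg fun _ _ => abs_nonneg _

lemma l1_add_le {p : ℕ} (u v : Fin p → ℝ) : l1 (u + v) ≤ l1 u + l1 v := by
  unfold l1
  rw [← Finset.sum_add_distrib]
  exact Finset.sum_le_sum fun j _ => abs_add_le _ _

lemma l1_neg {p : ℕ} (v : Fin p → ℝ) : l1 (-v) = l1 v := by simp [l1]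

lemma l1_sub_le {p : ℕ} (u v : Fin p → ℝ) : l1 (u - v) ≤ l1 u + l1 v := by
  rw [sub_eq_add_neg, ← l1_neg v]; exact l1_add_le _ _

lemma l1_smul {p : ℕ} (c : ℝ) (v : Fin p → ℝ) : l1 (c • v) = |c| * l1 v := by
  simp [l1, abs_mul, Finset.mul_sum]

lemma l1_sum_le {p : ℕ} {ι : Type*} (s : Finset ι) (f : ι → Fin p → ℝ) :
    l1 (∑ k ∈ s, f k) ≤ ∑ k ∈ s, l1 (f k) := by
  unfold l1
  rw [Finset.sum_comm]
  refine Finset.sum_le_sum fun j _ => ?_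
  rw [Finset.sum_apply]
  exact Finset.abs_sum_le_sum_abs _ _

lemma l1On_add_l1On_compl {p : ℕ} (S : Finset (Fin p)) (v : Fin p → ℝ) :
    l1On S v + l1On Sᶜ v = l1 v := Finset.sum_add_sum_compl _ _

lemma l1On_le_l1 {p : ℕ} (S : Finset (Fin p)) (v : Fin p → ℝ) : l1On S v ≤ l1 v := by
  rw [← l1On_add_l1On_compl S v]; linarith [l1On_nonneg Sᶜ v]

lemma l1On_add_le {p : ℕ} (S : Finset (Fin p)) (u v : Fin p → ℝ) :
    l1On S (u + v) ≤ l1On S u + l1On S v := by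
  unfold l1On
  rw [← Finset.sum_add_distrib]
  exact Finset.sum_le_sum fun j _ => abs_add_le _ _

lemma l1On_neg {p : ℕ} (S : Finset (Fin p)) (v : Fin p → ℝ) : l1On S (-v) = l1On S v := by
  simp [l1On]

lemma sqNorm_nonneg {m : ℕ} (v : Fin m → ℝ) : 0 ≤ sqNorm v :=
  Finset.sum_nonneg fun _ _ => sq_nonneg _

lemma sqNorm_eq_dotProduct {m : ℕ} (v : Fin m → ℝ) : sqNorm v = v ⬝ᵥ v := by
  simp [sqNorm, dotProduct, sq]

lemma sqNorm_neg {m : ℕ} (v : Fin m → ℝ) : sqNorm (-v) = sqNorm v := by simp [sqNorm]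

lemma sqNorm_smul {m : ℕ} (c : ℝ) (v : Fin m → ℝ) : sqNorm (c • v) = c ^ 2 * sqNorm v := by
  simp [sqNorm, mul_pow, Finset.mul_sum]

lemma sqNorm_sub {m : ℕ} (u v : Fin m → ℝ) :
    sqNorm (u - v) = sqNorm u - 2 * (u ⬝ᵥ v) + sqNorm v := by
  simp only [sqNorm, dotProduct, Pi.sub_apply, Finset.mul_sum, ← Finset.sum_sub_distrib,
    ← Finset.sum_add_distrib]
  exact Finset.sum_congr rfl fun _ _ => by ring

lemma sqNorm_add {m : ℕ} (u v : Fin m → ℝ) :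
    sqNorm (u + v) = sqNorm u + 2 * (u ⬝ᵥ v) + sqNorm v := by
  simp only [sqNorm, dotProduct, Pi.add_apply, Finset.mul_sum, ← Finset.sum_add_distrib]
  exact Finset.sum_congr rfl fun _ _ => by ring

lemma sqNorm_add_le {m : ℕ} (u v : Fin m → ℝ) :
    sqNorm (u + v) ≤ 2 * sqNorm u + 2 * sqNorm v := by
  simp only [sqNorm, Finset.mul_sum, ← Finset.sum_add_distrib, Pi.add_apply]
  exact Finset.sum_le_sum fun j _ => by nlinarith [sq_nonneg (u j - v j)]

lemma sqNorm_eq_zero {m : ℕ} {v : Fin m → ℝ} : sqNorm v = 0 ↔ v = 0 := by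
  unfold sqNorm
  rw [Finset.sum_eq_zero_iff_of_nonneg fun _ _ => sq_nonneg _]
  simp [funext_iff]

lemma sqNorm_le_l1_sq {m : ℕ} (v : Fin m → ℝ) : sqNorm v ≤ l1 v ^ 2 := by
  have h := Finset.sum_sq_le_sq_sum_of_nonneg (s := Finset.univ) (f := fun j => |v j|)
    fun _ _ => abs_nonneg _
  simpa [sqNorm, l1] using h

lemma sq_l1On_le {p : ℕ} (S : Finset (Fin p)) (v : Fin p → ℝ) :
    l1On S v ^ 2 ≤ S.card * sqNorm v := by
  have h := sq_sum_le_card_mul_sum_sq (s := S) (f := fun j => |v j|)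
  simp only [sq_abs] at h
  refine h.trans (mul_le_mul_of_nonneg_left ?_ (Nat.cast_nonneg _))
  exact Finset.sum_le_sum_of_subset_of_nonneg (Finset.subset_univ _) fun _ _ _ => sq_nonneg _

lemma sq_l1_le {p : ℕ} (v : Fin p → ℝ) : l1 v ^ 2 ≤ p * sqNorm v := by
  simpa [l1, l1On] using sq_l1On_le Finset.univ v

lemma abs_dotProduct_le {p : ℕ} {g v : Fin p → ℝ} {M : ℝ} (hg : ∀ j, |g j| ≤ M) :
    |g ⬝ᵥ v| ≤ M * l1 v := by
  unfold dotProduct l1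
  rw [Finset.mul_sum]
  refine (Finset.abs_sum_le_sum_abs _ _).trans (Finset.sum_le_sum fun j _ => ?_)
  rw [abs_mul]
  exact mul_le_mul_of_nonneg_right (hg j) (abs_nonneg _)

lemma dotProduct_le_mul_l1 {p : ℕ} {g v : Fin p → ℝ} {M : ℝ} (hg : ∀ j, |g j| ≤ M) :
    g ⬝ᵥ v ≤ M * l1 v := (le_abs_self _).trans (abs_dotProduct_le hg)

/-- Decomposability of the `ℓ₁` norm, with an approximately sparse vector. -/
lemma l1_sub_l1_add_le {p : ℕ} (S : Finset (Fin p)) (b v : Fin p → ℝ) :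
    l1 b - l1 (b + v) ≤ l1On S v - l1On Sᶜ v + 2 * l1On Sᶜ b := by
  rw [← l1On_add_l1On_compl S b, ← l1On_add_l1On_compl S (b + v)]
  have h1 : l1On S b ≤ l1On S (b + v) + l1On S v := by
    have := l1On_add_le S (b + v) (-v)
    rwa [add_neg_cancel_right, l1On_neg] at this
  have h2 : l1On Sᶜ v ≤ l1On Sᶜ (b + v) + l1On Sᶜ b := by
    have := l1On_add_le Sᶜ (b + v) (-b)
    rwa [l1On_neg, add_comm b v, add_neg_cancel_right, add_comm v b] at this
  linarith

/-- A support set of a sparse vector. -/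
lemma exists_support {p s : ℕ} {b : Fin p → ℝ} (h : l0 b ≤ s) :
    ∃ S : Finset (Fin p), S.card ≤ s ∧ ∀ j ∉ S, b j = 0 := by
  classical
  refine ⟨Finset.univ.filter fun j => b j ≠ 0, ?_, fun j hj => by simpa using hj⟩
  rw [l0, Set.ncard_eq_toFinset_card'] at h
  simpa using h

lemma l1On_eq_zero {p : ℕ} {S : Finset (Fin p)} {b : Fin p → ℝ} (h : ∀ j ∉ S, b j = 0) :
    l1On Sᶜ b = 0 :=
  Finset.sum_eq_zero fun j hj => by simp [h j (Finset.mem_compl.1 hj)]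

/-! ### The lasso -/

section Lasso

variable {n p : ℕ} {X : Matrix (Fin n) (Fin p) ℝ}

/-- The empirical score `Xᵀ ε / n`. -/
def score (X : Matrix (Fin n) (Fin p) ℝ) (ε : Fin n → ℝ) : Fin p → ℝ :=
  (1 / (n : ℝ)) • (Xᵀ *ᵥ ε)

lemma score_dotProduct (X : Matrix (Fin n) (Fin p) ℝ) (ε : Fin n → ℝ) (v : Fin p → ℝ) :
    score X ε ⬝ᵥ v = 1 / (n : ℝ) * (ε ⬝ᵥ (X *ᵥ v)) := by
  rw [score, smul_dotProduct, Matrix.mulVec_transpose, ← Matrix.dotProduct_mulVec, smul_eq_mul]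

lemma lassoObj_le {y : Fin n → ℝ} {lam : ℝ} {b : Fin p → ℝ} (hb : IsLasso X y lam b)
    (b' : Fin p → ℝ) : lassoObj X y lam b ≤ lassoObj X y lam b' :=
  hb (Set.mem_univ b')

/-- The basic inequality of the lasso. -/
lemma lasso_basic {β b : Fin p → ℝ} {ε : Fin n → ℝ} {lam : ℝ}
    (hb : IsLasso X (X *ᵥ β + ε) lam b) :
    1 / (2 * (n : ℝ)) * sqNorm (X *ᵥ (b - β))
      ≤ score X ε ⬝ᵥ (b - β) + lam * (l1 β - l1 (β + (b - β))) := by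
  have h := lassoObj_le hb β
  unfold lassoObj at h
  have e1 : X *ᵥ β + ε - X *ᵥ b = ε - X *ᵥ (b - β) := by
    rw [Matrix.mulVec_sub]; abel
  rw [e1, add_sub_cancel_left, sqNorm_sub] at h
  rw [score_dotProduct, add_sub_cancel]
  have e2 : 1 / (n : ℝ) * (ε ⬝ᵥ (X *ᵥ (b - β)))
      = 1 / (2 * (n : ℝ)) * (2 * (ε ⬝ᵥ (X *ᵥ (b - β)))) := by
    rw [one_div, one_div, mul_inv]; ring
  rw [e2]
  linarith

/-- The cone inequality of the lasso for an approximately sparse coefficient. -/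
lemma lasso_cone {β b : Fin p → ℝ} {ε : Fin n → ℝ} {lam : ℝ} (S : Finset (Fin p))
    (hb : IsLasso X (X *ᵥ β + ε) lam b) (hz : ∀ j, |score X ε j| ≤ lam / 2) :
    1 / (2 * (n : ℝ)) * sqNorm (X *ᵥ (b - β)) + lam / 2 * l1On Sᶜ (b - β)
      ≤ 3 / 2 * lam * l1On S (b - β) + 2 * lam * l1On Sᶜ β := by
  -- The sign of `lam` is read off `hz` at some coordinate; without coordinates both vectors
  -- coincide.
  by_cases hp : Nonempty (Fin p)
  · obtain ⟨j0⟩ := hp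
    have hlam : 0 ≤ lam := by linarith [(abs_nonneg _).trans (hz j0)]
    have h1 := lasso_basic hb
    have h2 := dotProduct_le_mul_l1 (v := b - β) hz
    have h3 := mul_le_mul_of_nonneg_left (l1_sub_l1_add_le S β (b - β)) hlam
    rw [← l1On_add_l1On_compl S (b - β)] at h2
    linarith
  · have : IsEmpty (Fin p) := not_nonempty_iff.1 hp
    have e : b = β := Subsingleton.elim _ _
    subst e
    simp [l1On, sqNorm, Finset.eq_empty_of_isEmpty]

/-- The `ℓ₁` error of the lasso under a restricted eigenvalue condition. -/
lemma lasso_l1_error {β β0 b : Fin p → ℝ} {ε : Fin n → ℝ} {lam κ t h : ℝ} {s : ℕ}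
    (hb : IsLasso X (X *ᵥ β + ε) lam b) (hlam : 0 < lam) (hκ : 0 < κ) (ht : 0 ≤ t)
    (hz : ∀ j, |score X ε j| ≤ lam / 2)
    (hre : ∀ v : Fin p → ℝ, κ * sqNorm v - t * l1 v ^ 2 ≤ 1 / (n : ℝ) * sqNorm (X *ᵥ v))
    (hst : 128 * (s * t) ≤ κ) (hβ0 : l0 β0 ≤ s) (hβ : l1 (β - β0) ≤ h) :
    l1 (b - β) ≤ 112 * (s * lam) / κ + 8 * h := by
  obtain ⟨S, hS, hS0⟩ := exists_support hβ0
  set v := b - β with hv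
  have hcone := lasso_cone S hb hz
  rw [← hv] at hcone
  have hβS : l1On Sᶜ β ≤ h := by
    have h1 : l1On Sᶜ β ≤ l1On Sᶜ (β - β0) + l1On Sᶜ β0 := by
      simpa using l1On_add_le Sᶜ (β - β0) β0
    rw [l1On_eq_zero hS0] at h1
    linarith [l1On_le_l1 Sᶜ (β - β0)]
  have hh : 0 ≤ h := (l1_nonneg _).trans hβ
  have hq : 0 ≤ 1 / (2 * (n : ℝ)) * sqNorm (X *ᵥ v) :=
    mul_nonneg (by positivity) (sqNorm_nonneg _)
  have hv1 : l1 v ≤ 4 * l1On S v + 4 * h := by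
    have h1 : lam / 2 * l1On Sᶜ v ≤ lam / 2 * (3 * l1On S v + 4 * h) := by
      nlinarith [mul_le_mul_of_nonneg_left hβS hlam.le]
    have h2 := le_of_mul_le_mul_left h1 (by positivity)
    rw [← l1On_add_l1On_compl S v]; linarith
  have hs : 0 ≤ 112 * (s * lam) / κ := by positivity
  -- If the error on `S` is below `h`, the cone inequality alone gives 8h. Otherwise the
  -- approximation term is absorbed, the error lies in a genuine cone, and the smallness of s·t
  -- makes the restricted eigenvalue condition effective there.
  rcases le_total (l1On S v) h with hc | hc
  · linarith
  · have hv2 : l1 v ≤ 8 * l1On S v := by linarith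
    have hN := sqNorm_nonneg v
    have hSn := l1On_nonneg S v
    have hsq : l1On S v ^ 2 ≤ s * sqNorm v :=
      (sq_l1On_le S v).trans (mul_le_mul_of_nonneg_right (by exact_mod_cast hS) hN)
    have hsq2 : l1 v ^ 2 ≤ 64 * (s * sqNorm v) := by nlinarith [l1_nonneg v]
    have hX : κ / 2 * sqNorm v ≤ 1 / (n : ℝ) * sqNorm (X *ᵥ v) := by
      have := hre v
      have h1 : t * l1 v ^ 2 ≤ κ / 2 * sqNorm v := by
        nlinarith [mul_le_mul_of_nonneg_left hsq2 ht, mul_le_mul_of_nonneg_right hst hN]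
      linarith
    have hX2 : κ / 4 * sqNorm v ≤ 7 / 2 * lam * l1On S v := by
      have e : 1 / (2 * (n : ℝ)) = 1 / 2 * (1 / (n : ℝ)) := by
        rw [one_div, one_div, one_div, mul_inv]
      rw [e] at hcone
      have h1 := mul_nonneg hlam.le (l1On_nonneg Sᶜ v)
      have h2 := mul_le_mul_of_nonneg_left (hβS.trans hc) hlam.le
      nlinarith
    have h3 : κ * l1On S v ^ 2 ≤ 14 * (s * lam) * l1On S v := by
      have := mul_le_mul_of_nonneg_left hX2 (Nat.cast_nonneg (α := ℝ) s)
      nlinarith [mul_le_mul_of_nonneg_left hsq hκ.le]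
    have h4 : l1On S v ≤ 14 * (s * lam) / κ := by
      rcases hSn.eq_or_lt with h0 | h0
      · rw [← h0]; positivity
      · rw [le_div_iff₀ hκ]
        refine le_of_mul_le_mul_right ?_ h0
        nlinarith
    have h5 : 112 * (s * lam) / κ = 8 * (14 * (s * lam) / κ) := by ring
    rw [h5]; linarith

/-- The `ℓ₁` error of the lasso for a well-conditioned design, without assumption on the noise. -/
lemma lasso_l1_error_crude {β b : Fin p → ℝ} {ε : Fin n → ℝ} {lam κ M : ℝ}
    (hb : IsLasso X (X *ᵥ β + ε) lam b) (hlam : 0 ≤ lam) (hκ : 0 < κ) (hM : 0 ≤ M)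
    (hz : ∀ j, |score X ε j| ≤ M)
    (hre : ∀ v : Fin p → ℝ, κ * sqNorm v ≤ 1 / (n : ℝ) * sqNorm (X *ᵥ v)) :
    l1 (b - β) ≤ 2 * p * (M + lam) / κ := by
  set v := b - β with hv
  have h1 := lasso_basic hb
  rw [← hv] at h1
  have h2 := dotProduct_le_mul_l1 (v := v) hz
  -- Only the triangle inequality is used for the penalty, so `lam` need not dominate the score. The
  -- price is the factor p coming from ‖v‖₁² ≤ p‖v‖₂².
  have h3 : l1 β - l1 (β + v) ≤ l1 v := by
    have := l1_sub_le (β + v) v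
    rw [add_sub_cancel_right] at this
    linarith
  have h4 := mul_le_mul_of_nonneg_left h3 hlam
  have h5 : κ / 2 * sqNorm v ≤ (M + lam) * l1 v := by
    have e : 1 / (2 * (n : ℝ)) = 1 / 2 * (1 / (n : ℝ)) := by
      rw [one_div, one_div, one_div, mul_inv]
    rw [e] at h1
    nlinarith [hre v]
  have h6 := sq_l1_le v
  have h7 : κ * l1 v ^ 2 ≤ 2 * p * (M + lam) * l1 v := by
    have := mul_le_mul_of_nonneg_left h5 (Nat.cast_nonneg (α := ℝ) p)
    nlinarith [mul_le_mul_of_nonneg_left h6 hκ.le]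
  rcases (l1_nonneg v).eq_or_lt with h0 | h0
  · rw [← h0]; positivity
  · rw [le_div_iff₀ hκ]
    refine le_of_mul_le_mul_right ?_ h0
    nlinarith

end Lasso

/-! ### The debiased lasso -/

lemma sampleCov_mulVec {n p : ℕ} (X : Matrix (Fin n) (Fin p) ℝ) (v : Fin p → ℝ) :
    sampleCov X *ᵥ v = (1 / (n : ℝ)) • (Xᵀ *ᵥ (X *ᵥ v)) := by
  rw [sampleCov, Matrix.smul_mulVec, Matrix.mulVec_mulVec]

lemma dotProduct_sampleCov_mulVec {n p : ℕ} (X : Matrix (Fin n) (Fin p) ℝ) (u v : Fin p → ℝ) :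
    u ⬝ᵥ (sampleCov X *ᵥ v) = 1 / (n : ℝ) * ((X *ᵥ u) ⬝ᵥ (X *ᵥ v)) := by
  rw [sampleCov_mulVec, dotProduct_smul, Matrix.mulVec_transpose, dotProduct_comm,
    ← Matrix.dotProduct_mulVec, smul_eq_mul, dotProduct_comm]

lemma quadForm_sampleCov {n p : ℕ} (X : Matrix (Fin n) (Fin p) ℝ) (v : Fin p → ℝ) :
    v ⬝ᵥ (sampleCov X *ᵥ v) = 1 / (n : ℝ) * sqNorm (X *ᵥ v) := by
  rw [dotProduct_sampleCov_mulVec, sqNorm_eq_dotProduct]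

/-- The noise part of the debiased lasso with approximate inverse `Θ`. -/
def debiasNoise {n p : ℕ} (X : Matrix (Fin n) (Fin p) ℝ) (Θ : Matrix (Fin p) (Fin p) ℝ)
    (ε : Fin n → ℝ) : Fin p → ℝ :=
  fun j => ((1 / (n : ℝ)) • (X *ᵥ Θ j)) ⬝ᵥ ε

/-- The error of the debiased lasso is a noise term plus a bias controlled by the `ℓ₁` error of
the lasso. -/
lemma debiased_error {n p : ℕ} {X : Matrix (Fin n) (Fin p) ℝ} {β ε bL} {mu : ℝ}
    {Θ : Matrix (Fin p) (Fin p) ℝ} (hΘ : ∀ j, Θ j ∈ debiasFeasible (sampleCov X) mu j) (j : Fin p) :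
    |(bL + (1 / (n : ℝ)) • (Θ *ᵥ (Xᵀ *ᵥ (X *ᵥ β + ε - X *ᵥ bL))) - β) j - debiasNoise X Θ ε j|
      ≤ mu * l1 (bL - β) := by
  -- After the noise is removed, what is left is (e_j − Σ̂θ_j)ᵀ(b_L − β), to which Hölder's
  -- inequality applies.
  have key : (bL + (1 / (n : ℝ)) • (Θ *ᵥ (Xᵀ *ᵥ (X *ᵥ β + ε - X *ᵥ bL))) - β) j
      - debiasNoise X Θ ε j
      = ((Pi.single j 1 : Fin p → ℝ) - sampleCov X *ᵥ Θ j) ⬝ᵥ (bL - β) := by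
    have e1 : X *ᵥ β + ε - X *ᵥ bL = ε - X *ᵥ (bL - β) := by
      rw [Matrix.mulVec_sub]; abel
    have e2 : ∀ u : Fin n → ℝ, (Θ *ᵥ (Xᵀ *ᵥ u)) j = (X *ᵥ Θ j) ⬝ᵥ u := by
      intro u
      change Θ j ⬝ᵥ (Xᵀ *ᵥ u) = _
      rw [Matrix.mulVec_transpose, dotProduct_comm, ← Matrix.dotProduct_mulVec, dotProduct_comm]
    rw [e1]
    simp only [Pi.sub_apply, Pi.add_apply, Pi.smul_apply, smul_eq_mul, debiasNoise, e2,
      smul_dotProduct, dotProduct_sub, sub_dotProduct, single_dotProduct, one_mul]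
    rw [dotProduct_comm (sampleCov X *ᵥ Θ j) bL, dotProduct_comm (sampleCov X *ᵥ Θ j) β,
      dotProduct_sampleCov_mulVec, dotProduct_sampleCov_mulVec, Matrix.mulVec_sub, dotProduct_sub,
      dotProduct_comm (X *ᵥ bL), dotProduct_comm (X *ᵥ β)]
    ring
  rw [key]
  refine abs_dotProduct_le fun i => ?_
  rw [Pi.sub_apply, abs_sub_comm]
  exact hΘ j i

/-! ### Existence of minimizers -/

lemma norm_le_l1 {p : ℕ} (v : Fin p → ℝ) : ‖v‖ ≤ l1 v := by
  refine (pi_norm_le_iff_of_nonneg (l1_nonneg v)).2 fun j => ?_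
  exact Finset.single_le_sum (f := fun j => |v j|) (fun _ _ => abs_nonneg _) (Finset.mem_univ j)

lemma continuous_l1 {p : ℕ} : Continuous (l1 : (Fin p → ℝ) → ℝ) := by
  unfold l1; fun_prop

lemma continuous_sqNorm {p : ℕ} : Continuous (sqNorm : (Fin p → ℝ) → ℝ) := by
  unfold sqNorm; fun_prop

lemma continuous_mulVec {n p : ℕ} (X : Matrix (Fin n) (Fin p) ℝ) :
    Continuous fun v : Fin p → ℝ => X *ᵥ v := by
  exact (X.mulVecLin).continuous_of_finiteDimensional

lemma exists_isMinOn_of_norm_le {E : Type*} [NormedAddCommGroup E] [NormedSpace ℝ E]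
    [FiniteDimensional ℝ E] {f : E → ℝ} (hf : Continuous f) {c : ℝ} (hc : 0 < c)
    (h : ∀ x, c * ‖x‖ ≤ f x) : ∃ x, IsMinOn f Set.univ x := by
  have : ProperSpace E := FiniteDimensional.proper_real E
  obtain ⟨x, hx⟩ := hf.exists_forall_le (Filter.tendsto_atTop_mono h
    ((tendsto_norm_cocompact_atTop (E := E)).const_mul_atTop hc))
  exact ⟨x, fun y _ => hx y⟩

lemma exists_isLasso {n p : ℕ} (X : Matrix (Fin n) (Fin p) ℝ) (y : Fin n → ℝ) {lam : ℝ}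
    (hlam : 0 < lam) : ∃ b, IsLasso X y lam b := by
  refine exists_isMinOn_of_norm_le (c := lam) ?_ hlam fun b => ?_
  · unfold lassoObj
    exact ((continuous_sqNorm.comp (continuous_const.sub (continuous_mulVec X))).const_mul _).add
      (continuous_l1.const_mul _)
  · have h1 := mul_le_mul_of_nonneg_left (norm_le_l1 b) hlam.le
    have h2 : 0 ≤ 1 / (2 * (n : ℝ)) * sqNorm (y - X *ᵥ b) :=
      mul_nonneg (by positivity) (sqNorm_nonneg _)
    unfold lassoObj
    linarith

lemma total_nonneg (K nT nS : ℕ) : 0 ≤ total K nT nS := by unfold total; positivity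

/-- The penalty alone is coercive: it controls b⁽⁰⁾ and every contrast, hence every b⁽ᵏ⁾. -/
lemma exists_isMinOn_fusedObj {K p nT : ℕ} [Nonempty (Fin K)] (nS : ℕ)
    (X0 : Matrix (Fin nT) (Fin p) ℝ) (y0 : Fin nT → ℝ) (bt : Fin K → Fin p → ℝ) {lam0 : ℝ}
    {a : Fin K → ℝ} (hlam : 0 < lam0) (ha : ∀ k, 0 < a k) :
    ∃ b, IsMinOn (fusedObj nS X0 y0 bt lam0 a) Set.univ b := by
  obtain ⟨k0, hk0⟩ := Finite.exists_min a
  set m := min 1 (a k0) with hm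
  have hm0 : 0 < m := lt_min one_pos (ha k0)
  refine exists_isMinOn_of_norm_le (c := lam0 * m) ?_ (mul_pos hlam hm0) fun b => ?_
  · unfold fusedObj
    refine ((continuous_const.mul (continuous_finsetSum _ fun k _ => ?_)).add
      (continuous_const.mul ?_)).add (continuous_const.mul ((continuous_l1.comp continuous_fst).add
      (continuous_finsetSum _ fun k _ => continuous_const.mul (continuous_l1.comp ?_))))
    · exact continuous_sqNorm.comp (by fun_prop)
    · exact continuous_sqNorm.comp (continuous_const.sub
        ((continuous_mulVec X0).comp continuous_fst))
    · fun_prop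
  · have h1 : 0 ≤ 1 / (2 * total K nT nS) * ∑ k, sqNorm (√(nS : ℝ) • (bt k - b.2 k)) :=
      mul_nonneg (by have := total_nonneg K nT nS; positivity)
        (Finset.sum_nonneg fun k _ => sqNorm_nonneg _)
    have h2 : 0 ≤ 1 / (2 * total K nT nS) * sqNorm (y0 - X0 *ᵥ b.1) :=
      mul_nonneg (by have := total_nonneg K nT nS; positivity) (sqNorm_nonneg _)
    have hsum : ∀ k, l1 (b.2 k - b.1) ≤ ∑ k, l1 (b.2 k - b.1) := fun k =>
      Finset.single_le_sum (f := fun k => l1 (b.2 k - b.1)) (fun _ _ => l1_nonneg _)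
        (Finset.mem_univ k)
    have h3 : ‖b‖ ≤ l1 b.1 + ∑ k, l1 (b.2 k - b.1) := by
      rw [Prod.norm_def]
      refine max_le ?_ ?_
      · linarith [norm_le_l1 b.1, hsum k0, l1_nonneg (b.2 k0 - b.1)]
      · refine (pi_norm_le_iff_of_nonneg ?_).2 fun k => ?_
        · linarith [l1_nonneg b.1, hsum k0, l1_nonneg (b.2 k0 - b.1)]
        · have h4 := l1_add_le (b.2 k - b.1) b.1
          rw [sub_add_cancel] at h4
          linarith [norm_le_l1 (b.2 k), hsum k]
    have h4 : m * (l1 b.1 + ∑ k, l1 (b.2 k - b.1)) ≤ l1 b.1 + ∑ k, a k * l1 (b.2 k - b.1) := by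
      rw [mul_add, Finset.mul_sum]
      refine add_le_add ?_ (Finset.sum_le_sum fun k _ => ?_)
      · nlinarith [l1_nonneg b.1, min_le_left 1 (a k0)]
      · exact mul_le_mul_of_nonneg_right ((min_le_right _ _).trans (hk0 k)) (l1_nonneg _)
    have h5 := mul_le_mul_of_nonneg_left h4 hlam.le
    have h6 := mul_le_mul_of_nonneg_left h3 (mul_pos hlam hm0).le
    unfold fusedObj
    nlinarith

/-! ### The approximate inverse -/

lemma tendsto_sqNorm_cocompact {p : ℕ} :
    Filter.Tendsto (sqNorm : (Fin p → ℝ) → ℝ) (Filter.cocompact _) Filter.atTop := by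
  have h : ∀ v : Fin p → ℝ, ‖v‖ ^ 2 ≤ sqNorm v := by
    intro v
    rw [← Real.sqrt_le_sqrt_iff (sqNorm_nonneg v), Real.sqrt_sq (norm_nonneg _)]
    refine (pi_norm_le_iff_of_nonneg (Real.sqrt_nonneg _)).2 fun j => ?_
    refine Real.le_sqrt_of_sq_le ?_
    rw [Real.norm_eq_abs, sq_abs]
    exact Finset.single_le_sum (f := fun j => v j ^ 2) (fun _ _ => sq_nonneg _) (Finset.mem_univ j)
  exact Filter.tendsto_atTop_mono h
    ((Filter.tendsto_pow_atTop two_ne_zero).comp (tendsto_norm_cocompact_atTop))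

/-- `θ` is a solution of the program which defines the `j`-th row of an approximate inverse. -/
def IsDebiasRow {p : ℕ} (S : Matrix (Fin p) (Fin p) ℝ) (mu : ℝ) (j : Fin p) (θ : Fin p → ℝ) :
    Prop :=
  θ ∈ debiasFeasible S mu j ∧ IsMinOn (fun θ : Fin p → ℝ => θ ⬝ᵥ (S *ᵥ θ)) (debiasFeasible S mu j) θ

/-- The constraint of the debiasing program can be satisfied strictly. -/
def StrictlyFeasible {p : ℕ} (S : Matrix (Fin p) (Fin p) ℝ) (mu : ℝ) (j : Fin p) : Prop :=
  ∃ θ : Fin p → ℝ, ∀ i, |(S *ᵥ θ) i - (Pi.single j 1 : Fin p → ℝ) i| < mu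

/-- The objective is not coercive in θ, since Σ̂ may be singular. But the objective and the
constraint depend on θ only through a = Xθ, and ‖a‖² is coercive on the closed set of admissible a.
-/
lemma exists_isDebiasRow {n p : ℕ} (X : Matrix (Fin n) (Fin p) ℝ) {mu : ℝ} {j : Fin p}
    (h : (debiasFeasible (sampleCov X) mu j).Nonempty) :
    ∃ θ, IsDebiasRow (sampleCov X) mu j θ := by
  set C : Set (Fin n → ℝ) := (LinearMap.range X.mulVecLin : Set (Fin n → ℝ)) ∩
    {a | ∀ i, |((1 / (n : ℝ)) • (Xᵀ *ᵥ a)) i - (Pi.single j 1 : Fin p → ℝ) i| ≤ mu} with hC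
  have hclosed : IsClosed C := by
    refine (Submodule.closed_of_finiteDimensional _).inter ?_
    simp only [Set.ofPred_forall]
    refine isClosed_iInter fun i => isClosed_le ?_ continuous_const
    have h1 : Continuous fun a : Fin n → ℝ => (1 / (n : ℝ)) • (Xᵀ *ᵥ a) :=
      (continuous_mulVec Xᵀ).const_smul (1 / (n : ℝ))
    exact (((continuous_apply i).comp h1).sub continuous_const).abs
  have hmem : ∀ θ, θ ∈ debiasFeasible (sampleCov X) mu j → X *ᵥ θ ∈ C := fun θ hθ => by
    refine ⟨⟨θ, rfl⟩, fun i => ?_⟩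
    have := hθ i
    rwa [sampleCov_mulVec] at this
  obtain ⟨θ0, hθ0⟩ := h
  obtain ⟨a, ha, hmin⟩ := continuous_sqNorm.continuousOn.exists_isMinOn' hclosed (hmem θ0 hθ0)
    (Filter.Eventually.filter_mono inf_le_left
      (tendsto_sqNorm_cocompact.eventually_ge_atTop (sqNorm (X *ᵥ θ0))))
  obtain ⟨⟨θ, rfl⟩, hθ⟩ := ha
  refine ⟨θ, fun i => ?_, fun θ' hθ' => ?_⟩
  · have := hθ i
    rw [sampleCov_mulVec]; exact this
  · change θ ⬝ᵥ _ ≤ θ' ⬝ᵥ _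
    rw [quadForm_sampleCov, quadForm_sampleCov]
    exact mul_le_mul_of_nonneg_left (hmin (hmem θ' hθ')) (by positivity)

lemma debiasFeasible_convexComb {p : ℕ} {S : Matrix (Fin p) (Fin p) ℝ} {mu mu' t : ℝ} {j : Fin p}
    {θ θ' : Fin p → ℝ} (h : θ ∈ debiasFeasible S mu j) (h' : θ' ∈ debiasFeasible S mu' j)
    (h0 : 0 ≤ t) (h1 : t ≤ 1) (i : Fin p) :
    |(S *ᵥ ((1 - t) • θ + t • θ')) i - (Pi.single j 1 : Fin p → ℝ) i| ≤ (1 - t) * mu + t * mu' := by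
  have e : (S *ᵥ ((1 - t) • θ + t • θ')) i - (Pi.single j 1 : Fin p → ℝ) i
      = (1 - t) * ((S *ᵥ θ) i - (Pi.single j 1 : Fin p → ℝ) i)
        + t * ((S *ᵥ θ') i - (Pi.single j 1 : Fin p → ℝ) i) := by
    rw [Matrix.mulVec_add, Matrix.mulVec_smul, Matrix.mulVec_smul]
    simp only [Pi.add_apply, Pi.smul_apply, smul_eq_mul]
    ring
  rw [e]
  refine (abs_add_le _ _).trans (add_le_add ?_ ?_)
  · rw [abs_mul, abs_of_nonneg (sub_nonneg.2 h1)]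
    exact mul_le_mul_of_nonneg_left (h i) (sub_nonneg.2 h1)
  · rw [abs_mul, abs_of_nonneg h0]
    exact mul_le_mul_of_nonneg_left (h' i) h0

/-- Strict convexity in Xθ: the midpoint of two minimizers is feasible and would do strictly better
if Xθ ≠ Xθ'. Hence the noise term of the debiased lasso does not depend on the version of the
approximate inverse. -/
lemma mulVec_eq_of_isDebiasRow {n p : ℕ} {X : Matrix (Fin n) (Fin p) ℝ} {mu : ℝ} {j : Fin p}
    {θ θ' : Fin p → ℝ} (h : IsDebiasRow (sampleCov X) mu j θ)
    (h' : IsDebiasRow (sampleCov X) mu j θ') : X *ᵥ θ = X *ᵥ θ' := by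
  rcases Nat.eq_zero_or_pos n with hn | hn
  · subst hn; exact Subsingleton.elim _ _
  set m : Fin p → ℝ := (1 - 1 / 2 : ℝ) • θ + (1 / 2 : ℝ) • θ' with hm
  have hmf : m ∈ debiasFeasible (sampleCov X) mu j := fun i => by
    have := debiasFeasible_convexComb h.1 h'.1 (t := 1 / 2) (by norm_num) (by norm_num) i
    refine this.trans (le_of_eq ?_)
    ring
  have h1 : θ ⬝ᵥ (sampleCov X *ᵥ θ) ≤ m ⬝ᵥ (sampleCov X *ᵥ m) := h.2 hmf
  have h2 : θ' ⬝ᵥ (sampleCov X *ᵥ θ') ≤ m ⬝ᵥ (sampleCov X *ᵥ m) := h'.2 hmf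
  simp only [quadForm_sampleCov] at h1 h2
  have hn' : (0 : ℝ) < 1 / n := by positivity
  have h1 := le_of_mul_le_mul_left h1 hn'
  have h2 := le_of_mul_le_mul_left h2 hn'
  have e : sqNorm (X *ᵥ m) = 1 / 2 * sqNorm (X *ᵥ θ) + 1 / 2 * sqNorm (X *ᵥ θ')
      - 1 / 4 * sqNorm (X *ᵥ θ - X *ᵥ θ') := by
    rw [hm, Matrix.mulVec_add, Matrix.mulVec_smul, Matrix.mulVec_smul, sqNorm_add, sqNorm_smul,
      sqNorm_smul, sqNorm_sub, smul_dotProduct, dotProduct_smul, smul_eq_mul, smul_eq_mul]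
    ring
  have h3 : sqNorm (X *ᵥ θ - X *ᵥ θ') = 0 := le_antisymm (by linarith) (sqNorm_nonneg _)
  exact sub_eq_zero.1 (sqNorm_eq_zero.1 h3)

/-- A feasible competitor is a limit of strictly feasible ones along a segment towards a strictly
feasible point. Restricting to strict competitors makes optimality a closed condition jointly in the
design and θ, because failing a strict constraint is closed. -/
lemma isDebiasRow_iff {p : ℕ} {S : Matrix (Fin p) (Fin p) ℝ} {mu : ℝ} {j : Fin p}
    (hS : StrictlyFeasible S mu j) (θ : Fin p → ℝ) :
    IsDebiasRow S mu j θ ↔ θ ∈ debiasFeasible S mu j ∧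
      ∀ θ' : Fin p → ℝ, (∀ i, |(S *ᵥ θ') i - (Pi.single j 1 : Fin p → ℝ) i| < mu) →
        θ ⬝ᵥ (S *ᵥ θ) ≤ θ' ⬝ᵥ (S *ᵥ θ') := by
  refine and_congr_right fun hθ => ⟨fun h θ' hθ' => h fun i => (hθ' i).le, fun h θ' hθ' => ?_⟩
  obtain ⟨θs, hθs⟩ := hS
  have hlim : Filter.Tendsto (fun t : ℝ => ((1 - t) • θ' + t • θs) ⬝ᵥ
      (S *ᵥ ((1 - t) • θ' + t • θs))) (nhdsWithin 0 (Set.Ioi 0)) (nhds (θ' ⬝ᵥ (S *ᵥ θ'))) := by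
    have hc : Continuous (fun t : ℝ => ((1 - t) • θ' + t • θs) ⬝ᵥ
        (S *ᵥ ((1 - t) • θ' + t • θs))) := by
      have h1 : Continuous fun t : ℝ => (1 - t) • θ' + t • θs := by fun_prop
      exact h1.dotProduct ((continuous_mulVec S).comp h1)
    have := (hc.tendsto 0).mono_left (nhdsWithin_le_nhds (s := Set.Ioi 0))
    simpa using this
  refine ge_of_tendsto hlim ?_
  filter_upwards [Ioo_mem_nhdsGT (zero_lt_one (α := ℝ))] with t ht
  refine h _ fun i => ?_
  have e : (S *ᵥ ((1 - t) • θ' + t • θs)) i - (Pi.single j 1 : Fin p → ℝ) i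
      = (1 - t) * ((S *ᵥ θ') i - (Pi.single j 1 : Fin p → ℝ) i)
        + t * ((S *ᵥ θs) i - (Pi.single j 1 : Fin p → ℝ) i) := by
    rw [Matrix.mulVec_add, Matrix.mulVec_smul, Matrix.mulVec_smul]
    simp only [Pi.add_apply, Pi.smul_apply, smul_eq_mul]
    ring
  rw [e]
  refine (abs_add_le _ _).trans_lt ?_
  rw [abs_mul, abs_mul, abs_of_pos ht.1, abs_of_pos (sub_pos.2 ht.2)]
  have h1 := mul_le_mul_of_nonneg_left (hθ' i) (sub_pos.2 ht.2).le
  have h2 := mul_lt_mul_of_pos_left (hθs i) ht.1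
  linarith

open Classical in
/-- The vector `X θ / n` for the solution `θ` of the debiasing program, when the program is
strictly feasible. -/
def debiasDir {n p : ℕ} (X : Matrix (Fin n) (Fin p) ℝ) (mu : ℝ) (j : Fin p) : Fin n → ℝ :=
  if h : StrictlyFeasible (sampleCov X) mu j then
    (1 / (n : ℝ)) • (X *ᵥ (exists_isDebiasRow X ⟨h.choose, fun i => (h.choose_spec i).le⟩).choose)
  else 0

lemma debiasDir_eq {n p : ℕ} {X : Matrix (Fin n) (Fin p) ℝ} {mu : ℝ} {j : Fin p}
    (hS : StrictlyFeasible (sampleCov X) mu j) {θ : Fin p → ℝ}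
    (h : IsDebiasRow (sampleCov X) mu j θ) : debiasDir X mu j = (1 / (n : ℝ)) • (X *ᵥ θ) := by
  rw [debiasDir, dif_pos hS]
  congr 1
  exact mulVec_eq_of_isDebiasRow (Exists.choose_spec _) h

/-- The squared norm is the optimal value divided by n, and any strictly feasible point bounds the
optimal value. -/
lemma sqNorm_debiasDir_le {n p : ℕ} {X : Matrix (Fin n) (Fin p) ℝ} {mu B : ℝ} {j : Fin p}
    {θ : Fin p → ℝ} (hS : ∀ i, |(sampleCov X *ᵥ θ) i - (Pi.single j 1 : Fin p → ℝ) i| < mu)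
    (hB : θ ⬝ᵥ (sampleCov X *ᵥ θ) ≤ B) : sqNorm (debiasDir X mu j) ≤ B / n := by
  have hθ : θ ∈ debiasFeasible (sampleCov X) mu j := fun i => (hS i).le
  obtain ⟨θ', h'⟩ := exists_isDebiasRow X ⟨θ, hθ⟩
  rw [debiasDir_eq ⟨θ, hS⟩ h', sqNorm_smul]
  have h1 : θ' ⬝ᵥ (sampleCov X *ᵥ θ') ≤ θ ⬝ᵥ (sampleCov X *ᵥ θ) := h'.2 hθ
  rw [quadForm_sampleCov] at h1
  have h2 : (1 / (n : ℝ)) ^ 2 * sqNorm (X *ᵥ θ') = 1 / n * (1 / n * sqNorm (X *ᵥ θ')) := by ring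
  rw [h2, div_eq_mul_one_div B, mul_comm B]
  exact mul_le_mul_of_nonneg_left (h1.trans hB) (by positivity)

/-! ### Measurability of the debiasing direction -/

lemma IsSigmaCompact.measurableSet {α : Type*} [TopologicalSpace α] [T2Space α]
    [MeasurableSpace α] [BorelSpace α] {s : Set α} (hs : IsSigmaCompact s) : MeasurableSet s := by
  obtain ⟨K, hK, rfl⟩ := hs
  exact MeasurableSet.iUnion fun n => (hK n).isClosed.measurableSet

lemma continuous_sampleCov_of {n p : ℕ} :
    Continuous fun x : Fin n → Fin p → ℝ => sampleCov (Matrix.of x) := by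
  unfold sampleCov
  have h : Continuous fun x : Fin n → Fin p → ℝ => (Matrix.of x : Matrix (Fin n) (Fin p) ℝ) :=
    continuous_id
  exact (h.matrix_transpose.matrix_mul h).const_smul (1 / (n : ℝ))

/-- On the open set of strictly feasible designs, the preimage of a closed set `C` is the projection
of the closed set of pairs (x, θ) with θ optimal and Xθ/n ∈ `C`. A closed subset of a
finite-dimensional space is σ-compact, so its projection is σ-compact and therefore Borel; no
measurable selection of θ is needed. -/
lemma measurable_debiasDir {n p : ℕ} (mu : ℝ) (j : Fin p) :
    Measurable fun x : Fin n → Fin p → ℝ => debiasDir (Matrix.of x) mu j := by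
  have hof : Continuous fun x : Fin n → Fin p → ℝ => (Matrix.of x : Matrix (Fin n) (Fin p) ℝ) :=
    continuous_id
  have hG : IsOpen {x : Fin n → Fin p → ℝ | StrictlyFeasible (sampleCov (Matrix.of x)) mu j} := by
    simp only [StrictlyFeasible, Set.ofPred_exists, Set.ofPred_forall]
    refine isOpen_iUnion fun θ => isOpen_iInter_of_finite fun i => isOpen_lt ?_ continuous_const
    have h1 := (continuous_sampleCov_of (n := n)).matrix_mulVec (continuous_const (y := θ))
    exact (((continuous_apply i).comp h1).sub continuous_const).abs
  refine measurable_of_isClosed fun C hC => ?_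
  set T₁ : Set ((Fin n → Fin p → ℝ) × (Fin p → ℝ)) := ⋂ i : Fin p,
    {q | |(sampleCov (Matrix.of q.1) *ᵥ q.2) i - (Pi.single j 1 : Fin p → ℝ) i| ≤ mu} with hT₁
  -- The intersection is uncountable, which is harmless since each member is closed.
  set T₂ : Set ((Fin n → Fin p → ℝ) × (Fin p → ℝ)) := ⋂ θ' : Fin p → ℝ,
    ((⋃ i : Fin p, {q | mu ≤ |(sampleCov (Matrix.of q.1) *ᵥ θ') i
      - (Pi.single j 1 : Fin p → ℝ) i|}) ∪ {q | q.2 ⬝ᵥ (sampleCov (Matrix.of q.1) *ᵥ q.2)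
        ≤ θ' ⬝ᵥ (sampleCov (Matrix.of q.1) *ᵥ θ')}) with hT₂
  set T₃ : Set ((Fin n → Fin p → ℝ) × (Fin p → ℝ)) :=
    (fun q => (1 / (n : ℝ)) • (Matrix.of q.1 *ᵥ q.2)) ⁻¹' C with hT₃
  have hT : ∀ q, q ∈ T₁ ∩ T₂ ∩ T₃ ↔ (q.2 ∈ debiasFeasible (sampleCov (Matrix.of q.1)) mu j ∧
      ∀ θ' : Fin p → ℝ, (∀ i, |(sampleCov (Matrix.of q.1) *ᵥ θ') i
        - (Pi.single j 1 : Fin p → ℝ) i| < mu) →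
        q.2 ⬝ᵥ (sampleCov (Matrix.of q.1) *ᵥ q.2) ≤ θ' ⬝ᵥ (sampleCov (Matrix.of q.1) *ᵥ θ')) ∧
      (1 / (n : ℝ)) • (Matrix.of q.1 *ᵥ q.2) ∈ C := by
    intro q
    simp only [hT₁, hT₂, hT₃, Set.mem_inter_iff, Set.mem_iInter, Set.mem_union, Set.mem_iUnion,
      Set.mem_ofPred_eq, Set.mem_preimage, debiasFeasible]
    refine and_congr_left fun _ => and_congr_right fun _ => forall_congr' fun θ' => ?_
    rw [imp_iff_not_or]
    push Not
    rfl
  have hSc : Continuous fun q : (Fin n → Fin p → ℝ) × (Fin p → ℝ) => sampleCov (Matrix.of q.1) :=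
    continuous_sampleCov_of.comp continuous_fst
  have hSm : Continuous fun q : (Fin n → Fin p → ℝ) × (Fin p → ℝ) =>
      sampleCov (Matrix.of q.1) *ᵥ q.2 := hSc.matrix_mulVec continuous_snd
  have hTc : IsClosed (T₁ ∩ T₂ ∩ T₃) := by
    refine IsClosed.inter (IsClosed.inter ?_ ?_) ?_
    · exact isClosed_iInter fun i => isClosed_le
        (((continuous_apply i).comp hSm).sub continuous_const).abs continuous_const
    · refine isClosed_iInter fun θ' => ?_
      have h1 := hSc.matrix_mulVec (continuous_const (y := θ'))
      refine IsClosed.union ?_ (isClosed_le (continuous_snd.dotProduct hSm)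
        (continuous_const.dotProduct h1))
      exact isClosed_iUnion_of_finite fun i => isClosed_le continuous_const
        (((continuous_apply i).comp h1).sub continuous_const).abs
    · exact hC.preimage ((((hof.comp continuous_fst).matrix_mulVec continuous_snd)).const_smul
        (1 / (n : ℝ)))
  have hproj : MeasurableSet (Prod.fst '' (T₁ ∩ T₂ ∩ T₃)) := IsSigmaCompact.measurableSet
    ((isSigmaCompact_univ.of_isClosed_subset hTc (Set.subset_univ _)).image continuous_fst)
  have e : (fun x : Fin n → Fin p → ℝ => debiasDir (Matrix.of x) mu j) ⁻¹' C
      = ({x | StrictlyFeasible (sampleCov (Matrix.of x)) mu j} ∩ Prod.fst '' (T₁ ∩ T₂ ∩ T₃)) ∪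
        ({x | StrictlyFeasible (sampleCov (Matrix.of x)) mu j}ᶜ ∩ {_x | (0 : Fin n → ℝ) ∈ C}) := by
    ext x
    by_cases hx : StrictlyFeasible (sampleCov (Matrix.of x)) mu j
    · obtain ⟨θ, hθ⟩ := hx
      obtain ⟨θm, hm⟩ := exists_isDebiasRow (Matrix.of x) ⟨θ, fun i => (hθ i).le⟩
      have hx : StrictlyFeasible (sampleCov (Matrix.of x)) mu j := ⟨θ, hθ⟩
      simp only [Set.mem_preimage, Set.mem_union, Set.mem_inter_iff, Set.mem_ofPred_eq, hx,
        Set.mem_compl_iff, not_true_eq_false, false_and, or_false, true_and, Set.mem_image]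
      constructor
      · intro h
        refine ⟨(x, θm), (hT _).2 ⟨(isDebiasRow_iff hx θm).1 hm, ?_⟩, rfl⟩
        rwa [debiasDir_eq hx hm] at h
      · rintro ⟨⟨x', θ'⟩, hq, rfl⟩
        obtain ⟨h1, h2⟩ := (hT _).1 hq
        rw [debiasDir_eq hx ((isDebiasRow_iff hx θ').2 h1)]
        exact h2
    · have h0 : debiasDir (Matrix.of x) mu j = 0 := by rw [debiasDir, dif_neg hx]
      simp [hx, h0]
  rw [e]
  exact (hG.measurableSet.inter hproj).union (hG.measurableSet.compl.inter (MeasurableSet.const _))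

/-! ### The fused step -/

/-- The truncation of `x` to `[-a, a]`. -/
def clip (a x : ℝ) : ℝ := max (-a) (min a x)

lemma abs_clip_le {a : ℝ} (ha : 0 ≤ a) (x : ℝ) : |clip a x| ≤ a :=
  abs_le.2 ⟨le_max_left _ _, max_le (by linarith) (min_le_left _ _)⟩

lemma clip_of_abs_le {a x : ℝ} (h : |x| ≤ a) : clip a x = x := by
  rw [clip, min_eq_right (abs_le.1 h).2, max_eq_right (abs_le.1 h).1]

lemma abs_clip_sub_clip_le (a x y : ℝ) : |clip a x - clip a y| ≤ |x - y| := by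
  unfold clip
  refine (abs_max_sub_max_le_max _ _ _ _).trans ?_
  rw [sub_self, abs_zero]
  refine max_le (abs_nonneg _) ((abs_min_sub_min_le_max _ _ _ _).trans ?_)
  rw [sub_self, abs_zero]
  exact max_le (abs_nonneg _) le_rfl

lemma clip_neg {a : ℝ} (ha : 0 ≤ a) (x : ℝ) : clip a (-x) = -clip a x := by
  unfold clip
  rcases le_total x a with h1 | h1 <;> rcases le_total (-a) x with h2 | h2
  · rw [min_eq_right (by linarith), min_eq_right h1, max_eq_right (by linarith), max_eq_right h2]
  · rw [min_eq_left (by linarith), min_eq_right h1, max_eq_right (by linarith), max_eq_left h2]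
    ring
  · rw [min_eq_right (by linarith), min_eq_left h1, max_eq_left (by linarith),
      max_eq_right (by linarith)]
  · have h : a = 0 := by linarith
    subst h
    have h' : x = 0 := by linarith
    simp [h']

lemma abs_clip_le_abs {a : ℝ} (ha : 0 ≤ a) (x : ℝ) : |clip a x| ≤ |x| := by
  have h := abs_clip_sub_clip_le a x 0
  rwa [clip_of_abs_le (x := 0) (by simpa using ha), sub_zero, sub_zero] at h

/-- The excess of `x` over the truncation is compatible with the subgradient of the absolute
value. -/
lemma clip_subgradient {a x w e D : ℝ} (ha : 0 ≤ a) (hw : 0 < w) (he : w * e = x - clip a x) :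
    (a - |clip a x|) * |D| ≤ a * (|e + D| - |e|) - clip a x * D := by
  -- When x is truncated, the left side vanishes and `clip a x` = ± a is the derivative of a|·| at e
  -- ≠ 0. When it is not, e = 0 and `clip a x` has modulus at most a.
  rcases lt_or_ge a x with h1 | h1
  · have hc : clip a x = a := by rw [clip, min_eq_left h1.le, max_eq_right (by linarith)]
    rw [hc] at he ⊢
    have he0 : 0 < e := by
      by_contra hn
      nlinarith
    rw [abs_of_nonneg ha, sub_self, zero_mul, abs_of_pos he0]
    nlinarith [le_abs_self (e + D)]
  · rcases lt_or_ge x (-a) with h2 | h2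
    · have hc : clip a x = -a := by rw [clip, min_eq_right h1, max_eq_left h2.le]
      rw [hc] at he ⊢
      have he0 : e < 0 := by
        by_contra hn
        nlinarith
      rw [abs_neg, abs_of_nonneg ha, sub_self, zero_mul, abs_of_neg he0]
      nlinarith [neg_abs_le (e + D)]
    · have hc : clip a x = x := clip_of_abs_le (abs_le.2 ⟨h2, h1⟩)
      rw [hc] at he ⊢
      have he0 : e = 0 := by
        have : w * e = 0 := by linarith
        exact (mul_eq_zero.1 this).resolve_left hw.ne'
      rw [he0, zero_add, abs_zero, sub_zero]
      have := le_abs_self (x * D)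
      rw [abs_mul] at this
      nlinarith

/-- Jensen's inequality for the square, by expanding a nonnegative variance. -/
lemma sq_add_le_of_sum_eq_one {ι : Type*} {s : Finset ι} {v x : ι → ℝ} {v0 x0 : ℝ}
    (hv : ∀ i ∈ s, 0 ≤ v i) (hv0 : 0 ≤ v0) (h : ∑ i ∈ s, v i + v0 = 1) :
    (∑ i ∈ s, v i * x i + v0 * x0) ^ 2 ≤ ∑ i ∈ s, v i * x i ^ 2 + v0 * x0 ^ 2 := by
  set m := ∑ i ∈ s, v i * x i + v0 * x0 with hm
  have h1 : 0 ≤ ∑ i ∈ s, v i * (x i - m) ^ 2 + v0 * (x0 - m) ^ 2 :=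
    add_nonneg (Finset.sum_nonneg fun i hi => mul_nonneg (hv i hi) (sq_nonneg _))
      (mul_nonneg hv0 (sq_nonneg _))
  have h2 : ∑ i ∈ s, v i * (x i - m) ^ 2
      = ∑ i ∈ s, v i * x i ^ 2 - 2 * m * ∑ i ∈ s, v i * x i + m ^ 2 * ∑ i ∈ s, v i := by
    rw [Finset.mul_sum, Finset.mul_sum, ← Finset.sum_sub_distrib, ← Finset.sum_add_distrib]
    exact Finset.sum_congr rfl fun _ _ => by ring
  rw [h2, show ∑ i ∈ s, v i * x i = m - v0 * x0 by rw [hm]; ring,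
    show ∑ i ∈ s, v i = 1 - v0 by rw [← h]; ring] at h1
  nlinarith

section Fused

variable {K p nT nS : ℕ} {X0 : Matrix (Fin nT) (Fin p) ℝ} {ε0 : Fin nT → ℝ}
  {bt : Fin K → Fin p → ℝ} {lam0 : ℝ} {a : Fin K → ℝ} {b : (Fin p → ℝ) × (Fin K → Fin p → ℝ)}
  {β0 Δ0 : Fin p → ℝ} {d ζ e ρ D : Fin K → Fin p → ℝ}

/-- The basic inequality of the fused step. The minimizer is compared with the true coefficients,
shifted by the part of the noise of the debiased estimators which exceeds the fusion penalty. -/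
lemma fused_basic (hN : 0 < total K nT nS) (hnS : 0 < nS) (ha : ∀ k, 0 ≤ lam0 * a k)
    (hb : IsMinOn (fusedObj nS X0 (X0 *ᵥ β0 + ε0) bt lam0 a) Set.univ b)
    (hbt : ∀ k, bt k = β0 + d k + ζ k)
    (hρ : ∀ k j, ρ k j = clip (lam0 * a k) ((nS : ℝ) / total K nT nS * ζ k j))
    (he : ∀ k j, (nS : ℝ) / total K nT nS * e k j = (nS : ℝ) / total K nT nS * ζ k j - ρ k j)
    (hb1 : b.1 = β0 + Δ0) (hb2 : ∀ k, b.2 k = b.1 + d k + e k + D k) :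
    1 / 2 * (∑ k, (nS : ℝ) / total K nT nS * sqNorm (Δ0 + D k)
        + 1 / total K nT nS * sqNorm (X0 *ᵥ Δ0))
      + ∑ k, ∑ j, (lam0 * a k - |ρ k j|) * |D k j|
      ≤ ((1 / total K nT nS) • (X0ᵀ *ᵥ ε0) + ∑ k, ρ k) ⬝ᵥ Δ0
        + lam0 * (l1 β0 - l1 (β0 + Δ0)) + 2 * ∑ k, lam0 * a k * l1 (d k) := by
  set N := total K nT nS with hNdef
  set w := (nS : ℝ) / N with hw
  have hw0 : 0 < w := by positivity
  have h := hb (Set.mem_univ (β0, fun k => β0 + d k + e k))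
  change fusedObj nS X0 (X0 *ᵥ β0 + ε0) bt lam0 a b
    ≤ fusedObj nS X0 (X0 *ᵥ β0 + ε0) bt lam0 a (β0, fun k => β0 + d k + e k) at h
  unfold fusedObj at h
  rw [← hNdef] at h
  -- the quadratic terms of the sources
  have hζ : ∀ k, ζ k - e k = (1 / w) • ρ k := by
    intro k
    ext j
    have := he k j
    simp only [Pi.sub_apply, Pi.smul_apply, smul_eq_mul]
    field_simp
    linarith
  have hq : ∀ v : Fin p → ℝ, 1 / (2 * N) * sqNorm (√(nS : ℝ) • v) = w / 2 * sqNorm v := by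
    intro v
    rw [sqNorm_smul, Real.sq_sqrt (Nat.cast_nonneg _), hw]
    field_simp
  have hA : 1 / (2 * N) * ∑ k, sqNorm (√(nS : ℝ) • (bt k - b.2 k))
      = 1 / (2 * N) * ∑ k, sqNorm (√(nS : ℝ) • (bt k - (β0 + d k + e k)))
        + ∑ k, w / 2 * sqNorm (Δ0 + D k) - ∑ k, ρ k ⬝ᵥ (Δ0 + D k) := by
    rw [Finset.mul_sum, Finset.mul_sum, ← Finset.sum_add_distrib, ← Finset.sum_sub_distrib]
    refine Finset.sum_congr rfl fun k _ => ?_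
    have e1 : bt k - b.2 k = (1 / w) • ρ k - (Δ0 + D k) := by
      rw [hbt, hb2, hb1, ← hζ]; abel
    have e2 : bt k - (β0 + d k + e k) = (1 / w) • ρ k := by rw [hbt, ← hζ]; abel
    rw [hq, hq, e1, e2, sqNorm_sub, smul_dotProduct, smul_eq_mul]
    field_simp
    ring
  have hB : 1 / (2 * N) * sqNorm (X0 *ᵥ β0 + ε0 - X0 *ᵥ b.1)
      = 1 / (2 * N) * sqNorm (X0 *ᵥ β0 + ε0 - X0 *ᵥ β0)
        + 1 / 2 * (1 / N * sqNorm (X0 *ᵥ Δ0)) - ((1 / N) • (X0ᵀ *ᵥ ε0)) ⬝ᵥ Δ0 := by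
    have e1 : X0 *ᵥ β0 + ε0 - X0 *ᵥ b.1 = ε0 - X0 *ᵥ Δ0 := by
      rw [hb1, Matrix.mulVec_add]; abel
    rw [e1, add_sub_cancel_left, sqNorm_sub, smul_dotProduct, Matrix.mulVec_transpose,
      ← Matrix.dotProduct_mulVec, smul_eq_mul]
    field_simp
    ring
  -- Coordinatewise, ρ is a subgradient of the fusion penalty at the excess e. Removing the true
  -- contrast d from the arguments of the penalty costs |d| twice, once at the minimizer and once at
  -- the competitor.
  have hC : ∑ k, ∑ j, (lam0 * a k - |ρ k j|) * |D k j|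
      ≤ ∑ k, (lam0 * a k * (l1 (b.2 k - b.1) - l1 (β0 + d k + e k - β0)) - ρ k ⬝ᵥ D k
        + 2 * (lam0 * a k * l1 (d k))) := by
    refine Finset.sum_le_sum fun k _ => ?_
    have e1 : b.2 k - b.1 = d k + (e k + D k) := by rw [hb2]; abel
    have e2 : β0 + d k + e k - β0 = d k + e k := by abel
    rw [e1, e2]
    simp only [l1, dotProduct, ← Finset.sum_sub_distrib, Finset.mul_sum,
      ← Finset.sum_add_distrib]
    refine Finset.sum_le_sum fun j _ => ?_
    have h1 := clip_subgradient (D := D k j) (ha k) hw0 (x := w * ζ k j) (e := e k j)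
      (by rw [he, hρ])
    rw [← hρ] at h1
    have h2 : |e k j + D k j| ≤ |d k j + (e k j + D k j)| + |d k j| := by
      have := abs_sub (d k j + (e k j + D k j)) (d k j)
      rwa [add_sub_cancel_left] at this
    have h3 := abs_add_le (d k j) (e k j)
    simp only [Pi.add_apply]
    nlinarith [mul_le_mul_of_nonneg_left h2 (ha k), mul_le_mul_of_nonneg_left h3 (ha k)]
  have hD : ∑ k, ρ k ⬝ᵥ (Δ0 + D k) = (∑ k, ρ k) ⬝ᵥ Δ0 + ∑ k, ρ k ⬝ᵥ D k := by
    simp only [dotProduct_add, Finset.sum_add_distrib, sum_dotProduct]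
  have hE : lam0 * (l1 b.1 + ∑ k, a k * l1 (b.2 k - b.1))
      = lam0 * l1 (β0 + Δ0) + ∑ k, lam0 * a k * l1 (b.2 k - b.1) := by
    rw [hb1, mul_add, Finset.mul_sum]
    simp only [mul_assoc]
  have hF : lam0 * (l1 β0 + ∑ k, a k * l1 (β0 + d k + e k - β0))
      = lam0 * l1 β0 + ∑ k, lam0 * a k * l1 (β0 + d k + e k - β0) := by
    rw [mul_add, Finset.mul_sum]
    simp only [mul_assoc]
  have hC' : ∑ k, (lam0 * a k * (l1 (b.2 k - b.1) - l1 (β0 + d k + e k - β0)) - ρ k ⬝ᵥ D k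
        + 2 * (lam0 * a k * l1 (d k)))
      = ∑ k, lam0 * a k * l1 (b.2 k - b.1) - ∑ k, lam0 * a k * l1 (β0 + d k + e k - β0)
        - ∑ k, ρ k ⬝ᵥ D k + 2 * ∑ k, lam0 * a k * l1 (d k) := by
    simp only [Finset.sum_add_distrib, Finset.sum_sub_distrib, Finset.mul_sum, mul_sub]
  have hG : ∑ k, w / 2 * sqNorm (Δ0 + D k) = 1 / 2 * ∑ k, w * sqNorm (Δ0 + D k) := by
    rw [Finset.mul_sum]
    exact Finset.sum_congr rfl fun _ _ => by ring
  dsimp only at h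
  rw [hA, hB, hE, hF, hD, hG] at h
  rw [hC'] at hC
  rw [add_dotProduct]
  linarith

set_option maxHeartbeats 800000 in
/-- The error bound of the fused step. -/
lemma fused_error {S : Finset (Fin p)} {s : ℕ} {η κ C q P : ℝ} {v γ : Fin K → Fin p → ℝ}
    {v0 : Fin p → ℝ} (hN : 0 < total K nT nS) (hnS : 0 < nS)
    (hlam : 0 < lam0) (ha : ∀ k, 0 ≤ lam0 * a k)
    (hb : IsMinOn (fusedObj nS X0 (X0 *ᵥ β0 + ε0) bt lam0 a) Set.univ b)
    (hbt : ∀ k, bt k = β0 + d k + ζ k)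
    (hρ : ∀ k j, ρ k j = clip (lam0 * a k) ((nS : ℝ) / total K nT nS * ζ k j))
    (he : ∀ k j, (nS : ℝ) / total K nT nS * e k j = (nS : ℝ) / total K nT nS * ζ k j - ρ k j)
    (hb1 : b.1 = β0 + Δ0) (hb2 : ∀ k, b.2 k = b.1 + d k + e k + D k)
    (hS : ∀ j ∉ S, β0 j = 0) (hSs : S.card ≤ s) (hs : 1 ≤ s)
    (hη : 0 < η) (hη' : η ≤ 1 / 2) (hκ : 0 < κ) (hκ1 : κ ≤ 1) (hC : 0 ≤ C) (hq : 0 ≤ q)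
    (hre : ∀ u : Fin p → ℝ, κ * ((nT : ℝ) / total K nT nS) * sqNorm u - C * q * l1 u ^ 2
      ≤ 1 / total K nT nS * sqNorm (X0 *ᵥ u))
    (hP : ∑ k, lam0 * a k * l1 (d k) ≤ P)
    (hg : ∀ j, |((1 / total K nT nS) • (X0ᵀ *ᵥ ε0) + ∑ k, ρ k) j| ≤ η * lam0)
    (hv : ∀ k j, 0 ≤ v k j) (hv0 : ∀ j, 0 ≤ v0 j) (hvsum : ∀ j, ∑ k, v k j + v0 j = 1)
    (hvw : ∀ k j, v k j ≤ 4 * ((nS : ℝ) / total K nT nS))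
    (hv0w : ∀ j, v0 j ≤ 4 * ((nT : ℝ) / total K nT nS))
    (hγ : ∀ k j, 0 ≤ γ k j) (hγ1 : ∀ k j, γ k j ≤ 1)
    (hbad : ∑ k, ∑ j, (nS : ℝ) / total K nT nS * (1 - γ k j) ≤ 1)
    (hweight : ∀ k j, (1 + 2 * η) * (lam0 * v k j) + η * (lam0 * ((nS : ℝ) / total K nT nS))
      * γ k j ≤ lam0 * a k - |ρ k j|)
    (hsq : 288 * (C * q * s) ≤ κ * η ^ 2) (hPq : 4 * (C * q * (P / lam0) ^ 2) ≤ η ^ 2 * P) :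
    ∃ Q : ℝ, 0 ≤ Q ∧ Q ≤ 128 / κ ^ 2 * (s * lam0 ^ 2) + 12 / κ * P ∧
      sqNorm (∑ k, ((nS : ℝ) / total K nT nS) • (Δ0 + D k)
        + ((nT : ℝ) / total K nT nS) • Δ0) ≤ Q ∧
      l1 (∑ k, ((nS : ℝ) / total K nT nS) • (Δ0 + D k) + ((nT : ℝ) / total K nT nS) • Δ0)
        ≤ (17 * √(s * Q) + 6 * (P / lam0)) / η := by
  have hbasic := fused_basic hN hnS ha hb hbt hρ he hb1 hb2
  have hwsum : (K : ℝ) * ((nS : ℝ) / total K nT nS) + (nT : ℝ) / total K nT nS = 1 := by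
    rw [← mul_div_assoc, ← add_div]
    exact div_self hN.ne'
  set N := total K nT nS with hNdef
  set w := (nS : ℝ) / N with hw
  set w0 := (nT : ℝ) / N with hw0
  have hwpos : 0 < w := by positivity
  have hw0nn : 0 ≤ w0 := by positivity
  have hP0 : 0 ≤ P := (Finset.sum_nonneg fun k _ => mul_nonneg (ha k) (l1_nonneg _)).trans hP
  set H := P / lam0 with hH
  have hH0 : 0 ≤ H := div_nonneg hP0 hlam.le
  have hHP : lam0 * H = P := by rw [hH]; field_simp
  set Q := ∑ k, w * sqNorm (Δ0 + D k) + w0 * sqNorm Δ0 with hQ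
  have hQ0 : 0 ≤ Q := add_nonneg (Finset.sum_nonneg fun k _ =>
    mul_nonneg hwpos.le (sqNorm_nonneg _)) (mul_nonneg hw0nn (sqNorm_nonneg _))
  -- the averaged error
  set r : Fin p → ℝ := fun j => ∑ k, v k j * D k j with hr
  set u : Fin p → ℝ := Δ0 + r with hu
  have hu' : ∀ j, u j = ∑ k, v k j * (Δ0 j + D k j) + v0 j * Δ0 j := by
    intro j
    simp only [hu, hr, Pi.add_apply, mul_add, Finset.sum_add_distrib, ← Finset.sum_mul]
    linear_combination (-Δ0 j) * hvsum j
  -- `u` is a convex combination of the errors of all tasks, with weights at most four times those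
  -- in the quadratic loss.
  have hU : sqNorm u ≤ 4 * Q := by
    have h1 : sqNorm u ≤ ∑ j, (∑ k, 4 * w * (Δ0 j + D k j) ^ 2 + 4 * w0 * Δ0 j ^ 2) := by
      unfold sqNorm
      refine Finset.sum_le_sum fun j _ => ?_
      rw [hu' j]
      refine (sq_add_le_of_sum_eq_one (fun k _ => hv k j) (hv0 j) (hvsum j)).trans ?_
      exact add_le_add (Finset.sum_le_sum fun k _ =>
        mul_le_mul_of_nonneg_right (hvw k j) (sq_nonneg _))
        (mul_le_mul_of_nonneg_right (hv0w j) (sq_nonneg _))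
    refine h1.trans (le_of_eq ?_)
    rw [Finset.sum_add_distrib, Finset.sum_comm, hQ, mul_add, Finset.mul_sum]
    simp only [sqNorm, Finset.mul_sum, Pi.add_apply, mul_assoc]
  set Y1 := ∑ k, ∑ j, v k j * |D k j| with hY1
  set Y2 := ∑ k, ∑ j, w * γ k j * |D k j| with hY2
  have hY1nn : 0 ≤ Y1 := Finset.sum_nonneg fun k _ => Finset.sum_nonneg fun j _ =>
    mul_nonneg (hv k j) (abs_nonneg _)
  have hY2nn : 0 ≤ Y2 := Finset.sum_nonneg fun k _ => Finset.sum_nonneg fun j _ =>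
    mul_nonneg (mul_nonneg hwpos.le (hγ k j)) (abs_nonneg _)
  have hr1 : l1 r ≤ Y1 := by
    unfold l1
    rw [hY1, Finset.sum_comm]
    refine Finset.sum_le_sum fun j _ => (Finset.abs_sum_le_sum_abs _ _).trans (le_of_eq ?_)
    exact Finset.sum_congr rfl fun k _ => by rw [abs_mul, abs_of_nonneg (hv k j)]
  have hΔu : Δ0 = u + -r := by rw [hu]; abel
  set Us := l1On S u with hUs
  set Uc := l1On Sᶜ u with hUc
  have hUcnn : 0 ≤ Uc := l1On_nonneg _ _
  have hUsplit : l1 u = Us + Uc := (l1On_add_l1On_compl S u).symm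
  have hΔ1 : l1 Δ0 ≤ Us + Uc + Y1 := by
    have h1 := l1_add_le u (-r)
    rw [← hΔu, l1_neg] at h1
    linarith
  -- The sparsity of `β0` is exploited through `u` instead of `Δ0`, since `Q` controls ‖u‖₂ without
  -- the factor n_T/N. The replacement costs ‖u − Δ0‖₁ ≤ `Y1`.
  have hpen : l1 β0 - l1 (β0 + Δ0) ≤ Us - Uc + Y1 := by
    have h1 := l1_sub_l1_add_le S β0 Δ0
    rw [l1On_eq_zero hS] at h1
    have h2 : l1On S Δ0 ≤ Us + l1On S r := by
      have := l1On_add_le S u (-r)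
      rwa [← hΔu, l1On_neg] at this
    have h3 : Uc ≤ l1On Sᶜ Δ0 + l1On Sᶜ r := l1On_add_le Sᶜ Δ0 r
    have h4 := l1On_add_l1On_compl S r
    linarith
  have hgd := dotProduct_le_mul_l1 (v := Δ0) hg
  -- Of the factor 1 + 2η granted to `Y1` by `hweight`, one unit pays for replacing Δ0 by u, one η
  -- pays for the noise term, and one η remains on the left.
  have hmain : 1 / 2 * (∑ k, w * sqNorm (Δ0 + D k) + 1 / N * sqNorm (X0 *ᵥ Δ0))
      + η * lam0 * (Uc + Y1 + Y2) ≤ 2 * lam0 * Us + 2 * P := by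
    have h1 : (1 + 2 * η) * lam0 * Y1 + η * lam0 * Y2
        ≤ ∑ k, ∑ j, (lam0 * a k - |ρ k j|) * |D k j| := by
      rw [hY1, hY2, Finset.mul_sum, Finset.mul_sum, ← Finset.sum_add_distrib]
      refine Finset.sum_le_sum fun k _ => ?_
      rw [Finset.mul_sum, Finset.mul_sum, ← Finset.sum_add_distrib]
      refine Finset.sum_le_sum fun j _ => ?_
      refine le_trans (le_of_eq ?_) (mul_le_mul_of_nonneg_right (hweight k j) (abs_nonneg (D k j)))
      ring
    have h2 := mul_le_mul_of_nonneg_left hpen hlam.le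
    have h3 := mul_le_mul_of_nonneg_left hΔ1 (mul_pos hη hlam).le
    have h4 : η * lam0 * Uc ≤ 1 / 2 * (lam0 * Uc) := by
      linarith [mul_le_mul_of_nonneg_right hη' (mul_nonneg hlam.le hUcnn)]
    have hUsnn : 0 ≤ Us := l1On_nonneg _ _
    have h5 : η * lam0 * Us ≤ 1 / 2 * (lam0 * Us) := by
      linarith [mul_le_mul_of_nonneg_right hη' (mul_nonneg hlam.le hUsnn)]
    linarith [mul_nonneg hlam.le hUsnn]
  set T := √(s * Q) with hT
  have hT0 : 0 ≤ T := Real.sqrt_nonneg _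
  have hTsq : T ^ 2 = s * Q := Real.sq_sqrt (by positivity)
  have hUsT : Us ≤ 2 * T := by
    refine le_of_sq_le_sq ?_ (by positivity)
    have h1 := sq_l1On_le S u
    have h2 : (S.card : ℝ) * sqNorm u ≤ s * (4 * Q) :=
      mul_le_mul (by exact_mod_cast hSs) hU (sqNorm_nonneg _) (Nat.cast_nonneg _)
    linarith
  have hX0 : 0 ≤ 1 / N * sqNorm (X0 *ᵥ Δ0) := mul_nonneg (by positivity) (sqNorm_nonneg _)
  have hW0 : 0 ≤ ∑ k, w * sqNorm (Δ0 + D k) :=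
    Finset.sum_nonneg fun k _ => mul_nonneg hwpos.le (sqNorm_nonneg _)
  have hYb : η * (Uc + Y1 + Y2) ≤ 4 * T + 2 * H := by
    have h1 : lam0 * (η * (Uc + Y1 + Y2)) ≤ lam0 * (4 * T + 2 * H) := by
      linarith [mul_le_mul_of_nonneg_left hUsT hlam.le]
    exact le_of_mul_le_mul_left h1 hlam
  have hΔb : η * l1 Δ0 ≤ 6 * T + 2 * H := by
    have h1 := mul_le_mul_of_nonneg_left hΔ1 hη.le
    linarith [mul_nonneg hη.le hY2nn, mul_le_mul_of_nonneg_right hη' hT0,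
      mul_le_mul_of_nonneg_left hUsT hη.le]
  have hΔsq : η ^ 2 * l1 Δ0 ^ 2 ≤ 72 * T ^ 2 + 8 * H ^ 2 := by
    have h0 := mul_nonneg hη.le (l1_nonneg Δ0)
    have h1 : (η * l1 Δ0) ^ 2 ≤ (6 * T + 2 * H) ^ 2 := by gcongr
    linarith [sq_nonneg (6 * T - 2 * H)]
  -- The restricted eigenvalue error is absorbed: `hsq` takes the part proportional to s Q and `hPq`
  -- the part coming from P/λ₀.
  have hCq : C * q * l1 Δ0 ^ 2 ≤ κ / 4 * Q + 2 * P := by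
    have hη2 : 0 < η ^ 2 := by positivity
    refine le_of_mul_le_mul_left ?_ hη2
    have h1 := mul_le_mul_of_nonneg_left hΔsq (mul_nonneg hC hq)
    rw [hTsq] at h1
    have h2 := mul_le_mul_of_nonneg_right hsq hQ0
    linarith
  have hQb : κ * Q ≤ 8 * lam0 * T + 4 * P + (κ / 4 * Q + 2 * P) := by
    have h1 := hre Δ0
    have h2 : κ * ∑ k, w * sqNorm (Δ0 + D k) ≤ ∑ k, w * sqNorm (Δ0 + D k) :=
      mul_le_of_le_one_left hW0 hκ1
    have h3 : 0 ≤ η * lam0 * (Uc + Y1 + Y2) := by positivity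
    have h4 := mul_le_mul_of_nonneg_left hUsT hlam.le
    have h5 : κ * Q = κ * ∑ k, w * sqNorm (Δ0 + D k) + κ * w0 * sqNorm Δ0 := by
      rw [hQ]; ring
    linarith
  refine ⟨Q, hQ0, ?_, ?_, ?_⟩
  · -- `8 lam0 T ≤ κ Q / 4 + 64 s lam0² / κ`
    have h1 : 8 * lam0 * T ≤ κ / 4 * Q + 64 / κ * (s * lam0 ^ 2) := by
      have hs0 : (0 : ℝ) < s := by exact_mod_cast hs
      have h2 : 0 ≤ (κ * T - 16 * (s * lam0)) ^ 2 := sq_nonneg _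
      have h3 : 0 ≤ κ ^ 2 * Q - 32 * κ * lam0 * T + 256 * (s * lam0 ^ 2) := by
        refine le_of_mul_le_mul_left ?_ hs0
        have h4 : (s : ℝ) * (κ ^ 2 * Q - 32 * κ * lam0 * T + 256 * (s * lam0 ^ 2))
            = (κ * T - 16 * (s * lam0)) ^ 2 := by
          linear_combination (-κ ^ 2) * hTsq
        rw [h4, mul_zero]; exact h2
      have h5 : κ / 4 * Q + 64 / κ * (s * lam0 ^ 2) - 8 * lam0 * T
          = (κ ^ 2 * Q - 32 * κ * lam0 * T + 256 * (s * lam0 ^ 2)) / (4 * κ) := by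
        field_simp; ring
      have h6 := div_nonneg h3 (by positivity : 0 ≤ 4 * κ)
      linarith
    have h2 : κ / 2 * Q ≤ 64 / κ * (s * lam0 ^ 2) + 6 * P := by linarith
    have h3 : Q = 2 / κ * (κ / 2 * Q) := by field_simp
    rw [h3]
    refine (mul_le_mul_of_nonneg_left h2 (by positivity)).trans (le_of_eq ?_)
    field_simp
    ring
  · have h1 : sqNorm (∑ k, w • (Δ0 + D k) + w0 • Δ0)
        ≤ ∑ j, (∑ k, w * (Δ0 j + D k j) ^ 2 + w0 * Δ0 j ^ 2) := by
      unfold sqNorm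
      refine Finset.sum_le_sum fun j _ => ?_
      simp only [Pi.add_apply, Finset.sum_apply, Pi.smul_apply, smul_eq_mul]
      exact sq_add_le_of_sum_eq_one (fun k _ => hwpos.le) hw0nn (by simpa using hwsum)
    refine h1.trans (le_of_eq ?_)
    rw [Finset.sum_add_distrib, Finset.sum_comm, hQ]
    simp only [sqNorm, Finset.mul_sum, Pi.add_apply]
  · have e1 : ∑ k, w • (Δ0 + D k) + w0 • Δ0 = Δ0 + ∑ k, w • D k := by
      simp only [smul_add, Finset.sum_add_distrib, Finset.sum_const, Finset.card_univ,
        Fintype.card_fin]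
      ext j
      simp only [Pi.add_apply, Pi.smul_apply, nsmul_eq_mul, smul_eq_mul, Finset.sum_apply,
        Pi.natCast_apply, Pi.mul_apply]
      linear_combination (Δ0 j) * hwsum
    have h1 : l1 (∑ k, w • D k) ≤ ∑ k, ∑ j, w * |D k j| := by
      refine (l1_sum_le _ _).trans (Finset.sum_le_sum fun k _ => ?_)
      rw [l1_smul, abs_of_pos hwpos, l1, Finset.mul_sum]
    -- On good pairs the fusion penalty controls |D|. On bad pairs it may not, and D is rewritten
    -- through Δ0 + D, which the quadratic loss controls.
    have h2 : ∑ k, ∑ j, w * |D k j| ≤ Y2 + ∑ k, ∑ j, w * (1 - γ k j) * |Δ0 j + D k j|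
        + ∑ k, ∑ j, w * (1 - γ k j) * |Δ0 j| := by
      rw [hY2, ← Finset.sum_add_distrib, ← Finset.sum_add_distrib]
      refine Finset.sum_le_sum fun k _ => ?_
      rw [← Finset.sum_add_distrib, ← Finset.sum_add_distrib]
      refine Finset.sum_le_sum fun j _ => ?_
      have h3 : |D k j| ≤ |Δ0 j + D k j| + |Δ0 j| := by
        have := abs_sub (Δ0 j + D k j) (Δ0 j)
        rwa [add_sub_cancel_left] at this
      have h4 := mul_le_mul_of_nonneg_left h3
        (mul_nonneg hwpos.le (sub_nonneg.2 (hγ1 k j)))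
      linarith
    have h3 : ∑ k, ∑ j, w * (1 - γ k j) * |Δ0 j| ≤ l1 Δ0 := by
      rw [Finset.sum_comm]
      refine Finset.sum_le_sum fun j _ => ?_
      rw [← Finset.sum_mul]
      refine mul_le_of_le_one_left (abs_nonneg _) ?_
      calc ∑ k, w * (1 - γ k j) ≤ ∑ _k : Fin K, w :=
            Finset.sum_le_sum fun k _ =>
              mul_le_of_le_one_right hwpos.le (by linarith [hγ k j])
        _ = K * w := by simp
        _ ≤ 1 := by linarith
    -- Cauchy–Schwarz: the bad pairs have total weight at most 1.
    have h4 : ∑ k, ∑ j, w * (1 - γ k j) * |Δ0 j + D k j| ≤ T := by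
      refine le_of_sq_le_sq ?_ hT0
      rw [hTsq]
      simp only [← Fintype.sum_prod_type' (f := fun k j => w * (1 - γ k j) * |Δ0 j + D k j|)]
      have h5 := Finset.sum_sq_le_sum_mul_sum_of_sq_le_mul (Finset.univ : Finset (Fin K × Fin p))
        (f := fun x => w * (1 - γ x.1 x.2))
        (g := fun x => w * (1 - γ x.1 x.2) * |Δ0 x.2 + D x.1 x.2| ^ 2)
        (r := fun x => w * (1 - γ x.1 x.2) * |Δ0 x.2 + D x.1 x.2|)
        (fun x _ => mul_nonneg hwpos.le (sub_nonneg.2 (hγ1 _ _)))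
        (fun x _ => mul_nonneg (mul_nonneg hwpos.le (sub_nonneg.2 (hγ1 _ _))) (sq_nonneg _))
        (fun x _ => le_of_eq (by ring))
      refine h5.trans ?_
      have h6 : ∑ x : Fin K × Fin p, w * (1 - γ x.1 x.2) ≤ 1 := by
        rw [Fintype.sum_prod_type]; exact hbad
      have h7 : ∑ x : Fin K × Fin p, w * (1 - γ x.1 x.2) * |Δ0 x.2 + D x.1 x.2| ^ 2 ≤ Q := by
        rw [Fintype.sum_prod_type]
        have h8 : ∑ k, ∑ j, w * (1 - γ k j) * |Δ0 j + D k j| ^ 2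
            ≤ ∑ k, w * sqNorm (Δ0 + D k) := by
          refine Finset.sum_le_sum fun k _ => ?_
          unfold sqNorm
          rw [Finset.mul_sum]
          refine Finset.sum_le_sum fun j _ => ?_
          rw [sq_abs, Pi.add_apply]
          refine mul_le_mul_of_nonneg_right ?_ (sq_nonneg _)
          exact mul_le_of_le_one_right hwpos.le (by linarith [hγ k j])
        exact h8.trans (le_add_of_nonneg_right (mul_nonneg hw0nn (sqNorm_nonneg _)))
      have h9 : 0 ≤ ∑ x : Fin K × Fin p, w * (1 - γ x.1 x.2) * |Δ0 x.2 + D x.1 x.2| ^ 2 :=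
        Finset.sum_nonneg fun x _ => mul_nonneg (mul_nonneg hwpos.le
          (sub_nonneg.2 (hγ1 _ _))) (sq_nonneg _)
      have h10 : (1 : ℝ) ≤ s := by exact_mod_cast hs
      exact (mul_le_mul h6 h7 h9 zero_le_one).trans
        (mul_le_mul_of_nonneg_right h10 hQ0)
    rw [e1, le_div_iff₀ hη]
    have h5 := l1_add_le Δ0 (∑ k, w • D k)
    have h6 : l1 (Δ0 + ∑ k, w • D k) ≤ 2 * l1 Δ0 + Y2 + T := by linarith
    have h7 := mul_le_mul_of_nonneg_left h6 hη.le
    linarith [mul_nonneg hη.le hUcnn, mul_nonneg hη.le hY1nn, mul_le_mul_of_nonneg_right hη' hT0]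

end Fused

/-! ### The correction step -/

section Correction

variable {n p : ℕ} {X : Matrix (Fin n) (Fin p) ℝ} {β0 what δ : Fin p → ℝ} {ε0 : Fin n → ℝ}
  {lam κ C q : ℝ}

/-- The correction step when the first-step error is small in `ℓ₂` norm up to a vector which is
small in `ℓ₁` norm. -/
lemma correction_error {g u : Fin p → ℝ} {M Γ : ℝ} (hlam : 0 < lam) (hC : 0 ≤ C) (hq : 0 ≤ q)
    (hw : what = β0 + g + u) (hδ : IsLasso X (X *ᵥ β0 + ε0 - X *ᵥ what) lam δ)
    (hz : ∀ j, |score X ε0 j| ≤ lam / 2)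
    (hre : ∀ v : Fin p → ℝ, κ * sqNorm v - C * q * l1 v ^ 2 ≤ 1 / (n : ℝ) * sqNorm (X *ᵥ v))
    (hg : l1 g ≤ Γ) (hM : 1 / (n : ℝ) * sqNorm (X *ᵥ u) + 3 * lam * Γ ≤ M) :
    κ * sqNorm (what + δ - β0) ≤ M + 3 * (C * q) * (M ^ 2 / lam ^ 2 + Γ ^ 2 + l1 u ^ 2) := by
  set f := what + δ - β0 with hf
  have e0 : 1 / (2 * (n : ℝ)) = 1 / 2 * (1 / (n : ℝ)) := by
    rw [one_div, one_div, one_div, mul_inv]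
  -- The competitor −g undoes the ℓ₁-small part of the first-step error and leaves the residual ε0 −
  -- Xu.
  have h := lassoObj_le hδ (-g)
  unfold lassoObj at h
  have e1 : X *ᵥ β0 + ε0 - X *ᵥ what - X *ᵥ δ = ε0 - X *ᵥ f := by
    rw [hf, Matrix.mulVec_sub, Matrix.mulVec_add]; abel
  have e2 : X *ᵥ β0 + ε0 - X *ᵥ what - X *ᵥ (-g) = ε0 - X *ᵥ u := by
    rw [hw, Matrix.mulVec_neg, Matrix.mulVec_add, Matrix.mulVec_add]; abel
  rw [e1, e2, sqNorm_sub, sqNorm_sub, e0, l1_neg] at h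
  have hdg : δ + g = f - u := by rw [hf, hw]; abel
  have h1 : 1 / (n : ℝ) * (ε0 ⬝ᵥ (X *ᵥ f)) - 1 / (n : ℝ) * (ε0 ⬝ᵥ (X *ᵥ u))
      ≤ lam / 2 * (l1 δ + l1 g) := by
    rw [← score_dotProduct, ← score_dotProduct, ← dotProduct_sub, ← hdg]
    exact (dotProduct_le_mul_l1 hz).trans
      (mul_le_mul_of_nonneg_left (l1_add_le _ _) (by positivity))
  have hlg := mul_le_mul_of_nonneg_left hg hlam.le
  have h2 : 1 / (n : ℝ) * sqNorm (X *ᵥ f) + lam * l1 δ ≤ M := by nlinarith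
  have hX : 0 ≤ 1 / (n : ℝ) * sqNorm (X *ᵥ f) := mul_nonneg (by positivity) (sqNorm_nonneg _)
  have hδM : l1 δ ≤ M / lam := by rw [le_div_iff₀ hlam]; linarith
  have h3 : l1 f ≤ M / lam + Γ + l1 u := by
    have e3 : f = δ + g + u := by rw [hf, hw]; abel
    have := l1_add_le (δ + g) u
    rw [← e3] at this
    linarith [l1_add_le δ g]
  have h4 : l1 f ^ 2 ≤ 3 * (M ^ 2 / lam ^ 2 + Γ ^ 2 + l1 u ^ 2) := by
    rw [← div_pow]
    have h5 : l1 f ^ 2 ≤ (M / lam + Γ + l1 u) ^ 2 := by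
      gcongr
      exact l1_nonneg _
    nlinarith [sq_nonneg (M / lam - Γ), sq_nonneg (M / lam - l1 u), sq_nonneg (Γ - l1 u)]
  have h6 := hre f
  have h7 := mul_le_mul_of_nonneg_left h4 (mul_nonneg hC hq)
  have h8 := mul_nonneg hlam.le (l1_nonneg δ)
  linarith

/-- The correction step when the first-step error is small in `ℓ₁` norm outside of the support. -/
lemma correction_error_sparse {S : Finset (Fin p)} {s : ℕ} {Γ : ℝ} (hlam : 0 < lam) (hC : 0 ≤ C)
    (hq : 0 ≤ q) (hκ : 0 < κ) (hS : ∀ j ∉ S, β0 j = 0) (hSs : S.card ≤ s)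
    (hδ : IsLasso X (X *ᵥ β0 + ε0 - X *ᵥ what) lam δ) (hz : ∀ j, |score X ε0 j| ≤ lam / 2)
    (hre : ∀ v : Fin p → ℝ, κ * sqNorm v - C * q * l1 v ^ 2 ≤ 1 / (n : ℝ) * sqNorm (X *ᵥ v))
    (hΓ : l1On Sᶜ what ≤ Γ) (hsq : 128 * (C * q * s) ≤ κ) :
    sqNorm (what + δ - β0)
      ≤ 2 / κ * (9 * (s * lam ^ 2) / κ + 4 * (lam * Γ) + 32 * (C * q * Γ ^ 2)) := by
  -- δ is a lasso estimator of β0 − ŵ, which has ℓ₁ mass at most Γ outside `S`.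
  have hδ' : IsLasso X (X *ᵥ (β0 - what) + ε0) lam δ := by
    rw [Matrix.mulVec_sub, sub_add_eq_add_sub]; exact hδ
  have hcone := lasso_cone S hδ' hz
  have e1 : δ - (β0 - what) = what + δ - β0 := by abel
  rw [e1] at hcone
  set f := what + δ - β0 with hf
  have hγ : l1On Sᶜ (β0 - what) ≤ Γ := by
    have h1 := l1On_add_le Sᶜ β0 (-what)
    rw [l1On_neg, l1On_eq_zero hS, ← sub_eq_add_neg] at h1
    linarith
  have hΓ0 : 0 ≤ Γ := (l1On_nonneg _ _).trans hΓ
  have e0 : 1 / (2 * (n : ℝ)) = 1 / 2 * (1 / (n : ℝ)) := by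
    rw [one_div, one_div, one_div, mul_inv]
  rw [e0] at hcone
  have h1 := mul_le_mul_of_nonneg_left hγ hlam.le
  have hX : 0 ≤ 1 / (n : ℝ) * sqNorm (X *ᵥ f) := mul_nonneg (by positivity) (sqNorm_nonneg _)
  have hSn := l1On_nonneg S f
  have hSc := l1On_nonneg Sᶜ f
  have h2 : l1 f ≤ 4 * l1On S f + 4 * Γ := by
    have h3 : lam * l1On Sᶜ f ≤ lam * (3 * l1On S f + 4 * Γ) := by nlinarith
    have := le_of_mul_le_mul_left h3 hlam
    rw [← l1On_add_l1On_compl S f]; linarith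
  have hN := sqNorm_nonneg f
  have h3 : l1On S f ^ 2 ≤ s * sqNorm f :=
    (sq_l1On_le S f).trans (mul_le_mul_of_nonneg_right (by exact_mod_cast hSs) hN)
  have h4 : l1 f ^ 2 ≤ 32 * (s * sqNorm f) + 32 * Γ ^ 2 := by
    have h5 : l1 f ^ 2 ≤ (4 * l1On S f + 4 * Γ) ^ 2 := by
      gcongr
      exact l1_nonneg _
    nlinarith [sq_nonneg (l1On S f - Γ)]
  have h5 := hre f
  have h6 := mul_le_mul_of_nonneg_left h4 (mul_nonneg hC hq)
  have h7 := mul_le_mul_of_nonneg_right hsq hN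
  have h8 : 1 / (n : ℝ) * sqNorm (X *ᵥ f) ≤ 3 * lam * l1On S f + 4 * (lam * Γ) := by
    nlinarith [mul_nonneg hlam.le hSc]
  have h9 : 3 * lam * l1On S f ≤ κ / 4 * sqNorm f + 9 * (s * lam ^ 2) / κ := by
    rcases Nat.eq_zero_or_pos s with hs | hs
    · subst hs
      have : l1On S f = 0 := by
        have : l1On S f ^ 2 ≤ 0 := by simpa using h3
        nlinarith
      rw [this]; simp; positivity
    · have hs0 : (0 : ℝ) < s := by exact_mod_cast hs
      have h10 : 0 ≤ (κ * l1On S f - 6 * (s * lam)) ^ 2 := sq_nonneg _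
      have h11 : 0 ≤ κ ^ 2 * sqNorm f - 12 * κ * lam * l1On S f + 36 * (s * lam ^ 2) := by
        refine nonneg_of_mul_nonneg_right (a := (s : ℝ)) ?_ hs0
        nlinarith [mul_le_mul_of_nonneg_left h3 (sq_nonneg κ)]
      have h12 : κ / 4 * sqNorm f + 9 * (s * lam ^ 2) / κ - 3 * lam * l1On S f
          = (κ ^ 2 * sqNorm f - 12 * κ * lam * l1On S f + 36 * (s * lam ^ 2)) / (4 * κ) := by
        field_simp; ring
      have := div_nonneg h11 (by positivity : 0 ≤ 4 * κ)
      linarith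
  have h10 : κ / 2 * sqNorm f ≤ 9 * (s * lam ^ 2) / κ + 4 * (lam * Γ) + 32 * (C * q * Γ ^ 2) := by
    linarith
  have h11 : sqNorm f = 2 / κ * (κ / 2 * sqNorm f) := by field_simp
  rw [h11]
  exact mul_le_mul_of_nonneg_left h10 (by positivity)

end Correction

/-! ### Comparison of the rates -/

section Rates

variable {A B T g s K Λ lam0 P H CP c₀ : ℝ}

/-- Bounds on the tuning parameter and on the approximation error when `h̄ ≤ s √(log p / n_T)`. Here
`A, B, T` are `√(log p / N)`, `√(log p / n_S)`, `√(log p / n_T)` and `g` is `h̄`. -/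
lemma rate_lam_of_le (hA : 0 < A) (hAB : A ≤ B) (hBT : B ≤ T) (hg : 0 ≤ g) (hs : 1 ≤ s)
    (hK : 1 ≤ K) (hKA : K * A ^ 2 ≤ B ^ 2) (hsB : K * s ^ 2 * B ^ 2 ≤ 1)
    (hΛ0 : 0 ≤ Λ) (hΛ : Λ ≤ A + K * s * A ^ 2 + B * g ∨
      (s * B ^ 2 ≤ g * T ∧ Λ ≤ B + K * s * A ^ 2 + B * g)) (hI : g ≤ s * T) :
    s * Λ ^ 2 ≤ 9 * (s * A ^ 2 + T * g) := by
  have hB : 0 < B := hA.trans_le hAB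
  have hT : 0 < T := hB.trans_le hBT
  have hTg : 0 ≤ T * g := by positivity
  -- The leading term `L0` is A or B according to the indicator in λ₀. The term KsA² is harmless
  -- since Ks²B² ≤ 1, and the term Bg since g ≤ sT.
  have key : ∀ L0 : ℝ, 0 ≤ L0 → s * L0 ^ 2 ≤ s * A ^ 2 + T * g → Λ ≤ L0 + K * s * A ^ 2 + B * g →
      s * Λ ^ 2 ≤ 9 * (s * A ^ 2 + T * g) := by
    intro L0 hL0 h1 h2
    have h3 : Λ ^ 2 ≤ 3 * (L0 ^ 2 + (K * s * A ^ 2) ^ 2 + (B * g) ^ 2) := by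
      have h4 : Λ ^ 2 ≤ (L0 + K * s * A ^ 2 + B * g) ^ 2 := by gcongr
      nlinarith [sq_nonneg (L0 - K * s * A ^ 2), sq_nonneg (L0 - B * g),
        sq_nonneg (K * s * A ^ 2 - B * g)]
    have h5 : s * (K * s * A ^ 2) ^ 2 ≤ s * A ^ 2 := by
      have e : s * (K * s * A ^ 2) ^ 2 = s * A ^ 2 * (K * s ^ 2 * (K * A ^ 2)) := by ring
      rw [e]
      refine mul_le_of_le_one_right (by positivity) (le_trans ?_ hsB)
      exact mul_le_mul_of_nonneg_left hKA (by positivity)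
    have h6 : s * (B * g) ^ 2 ≤ T * g := by
      have h7 : s * (B * g) ^ 2 ≤ s * B ^ 2 * g * (s * T) := by
        have : s * (B * g) ^ 2 = s * B ^ 2 * g * g := by ring
        rw [this]
        exact mul_le_mul_of_nonneg_left hI (by positivity)
      have h8 : s * B ^ 2 * g * (s * T) = s ^ 2 * B ^ 2 * (T * g) := by ring
      have h9 : s ^ 2 * B ^ 2 ≤ 1 := by
        refine le_trans ?_ hsB
        rw [mul_assoc]
        exact le_mul_of_one_le_left (by positivity) hK
      rw [h8] at h7
      exact h7.trans (mul_le_of_le_one_left hTg h9)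
    have h7 : 0 ≤ s * A ^ 2 := by positivity
    nlinarith [mul_le_mul_of_nonneg_left h3 (by positivity : 0 ≤ s)]
  rcases hΛ with h | ⟨h, h'⟩
  · exact key A hA.le (by linarith) h
  · exact key B hB.le (by linarith [show 0 ≤ s * A ^ 2 by positivity]) h'

lemma rate_pen_of_le (hB : 0 < B) (hBT : B ≤ T) (hg : 0 ≤ g)
    (hsB : s * B ≤ 1) (hI : g ≤ s * T) :
    B * g + s * B ^ 2 * g + B * g ^ 2 ≤ 3 * (T * g) := by
  have hT : 0 < T := hB.trans_le hBT
  have h1 : B * g ≤ T * g := mul_le_mul_of_nonneg_right hBT hg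
  have h2 : s * B ^ 2 * g ≤ B * g := by
    have : s * B ^ 2 * g = s * B * (B * g) := by ring
    rw [this]
    exact mul_le_of_le_one_left (by positivity) hsB
  have h3 : B * g ^ 2 ≤ T * g := by
    have h4 : B * g ^ 2 ≤ B * g * (s * T) := by
      rw [sq, ← mul_assoc]
      exact mul_le_mul_of_nonneg_left hI (by positivity)
    have h5 : B * g * (s * T) = s * B * (T * g) := by ring
    rw [h5] at h4
    exact h4.trans (mul_le_of_le_one_left (by positivity) hsB)
  linarith

/-- The bounds on `H = P / lam0`. -/
lemma rate_ratio (hA : 0 < A) (hAB : A ≤ B) (hg : 0 ≤ g) (hsB : s * B ≤ 1)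
    (hc : 0 < c₀) (hCP : 0 ≤ CP) (hP : P ≤ CP * c₀ * (B * g + s * B ^ 2 * g + B * g ^ 2))
    (hlam : c₀ * (A + B * g) ≤ lam0) :
    A * (P / lam0) ≤ 3 * CP * (B * g) ∧
      (c₀ * (B + B * g) ≤ lam0 → P / lam0 ≤ 2 * CP * g) := by
  have hB : 0 < B := hA.trans_le hAB
  have h2 : s * B ^ 2 * g ≤ B * g := by
    have : s * B ^ 2 * g = s * B * (B * g) := by ring
    rw [this]
    exact mul_le_of_le_one_left (by positivity) hsB
  have hP' : P ≤ CP * c₀ * (2 * (B * g) + B * g ^ 2) :=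
    hP.trans (mul_le_mul_of_nonneg_left (by linarith) (by positivity))
  have hl0 : 0 < lam0 := lt_of_lt_of_le (by positivity) hlam
  constructor
  · rw [← mul_div_assoc, div_le_iff₀ hl0]
    have h3 := mul_le_mul_of_nonneg_left hlam (by positivity : 0 ≤ 3 * CP * (B * g))
    have h4 := mul_le_mul_of_nonneg_left hP' hA.le
    have h5 : A * (B * g ^ 2) ≤ B * (B * g ^ 2) := mul_le_mul_of_nonneg_right hAB (by positivity)
    have h6 := mul_le_mul_of_nonneg_left h5 (by positivity : 0 ≤ CP * c₀)
    have h7 : 0 ≤ CP * c₀ * (A * (B * g)) := by positivity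
    have h8 : 0 ≤ CP * c₀ * (B * (B * g ^ 2)) := by positivity
    nlinarith
  · intro h
    rw [div_le_iff₀ hl0]
    have h3 := mul_le_mul_of_nonneg_left h (by positivity : 0 ≤ 2 * CP * g)
    have h8 : 0 ≤ CP * c₀ * (B * g ^ 2) := by positivity
    nlinarith

end Rates

/-! ### Properties of the tuning parameters -/

section Tuning

variable {K p nT nS s : ℕ} {h : Fin K → ℝ} {c₀ κ₂ : ℝ}

lemma total_pos (hK : 1 ≤ K) (hnS : 0 < nS) : 0 < total K nT nS := by
  have h1 : (1 : ℝ) ≤ K := by exact_mod_cast hK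
  have h2 : (0 : ℝ) < nS := by exact_mod_cast hnS
  unfold total
  positivity

lemma weights_sum (hN : 0 < total K nT nS) :
    (K : ℝ) * ((nS : ℝ) / total K nT nS) + (nT : ℝ) / total K nT nS = 1 := by
  rw [← mul_div_assoc, ← add_div]
  exact div_self hN.ne'

lemma hbar_nonneg (hh : ∀ k, 0 ≤ h k) : 0 ≤ hbar nT nS h :=
  mul_nonneg (div_nonneg (Nat.cast_nonneg _) (total_nonneg _ _ _))
    (Finset.sum_nonneg fun k _ => hh k)

/-- In this form the first term of λ₀a_k is visibly the noise level of one entry of (n_S/N) ζ_k. -/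
lemma sqrt_weight : √((nS : ℝ) / total K nT nS * (Real.log p / total K nT nS))
    = (nS : ℝ) / total K nT nS * √(Real.log p / nS) := by
  have hN := total_nonneg K nT nS
  have hw : 0 ≤ (nS : ℝ) / total K nT nS := by positivity
  rcases Nat.eq_zero_or_pos nS with h0 | h0
  · simp [h0]
  have h0' : (0 : ℝ) < nS := by exact_mod_cast h0
  rw [← Real.sqrt_sq hw, ← Real.sqrt_mul (sq_nonneg _), Real.sqrt_sq hw]
  congr 1
  field_simp

lemma deltaT_eq : deltaT p nT nS s h
    = K * s * √(Real.log p / total K nT nS) ^ 2 + √(Real.log p / nS) * hbar nT nS h := by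
  have hl : 0 ≤ Real.log p := Real.log_natCast_nonneg p
  rw [deltaT, Real.sq_sqrt (div_nonneg hl (total_nonneg _ _ _)), mul_div_assoc]

lemma deltaS_eq (k : Fin K) : deltaS p nT nS s h k
    = s * √(Real.log p / total K nT nS) ^ 2
      + (nS : ℝ) / total K nT nS * √(Real.log p / nS) * h k := by
  have hl : 0 ≤ Real.log p := Real.log_natCast_nonneg p
  rw [deltaS, Real.sq_sqrt (div_nonneg hl (total_nonneg _ _ _)), mul_div_assoc]

lemma deltaT_nonneg (hh : ∀ k, 0 ≤ h k) : 0 ≤ deltaT p nT nS s h := by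
  have hl : 0 ≤ Real.log p := Real.log_natCast_nonneg p
  have := hbar_nonneg (nT := nT) (nS := nS) hh
  have hN := total_nonneg K nT nS
  unfold deltaT
  positivity

lemma deltaS_nonneg (hh : ∀ k, 0 ≤ h k) (k : Fin K) : 0 ≤ deltaS p nT nS s h k := by
  have hl : 0 ≤ Real.log p := Real.log_natCast_nonneg p
  have := hh k
  have hN := total_nonneg K nT nS
  unfold deltaS
  positivity

lemma sqrt_total_le (hK : 1 ≤ K) (hnS : 0 < nS) :
    √(Real.log p / total K nT nS) ≤ √(Real.log p / nS) := by
  have hl : 0 ≤ Real.log p := Real.log_natCast_nonneg p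
  have h1 : (1 : ℝ) ≤ K := by exact_mod_cast hK
  have h2 : (0 : ℝ) < nS := by exact_mod_cast hnS
  refine Real.sqrt_le_sqrt (div_le_div_of_nonneg_left hl h2 ?_)
  unfold total
  nlinarith [Nat.cast_nonneg (α := ℝ) nT]

lemma tuneLam_of_condA (hA : condA p nT nS s h) : tuneLam c₀ p nT nS s h
    = c₀ * (√(Real.log p / total K nT nS) + deltaT p nT nS s h) := by
  rw [tuneLam, if_pos hA]

lemma tuneLam_of_not_condA (hA : ¬ condA p nT nS s h) : tuneLam c₀ p nT nS s h
    = c₀ * (√(Real.log p / nS) + deltaT p nT nS s h) := by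
  rw [tuneLam, if_neg hA]

lemma le_tuneLam (hK : 1 ≤ K) (hnS : 0 < nS) (hc : 0 ≤ c₀) :
    c₀ * (√(Real.log p / total K nT nS) + deltaT p nT nS s h) ≤ tuneLam c₀ p nT nS s h := by
  by_cases hA : condA p nT nS s h
  · rw [tuneLam_of_condA hA]
  · rw [tuneLam_of_not_condA hA]
    have := sqrt_total_le (p := p) (nT := nT) hK hnS
    gcongr

lemma tuneLam_le (hK : 1 ≤ K) (hnS : 0 < nS) (hc : 0 ≤ c₀) :
    tuneLam c₀ p nT nS s h ≤ c₀ * (√(Real.log p / nS) + deltaT p nT nS s h) := by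
  by_cases hA : condA p nT nS s h
  · rw [tuneLam_of_condA hA]
    have := sqrt_total_le (p := p) (nT := nT) hK hnS
    gcongr
  · rw [tuneLam_of_not_condA hA]

lemma tuneLam_pos (hK : 1 ≤ K) (hp : 2 ≤ p) (hnS : 0 < nS) (hc : 0 < c₀) (hh : ∀ k, 0 ≤ h k) :
    0 < tuneLam c₀ p nT nS s h := by
  refine lt_of_lt_of_le ?_ (le_tuneLam hK hnS hc.le)
  have h1 : 0 < √(Real.log p / total K nT nS) :=
    Real.sqrt_pos.2 (div_pos (Real.log_pos (by exact_mod_cast hp)) (total_pos hK hnS))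
  have h2 := deltaT_nonneg (p := p) (nT := nT) (nS := nS) (s := s) hh
  positivity

lemma tuneLam_mul_tuneWeight (hlam : 0 < tuneLam c₀ p nT nS s h) (k : Fin K) :
    tuneLam c₀ p nT nS s h * tuneWeight c₀ p nT nS s h k
      = c₀ * max 8 (hbar nT nS h / h k)
        * ((nS : ℝ) / total K nT nS * √(Real.log p / nS) + deltaS p nT nS s h k) := by
  rw [tuneWeight, mul_div_cancel₀ _ hlam.ne', sqrt_weight]

lemma tuneWeight_pos (hK : 1 ≤ K) (hp : 2 ≤ p) (hnS : 0 < nS) (hc : 0 < c₀) (hh : ∀ k, 0 ≤ h k)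
    (k : Fin K) : 0 < tuneWeight c₀ p nT nS s h k := by
  have hlam := tuneLam_pos (nT := nT) (s := s) hK hp hnS hc hh
  refine pos_of_mul_pos_right (b := tuneWeight c₀ p nT nS s h k) ?_ hlam.le
  rw [tuneLam_mul_tuneWeight hlam]
  have hN : 0 < total K nT nS := total_pos hK hnS
  have h1 : 0 < √(Real.log p / nS) := Real.sqrt_pos.2
    (div_pos (Real.log_pos (by exact_mod_cast hp)) (by exact_mod_cast hnS))
  have h2 := deltaS_nonneg (p := p) (nT := nT) (nS := nS) (s := s) hh k
  have h3 : (0 : ℝ) < nS := by exact_mod_cast hnS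
  positivity

/-- Lower bounds on the weight `lam₀ aₖ` of the fusion penalty. -/
lemma le_tuneLam_mul_tuneWeight (hlam : 0 < tuneLam c₀ p nT nS s h) (hc : 0 ≤ c₀)
    (hh : ∀ k, 0 ≤ h k) (k : Fin K) (hκ : hbar nT nS h ≤ κ₂ * h k) :
    c₀ * (8 * ((nS : ℝ) / total K nT nS * √(Real.log p / nS)
        + s * √(Real.log p / total K nT nS) ^ 2)
      + 8 * ((nS : ℝ) / total K nT nS * √(Real.log p / nS) * h k))
      ≤ tuneLam c₀ p nT nS s h * tuneWeight c₀ p nT nS s h k ∧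
    c₀ * (8 * ((nS : ℝ) / total K nT nS * √(Real.log p / nS)
        + s * √(Real.log p / total K nT nS) ^ 2)
      + (nS : ℝ) / total K nT nS * √(Real.log p / nS) * hbar nT nS h)
      ≤ tuneLam c₀ p nT nS s h * tuneWeight c₀ p nT nS s h k := by
  rw [tuneLam_mul_tuneWeight hlam, deltaS_eq]
  set τ := (nS : ℝ) / total K nT nS * √(Real.log p / nS) with hτ
  set σ := (s : ℝ) * √(Real.log p / total K nT nS) ^ 2 with hσ
  set m := max 8 (hbar nT nS h / h k) with hm
  have hτ0 : 0 ≤ τ := mul_nonneg (div_nonneg (Nat.cast_nonneg _) (total_nonneg _ _ _))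
    (Real.sqrt_nonneg _)
  have hσ0 : 0 ≤ σ := by positivity
  have hm8 : 8 ≤ m := le_max_left _ _
  -- If `h k` = 0, then `hκ` forces h̄ ≤ 0, so the convention h̄/0 = 0 agrees with reading the
  -- maximum as 8.
  have hmh : hbar nT nS h ≤ m * h k := by
    rcases (hh k).eq_or_lt with h0 | h0
    · rw [← h0] at hκ ⊢; linarith
    · have := mul_le_mul_of_nonneg_right (le_max_right 8 (hbar nT nS h / h k)) h0.le
      rwa [div_mul_cancel₀ _ h0.ne'] at this
  have h8h : 8 * h k ≤ m * h k := mul_le_mul_of_nonneg_right hm8 (hh k)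
  have hmτ := mul_le_mul_of_nonneg_right hm8 (add_nonneg hτ0 hσ0)
  constructor
  · rw [mul_assoc c₀ m]
    refine mul_le_mul_of_nonneg_left ?_ hc
    have := mul_le_mul_of_nonneg_left h8h hτ0
    linarith
  · rw [mul_assoc c₀ m]
    refine mul_le_mul_of_nonneg_left ?_ hc
    have := mul_le_mul_of_nonneg_left hmh hτ0
    linarith

/-- Since K n_S ≤ N, multiplying δ₀ by n_S/N removes the factor K from its first term, and the
result can be compared with λ₀a_k term by term. -/
lemma tuneLam_mul_weight_le (hK : 1 ≤ K) (hnS : 0 < nS) (hc : 0 ≤ c₀) :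
    tuneLam c₀ p nT nS s h * ((nS : ℝ) / total K nT nS)
      ≤ c₀ * ((nS : ℝ) / total K nT nS * √(Real.log p / nS)
          + s * √(Real.log p / total K nT nS) ^ 2
        + (nS : ℝ) / total K nT nS * √(Real.log p / nS) * hbar nT nS h) := by
  have hN : 0 < total K nT nS := total_pos hK hnS
  set w := (nS : ℝ) / total K nT nS with hw
  have hw0 : 0 ≤ w := by positivity
  have hKw : (K : ℝ) * w ≤ 1 := by
    have := weights_sum hN
    have h2 : 0 ≤ (nT : ℝ) / total K nT nS := by positivity
    linarith
  have h1 := mul_le_mul_of_nonneg_right (tuneLam_le (p := p) (s := s) (h := h) (nT := nT) hK hnS hc)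
    hw0
  refine h1.trans ?_
  rw [deltaT_eq, mul_assoc]
  refine mul_le_mul_of_nonneg_left ?_ hc
  have h2 := mul_le_mul_of_nonneg_right hKw
    (by positivity : 0 ≤ (s : ℝ) * √(Real.log p / total K nT nS) ^ 2)
  linarith

/-- The comparison proved here has slack 8 in the noise terms but none in the term with h̄, so n_S/N
alone cannot serve as averaging weights with a margin. -/
lemma tuneLam_mul_weight_le_tuneWeight (hK : 1 ≤ K) (hp : 2 ≤ p) (hnS : 0 < nS) (hc : 0 < c₀)
    (hh : ∀ k, 0 ≤ h k) (k : Fin K) (hκ : hbar nT nS h ≤ κ₂ * h k) :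
    tuneLam c₀ p nT nS s h * ((nS : ℝ) / total K nT nS)
      ≤ tuneLam c₀ p nT nS s h * tuneWeight c₀ p nT nS s h k := by
  refine (tuneLam_mul_weight_le hK hnS hc.le).trans (le_trans ?_
    (le_tuneLam_mul_tuneWeight (tuneLam_pos hK hp hnS hc hh) hc.le hh k hκ).2)
  refine mul_le_mul_of_nonneg_left ?_ hc.le
  have h1 : 0 ≤ (nS : ℝ) / total K nT nS * √(Real.log p / nS)
      + s * √(Real.log p / total K nT nS) ^ 2 := by
    have := total_nonneg K nT nS
    positivity
  linarith

/-- Averaging weights on the tasks which are dominated by the fusion penalty, with some margin. -/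
lemma exists_base_weights {θ : ℝ} (hK : 1 ≤ K) (hp : 2 ≤ p) (hnS : 0 < nS) (hc : 0 < c₀)
    (hh : ∀ k, 0 ≤ h k) (hκ : ∀ k, h k ≤ κ₂ * hbar nT nS h ∧ hbar nT nS h ≤ κ₂ * h k)
    (hθ : 0 < θ) (hθ' : θ ≤ 1 / 2) (hθκ : θ * κ₂ ≤ 1) :
    ∃ (v : Fin K → ℝ) (v0 : ℝ), (∀ k, 0 ≤ v k) ∧ 0 ≤ v0 ∧ ∑ k, v k + v0 = 1 ∧
      (∀ k, v k ≤ 2 * ((nS : ℝ) / total K nT nS)) ∧ v0 ≤ (nT : ℝ) / total K nT nS ∧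
      ∀ k, tuneLam c₀ p nT nS s h * v k
        ≤ (1 - 7 * θ / 8) * (tuneLam c₀ p nT nS s h * tuneWeight c₀ p nT nS s h k) := by
  have hN : 0 < total K nT nS := total_pos hK hnS
  have hlam := tuneLam_pos (nT := nT) (s := s) hK hp hnS hc hh
  have hsum := weights_sum hN
  have hg := hbar_nonneg (nT := nT) (nS := nS) hh
  have hlw := tuneLam_mul_weight_le (nT := nT) (s := s) (h := h) (p := p) hK hnS hc.le
  set lam := tuneLam c₀ p nT nS s h with hlamdef
  set w := (nS : ℝ) / total K nT nS with hw
  set w0 := (nT : ℝ) / total K nT nS with hw0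
  set g := hbar nT nS h with hgdef
  set τ := w * √(Real.log p / nS) with hτ
  set σ := (s : ℝ) * √(Real.log p / total K nT nS) ^ 2 with hσ
  have hw0' : 0 ≤ w := by positivity
  have hw0nn : 0 ≤ w0 := by positivity
  have hτ0 : 0 ≤ τ := by positivity
  have hσ0 : 0 ≤ σ := by positivity
  have hlow : ∀ k, c₀ * (8 * (τ + σ) + 8 * (τ * h k)) ≤ lam * tuneWeight c₀ p nT nS s h k ∧
      c₀ * (8 * (τ + σ) + τ * g) ≤ lam * tuneWeight c₀ p nT nS s h k := fun k =>
    le_tuneLam_mul_tuneWeight hlam hc.le hh k (hκ k).2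
  rcases hg.eq_or_lt with h0 | h0
  -- If h̄ = 0, the term without slack is absent and the plain weights work.
  · refine ⟨fun _ => w, w0, fun _ => hw0', hw0nn, by simpa using hsum, fun _ => by linarith, le_rfl,
      fun k => ?_⟩
    have h1 := (hlow k).2
    rw [← h0, mul_zero, add_zero] at h1 hlw
    have h2 : 0 ≤ c₀ * (τ + σ) := by positivity
    have h3 := mul_le_mul_of_nonneg_left h1 (by linarith : 0 ≤ 1 - 7 * θ / 8)
    nlinarith
  · have hwh : w * ∑ k, h k = g := rfl
    -- In the mixed weights, θτg is traded for θτh_k, and λ₀a_k dominates τh_k with slack 8.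
    -- Combining the two lower bounds with coefficients 1 − θ and θ/8 leaves the factor 1 − 7θ/8.
    -- The total mass is still 1 because w ∑ h_k = g.
    refine ⟨fun k => (1 - θ) * w + θ * w * (h k / g), (1 - θ) * w0, fun k => ?_, ?_, ?_,
      fun k => ?_, ?_, fun k => ?_⟩
    · have := hh k
      have : 0 ≤ 1 - θ := by linarith
      positivity
    · exact mul_nonneg (by linarith) hw0nn
    · have e1 : ∑ k, ((1 - θ) * w + θ * w * (h k / g)) = (1 - θ) * (K * w) + θ * ((w * ∑ k, h k) / g) := by
        rw [Finset.sum_add_distrib, ← Finset.mul_sum (f := fun k => h k / g), ← Finset.sum_div]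
        simp only [Finset.sum_const, Finset.card_univ, Fintype.card_fin, nsmul_eq_mul]
        ring
      rw [e1, hwh, div_self h0.ne']
      linear_combination (1 - θ) * hsum
    · have h1 : θ * (h k / g) ≤ 1 := by
        have : h k / g ≤ κ₂ := by rw [div_le_iff₀ h0]; exact (hκ k).1
        nlinarith
      nlinarith
    · nlinarith
    · have hq : θ * (h k / g) ≤ 1 := by
        have : h k / g ≤ κ₂ := by rw [div_le_iff₀ h0]; exact (hκ k).1
        nlinarith
      have hq0 : 0 ≤ h k / g := div_nonneg (hh k) hg
      have hqg : h k / g * g = h k := div_mul_cancel₀ _ h0.ne'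
      have h1 : lam * ((1 - θ) * w + θ * w * (h k / g))
          ≤ c₀ * (τ + σ + τ * g) * ((1 - θ) + θ * (h k / g)) := by
        have h2 := mul_le_mul_of_nonneg_right hlw
          (by nlinarith [mul_nonneg hθ.le hq0] : 0 ≤ (1 - θ) + θ * (h k / g))
        linarith
      have h2 : c₀ * (τ + σ + τ * g) * ((1 - θ) + θ * (h k / g))
          = c₀ * ((τ + σ) * ((1 - θ) + θ * (h k / g)) + (1 - θ) * (τ * g) + θ * (τ * h k)) := by
        linear_combination (c₀ * τ * θ) * hqg
      have h3 : c₀ * ((τ + σ) * ((1 - θ) + θ * (h k / g)) + (1 - θ) * (τ * g) + θ * (τ * h k))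
          ≤ c₀ * (2 * (τ + σ) + (1 - θ) * (τ * g) + θ * (τ * h k)) := by
        refine mul_le_mul_of_nonneg_left ?_ hc.le
        have := mul_le_mul_of_nonneg_left (by linarith : (1 - θ) + θ * (h k / g) ≤ 2)
          (add_nonneg hτ0 hσ0)
        linarith
      have h4 := mul_le_mul_of_nonneg_left (hlow k).2 (by linarith : 0 ≤ 1 - θ)
      have h5 := mul_le_mul_of_nonneg_left (hlow k).1 (by linarith : 0 ≤ θ / 8)
      have h6 : 0 ≤ (6 - 7 * θ) * (c₀ * (τ + σ)) :=
        mul_nonneg (by linarith) (by positivity)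
      linarith

/-- Averaging weights which vanish on a small set of bad pairs of a task and a coordinate. -/
lemma exists_weights {η : ℝ} {ρ γ : Fin K → Fin p → ℝ} (hK : 1 ≤ K) (hp : 2 ≤ p) (hnS : 0 < nS)
    (hc : 0 < c₀) (hh : ∀ k, 0 ≤ h k)
    (hκ : ∀ k, h k ≤ κ₂ * hbar nT nS h ∧ hbar nT nS h ≤ κ₂ * h k)
    (hη : 0 < η) (hη' : 16 * η ≤ 1 / 2) (hηκ : 16 * η * κ₂ ≤ 1)
    (hρ : ∀ k j, |ρ k j| ≤ tuneLam c₀ p nT nS s h * tuneWeight c₀ p nT nS s h k)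
    (hγ : ∀ k j, (γ k j = 1 ∧
      |ρ k j| ≤ η * (tuneLam c₀ p nT nS s h * tuneWeight c₀ p nT nS s h k)) ∨ γ k j = 0)
    (hbad : ∀ j, ∑ k, (nS : ℝ) / total K nT nS * (1 - γ k j) ≤ η / 2) :
    ∃ (v : Fin K → Fin p → ℝ) (v0 : Fin p → ℝ), (∀ k j, 0 ≤ v k j) ∧ (∀ j, 0 ≤ v0 j) ∧
      (∀ j, ∑ k, v k j + v0 j = 1) ∧ (∀ k j, v k j ≤ 4 * ((nS : ℝ) / total K nT nS)) ∧
      (∀ j, v0 j ≤ 4 * ((nT : ℝ) / total K nT nS)) ∧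
      ∀ k j, (1 + 2 * η) * (tuneLam c₀ p nT nS s h * v k j)
        + η * (tuneLam c₀ p nT nS s h * ((nS : ℝ) / total K nT nS)) * γ k j
        ≤ tuneLam c₀ p nT nS s h * tuneWeight c₀ p nT nS s h k - |ρ k j| := by
  obtain ⟨v, v0, hv, hv0, hsum, hvw, hv0w, hvl⟩ := exists_base_weights (s := s) (θ := 16 * η) hK hp
    hnS hc hh hκ (by linarith) hη' hηκ
  have hlw := fun k => tuneLam_mul_weight_le_tuneWeight (s := s) hK hp hnS hc hh k (hκ k).2
  have hlam := tuneLam_pos (nT := nT) (s := s) hK hp hnS hc hh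
  have hN : 0 < total K nT nS := total_pos hK hnS
  set lam := tuneLam c₀ p nT nS s h with hlamdef
  set w := (nS : ℝ) / total K nT nS with hw
  have hw0 : 0 ≤ w := by positivity
  -- The mass kept at coordinate j after deleting the bad pairs. Renormalizing by it costs at most a
  -- factor 1/(1 − η), because v ≤ 2w and the bad weight is at most η/2.
  set m : Fin p → ℝ := fun j => ∑ k, v k * γ k j + v0 with hm
  have hγ0 : ∀ k j, 0 ≤ γ k j ∧ γ k j ≤ 1 := fun k j => by
    rcases hγ k j with ⟨h, _⟩ | h <;> rw [h] <;> norm_num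
  have hm1 : ∀ j, 1 - η ≤ m j := by
    intro j
    have h1 : ∑ k, v k * (1 - γ k j) ≤ 2 * ∑ k, w * (1 - γ k j) := by
      rw [Finset.mul_sum]
      refine Finset.sum_le_sum fun k _ => ?_
      have := mul_le_mul_of_nonneg_right (hvw k) (sub_nonneg.2 (hγ0 k j).2)
      linarith
    have h2 : ∑ k, v k * (1 - γ k j) = ∑ k, v k - ∑ k, v k * γ k j := by
      rw [← Finset.sum_sub_distrib]
      exact Finset.sum_congr rfl fun _ _ => by ring
    have h3 := hbad j
    simp only [hm]
    linarith
  have hm0 : ∀ j, 0 < m j := fun j => lt_of_lt_of_le (by linarith) (hm1 j)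
  have hdiv : ∀ (j : Fin p) (x y : ℝ), 0 ≤ x → x ≤ y → x / m j ≤ 2 * y := by
    intro j x y hx hxy
    rw [div_le_iff₀ (hm0 j)]
    have : 1 / 2 ≤ m j := by linarith [hm1 j]
    nlinarith
  refine ⟨fun k j => v k * γ k j / m j, fun j => v0 / m j, fun k j => ?_, fun j => ?_, fun j => ?_,
    fun k j => ?_, fun j => ?_, fun k j => ?_⟩
  · exact div_nonneg (mul_nonneg (hv k) (hγ0 k j).1) (hm0 j).le
  · exact div_nonneg hv0 (hm0 j).le
  · rw [← Finset.sum_div, ← add_div]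
    exact div_self (hm0 j).ne'
  · have h1 : v k * γ k j ≤ 2 * w :=
      (mul_le_of_le_one_right (hv k) (hγ0 k j).2).trans (hvw k)
    linarith [hdiv j _ _ (mul_nonneg (hv k) (hγ0 k j).1) h1]
  · have h2 : 0 ≤ (nT : ℝ) / total K nT nS := by positivity
    linarith [hdiv j _ _ hv0 hv0w]
  · dsimp only
    rcases hγ k j with ⟨h1, h2⟩ | h1
    · rw [h1]
      set α := lam * tuneWeight c₀ p nT nS s h k with hα
      have hα0 : 0 ≤ α := (abs_nonneg _).trans (hρ k j)
      -- 14η = 7θ/8 with θ = 16η.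
      have h3 : lam * (v k * 1 / m j) ≤ (1 - 14 * η) * α / (1 - η) := by
        rw [mul_one, ← mul_div_assoc]
        have h4 := hvl k
        refine (div_le_div_of_nonneg_left (mul_nonneg hlam.le (hv k)) (by linarith) (hm1 j)).trans ?_
        refine div_le_div_of_nonneg_right ?_ (by linarith)
        linarith
      -- The remaining 2ηα is shared between the noise |ρ| ≤ ηα and the term η λ₀w ≤ ηα.
      have h4 : (1 + 2 * η) * ((1 - 14 * η) * α / (1 - η)) ≤ (1 - 2 * η) * α := by
        rw [mul_div_assoc', div_le_iff₀ (by linarith)]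
        nlinarith [mul_nonneg hη.le hα0, mul_nonneg (mul_nonneg hη.le hη.le) hα0]
      have h5 := mul_le_mul_of_nonneg_left h3 (by linarith : 0 ≤ 1 + 2 * η)
      have h6 := mul_le_mul_of_nonneg_left (hlw k) hη.le
      linarith
    · rw [h1]
      have := hρ k j
      simp only [mul_zero, zero_div, add_zero]
      linarith

/-- The total weight of the fusion penalty at the true contrasts. -/
lemma sum_tuneWeight_le {d : Fin K → Fin p → ℝ} (hK : 1 ≤ K) (hp : 2 ≤ p) (hnS : 0 < nS)
    (hc : 0 < c₀) (hκ1 : 1 ≤ κ₂) (hd : ∀ k, l1 (d k) ≤ h k)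
    (hκ : ∀ k, h k ≤ κ₂ * hbar nT nS h ∧ hbar nT nS h ≤ κ₂ * h k) :
    ∑ k, tuneLam c₀ p nT nS s h * tuneWeight c₀ p nT nS s h k * l1 (d k)
      ≤ 8 * κ₂ ^ 2 * c₀ * (√(Real.log p / nS) * hbar nT nS h
        + s * √(Real.log p / nS) ^ 2 * hbar nT nS h + √(Real.log p / nS) * hbar nT nS h ^ 2) := by
  have hh : ∀ k, 0 ≤ h k := fun k => (l1_nonneg _).trans (hd k)
  have hN : 0 < total K nT nS := total_pos hK hnS
  have hlam := tuneLam_pos (nT := nT) (s := s) hK hp hnS hc hh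
  have hg := hbar_nonneg (nT := nT) (nS := nS) hh
  have hl : 0 ≤ Real.log p := Real.log_natCast_nonneg p
  have hnS' : (0 : ℝ) < nS := by exact_mod_cast hnS
  set g := hbar nT nS h with hgdef
  set B := √(Real.log p / nS) with hB
  set w := (nS : ℝ) / total K nT nS with hw
  have hw0 : 0 < w := by positivity
  have hB0 : 0 ≤ B := Real.sqrt_nonneg _
  have hwh : ∑ k, w * h k = g := by rw [← Finset.mul_sum]; rfl
  have hσ : (s : ℝ) * √(Real.log p / total K nT nS) ^ 2 = s * B ^ 2 * w := by
    rw [hB, hw, Real.sq_sqrt (by positivity), Real.sq_sqrt (by positivity)]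
    field_simp
  have h1 : ∀ k, tuneLam c₀ p nT nS s h * tuneWeight c₀ p nT nS s h k * l1 (d k)
      ≤ 8 * κ₂ * c₀ * (B + s * B ^ 2 + κ₂ * (B * g)) * (w * h k) := by
    intro k
    rw [tuneLam_mul_tuneWeight hlam, deltaS_eq, hσ]
    have hm : max 8 (g / h k) ≤ 8 * κ₂ := by
      refine max_le (by linarith) ?_
      rcases (hh k).eq_or_lt with h0 | h0
      · rw [← h0, div_zero]; positivity
      · rw [div_le_iff₀ h0]
        nlinarith [(hκ k).2, mul_nonneg (by linarith : 0 ≤ κ₂) h0.le]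
    have hb : w * B + (s * B ^ 2 * w + w * B * h k) ≤ w * (B + s * B ^ 2 + κ₂ * (B * g)) := by
      have := mul_le_mul_of_nonneg_left (hκ k).1 (mul_nonneg hw0.le hB0)
      linarith
    have hb0 : 0 ≤ w * B + (s * B ^ 2 * w + w * B * h k) := by
      have := hh k
      positivity
    calc c₀ * max 8 (g / h k) * (w * B + (s * B ^ 2 * w + w * B * h k)) * l1 (d k)
        ≤ c₀ * (8 * κ₂) * (w * (B + s * B ^ 2 + κ₂ * (B * g))) * h k := by
          have h3 : 0 ≤ max 8 (g / h k) := le_trans (by norm_num) (le_max_left _ _)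
          have h4 : 0 ≤ w * (B + s * B ^ 2 + κ₂ * (B * g)) := hb0.trans hb
          have h5 := hd k
          have h6 := l1_nonneg (d k)
          gcongr
      _ = _ := by ring
  refine (Finset.sum_le_sum fun k _ => h1 k).trans ?_
  rw [← Finset.mul_sum, hwh]
  have h2 : 0 ≤ 8 * κ₂ * c₀ := by positivity
  have h3 : (B + s * B ^ 2 + κ₂ * (B * g)) * g
      ≤ κ₂ * (B * g + s * B ^ 2 * g + B * g ^ 2) := by
    have h4 : 0 ≤ B * g + s * B ^ 2 * g := by positivity
    nlinarith
  calc 8 * κ₂ * c₀ * (B + s * B ^ 2 + κ₂ * (B * g)) * g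
      = 8 * κ₂ * c₀ * ((B + s * B ^ 2 + κ₂ * (B * g)) * g) := by ring
    _ ≤ 8 * κ₂ * c₀ * (κ₂ * (B * g + s * B ^ 2 * g + B * g ^ 2)) :=
        mul_le_mul_of_nonneg_left h3 h2
    _ = _ := by ring

end Tuning

/-! ### The deterministic error bound -/

/-- The margin used for the noise level relative to the penalties. -/
def margin (κ₂ : ℝ) : ℝ := 1 / (32 * κ₂)

lemma margin_pos {κ₂ : ℝ} (h : 1 ≤ κ₂) : 0 < margin κ₂ := by unfold margin; positivity

lemma margin_le {κ₂ : ℝ} (h : 1 ≤ κ₂) : margin κ₂ ≤ 1 / 32 := by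
  unfold margin
  rw [div_le_div_iff₀ (by positivity) (by norm_num)]
  linarith

lemma margin_mul {κ₂ : ℝ} (h : 1 ≤ κ₂) : 16 * margin κ₂ * κ₂ ≤ 1 := by
  unfold margin
  have : κ₂ ≠ 0 := by positivity
  field_simp
  norm_num

/-- The first-step error: the estimator `ŵ` is the sum of the true target coefficient, the weighted
average of the contrasts, and an error `u` which is controlled in `ℓ₂` and `ℓ₁` norm. -/
lemma first_step_error {κ₂ κ Cr c₀ : ℝ} {K p nT nS s : ℕ} {h : Fin K → ℝ}
    (hκ₂ : 1 ≤ κ₂) (hκ : 0 < κ) (hκ1 : κ ≤ 1) (hCr : 0 ≤ Cr) (hc₀ : 0 < c₀)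
    (hK : 1 ≤ K) (hp : 2 ≤ p) (hs : 1 ≤ s) (hnT : 0 < nT) (hnS : 0 < nS)
    (hh : ∀ k, h k ≤ κ₂ * hbar nT nS h ∧ hbar nT nS h ≤ κ₂ * h k)
    {X0 : Matrix (Fin nT) (Fin p) ℝ} {ε0 : Fin nT → ℝ} {β0 : Fin p → ℝ}
    {d ζ bt : Fin K → Fin p → ℝ} {b : (Fin p → ℝ) × (Fin K → Fin p → ℝ)} {S : Finset (Fin p)}
    (hS : ∀ j ∉ S, β0 j = 0) (hSs : S.card ≤ s) (hd : ∀ k, l1 (d k) ≤ h k)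
    (hre : ∀ v : Fin p → ℝ, κ * sqNorm v - Cr * (Real.log p / nT) * l1 v ^ 2
      ≤ 1 / (nT : ℝ) * sqNorm (X0 *ᵥ v))
    (hbt : ∀ k, bt k = β0 + d k + ζ k) {ρ : Fin K → Fin p → ℝ}
    (hρ : ∀ k j, ρ k j = clip (tuneLam c₀ p nT nS s h * tuneWeight c₀ p nT nS s h k)
      ((nS : ℝ) / total K nT nS * ζ k j))
    (hg : ∀ j, |((1 / total K nT nS) • (X0ᵀ *ᵥ ε0) + ∑ k, ρ k) j|
      ≤ margin κ₂ * tuneLam c₀ p nT nS s h) {γ : Fin K → Fin p → ℝ}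
    (hγ : ∀ k j, (γ k j = 1 ∧ |ρ k j| ≤ margin κ₂ *
      (tuneLam c₀ p nT nS s h * tuneWeight c₀ p nT nS s h k)) ∨ γ k j = 0)
    (hbad : ∑ k, ∑ j, (nS : ℝ) / total K nT nS * (1 - γ k j) ≤ margin κ₂ / 2)
    (hb : IsMinOn (fusedObj nS X0 (X0 *ᵥ β0 + ε0) bt (tuneLam c₀ p nT nS s h)
      (tuneWeight c₀ p nT nS s h)) Set.univ b) {P : ℝ}
    (hP : ∑ k, tuneLam c₀ p nT nS s h * tuneWeight c₀ p nT nS s h k * l1 (d k) ≤ P)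
    (hsq : 288 * (Cr * √(Real.log p / total K nT nS) ^ 2 * s) ≤ κ * margin κ₂ ^ 2)
    (hPq : 4 * (Cr * √(Real.log p / total K nT nS) ^ 2 * (P / tuneLam c₀ p nT nS s h) ^ 2)
      ≤ margin κ₂ ^ 2 * P) :
    ∃ (Q : ℝ) (u : Fin p → ℝ), 0 ≤ Q ∧
      Q ≤ 128 / κ ^ 2 * (s * tuneLam c₀ p nT nS s h ^ 2) + 12 / κ * P ∧
      sqNorm u ≤ Q ∧ l1 u ≤ (17 * √(s * Q) + 6 * (P / tuneLam c₀ p nT nS s h)) / margin κ₂ ∧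
      weightedAvg nT nS b = β0 + ((nS : ℝ) / total K nT nS) • ∑ k, d k
        + (u + ∑ k, (((nS : ℝ) / total K nT nS) • ζ k - ρ k)) := by
  have hh0 : ∀ k, 0 ≤ h k := fun k => (l1_nonneg _).trans (hd k)
  have hN : 0 < total K nT nS := total_pos hK hnS
  have hlam := tuneLam_pos (nT := nT) (s := s) hK hp hnS hc₀ hh0
  have ha : ∀ k, 0 ≤ tuneLam c₀ p nT nS s h * tuneWeight c₀ p nT nS s h k := fun k =>
    mul_nonneg hlam.le (tuneWeight_pos hK hp hnS hc₀ hh0 k).le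
  have hη := margin_pos hκ₂
  have hη1 := margin_le hκ₂
  have hl : 0 ≤ Real.log p := Real.log_natCast_nonneg p
  have hw : 0 < (nS : ℝ) / total K nT nS := div_pos (by exact_mod_cast hnS) hN
  have hsum := weights_sum hN
  have hγ0 : ∀ k j, 0 ≤ γ k j ∧ γ k j ≤ 1 := fun k j => by
    rcases hγ k j with ⟨h, _⟩ | h <;> rw [h] <;> norm_num
  have hbad' : ∀ j, ∑ k, (nS : ℝ) / total K nT nS * (1 - γ k j) ≤ margin κ₂ / 2 := by
    intro j
    refine le_trans ?_ hbad
    rw [Finset.sum_comm]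
    exact Finset.single_le_sum (f := fun j => ∑ k, (nS : ℝ) / total K nT nS * (1 - γ k j))
      (fun j _ => Finset.sum_nonneg fun k _ => mul_nonneg hw.le (sub_nonneg.2 (hγ0 k j).2))
      (Finset.mem_univ j)
  have hρle : ∀ k j, |ρ k j| ≤ tuneLam c₀ p nT nS s h * tuneWeight c₀ p nT nS s h k := fun k j => by
    rw [hρ]; exact abs_clip_le (ha k) _
  obtain ⟨v, v0, hv, hv0, hvsum, hvw, hv0w, hweight⟩ := exists_weights hK hp hnS hc₀ hh0 hh hη
    (by linarith) (margin_mul hκ₂) hρle hγ hbad'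
  set N := total K nT nS with hNdef
  set w := (nS : ℝ) / N with hwdef
  set w0 := (nT : ℝ) / N with hw0def
  set lam := tuneLam c₀ p nT nS s h with hlamdef
  set e : Fin K → Fin p → ℝ := fun k => ζ k - (1 / w) • ρ k with he
  have hwe : ∀ k, w • e k = w • ζ k - ρ k := by
    intro k
    simp only [he, smul_sub, smul_smul]
    rw [mul_one_div_cancel hw.ne', one_smul]
  set Δ0 := b.1 - β0 with hΔ0
  set D : Fin K → Fin p → ℝ := fun k => b.2 k - b.1 - d k - e k with hD
  obtain ⟨Q, hQ0, hQ, hu2, hu1⟩ := fused_error (e := e) (D := D) (Δ0 := Δ0) (q := √(Real.log p / N) ^ 2)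
    (γ := γ) hN hnS hlam ha hb hbt hρ
    (fun k j => by have := congrFun (hwe k) j; simpa using this)
    (by rw [hΔ0]; abel) (fun k => by simp only [hD]; abel) hS hSs hs hη (by linarith) hκ hκ1 hCr
    (sq_nonneg _) (fun u => by
      have h1 := mul_le_mul_of_nonneg_left (hre u) (by positivity : 0 ≤ w0)
      have hnT' : (0 : ℝ) < nT := by exact_mod_cast hnT
      have e1 : w0 * (1 / (nT : ℝ) * sqNorm (X0 *ᵥ u)) = 1 / N * sqNorm (X0 *ᵥ u) := by
        rw [hw0def]; field_simp
      have e2 : w0 * (κ * sqNorm u - Cr * (Real.log p / nT) * l1 u ^ 2)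
          = κ * w0 * sqNorm u - Cr * √(Real.log p / N) ^ 2 * l1 u ^ 2 := by
        rw [Real.sq_sqrt (by positivity), hw0def]; field_simp
      rwa [e1, e2] at h1) hP hg hv hv0 hvsum hvw hv0w
    (fun k j => (hγ0 k j).1) (fun k j => (hγ0 k j).2) (hbad.trans (by linarith)) hweight hsq hPq
  refine ⟨Q, _, hQ0, hQ, hu2, hu1, ?_⟩
  have e1 : ∀ k, b.2 k = β0 + d k + e k + (Δ0 + D k) := fun k => by
    simp only [hD, hΔ0]; abel
  have e2 : b.1 = β0 + Δ0 := by rw [hΔ0]; abel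
  simp only [weightedAvg, ← hNdef, ← hwdef, ← hw0def, ← hwe, ← Finset.smul_sum]
  ext j
  have e3 : ∑ k, b.2 k j = K * β0 j + ∑ k, d k j + ∑ k, e k j + ∑ k, (Δ0 j + D k j) := by
    have : ∀ k, b.2 k j = β0 j + d k j + e k j + (Δ0 j + D k j) := fun k => by
      have := congrFun (e1 k) j
      simpa using this
    simp only [this, Finset.sum_add_distrib, Finset.sum_const, Finset.card_univ, Fintype.card_fin,
      nsmul_eq_mul]
  have e4 : b.1 j = β0 j + Δ0 j := by have := congrFun e2 j; simpa using this
  simp only [Pi.add_apply, Pi.smul_apply, smul_eq_mul, Finset.sum_apply]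
  rw [e3, e4]
  linear_combination (β0 j) * hsum

set_option maxHeartbeats 4000000 in
/-- The error bound of the two-step estimator, given the size of the noise terms. -/
theorem two_step_error {κ₂ κ₃ κ Cr Cu c₀ c₁ : ℝ} (hκ₂ : 1 ≤ κ₂) (hκ₃ : 0 < κ₃) (hκ : 0 < κ)
    (hκ1 : κ ≤ 1) (hCr : 0 ≤ Cr) (hCu : 0 ≤ Cu) (hc₀ : 0 < c₀) (hc₁ : 0 < c₁) :
    ∃ ε C : ℝ, 0 < ε ∧ ε ≤ 1 ∧ 0 < C ∧ ∀ (K p nT nS s : ℕ) (h : Fin K → ℝ),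
      1 ≤ K → 2 ≤ p → 1 ≤ s → 0 < nT → nT ≤ nS → K * (s : ℝ) ^ 2 * Real.log p ≤ ε * nS →
      (∀ k, h k ≤ κ₂ * hbar nT nS h ∧ hbar nT nS h ≤ κ₂ * h k) →
      κ₃ * (s * Real.log p) ≤ nT → hbar nT nS h * √(Real.log p / nT) ≤ ε →
      ∀ (X0 : Matrix (Fin nT) (Fin p) ℝ) (ε0 : Fin nT → ℝ) (β0 : Fin p → ℝ)
        (d ζ bt ρ γ : Fin K → Fin p → ℝ) (b : (Fin p → ℝ) × (Fin K → Fin p → ℝ)) (δ : Fin p → ℝ),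
      l0 β0 ≤ s → (∀ k, l1 (d k) ≤ h k) →
      (∀ v : Fin p → ℝ, κ * sqNorm v - Cr * (Real.log p / nT) * l1 v ^ 2
        ≤ 1 / (nT : ℝ) * sqNorm (X0 *ᵥ v)) →
      (∀ v : Fin p → ℝ, 1 / (nT : ℝ) * sqNorm (X0 *ᵥ v)
        ≤ Cu * sqNorm v + Cr * (Real.log p / nT) * l1 v ^ 2) →
      (∀ j, |score X0 ε0 j| ≤ c₁ * √(Real.log p / nT) / 2) →
      (∀ k, bt k = β0 + d k + ζ k) →
      (∀ k j, ρ k j = clip (tuneLam c₀ p nT nS s h * tuneWeight c₀ p nT nS s h k)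
        ((nS : ℝ) / total K nT nS * ζ k j)) →
      (∀ j, |((1 / total K nT nS) • (X0ᵀ *ᵥ ε0) + ∑ k, ρ k) j|
        ≤ margin κ₂ * tuneLam c₀ p nT nS s h) →
      (∀ k j, (γ k j = 1 ∧ |ρ k j| ≤ margin κ₂ *
        (tuneLam c₀ p nT nS s h * tuneWeight c₀ p nT nS s h k)) ∨ γ k j = 0) →
      ∑ k, ∑ j, (nS : ℝ) / total K nT nS * (1 - γ k j) ≤ margin κ₂ / 2 →
      l1 (∑ k, (((nS : ℝ) / total K nT nS) • ζ k - ρ k)) ≤ √(Real.log p / total K nT nS) →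
      IsMinOn (fusedObj nS X0 (X0 *ᵥ β0 + ε0) bt (tuneLam c₀ p nT nS s h)
        (tuneWeight c₀ p nT nS s h)) Set.univ b →
      IsLasso X0 (X0 *ᵥ β0 + ε0 - X0 *ᵥ weightedAvg nT nS b) (c₁ * √(Real.log p / nT)) δ →
      sqNorm (weightedAvg nT nS b + δ - β0)
        ≤ C * (s * Real.log p / total K nT nS + √(Real.log p / nT) * hbar nT nS h) := by
  set η := margin κ₂ with hηdef
  have hη : 0 < η := margin_pos hκ₂
  have hη1 : η ≤ 1 / 32 := margin_le hκ₂
  set CP := 8 * κ₂ ^ 2 with hCPdef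
  have hCP : 0 < CP := by positivity
  -- Besides 1, the two entries are what the smallness conditions `hsq` and `hPq` of the first step
  -- require; the +1 only keeps the denominators positive.
  set ε := min 1 (min (κ * η ^ 2 / (288 * Cr + 1)) (η ^ 2 * c₀ / (12 * (Cr * CP) + 1))) with hεdef
  have hε0 : 0 < ε := by positivity
  have hε1 : ε ≤ 1 := min_le_left _ _
  have hεa : 288 * (Cr * ε) ≤ κ * η ^ 2 := by
    have h1 : ε ≤ κ * η ^ 2 / (288 * Cr + 1) := (min_le_right _ _).trans (min_le_left _ _)
    rw [le_div_iff₀ (by positivity)] at h1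
    linarith
  have hεb : 12 * (Cr * CP * ε) ≤ η ^ 2 * c₀ := by
    have h1 : ε ≤ η ^ 2 * c₀ / (12 * (Cr * CP) + 1) := (min_le_right _ _).trans (min_le_right _ _)
    rw [le_div_iff₀ (by positivity)] at h1
    linarith
  -- the constants
  set CQ := 1152 * c₀ ^ 2 / κ ^ 2 + 36 * CP * c₀ / κ with hCQ
  have hCQ0 : 0 < CQ := by positivity
  set C1 := 2 / η ^ 2 * (289 * CQ / κ₃ + 648 * CP ^ 2) with hC1
  have hC10 : 0 < C1 := by positivity
  set C2 := 2 * C1 + 2 / κ₃ with hC2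
  have hC20 : 0 < C2 := by positivity
  set CM := Cu * (2 * CQ + 2) + Cr * C2 + 3 * c₁ with hCM
  have hCM0 : 0 < CM := by positivity
  set CI := (CM + 3 * Cr * (2 * CM ^ 2 / c₁ ^ 2 + 1 + C2)) / κ with hCI
  have hCI0 : 0 < CI := by positivity
  set CΓ := 2 + (17 * (12 / κ * (3 * c₀ + 2 * CP)) + 12 * CP) / η with hCΓ
  have hCΓ0 : 0 < CΓ := by positivity
  set CII := 2 / κ * (9 * c₁ ^ 2 / κ + 4 * c₁ * CΓ + 32 * Cr * CΓ ^ 2) with hCII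
  have hCII0 : 0 < CII := by positivity
  refine ⟨ε, CI + CII, hε0, hε1, by positivity, ?_⟩
  intro K p nT nS s h hK hp hs hnT hTS hKs hh hκs hgε X0 ε0 β0 d ζ bt ρ γ b δ hβ0 hd hre hru hz hbt
    hρ hg hγ hbad hexc hb hδ
  obtain ⟨S, hSs, hS⟩ := exists_support hβ0
  have hnS : 0 < nS := hnT.trans_le hTS
  have hh0 : ∀ k, 0 ≤ h k := fun k => (l1_nonneg _).trans (hd k)
  have hN : 0 < total K nT nS := total_pos hK hnS
  have hlam := tuneLam_pos (nT := nT) (s := s) hK hp hnS hc₀ hh0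
  have hlamge := le_tuneLam (p := p) (nT := nT) (s := s) (h := h) hK hnS hc₀.le
  have hlamle := tuneLam_le (p := p) (nT := nT) (s := s) (h := h) hK hnS hc₀.le
  have hlamA := tuneLam_of_condA (c₀ := c₀) (p := p) (nT := nT) (nS := nS) (s := s) (h := h)
  have hlamB := tuneLam_of_not_condA (c₀ := c₀) (p := p) (nT := nT) (nS := nS) (s := s) (h := h)
  have hP := sum_tuneWeight_le (s := s) hK hp hnS hc₀ hκ₂ hd hh
  have hl : 0 < Real.log p := Real.log_pos (by exact_mod_cast hp)
  have hAB := sqrt_total_le (p := p) (nT := nT) hK hnS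
  have hsum := weights_sum hN
  have hg0 : 0 ≤ hbar nT nS h := hbar_nonneg hh0
  have hnT' : (0 : ℝ) < nT := by exact_mod_cast hnT
  have hnS' : (0 : ℝ) < nS := by exact_mod_cast hnS
  have hTS' : (nT : ℝ) ≤ nS := by exact_mod_cast hTS
  have hK' : (1 : ℝ) ≤ K := by exact_mod_cast hK
  have hs' : (1 : ℝ) ≤ s := by exact_mod_cast hs
  have hfirst := first_step_error (X0 := X0) (ε0 := ε0) (β0 := β0) (d := d) (ζ := ζ) (bt := bt)
    (b := b) (S := S) (ρ := ρ) (γ := γ) hκ₂ hκ hκ1 hCr hc₀ hK hp hs hnT hnS hh hS hSs hd hre hbt hρ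
    hg hγ hbad hb hP
  rw [condA] at hlamA hlamB
  rw [deltaT_eq] at hlamge hlamle hlamA hlamB
  set ℓ := Real.log p with hℓ
  set N := total K nT nS with hNdef
  set g := hbar nT nS h with hgdef
  set lam := tuneLam c₀ p nT nS s h with hlamdef
  set A := √(ℓ / N) with hA
  set B := √(ℓ / nS) with hB
  set T := √(ℓ / nT) with hT
  have hA2 : A ^ 2 = ℓ / N := Real.sq_sqrt (by positivity)
  have hB2 : B ^ 2 = ℓ / nS := Real.sq_sqrt (by positivity)
  have hT2 : T ^ 2 = ℓ / nT := Real.sq_sqrt (by positivity)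
  have hA0 : 0 < A := Real.sqrt_pos.2 (by positivity)
  have hB0 : 0 < B := hA0.trans_le hAB
  have hBT : B ≤ T := Real.sqrt_le_sqrt (div_le_div_of_nonneg_left hl.le hnT' hTS')
  have hT0 : 0 < T := hB0.trans_le hBT
  have hKA : K * A ^ 2 ≤ B ^ 2 := by
    rw [hA2, hB2, mul_div_assoc', div_le_div_iff₀ hN hnS']
    have : (K : ℝ) * nS ≤ N := by rw [hNdef]; unfold total; linarith
    have := mul_le_mul_of_nonneg_left this hl.le
    linarith
  have hB2A : B ^ 2 ≤ 2 * K * A ^ 2 := by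
    rw [hA2, hB2, mul_div_assoc', div_le_div_iff₀ hnS' hN]
    have : N ≤ 2 * K * nS := by
      rw [hNdef]; unfold total
      have := mul_le_mul_of_nonneg_right hK' hnS'.le
      linarith
    have := mul_le_mul_of_nonneg_left this hl.le
    linarith
  have hsBε : K * (s : ℝ) ^ 2 * B ^ 2 ≤ ε := by
    rw [hB2, mul_div_assoc', div_le_iff₀ hnS']; exact hKs
  have hsB1 : K * (s : ℝ) ^ 2 * B ^ 2 ≤ 1 := hsBε.trans hε1
  have hsB : (s : ℝ) * B ≤ 1 := by
    have h1 : ((s : ℝ) * B) ^ 2 ≤ 1 := by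
      rw [mul_pow]
      refine le_trans ?_ hsB1
      rw [mul_assoc]
      exact le_mul_of_one_le_left (by positivity) hK'
    exact (sq_le_one_iff₀ (by positivity)).1 h1
  have hsT : κ₃ * (s * T ^ 2) ≤ 1 := by
    rw [hT2, mul_div_assoc', mul_div_assoc', div_le_one hnT']; exact hκs
  have hTg0 : 0 ≤ T * g := by positivity
  have hTgε : T * g ≤ ε := by rw [mul_comm]; exact hgε
  have hTg1 : T * g ≤ 1 := hTgε.trans hε1
  set R := (s : ℝ) * A ^ 2 + T * g with hR
  have hsA0 : 0 ≤ (s : ℝ) * A ^ 2 := by positivity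
  have hsAε : (s : ℝ) * A ^ 2 ≤ ε := by
    refine le_trans ?_ hsBε
    have h1 : (s : ℝ) * A ^ 2 ≤ s ^ 2 * (K * A ^ 2) := by
      have h2 : (s : ℝ) * 1 ≤ s * (s * K) :=
        mul_le_mul_of_nonneg_left (one_le_mul_of_one_le_of_one_le hs' hK') (by positivity)
      have h3 := mul_le_mul_of_nonneg_right h2 (sq_nonneg A)
      linarith
    refine h1.trans ?_
    calc (s : ℝ) ^ 2 * (K * A ^ 2) ≤ s ^ 2 * B ^ 2 := mul_le_mul_of_nonneg_left hKA (by positivity)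
      _ ≤ K * (s ^ 2 * B ^ 2) := le_mul_of_one_le_left (by positivity) hK'
      _ = _ := by ring
  have hR0 : 0 ≤ R := by positivity
  have hR2 : R ≤ 2 := by linarith
  have hTgR : T * g ≤ R := by linarith
  have hA2R : A ^ 2 ≤ R := by
    have := le_mul_of_one_le_left (sq_nonneg A) hs'
    linarith
  -- the penalty at the truth
  set P := 8 * κ₂ ^ 2 * c₀ * (B * g + s * B ^ 2 * g + B * g ^ 2) with hPdef
  have hP0 : 0 ≤ P := by positivity
  set H := P / lam with hH
  have hH0 : 0 ≤ H := div_nonneg hP0 hlam.le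
  have hHP : lam * H = P := by rw [hH]; field_simp
  have hlamge' : c₀ * (A + B * g) ≤ lam := by
    refine le_trans ?_ hlamge
    refine mul_le_mul_of_nonneg_left ?_ hc₀.le
    have : 0 ≤ (K : ℝ) * s * A ^ 2 := by positivity
    linarith
  obtain ⟨hHA, hHB⟩ := rate_ratio (P := P) hA0 hAB hg0 hsB hc₀ hCP.le le_rfl hlamge'
  rw [← hH] at hHA hHB
  -- In general P/λ₀ can exceed h̄ by √K, because λ₀ may be as small as √(log p / N) while P
  -- involves √(log p / n_S).
  have hHA2 : H ^ 2 ≤ 18 * CP ^ 2 * K * g ^ 2 := by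
    have h1 : (A * H) ^ 2 ≤ (3 * CP * (B * g)) ^ 2 := by gcongr
    have h2 : 9 * CP ^ 2 * g ^ 2 * B ^ 2 ≤ 9 * CP ^ 2 * g ^ 2 * (2 * K * A ^ 2) :=
      mul_le_mul_of_nonneg_left hB2A (by positivity)
    have h3 : 0 < A ^ 2 := by positivity
    refine le_of_mul_le_mul_left ?_ h3
    linarith
  have hsq : 288 * (Cr * A ^ 2 * s) ≤ κ * η ^ 2 := by
    refine le_trans ?_ hεa
    have := mul_le_mul_of_nonneg_left hsAε hCr
    linarith
  have hPq : 4 * (Cr * A ^ 2 * H ^ 2) ≤ η ^ 2 * P := by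
    have h1 : 4 * (Cr * A ^ 2 * H) ≤ η ^ 2 * lam := by
      have h2 : A * (A * H) ≤ A * (3 * CP * ε) := by
        refine mul_le_mul_of_nonneg_left (hHA.trans ?_) hA0.le
        refine mul_le_mul_of_nonneg_left ?_ (by positivity)
        exact (mul_le_mul_of_nonneg_right hBT hg0).trans hTgε
      have h3 := mul_le_mul_of_nonneg_left h2 hCr
      have h4 := mul_le_mul_of_nonneg_left hεb hA0.le
      have h5 : c₀ * A ≤ lam := by
        refine le_trans ?_ hlamge'
        refine mul_le_mul_of_nonneg_left ?_ hc₀.le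
        linarith [mul_nonneg hB0.le hg0]
      have h6 := mul_le_mul_of_nonneg_left h5 (sq_nonneg η)
      linarith
    have h2 := mul_le_mul_of_nonneg_right h1 hH0
    rw [← hHP]
    linarith
  obtain ⟨Q, u, hQ0, hQ, hu2, hu1, hwhat⟩ := hfirst hsq hPq
  rw [← hηdef] at hu1
  set w := (nS : ℝ) / N with hw
  have hw0 : 0 ≤ w := by positivity
  set exc := ∑ k, (w • ζ k - ρ k) with hexcdef
  set dbar := w • ∑ k, d k with hdbar
  have hdbar1 : l1 dbar ≤ g := by
    rw [hdbar, l1_smul, abs_of_nonneg hw0]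
    refine mul_le_mul_of_nonneg_left ((l1_sum_le _ _).trans ?_) hw0
    exact Finset.sum_le_sum fun k _ => hd k
  set what := weightedAvg nT nS b with hwhatdef
  have hκs' : T ^ 2 ≤ 1 / κ₃ := by
    rw [le_div_iff₀ hκ₃]
    have := mul_le_mul_of_nonneg_right hs' (mul_nonneg hκ₃.le (sq_nonneg T))
    linarith
  have hsT3 : (s : ℝ) * T ^ 2 ≤ 1 / κ₃ := by
    rw [le_div_iff₀ hκ₃]; linarith
  have htarget : (s : ℝ) * ℓ / N = s * A ^ 2 := by rw [hA2, mul_div_assoc]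
  rw [htarget, ← hR]
  have hsQ : √(s * Q) ^ 2 = s * Q := Real.sq_sqrt (by positivity)
  -- This is the comparison of s log p / n_T, the rate of a sparse lasso on the target alone, with
  -- the rate T g.
  rcases le_or_gt g (s * T) with hI | hII
  · -- the error of the first step is of the right order
    have hlamsq : s * lam ^ 2 ≤ 9 * c₀ ^ 2 * R := by
      have h1 : s * (lam / c₀) ^ 2 ≤ 9 * R := by
        refine rate_lam_of_le hA0 hAB hBT hg0 hs' hK' hKA hsB1 (by positivity) ?_ hI
        by_cases hc : g * T ≤ s * ℓ / nS
        · left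
          rw [hlamA hc, mul_div_cancel_left₀ _ hc₀.ne']
          linarith
        · right
          refine ⟨?_, ?_⟩
          · rw [hB2, mul_div_assoc']; exact (not_le.1 hc).le
          · rw [hlamB hc, mul_div_cancel_left₀ _ hc₀.ne']
            linarith
      rw [div_pow, mul_div_assoc', div_le_iff₀ (by positivity)] at h1
      linarith
    have hPR : P ≤ 3 * CP * c₀ * R := by
      have h1 := rate_pen_of_le hB0 hBT hg0 hsB hI
      have h2 : B * g + s * B ^ 2 * g + B * g ^ 2 ≤ 3 * R := by linarith
      have h3 := mul_le_mul_of_nonneg_left h2 (by positivity : 0 ≤ 8 * κ₂ ^ 2 * c₀)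
      rw [hPdef, hCPdef]
      linarith
    have hQR : Q ≤ CQ * R := by
      refine hQ.trans ?_
      have h1 := mul_le_mul_of_nonneg_left hlamsq (by positivity : 0 ≤ 128 / κ ^ 2)
      have h2 := mul_le_mul_of_nonneg_left hPR (by positivity : 0 ≤ 12 / κ)
      refine (add_le_add h1 h2).trans (le_of_eq ?_)
      rw [hCQ]; ring
    -- Under condition A the factor K lost in `hHA2` is recovered from K T g ≤ K s B² ≤ 1. Without
    -- A, λ₀ contains √(log p / n_S) and H is already of order g.
    have hTH : T ^ 2 * H ^ 2 ≤ 18 * CP ^ 2 * R := by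
      by_cases hc : g * T ≤ s * ℓ / nS
      · have h1 : K * (T * g) ≤ 1 := by
          have h2 : T * g ≤ s * B ^ 2 := by rw [hB2, mul_div_assoc', mul_comm T]; exact hc
          refine le_trans (mul_le_mul_of_nonneg_left h2 (by positivity)) (le_trans ?_ hsB1)
          have h3 : (s : ℝ) ≤ s ^ 2 := le_self_pow₀ hs' two_ne_zero
          have h4 := mul_le_mul_of_nonneg_right h3 (by positivity : 0 ≤ K * B ^ 2)
          linarith
        have h2 := mul_le_mul_of_nonneg_left hHA2 (sq_nonneg T)
        have h3 := mul_le_mul_of_nonneg_right h1 hTg0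
        have h4 := mul_le_mul_of_nonneg_left (h3.trans (by linarith : 1 * (T * g) ≤ R))
          (by positivity : 0 ≤ 18 * CP ^ 2)
        linarith
      · have h1 : H ≤ 2 * CP * g := by
          refine hHB ?_
          rw [hlamB hc]
          refine mul_le_mul_of_nonneg_left ?_ hc₀.le
          have : 0 ≤ (K : ℝ) * s * A ^ 2 := by positivity
          linarith
        have h2 : H ^ 2 ≤ (2 * CP * g) ^ 2 := by gcongr
        have h3 := mul_le_mul_of_nonneg_left h2 (sq_nonneg T)
        have h4 : (T * g) * (T * g) ≤ 1 * R := mul_le_mul hTg1 hTgR hTg0 zero_le_one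
        have h5 := mul_le_mul_of_nonneg_left h4 (by positivity : 0 ≤ 4 * CP ^ 2)
        have h6 : 0 ≤ CP ^ 2 * R := by positivity
        linarith
    have hu1sq : T ^ 2 * l1 u ^ 2 ≤ C1 * R := by
      have h1 : l1 u ^ 2 ≤ ((17 * √(s * Q) + 6 * H) / η) ^ 2 := by
        gcongr
        exact l1_nonneg _
      have h2 : (17 * √(s * Q) + 6 * H) ^ 2 ≤ 2 * (289 * (s * Q) + 36 * H ^ 2) := by
        linarith [sq_nonneg (17 * √(s * Q) - 6 * H), hsQ]
      rw [div_pow] at h1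
      have h3 : l1 u ^ 2 ≤ 2 * (289 * (s * Q) + 36 * H ^ 2) / η ^ 2 :=
        h1.trans (div_le_div_of_nonneg_right h2 (sq_nonneg η))
      have h4 := mul_le_mul_of_nonneg_left h3 (sq_nonneg T)
      have h5 : s * T ^ 2 * Q ≤ 1 / κ₃ * (CQ * R) :=
        mul_le_mul hsT3 hQR hQ0 (by positivity)
      have h6 : T ^ 2 * (2 * (289 * (s * Q) + 36 * H ^ 2) / η ^ 2)
          = 2 / η ^ 2 * (289 * (s * T ^ 2 * Q) + 36 * (T ^ 2 * H ^ 2)) := by ring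
      rw [h6] at h4
      refine h4.trans ?_
      have h7 : 289 * (s * T ^ 2 * Q) + 36 * (T ^ 2 * H ^ 2)
          ≤ (289 * CQ / κ₃ + 648 * CP ^ 2) * R := by
        have : 289 * CQ / κ₃ * R = 289 * (1 / κ₃ * (CQ * R)) := by ring
        rw [add_mul, this]
        linarith
      refine (mul_le_mul_of_nonneg_left h7 (by positivity)).trans (le_of_eq ?_)
      rw [hC1]; ring
    have hv2 : sqNorm (u + exc) ≤ (2 * CQ + 2) * R := by
      have h1 := sqNorm_add_le u exc
      have h2 : sqNorm exc ≤ A ^ 2 := (sqNorm_le_l1_sq exc).trans (by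
        gcongr
        exact l1_nonneg _)
      linarith
    have hv1 : T ^ 2 * l1 (u + exc) ^ 2 ≤ C2 * R := by
      have h1 : l1 (u + exc) ≤ l1 u + A := (l1_add_le _ _).trans (by linarith)
      have h2 : l1 (u + exc) ^ 2 ≤ (l1 u + A) ^ 2 := by
        gcongr
        exact l1_nonneg _
      have h3 : l1 (u + exc) ^ 2 ≤ 2 * l1 u ^ 2 + 2 * A ^ 2 := by
        linarith [sq_nonneg (l1 u - A)]
      have h4 := mul_le_mul_of_nonneg_left h3 (sq_nonneg T)
      have h5 : T ^ 2 * A ^ 2 ≤ 1 / κ₃ * R := mul_le_mul hκs' hA2R (sq_nonneg _) (by positivity)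
      have h6 : C2 * R = 2 * (C1 * R) + 2 * (1 / κ₃ * R) := by rw [hC2]; ring
      linarith
    have hfin := correction_error (g := dbar) (u := u + exc) (M := CM * R) (Γ := g)
      (C := Cr) (q := ℓ / nT) (by positivity) hCr (by positivity) hwhat hδ hz hre hdbar1 (by
        have h1 := hru (u + exc)
        rw [← hT2] at h1
        have h2 := mul_le_mul_of_nonneg_left hv2 hCu
        have h3 := mul_le_mul_of_nonneg_left hv1 hCr
        have h4 := mul_le_mul_of_nonneg_left hTgR hc₁.le
        have h5 : CM * R = Cu * ((2 * CQ + 2) * R) + Cr * (C2 * R) + 3 * (c₁ * R) := by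
          rw [hCM]; ring
        linarith)
    rw [← hT2] at hfin
    have h1 : T ^ 2 * ((CM * R) ^ 2 / (c₁ * T) ^ 2 + g ^ 2 + l1 (u + exc) ^ 2)
        ≤ (2 * CM ^ 2 / c₁ ^ 2 + 1 + C2) * R := by
      have h2 : T ^ 2 * ((CM * R) ^ 2 / (c₁ * T) ^ 2) = CM ^ 2 / c₁ ^ 2 * (R * R) := by
        field_simp
      have h3 : CM ^ 2 / c₁ ^ 2 * (R * R) ≤ CM ^ 2 / c₁ ^ 2 * (2 * R) :=
        mul_le_mul_of_nonneg_left (mul_le_mul_of_nonneg_right hR2 hR0) (by positivity)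
      have h4 : (T * g) * (T * g) ≤ 1 * R := mul_le_mul hTg1 hTgR hTg0 zero_le_one
      have h5 : (2 * CM ^ 2 / c₁ ^ 2 + 1 + C2) * R
          = CM ^ 2 / c₁ ^ 2 * (2 * R) + R + C2 * R := by ring
      rw [mul_add, mul_add, h2, h5]
      linarith
    have h2 := mul_le_mul_of_nonneg_left h1 (by positivity : 0 ≤ 3 * Cr)
    have h3 : κ * sqNorm (what + δ - β0) ≤ κ * (CI * R) := by
      have h4 : κ * (CI * R)
          = CM * R + 3 * Cr * ((2 * CM ^ 2 / c₁ ^ 2 + 1 + C2) * R) := by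
        rw [hCI]; field_simp
      rw [h4]
      linarith
    have h4 := le_of_mul_le_mul_left h3 hκ
    have h5 := mul_nonneg hCII0.le hR0
    linarith
  · -- the correction step alone is accurate enough
    have hsTT : (s : ℝ) * T ^ 2 ≤ T * g := by
      have := mul_le_mul_of_nonneg_left hII.le hT0.le
      linarith
    -- Large h̄ rules out condition A, so λ₀ has its larger value and H is of order h̄.
    have hnc : ¬ g * T ≤ s * ℓ / nS := by
      rw [not_le, ← mul_div_assoc', ← hB2]
      have h1 : (s : ℝ) * B ^ 2 ≤ s * T ^ 2 := by gcongr
      have h2 := mul_lt_mul_of_pos_right hII hT0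
      linarith
    have hHg : H ≤ 2 * CP * g := by
      refine hHB ?_
      rw [hlamB hnc]
      refine mul_le_mul_of_nonneg_left ?_ hc₀.le
      have : 0 ≤ (K : ℝ) * s * A ^ 2 := by positivity
      linarith
    have hTsl : T * (s * lam) ≤ 3 * c₀ * (T * g) := by
      have h1 := mul_le_mul_of_nonneg_left hlamle (by positivity : 0 ≤ T * s)
      have h2 : T * s * B ≤ T * g := by
        refine le_trans ?_ hsTT
        have := mul_le_mul_of_nonneg_left hBT (by positivity : 0 ≤ T * s)
        linarith
      have h3 : T * s * (K * s * A ^ 2) ≤ T * g := by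
        have h4 : T * s * (K * s * A ^ 2) ≤ T * s * (s * B ^ 2) := by
          have := mul_le_mul_of_nonneg_left hKA (by positivity : 0 ≤ T * s * s)
          linarith
        have h5 := mul_le_mul_of_nonneg_right hsB (by positivity : 0 ≤ T * s * B)
        linarith
      have h4 : T * s * (B * g) ≤ T * g := by
        have := mul_le_mul_of_nonneg_right hsB hTg0
        linarith
      have h5 := mul_le_mul_of_nonneg_left
        (by linarith : T * s * B + T * s * (K * s * A ^ 2) + T * s * (B * g) ≤ 3 * (T * g)) hc₀.le
      linarith
    have hsqrt : √(s * Q) ≤ 12 / κ * (s * lam + H) := by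
      refine Real.sqrt_le_iff.2 ⟨by positivity, ?_⟩
      have h1 := mul_le_mul_of_nonneg_left hQ (by positivity : 0 ≤ (s : ℝ))
      refine h1.trans ?_
      have hk2 : 1 / κ ≤ 1 / κ ^ 2 := one_div_le_one_div_of_le (by positivity)
        (pow_le_of_le_one hκ.le hκ1 two_ne_zero)
      have h2 : (s : ℝ) * (128 / κ ^ 2 * (s * lam ^ 2) + 12 / κ * P)
          = 128 * (1 / κ ^ 2) * (s * lam) ^ 2 + 12 * (1 / κ) * (s * lam * H) := by
        rw [← hHP]; ring
      have h3 : (12 / κ * (s * lam + H)) ^ 2 = 144 * (1 / κ ^ 2) * (s * lam) ^ 2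
          + 288 * (1 / κ ^ 2) * (s * lam * H) + 144 * (1 / κ ^ 2) * H ^ 2 := by ring
      rw [h2, h3]
      have h4 := mul_le_mul_of_nonneg_right hk2 (by positivity : 0 ≤ s * lam * H)
      have h5 : 0 ≤ 1 / κ ^ 2 * (s * lam) ^ 2 := by positivity
      have h6 : 0 ≤ 1 / κ ^ 2 * (s * lam * H) := by positivity
      have h7 : 0 ≤ 1 / κ ^ 2 * H ^ 2 := by positivity
      linarith
    have hTA : T * A ≤ T * g := by
      refine le_trans ?_ hsTT
      have h1 := mul_le_mul_of_nonneg_left (hAB.trans hBT) hT0.le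
      have h2 := mul_le_mul_of_nonneg_right hs' (sq_nonneg T)
      linarith
    have hTu : T * l1 u ≤ (17 * (12 / κ * (3 * c₀ + 2 * CP)) + 12 * CP) / η * (T * g) := by
      have hTH := mul_le_mul_of_nonneg_left hHg hT0.le
      have h1 := mul_le_mul_of_nonneg_left hu1 hT0.le
      refine h1.trans ?_
      rw [mul_div_assoc', div_mul_eq_mul_div]
      refine div_le_div_of_nonneg_right ?_ hη.le
      have h2 := mul_le_mul_of_nonneg_left hsqrt hT0.le
      have h3 : T * (12 / κ * (s * lam + H)) ≤ 12 / κ * ((3 * c₀ + 2 * CP) * (T * g)) := by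
        have e : T * (12 / κ * (s * lam + H)) = 12 / κ * (T * (s * lam) + T * H) := by ring
        rw [e]
        refine mul_le_mul_of_nonneg_left ?_ (by positivity)
        linarith
      linarith
    have hΓ : l1On Sᶜ what ≤ g + A + l1 u := by
      rw [hwhat]
      have h1 := l1On_add_le Sᶜ (β0 + dbar) (u + exc)
      have h2 := l1On_add_le Sᶜ β0 dbar
      rw [l1On_eq_zero hS] at h2
      have h3 := l1On_le_l1 Sᶜ dbar
      have h4 := l1On_le_l1 Sᶜ (u + exc)
      have h5 := l1_add_le u exc
      linarith
    have hfin := correction_error_sparse (C := Cr) (q := ℓ / nT) (Γ := g + A + l1 u) (s := s)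
      (by positivity) hCr (by positivity) hκ hS hSs hδ hz hre hΓ (by
        rw [← hT2]
        have h1 := mul_le_mul_of_nonneg_left (hsTT.trans hTgε) hCr
        have h2 : κ * η ^ 2 ≤ κ := mul_le_of_le_one_right hκ.le
          (pow_le_one₀ hη.le (hη1.trans (by norm_num)))
        have h3 : 0 ≤ Cr * ε := by positivity
        linarith)
    have hu0 := l1_nonneg u
    have hTΓ : T * (g + A + l1 u) ≤ CΓ * (T * g) := by
      rw [hCΓ, add_mul]
      linarith
    have hTΓ0 : 0 ≤ T * (g + A + l1 u) := by positivity
    have hTΓ2 : (T * (g + A + l1 u)) ^ 2 ≤ CΓ ^ 2 * (T * g) := by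
      have h1 : (T * (g + A + l1 u)) ^ 2 ≤ (CΓ * (T * g)) ^ 2 := by gcongr
      have h2 := mul_le_mul_of_nonneg_right hTg1 hTg0
      have h3 := mul_le_mul_of_nonneg_left h2 (sq_nonneg CΓ)
      linarith
    rw [← hT2] at hfin
    have h1 : sqNorm (what + δ - β0) ≤ CII * (T * g) := by
      refine hfin.trans ?_
      rw [hCII, mul_assoc (2 / κ)]
      refine mul_le_mul_of_nonneg_left ?_ (by positivity)
      have h2 := mul_le_mul_of_nonneg_left hsTT (by positivity : 0 ≤ 9 * c₁ ^ 2 / κ)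
      have h3 := mul_le_mul_of_nonneg_left hTΓ (by positivity : 0 ≤ 4 * c₁)
      have h4 := mul_le_mul_of_nonneg_left hTΓ2 (by positivity : 0 ≤ 32 * Cr)
      have e1 : 9 * (s * (c₁ * T) ^ 2) / κ = 9 * c₁ ^ 2 / κ * (s * T ^ 2) := by ring
      rw [e1]
      linarith
    have h2 := mul_le_mul_of_nonneg_left hTgR hCII0.le
    have h3 := mul_nonneg hCI0.le hR0
    linarith

/-! ### Centered Gaussian variables -/

section Gaussian

variable {Ω : Type*} [MeasurableSpace Ω] {μ : Measure Ω}

/-- `Y` is a centered Gaussian variable with variance at most `b`. -/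
def GaussianLE (Y : Ω → ℝ) (b : ℝ) (μ : Measure Ω) : Prop :=
  ∃ v : ℝ≥0, (v : ℝ) ≤ b ∧ HasLaw Y (gaussianReal 0 v) μ

lemma exp_abs_le (x : ℝ) : Real.exp |x| ≤ Real.exp x + Real.exp (-x) := by
  rcases abs_cases x with ⟨h, _⟩ | ⟨h, _⟩ <;> rw [h] <;>
    linarith [Real.exp_pos x, Real.exp_pos (-x)]

lemma integrable_exp_abs_gaussianReal (v : ℝ≥0) (t : ℝ) :
    Integrable (fun y => Real.exp (t * |y|)) (gaussianReal 0 v) := by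
  have h1 := integrable_exp_mul_gaussianReal (μ := 0) (v := v) |t|
  have h2 := integrable_exp_mul_gaussianReal (μ := 0) (v := v) (-|t|)
  refine (h1.add h2).mono' (by fun_prop) (ae_of_all _ fun y => ?_)
  rw [Real.norm_eq_abs, Real.abs_exp, Pi.add_apply]
  have h3 : t * |y| ≤ |(|t| * y)| := by
    rw [abs_mul, abs_abs]; exact mul_le_mul_of_nonneg_right (le_abs_self t) (abs_nonneg y)
  refine (Real.exp_le_exp.2 h3).trans ((exp_abs_le _).trans (le_of_eq ?_))
  ring_nf

lemma integral_exp_gaussianReal (v : ℝ≥0) (t : ℝ) :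
    ∫ y, Real.exp (t * y) ∂(gaussianReal 0 v) = Real.exp (v * t ^ 2 / 2) := by
  have := mgf_gaussianReal (p := gaussianReal 0 v) (X := id) (μ := 0) (v := v) (by simp) t
  simpa [mgf] using this

lemma integral_comp_neg_gaussianReal (v : ℝ≥0) (f : ℝ → ℝ) :
    ∫ y, f (-y) ∂(gaussianReal 0 v) = ∫ y, f y ∂(gaussianReal 0 v) := by
  have h := gaussianReal_map_neg (μ := 0) (v := v)
  rw [neg_zero] at h
  conv_rhs => rw [← h]
  exact (integral_map_equiv (MeasurableEquiv.neg ℝ) f).symm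

/-- An odd function of a centered Gaussian variable which is dominated by a linear function is
sub-Gaussian. -/
lemma GaussianLE.hasSubgaussianMGF_odd {Y : Ω → ℝ} {b w : ℝ} {c : ℝ≥0} (hY : GaussianLE Y b μ)
    (hw : 0 ≤ w) (hc : w ^ 2 * b ≤ c) {f : ℝ → ℝ} (hf : Measurable f) (hodd : ∀ y, f (-y) = -f y)
    (hle : ∀ y, |f y| ≤ w * |y|) : HasSubgaussianMGF (fun ω => f (Y ω)) c μ := by
  obtain ⟨v, hv, hlaw⟩ := hY
  have hint : ∀ t, Integrable (fun y => Real.exp (t * f y)) (gaussianReal 0 v) := fun t => by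
    refine (integrable_exp_abs_gaussianReal v (|t| * w)).mono' (by fun_prop)
      (ae_of_all _ fun y => ?_)
    rw [Real.norm_eq_abs, Real.abs_exp, Real.exp_le_exp, mul_assoc]
    refine (le_abs_self _).trans ?_
    rw [abs_mul]
    exact mul_le_mul_of_nonneg_left (hle y) (abs_nonneg t)
  constructor
  · intro t
    have := hint t
    rw [← hlaw.map_eq] at this
    exact this.comp_aemeasurable hlaw.aemeasurable
  · intro t
    have e1 : mgf (fun ω => f (Y ω)) μ t = ∫ y, Real.exp (t * f y) ∂(gaussianReal 0 v) := by
      rw [mgf, ← hlaw.integral_comp (f := fun y => Real.exp (t * f y)) (by fun_prop)]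
      rfl
    -- By symmetry the moment generating function of f(Y) is the mean of cosh(t f(Y)). Since cosh
    -- increases with the absolute value of its argument, |f(y)| ≤ w|y| is then enough for the
    -- comparison with a Gaussian.
    have e2 : ∫ y, Real.exp (t * f y) ∂(gaussianReal 0 v)
        = ∫ y, Real.exp (-(t * f y)) ∂(gaussianReal 0 v) := by
      rw [← integral_comp_neg_gaussianReal]
      simp only [hodd, mul_neg]
    have hint' : Integrable (fun y => Real.exp (-(t * f y))) (gaussianReal 0 v) := by
      have := hint (-t)
      simpa only [neg_mul] using this
    have e3 : 2 * ∫ y, Real.exp (t * f y) ∂(gaussianReal 0 v)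
        = ∫ y, (Real.exp (t * f y) + Real.exp (-(t * f y))) ∂(gaussianReal 0 v) := by
      rw [integral_add (hint t) hint', ← e2]; ring
    have i1 := integrable_exp_mul_gaussianReal (μ := 0) (v := v) (t * w)
    have i2 := integrable_exp_mul_gaussianReal (μ := 0) (v := v) (-(t * w))
    have e4 : ∫ y, (Real.exp (t * f y) + Real.exp (-(t * f y))) ∂(gaussianReal 0 v)
        ≤ ∫ y, (Real.exp (t * w * y) + Real.exp (-(t * w) * y)) ∂(gaussianReal 0 v) := by
      refine integral_mono ((hint t).add hint') (i1.add i2) fun y => ?_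
      have h1 : Real.cosh (t * f y) ≤ Real.cosh (t * w * y) := by
        rw [Real.cosh_le_cosh, abs_mul, abs_mul, abs_mul, abs_of_nonneg hw, mul_assoc]
        exact mul_le_mul_of_nonneg_left (hle y) (abs_nonneg t)
      rw [Real.cosh_eq, Real.cosh_eq] at h1
      simp only [neg_mul]
      linarith
    rw [integral_add i1 i2, integral_exp_gaussianReal, integral_exp_gaussianReal, neg_sq] at e4
    have e5 : Real.exp (v * (t * w) ^ 2 / 2) ≤ Real.exp (c * t ^ 2 / 2) := by
      rw [Real.exp_le_exp]
      have h1 := mul_le_mul_of_nonneg_left hv (sq_nonneg w)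
      have h2 := mul_le_mul_of_nonneg_right (h1.trans hc) (sq_nonneg t)
      linarith
    rw [e1]
    linarith

lemma GaussianLE.hasSubgaussianMGF {Y : Ω → ℝ} {b : ℝ} {c : ℝ≥0} (hY : GaussianLE Y b μ)
    (hc : b ≤ c) : HasSubgaussianMGF Y c μ :=
  hY.hasSubgaussianMGF_odd (w := 1) (f := fun y => y) zero_le_one (by linarith) measurable_id
    (fun _ => rfl) fun y => by rw [one_mul]

lemma HasSubgaussianMGF.measure_abs_ge_le {Y : Ω → ℝ} {c : ℝ≥0} [IsFiniteMeasure μ]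
    (hY : HasSubgaussianMGF Y c μ) {t : ℝ} (ht : 0 ≤ t) :
    μ.real {ω | t ≤ |Y ω|} ≤ 2 * Real.exp (-t ^ 2 / (2 * c)) := by
  have h1 := hY.measure_ge_le ht
  have h2 := hY.neg.measure_ge_le ht
  have h3 : {ω | t ≤ |Y ω|} ⊆ {ω | t ≤ Y ω} ∪ {ω | t ≤ (-Y) ω} := by
    intro ω hω
    rw [Set.mem_ofPred_eq] at hω
    rcases le_abs.1 hω with h | h
    · exact Or.inl h
    · exact Or.inr h
  have h4 := (measureReal_mono h3 (measure_ne_top μ _)).trans (measureReal_union_le _ _)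
  linarith

lemma GaussianLE.integral_odd {Y : Ω → ℝ} {b : ℝ} (hY : GaussianLE Y b μ) {f : ℝ → ℝ}
    (hf : Measurable f) (hodd : ∀ y, f (-y) = -f y) : ∫ ω, f (Y ω) ∂μ = 0 := by
  obtain ⟨v, -, hlaw⟩ := hY
  have e1 : ∫ ω, f (Y ω) ∂μ = ∫ y, f y ∂(gaussianReal 0 v) :=
    hlaw.integral_comp (f := f) hf.aestronglyMeasurable
  have e2 := integral_comp_neg_gaussianReal v f
  simp only [hodd, integral_neg] at e2
  rw [e1]
  linarith

/-- The truncated second moment of a Gaussian variable. -/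
lemma GaussianLE.integral_sq_le {Y : Ω → ℝ} {b w T : ℝ} (hY : GaussianLE Y b μ) (hb : 0 < b)
    (hT : 0 < T) {f : ℝ → ℝ} (hf : Measurable f) (hle : ∀ y, |f y| ≤ w * |y|)
    (h0 : ∀ y, |y| ≤ T → f y = 0) :
    ∫ ω, f (Y ω) ^ 2 ∂μ ≤ w ^ 2 * (64 * b ^ 2 / T ^ 2 * Real.exp (-(T ^ 2 / (8 * b)))) := by
  obtain ⟨v, hv, hlaw⟩ := hY
  have e1 : ∫ ω, f (Y ω) ^ 2 ∂μ = ∫ y, f y ^ 2 ∂(gaussianReal 0 v) :=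
    hlaw.integral_comp (f := fun y => f y ^ 2) (by fun_prop)
  -- For |y| > T one has y² ≤ (2/t²) e^{t|y|} ≤ (2/t²) e^{−tT} e^{2t|y|}. With this t, the Gaussian
  -- integral of the last factor costs e^{tT/2}, so half of the gain e^{−tT} survives.
  set t := T / (4 * b) with ht
  have ht0 : 0 < t := by positivity
  have hpt : ∀ y, f y ^ 2 ≤ w ^ 2 * (2 / t ^ 2 * Real.exp (-(t * T)))
      * (Real.exp (2 * t * y) + Real.exp (-(2 * t) * y)) := by
    intro y
    rcases le_or_gt |y| T with h | h
    · rw [h0 y h]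
      have := Real.exp_pos (2 * t * y)
      have := Real.exp_pos (-(2 * t) * y)
      have := Real.exp_pos (-(t * T))
      rw [zero_pow two_ne_zero]
      positivity
    · have h1 : f y ^ 2 ≤ w ^ 2 * y ^ 2 := by
        rw [← sq_abs (f y), ← sq_abs y, ← mul_pow]
        exact pow_le_pow_left₀ (abs_nonneg _) (hle y) 2
      have h2 : (t * |y|) ^ 2 ≤ 2 * Real.exp (t * |y|) := by
        have h3 := Real.quadratic_le_exp_of_nonneg (by positivity : 0 ≤ t * |y|)
        have : 0 ≤ t * |y| := by positivity
        linarith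
      have h3 : Real.exp (t * |y|) ≤ Real.exp (-(t * T)) * Real.exp (2 * (t * |y|)) := by
        rw [← Real.exp_add, Real.exp_le_exp]
        have := mul_le_mul_of_nonneg_left h.le ht0.le
        linarith
      have h4 : Real.exp (2 * (t * |y|)) ≤ Real.exp (2 * t * y) + Real.exp (-(2 * t) * y) := by
        have := exp_abs_le (2 * t * y)
        rw [abs_mul, abs_of_pos (by positivity : 0 < 2 * t)] at this
        simpa only [neg_mul, mul_assoc] using this
      have h5 : y ^ 2 ≤ 2 / t ^ 2 * (Real.exp (-(t * T))
          * (Real.exp (2 * t * y) + Real.exp (-(2 * t) * y))) := by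
        have h6 := h3.trans (mul_le_mul_of_nonneg_left h4 (Real.exp_pos (-(t * T))).le)
        rw [mul_pow, sq_abs] at h2
        rw [div_mul_eq_mul_div, le_div_iff₀ (by positivity)]
        linarith
      have h6 := h1.trans (mul_le_mul_of_nonneg_left h5 (sq_nonneg w))
      linarith
  have i1 := integrable_exp_mul_gaussianReal (μ := 0) (v := v) (2 * t)
  have i2 := integrable_exp_mul_gaussianReal (μ := 0) (v := v) (-(2 * t))
  have hi := (i1.add i2).const_mul (w ^ 2 * (2 / t ^ 2 * Real.exp (-(t * T))))
  rw [e1]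
  refine (integral_mono_of_nonneg (ae_of_all _ fun y => sq_nonneg _) hi (ae_of_all _ hpt)).trans ?_
  simp only [Pi.add_apply]
  rw [integral_const_mul, integral_add i1 i2, integral_exp_gaussianReal, integral_exp_gaussianReal,
    neg_sq]
  have h1 : Real.exp (v * (2 * t) ^ 2 / 2) ≤ Real.exp (T ^ 2 / (8 * b)) := by
    rw [Real.exp_le_exp]
    have h2 := mul_le_mul_of_nonneg_right hv (sq_nonneg t)
    have h3 : b * t ^ 2 * 2 = T ^ 2 / (8 * b) := by rw [ht]; field_simp; norm_num
    linarith
  have h2 : t * T = 2 * (T ^ 2 / (8 * b)) := by rw [ht]; field_simp; norm_num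
  have h3 : 2 / t ^ 2 = 32 * b ^ 2 / T ^ 2 := by rw [ht]; field_simp; norm_num
  rw [h2, h3]
  set x := T ^ 2 / (8 * b)
  have h4 : Real.exp (-(2 * x)) * Real.exp x = Real.exp (-x) := by
    rw [← Real.exp_add]; congr 1; ring
  calc w ^ 2 * (32 * b ^ 2 / T ^ 2 * Real.exp (-(2 * x))) * (Real.exp (v * (2 * t) ^ 2 / 2)
        + Real.exp (v * (2 * t) ^ 2 / 2))
      ≤ w ^ 2 * (32 * b ^ 2 / T ^ 2 * Real.exp (-(2 * x))) * (Real.exp x + Real.exp x) := by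
        gcongr
    _ = w ^ 2 * (64 * b ^ 2 / T ^ 2 * (Real.exp (-(2 * x)) * Real.exp x)) := by ring
    _ = _ := by rw [h4]

/-- A linear combination of independent centered Gaussian variables is a centered Gaussian
variable. -/
lemma gaussianLE_sum [IsProbabilityMeasure μ] {n : ℕ} {e : Fin n → Ω → ℝ} {V : ℝ≥0}
    (hind : iIndepFun e μ)
    (hlaw : ∀ i, ∃ v : ℝ≥0, v ≤ V ∧ HasLaw (e i) (gaussianReal 0 v) μ) (a : Fin n → ℝ) :
    GaussianLE (fun ω => a ⬝ᵥ fun i => e i ω) (V * sqNorm a) μ := by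
  choose v hv hlaw using hlaw
  have hG : ∀ i, HasGaussianLaw (fun ω => a i * e i ω) μ := fun i =>
    ((hlaw i).hasGaussianLaw).fun_smul (a i)
  have hI : iIndepFun (fun i ω => a i * e i ω) μ :=
    hind.comp (fun i y => a i * y) fun i => by fun_prop
  have hS := iIndepFun.hasGaussianLaw_fun_sum hG hI
  have hmean : ∀ i, ∫ ω, a i * e i ω ∂μ = 0 := fun i => by
    rw [integral_const_mul, (hlaw i).integral_eq, integral_id_gaussianReal, mul_zero]
  have hvar : ∀ i, variance (fun ω => a i * e i ω) μ = a i ^ 2 * v i := fun i => by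
    rw [variance_const_mul, (hlaw i).variance_eq, variance_id_gaussianReal]
  refine ⟨(variance (fun ω => ∑ i, a i * e i ω) μ).toNNReal, ?_, ⟨hS.aemeasurable, ?_⟩⟩
  · rw [Real.coe_toNNReal _ (variance_nonneg _ _)]
    have h1 := IndepFun.variance_sum (s := Finset.univ) (fun i _ => (hG i).memLp_two)
      (fun i _ j _ hij => hI.indepFun hij)
    have h2 : (∑ i, fun ω => a i * e i ω) = fun ω => ∑ i, a i * e i ω := by
      ext ω; simp
    rw [h2] at h1
    rw [h1, sqNorm, Finset.mul_sum]
    refine Finset.sum_le_sum fun i _ => ?_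
    rw [hvar, mul_comm]
    exact mul_le_mul_of_nonneg_right (by exact_mod_cast hv i) (sq_nonneg _)
  · have h1 := hS.map_eq_gaussianReal
    rw [integral_finsetSum _ fun i _ => (hG i).integrable] at h1
    simp only [hmean, Finset.sum_const_zero] at h1
    exact h1

/-- Linear combinations of disjoint blocks of independent Gaussian variables are independent. -/
lemma iIndepFun_block [IsProbabilityMeasure μ] {K n : ℕ} {e : Fin K → Fin n → Ω → ℝ} {V : ℝ≥0}
    (hind : iIndepFun (fun (q : Fin K × Fin n) ω => e q.1 q.2 ω) μ)
    (hlaw : ∀ k i, ∃ v : ℝ≥0, v ≤ V ∧ HasLaw (e k i) (gaussianReal 0 v) μ) (a : Fin K → Fin n → ℝ) :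
    iIndepFun (fun k ω => a k ⬝ᵥ fun i => e k i ω) μ := by
  have hG : HasGaussianLaw (fun ω (q : Fin K × Fin n) => e q.1 q.2 ω) μ := by
    refine hind.hasGaussianLaw fun q => ?_
    obtain ⟨v, -, h⟩ := hlaw q.1 q.2
    exact h.hasGaussianLaw
  set A : (Fin K × Fin n → ℝ) →L[ℝ] (Fin K → ℝ) := ContinuousLinearMap.pi fun k =>
    ∑ i, a k i • ContinuousLinearMap.proj (k, i) with hA
  have hA' : ∀ ω, A (fun q => e q.1 q.2 ω) = fun k => a k ⬝ᵥ fun i => e k i ω := fun ω => by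
    ext k
    simp [hA, dotProduct]
  have hG2 := hG.map_fun A
  simp only [hA'] at hG2
  -- The block sums are jointly Gaussian, so zero pairwise covariances suffice; these vanish since
  -- disjoint blocks are independent.
  refine hG2.iIndepFun_of_covariance_eq_zero fun k l hkl => ?_
  have hG3 : ∀ k, HasGaussianLaw (fun ω => a k ⬝ᵥ fun i => e k i ω) μ := fun k => hG2.eval k
  refine IndepFun.covariance_eq_zero ?_ (hG3 k).memLp_two (hG3 l).memLp_two
  have hmeas : ∀ q : Fin K × Fin n, AEMeasurable (fun ω => e q.1 q.2 ω) μ := fun q => by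
    obtain ⟨v, -, h⟩ := hlaw q.1 q.2
    exact h.aemeasurable
  have h1 := hind.indepFun_finset₀ ({k} ×ˢ Finset.univ) ({l} ×ˢ Finset.univ) (by
    rw [Finset.disjoint_left]
    rintro ⟨x, y⟩ h1 h2
    simp only [Finset.mem_product, Finset.mem_singleton, Finset.mem_univ, and_true] at h1 h2
    exact hkl (h1.symm.trans h2)) hmeas
  have hm : ∀ m : Fin K, Measurable fun z : ({m} ×ˢ Finset.univ : Finset (Fin K × Fin n)) → ℝ =>
      ∑ i, a m i * z ⟨(m, i), Finset.mem_product.2 ⟨Finset.mem_singleton_self m,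
        Finset.mem_univ i⟩⟩ := fun m => by fun_prop
  exact h1.comp (hm k) (hm l)

end Gaussian

/-! ### Noise bounds for fixed directions -/

section Noise

lemma abs_sub_clip_le {a : ℝ} (ha : 0 ≤ a) (x : ℝ) : |x - clip a x| ≤ |x| := by
  rcases le_or_gt |x| a with h | h
  · rw [clip_of_abs_le h, sub_self, abs_zero]; exact abs_nonneg x
  · unfold clip
    rcases lt_abs.1 h with h | h
    · rw [min_eq_left h.le, max_eq_right (by linarith), abs_of_pos (by linarith),
        abs_of_pos (by linarith)]
      linarith
    · rw [min_eq_right (by linarith), max_eq_left (by linarith), abs_of_neg (by linarith),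
        abs_of_neg (by linarith)]
      linarith

lemma measurable_clip (a : ℝ) : Measurable (clip a) := by unfold clip; fun_prop

variable {Ω : Type*} [MeasurableSpace Ω] {μ : Measure Ω} [IsProbabilityMeasure μ]

lemma measureReal_not_forall_le {ι : Type*} [Fintype ι] {P : ι → Ω → Prop} {q : ℝ}
    (h : ∀ i, μ.real {ω | ¬ P i ω} ≤ q) :
    μ.real {ω | ¬ ∀ i, P i ω} ≤ Fintype.card ι * q := by
  have h1 : {ω | ¬ ∀ i, P i ω} ⊆ ⋃ i, {ω | ¬ P i ω} := by
    intro ω hω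
    rw [Set.mem_ofPred_eq] at hω
    push Not at hω
    obtain ⟨i, hi⟩ := hω
    exact Set.mem_iUnion.2 ⟨i, hi⟩
  refine (measureReal_mono h1 (measure_ne_top μ _)).trans
    ((measureReal_iUnion_fintype_le _).trans ?_)
  refine (Finset.sum_le_sum fun i _ => h i).trans ?_
  rw [Finset.sum_const, Finset.card_univ, nsmul_eq_mul]

lemma measureReal_not_and_le {P Q : Ω → Prop} {q r : ℝ} (hP : μ.real {ω | ¬ P ω} ≤ q)
    (hQ : μ.real {ω | ¬ Q ω} ≤ r) : μ.real {ω | ¬ (P ω ∧ Q ω)} ≤ q + r := by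
  have h1 : {ω | ¬ (P ω ∧ Q ω)} ⊆ {ω | ¬ P ω} ∪ {ω | ¬ Q ω} := by
    intro ω hω
    rw [Set.mem_ofPred_eq, not_and_or] at hω
    exact hω
  exact (measureReal_mono h1 (measure_ne_top μ _)).trans
    ((measureReal_union_le _ _).trans (add_le_add hP hQ))

/-- The condition 6b ≤ M² makes the exponent at least 3x, which leaves room for union bounds over p
or pK events. -/
lemma subgaussian_tail {Y : Ω → ℝ} {c : ℝ≥0} {b n M x : ℝ} (hY : HasSubgaussianMGF Y c μ)
    (hn : 0 < n) (hb : 0 < b) (hc : (c : ℝ) ≤ b / n) (hM : 0 ≤ M) (hMb : 6 * b ≤ M ^ 2)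
    (hx : 0 ≤ x) : μ.real {ω | ¬ |Y ω| ≤ M * √(x / n)} ≤ 2 * Real.exp (-(3 * x)) := by
  set c' : ℝ≥0 := ⟨b / n, by positivity⟩ with hc'
  have hY' : HasSubgaussianMGF Y c' μ := ⟨hY.integrable_exp_mul, fun t => (hY.mgf_le t).trans (by
    rw [Real.exp_le_exp]
    have : (c : ℝ) ≤ c' := hc
    gcongr)⟩
  have h1 := HasSubgaussianMGF.measure_abs_ge_le hY' (t := M * √(x / n)) (by positivity)
  have h2 : {ω | ¬ |Y ω| ≤ M * √(x / n)} ⊆ {ω | M * √(x / n) ≤ |Y ω|} := by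
    intro ω hω
    rw [Set.mem_ofPred_eq, not_le] at hω
    exact hω.le
  refine (measureReal_mono h2 (measure_ne_top μ _)).trans (h1.trans ?_)
  refine mul_le_mul_of_nonneg_left (Real.exp_le_exp.2 ?_) zero_le_two
  have h3 : (c' : ℝ) = b / n := rfl
  rw [h3, mul_pow, Real.sq_sqrt (by positivity)]
  have h4 : -(M ^ 2 * (x / n)) / (2 * (b / n)) = -(M ^ 2 * x / (2 * b)) := by field_simp
  rw [h4, neg_le_neg_iff, le_div_iff₀ (by positivity)]
  have := mul_le_mul_of_nonneg_right hMb hx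
  linarith

lemma exp_neg_mul_log {x : ℝ} (hx : 0 < x) (m : ℕ) :
    Real.exp (-(m * Real.log x)) = 1 / x ^ m := by
  rw [Real.exp_neg, ← Real.log_pow, Real.exp_log (by positivity), one_div]

/-- The noise is well behaved in the given directions. -/
structure NoiseBound {K p nT nS : ℕ} (M η : ℝ) (α : Fin K → ℝ) (a0 : Fin p → Fin nT → ℝ)
    (z a : Fin K → Fin p → Fin nS → ℝ) (e0 : Fin nT → ℝ) (e : Fin K → Fin nS → ℝ) : Prop where
  target : ∀ j, |a0 j ⬝ᵥ e0| ≤ M * √(Real.log p / nT)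
  score : ∀ q : Fin K × Fin p, |z q.1 q.2 ⬝ᵥ e q.1| ≤ M * √(Real.log (p * K) / nS)
  dir : ∀ q : Fin K × Fin p, |a q.1 q.2 ⬝ᵥ e q.1| ≤ M * √(Real.log (p * K) / nS)
  clipped : ∀ j, |∑ k, clip (α k) ((nS : ℝ) / total K nT nS * (a k j ⬝ᵥ e k))|
    ≤ M * √(Real.log p / total K nT nS)
  count : ∑ k, ∑ j, (nS : ℝ) / total K nT nS *
    (if |a k j ⬝ᵥ e k| ≤ M * √(Real.log p / nS) then 0 else 1) ≤ η / 2
  excess : ∀ j, |∑ k, ((nS : ℝ) / total K nT nS * (a k j ⬝ᵥ e k)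
    - clip (α k) ((nS : ℝ) / total K nT nS * (a k j ⬝ᵥ e k)))|
    ≤ √(Real.log p / total K nT nS) / (2 * p)

variable {K p nT nS : ℕ} {M η b A : ℝ} {α : Fin K → ℝ}

/-- Clipping is odd and contracts, so each clipped term has mean zero and the variance proxy of the
unclipped one. The proxies add up to at most b/N since K n_S ≤ N: averaging over the sources gives
the pooled noise level. -/
lemma clipped_sum_tail {Y : Fin K → Ω → ℝ} (hK : 1 ≤ K) (hp : 2 ≤ p) (hnS : 0 < nS) (hb : 0 < b)
    (hM : 0 ≤ M) (hMb : 6 * b ≤ M ^ 2) (hα : ∀ k, 0 ≤ α k) (hY : ∀ k, GaussianLE (Y k) (b / nS) μ)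
    (hind : iIndepFun Y μ) :
    μ.real {ω | ¬ |∑ k, clip (α k) ((nS : ℝ) / total K nT nS * Y k ω)|
      ≤ M * √(Real.log p / total K nT nS)} ≤ 2 / (p : ℝ) ^ 3 := by
  have hN : 0 < total K nT nS := total_pos hK hnS
  have hnS' : (0 : ℝ) < nS := by exact_mod_cast hnS
  have hp' : (0 : ℝ) < p := by exact_mod_cast (by omega : 0 < p)
  set w := (nS : ℝ) / total K nT nS with hw
  have hw0 : 0 ≤ w := by positivity
  set c : ℝ≥0 := ⟨w ^ 2 * (b / nS), by positivity⟩ with hc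
  have hsub : ∀ k ∈ Finset.univ, HasSubgaussianMGF (fun ω => clip (α k) (w * Y k ω)) c μ :=
    fun k _ => (hY k).hasSubgaussianMGF_odd (f := fun y => clip (α k) (w * y)) hw0 le_rfl
      ((measurable_clip _).comp (by fun_prop)) (fun y => by rw [mul_neg, clip_neg (hα k)])
      fun y => (abs_clip_le_abs (hα k) _).trans (by rw [abs_mul, abs_of_nonneg hw0])
  have hI : iIndepFun (fun k ω => clip (α k) (w * Y k ω)) μ :=
    hind.comp (fun k y => clip (α k) (w * y)) fun k => (measurable_clip _).comp (by fun_prop)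
  have hS := HasSubgaussianMGF.sum_of_iIndepFun hI hsub
  have h1 := subgaussian_tail hS hN hb ?_ hM hMb (Real.log_natCast_nonneg p)
  · have e := exp_neg_mul_log hp' 3
    push_cast at e
    rw [e, mul_one_div] at h1
    exact h1
  · rw [Finset.sum_const, Finset.card_univ, Fintype.card_fin, nsmul_eq_mul, NNReal.coe_mul,
      NNReal.coe_natCast]
    have e1 : (c : ℝ) = w ^ 2 * (b / nS) := rfl
    have e2 : (K : ℝ) * (w ^ 2 * (b / nS)) = (K * w) * (b / total K nT nS) := by
      rw [hw]; field_simp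
    rw [e1, e2]
    have h2 := weights_sum hN
    rw [← hw] at h2
    have h3 : 0 ≤ (nT : ℝ) / total K nT nS := by positivity
    exact mul_le_of_le_one_left (by positivity) (by linarith)

/-- Chebyshev's inequality. The excess vanishes below A√(log p / n_S), and 32b ≤ A² turns the
Gaussian tail into a factor p⁻⁴ in its variance. The threshold squared uses up p⁻², so p⁻² is left
and a union bound over the coordinates is affordable. -/
lemma excess_sum_tail {Y : Fin K → Ω → ℝ} (hK : 1 ≤ K) (hp : 2 ≤ p) (hnS : 0 < nS) (hb : 0 < b)
    (hA : 0 < A) (hAb : 32 * b ≤ A ^ 2)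
    (hα : ∀ k, (nS : ℝ) / total K nT nS * (A * √(Real.log p / nS)) ≤ α k)
    (hY : ∀ k, GaussianLE (Y k) (b / nS) μ) (hind : iIndepFun Y μ) :
    μ.real {ω | ¬ |∑ k, ((nS : ℝ) / total K nT nS * Y k ω
      - clip (α k) ((nS : ℝ) / total K nT nS * Y k ω))|
      ≤ √(Real.log p / total K nT nS) / (2 * p)} ≤ 8 * b / Real.log 2 ^ 2 / (p : ℝ) ^ 2 := by
  have hN : 0 < total K nT nS := total_pos hK hnS
  have hnS' : (0 : ℝ) < nS := by exact_mod_cast hnS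
  have hp' : (0 : ℝ) < p := by exact_mod_cast (by omega : 0 < p)
  have hl : 0 < Real.log p := Real.log_pos (by exact_mod_cast hp)
  have hl2 : Real.log 2 ≤ Real.log p := Real.log_le_log two_pos (by exact_mod_cast hp)
  have hl20 : 0 < Real.log 2 := Real.log_pos one_lt_two
  set ℓ := Real.log p with hℓ
  set w := (nS : ℝ) / total K nT nS with hw
  have hw0 : 0 ≤ w := by positivity
  set T := A * √(ℓ / nS) with hT
  have hT0 : 0 < T := by positivity
  have hα0 : ∀ k, 0 ≤ α k := fun k => le_trans (by positivity) (hα k)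
  set f : Fin K → ℝ → ℝ := fun k y => w * y - clip (α k) (w * y) with hf
  have hfm : ∀ k, Measurable (f k) := fun k =>
    (by fun_prop : Measurable fun y : ℝ => w * y).sub ((measurable_clip _).comp (by fun_prop))
  have hodd : ∀ k y, f k (-y) = -f k y := fun k y => by
    simp only [hf, mul_neg, clip_neg (hα0 k)]; ring
  have hfle : ∀ k y, |f k y| ≤ w * |y| := fun k y =>
    (abs_sub_clip_le (hα0 k) _).trans (by rw [abs_mul, abs_of_nonneg hw0])
  have hf0 : ∀ k y, |y| ≤ T → f k y = 0 := fun k y hy => by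
    have : |w * y| ≤ α k := by
      rw [abs_mul, abs_of_nonneg hw0]
      exact (mul_le_mul_of_nonneg_left hy hw0).trans (hα k)
    simp only [hf, clip_of_abs_le this, sub_self]
  have hmem : ∀ k, MemLp (fun ω => f k (Y k ω)) 2 μ := fun k =>
    ((hY k).hasSubgaussianMGF_odd (c := ⟨w ^ 2 * (b / nS), by positivity⟩) hw0 le_rfl (hfm k)
      (hodd k) (hfle k)).memLp 2
  have hmean : ∀ k, ∫ ω, f k (Y k ω) ∂μ = 0 := fun k => (hY k).integral_odd (hfm k) (hodd k)
  have hI : iIndepFun (fun k ω => f k (Y k ω)) μ := hind.comp f hfm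
  have hvar : ∀ k, variance (fun ω => f k (Y k ω)) μ
      ≤ w ^ 2 * (2 * b / (nS * ℓ) * (1 / (p : ℝ) ^ 4)) := fun k => by
    rw [variance_of_integral_eq_zero (hmem k).aemeasurable (hmean k)]
    refine ((hY k).integral_sq_le (by positivity) hT0 (hfm k) (hfle k) (hf0 k)).trans ?_
    refine mul_le_mul_of_nonneg_left ?_ (sq_nonneg w)
    have hT2 : T ^ 2 = A ^ 2 * ℓ / nS := by
      rw [hT, mul_pow, Real.sq_sqrt (by positivity), mul_div_assoc]
    have e := exp_neg_mul_log hp' 4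
    push_cast at e
    rw [← e]
    refine mul_le_mul ?_ (Real.exp_le_exp.2 ?_) (Real.exp_pos _).le (by positivity)
    · rw [hT2, div_le_div_iff₀ (by positivity) (by positivity)]
      have e1 : 64 * (b / (nS : ℝ)) ^ 2 * (nS * ℓ) = 2 * b * (32 * b * ℓ / nS) := by
        field_simp; norm_num
      rw [e1]
      gcongr
    · rw [neg_le_neg_iff, hT2]
      have e1 : A ^ 2 * ℓ / nS / (8 * (b / nS)) = A ^ 2 * ℓ / (8 * b) := by field_simp
      rw [e1, le_div_iff₀ (by positivity)]
      have := mul_le_mul_of_nonneg_right hAb hl.le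
      linarith
  have hsum : (∑ k, fun ω => f k (Y k ω)) = fun ω => ∑ k, f k (Y k ω) := by
    ext ω; simp
  have hvs := IndepFun.variance_sum (s := Finset.univ) (fun k _ => hmem k)
    (fun i _ j _ hij => hI.indepFun hij)
  rw [hsum] at hvs
  have hms : MemLp (fun ω => ∑ k, f k (Y k ω)) 2 μ := memLp_finsetSum _ fun k _ => hmem k
  have hmeans : ∫ ω, ∑ k, f k (Y k ω) ∂μ = 0 := by
    rw [integral_finsetSum _ fun k _ => (hmem k).integrable one_le_two]
    exact Finset.sum_eq_zero fun k _ => hmean k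
  set cc := √(ℓ / total K nT nS) / (2 * p) with hcc
  have hcc0 : 0 < cc := by positivity
  have hch := meas_ge_le_variance_div_sq hms hcc0
  have h1 : {ω | ¬ |∑ k, f k (Y k ω)| ≤ cc}
      ⊆ {ω | cc ≤ |(∑ k, f k (Y k ω)) - ∫ ω, ∑ k, f k (Y k ω) ∂μ|} := by
    intro ω hω
    rw [Set.mem_ofPred_eq, not_le] at hω
    rw [Set.mem_ofPred_eq, hmeans, sub_zero]
    exact hω.le
  refine (measureReal_mono h1 (measure_ne_top μ _)).trans ?_
  refine ENNReal.toReal_le_of_le_ofReal (by positivity) (hch.trans (ENNReal.ofReal_le_ofReal ?_))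
  have hKw : K * w ≤ 1 := by
    have h2 := weights_sum hN
    rw [← hw] at h2
    have h3 : 0 ≤ (nT : ℝ) / total K nT nS := by positivity
    linarith
  have h2 : variance (fun ω => ∑ k, f k (Y k ω)) μ
      ≤ 2 * b / (total K nT nS * ℓ) * (1 / (p : ℝ) ^ 4) := by
    rw [hvs]
    refine (Finset.sum_le_sum fun k _ => hvar k).trans ?_
    rw [Finset.sum_const, Finset.card_univ, Fintype.card_fin, nsmul_eq_mul]
    have e1 : (K : ℝ) * (w ^ 2 * (2 * b / (nS * ℓ) * (1 / (p : ℝ) ^ 4)))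
        = (K * w) * (2 * b / (total K nT nS * ℓ) * (1 / (p : ℝ) ^ 4)) := by
      rw [hw]; field_simp
    rw [e1]
    exact mul_le_of_le_one_left (by positivity) hKw
  have h3 : cc ^ 2 = ℓ / (4 * p ^ 2 * total K nT nS) := by
    rw [hcc, div_pow, Real.sq_sqrt (by positivity)]; field_simp; norm_num
  rw [h3]
  refine (div_le_div_of_nonneg_right h2 (by positivity)).trans ?_
  have e1 : 2 * b / (total K nT nS * ℓ) * (1 / (p : ℝ) ^ 4) / (ℓ / (4 * p ^ 2 * total K nT nS))
      = 8 * b / ℓ ^ 2 / p ^ 2 := by field_simp; norm_num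
  rw [e1]
  gcongr

/-- Markov's inequality for the weighted number of exceedances. The weights n_S/N sum to at most 1
over the sources, so the bound does not depend on K although the threshold ignores K. -/
lemma count_tail {Y : Fin K → Fin p → Ω → ℝ} {x : ℝ} (hK : 1 ≤ K) (hp : 2 ≤ p) (hnS : 0 < nS)
    (hη : 0 < η) (hY : ∀ k j, μ.real {ω | ¬ |Y k j ω| ≤ x} ≤ 2 / (p : ℝ) ^ 3) :
    μ.real {ω | ¬ ∑ k, ∑ j, (nS : ℝ) / total K nT nS * (if |Y k j ω| ≤ x then 0 else 1) ≤ η / 2}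
      ≤ 4 / η / p := by
  have hN : 0 < total K nT nS := total_pos hK hnS
  have hp1 : (1 : ℝ) ≤ p := by exact_mod_cast (by omega : 1 ≤ p)
  have hp' : (0 : ℝ) < p := by linarith
  set w := (nS : ℝ) / total K nT nS with hw
  have hw0 : 0 ≤ w := by positivity
  -- The exceedance events are not assumed measurable; they are replaced by measurable hulls of the
  -- same measure.
  set s : Fin K → Fin p → Set Ω := fun k j => toMeasurable μ {ω | ¬ |Y k j ω| ≤ x} with hs
  have hms : ∀ k j, MeasurableSet (s k j) := fun k j => measurableSet_toMeasurable _ _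
  have hi : ∀ k j, Integrable (fun ω => w * (s k j).indicator (1 : Ω → ℝ) ω) μ := fun k j =>
    ((integrable_const (1 : ℝ)).indicator (hms k j)).const_mul w
  have hi2 : Integrable (fun ω => ∑ k, ∑ j, w * (s k j).indicator (1 : Ω → ℝ) ω) μ :=
    integrable_finsetSum _ fun k _ => integrable_finsetSum _ fun j _ => hi k j
  have hind0 : ∀ k j ω, 0 ≤ (s k j).indicator (1 : Ω → ℝ) ω := fun k j ω =>
    Set.indicator_nonneg (fun _ _ => zero_le_one) ω
  have h1 := mul_meas_ge_le_integral_of_nonneg (ae_of_all μ fun ω =>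
    Finset.sum_nonneg fun k (_ : k ∈ Finset.univ) => Finset.sum_nonneg
      fun j (_ : j ∈ Finset.univ) => mul_nonneg hw0 (hind0 k j ω)) hi2 (η / 2)
  have h2 : ∫ ω, ∑ k, ∑ j, w * (s k j).indicator (1 : Ω → ℝ) ω ∂μ ≤ 2 / p := by
    rw [integral_finsetSum _ fun k _ => integrable_finsetSum _ fun j _ => hi k j]
    have h3 : ∀ k, ∫ ω, ∑ j, w * (s k j).indicator (1 : Ω → ℝ) ω ∂μ ≤ w * (2 / p) := fun k => by
      rw [integral_finsetSum _ fun j _ => hi k j]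
      have h4 : ∀ j, ∫ ω, w * (s k j).indicator (1 : Ω → ℝ) ω ∂μ ≤ w * (2 / (p : ℝ) ^ 3) :=
        fun j => by
          rw [integral_const_mul, integral_indicator_one (hms k j)]
          refine mul_le_mul_of_nonneg_left ?_ hw0
          rw [hs, measureReal_def, measure_toMeasurable]
          exact hY k j
      refine (Finset.sum_le_sum fun j _ => h4 j).trans ?_
      rw [Finset.sum_const, Finset.card_univ, Fintype.card_fin, nsmul_eq_mul, mul_left_comm]
      refine mul_le_mul_of_nonneg_left ?_ hw0
      have e1 : (p : ℝ) * (2 / (p : ℝ) ^ 3) = 2 / (p : ℝ) ^ 2 := by field_simp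
      rw [e1]
      exact div_le_div_of_nonneg_left zero_le_two hp' (le_self_pow₀ hp1 two_ne_zero)
    refine (Finset.sum_le_sum fun k _ => h3 k).trans ?_
    rw [Finset.sum_const, Finset.card_univ, Fintype.card_fin, nsmul_eq_mul, ← mul_assoc]
    have h4 := weights_sum hN
    rw [← hw] at h4
    have h5 : 0 ≤ (nT : ℝ) / total K nT nS := by positivity
    exact mul_le_of_le_one_left (by positivity) (by linarith)
  have h3 : μ.real {ω | ¬ ∑ k, ∑ j, w * (if |Y k j ω| ≤ x then 0 else 1) ≤ η / 2}
      ≤ μ.real {ω | η / 2 ≤ ∑ k, ∑ j, w * (s k j).indicator (1 : Ω → ℝ) ω} := by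
    refine measureReal_mono (fun ω hω => ?_) (measure_ne_top μ _)
    rw [Set.mem_ofPred_eq, not_le] at hω
    rw [Set.mem_ofPred_eq]
    refine hω.le.trans (Finset.sum_le_sum fun k _ => Finset.sum_le_sum fun j _ =>
      mul_le_mul_of_nonneg_left ?_ hw0)
    split_ifs with h
    · exact hind0 k j ω
    · have : ω ∈ s k j := subset_toMeasurable μ _ h
      rw [Set.indicator_of_mem this]
      exact le_rfl
  refine h3.trans ?_
  have h4 := h1.trans h2
  rw [div_div, le_div_iff₀ (by positivity)]
  rw [le_div_iff₀ hp'] at h4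
  linarith

set_option maxHeartbeats 1000000 in
/-- For fixed directions of small norm, the noise is well behaved with large probability. -/
theorem noiseBound_of_fixed {a0 : Fin p → Fin nT → ℝ} {z a : Fin K → Fin p → Fin nS → ℝ}
    {B : ℝ} {V : ℝ≥0} (hK : 1 ≤ K) (hp : 2 ≤ p) (hnT : 0 < nT) (hnS : 0 < nS) (hB : 0 < B)
    (hb : b = (V + 1) * B) (hη : 0 < η)
    (hM : 0 ≤ M) (hMb : 6 * b ≤ M ^ 2) (hA : 0 < A) (hAb : 32 * b ≤ A ^ 2)
    (hα : ∀ k, (nS : ℝ) / total K nT nS * (A * √(Real.log p / nS)) ≤ α k)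
    (ha0 : ∀ j, sqNorm (a0 j) ≤ B / nT) (hz : ∀ k j, sqNorm (z k j) ≤ B / nS)
    (ha : ∀ k j, sqNorm (a k j) ≤ B / nS)
    {e0 : Ω → Fin nT → ℝ} {e : Fin K → Ω → Fin nS → ℝ}
    (hlaw0 : ∀ i, ∃ v : ℝ≥0, v ≤ V ∧ HasLaw (fun ω => e0 ω i) (gaussianReal 0 v) μ)
    (hlaw : ∀ k i, ∃ v : ℝ≥0, v ≤ V ∧ HasLaw (fun ω => e k ω i) (gaussianReal 0 v) μ)
    (hind : iIndepFun (β := fun _ : Fin nT ⊕ (Fin K × Fin nS) => ℝ)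
      (Sum.elim (fun (i : Fin nT) (ω : Ω) => e0 ω i)
        (fun (ki : Fin K × Fin nS) (ω : Ω) => e ki.1 ω ki.2)) μ) :
    μ.real {ω | ¬ NoiseBound M η α a0 z a (e0 ω) (fun k => e k ω)}
      ≤ (8 + 4 / η + 8 * b / Real.log 2 ^ 2) / p := by
  have hN : 0 < total K nT nS := total_pos hK hnS
  have hnS' : (0 : ℝ) < nS := by exact_mod_cast hnS
  have hnT' : (0 : ℝ) < nT := by exact_mod_cast hnT
  have hK' : (1 : ℝ) ≤ K := by exact_mod_cast hK
  have hp1 : (1 : ℝ) ≤ p := by exact_mod_cast (by omega : 1 ≤ p)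
  have hp' : (0 : ℝ) < p := by linarith
  have hb0 : 0 < b := by rw [hb]; positivity
  have hVB : (V : ℝ) * B ≤ b := by rw [hb]; linarith
  have hα0 : ∀ k, 0 ≤ α k := fun k => le_trans (by positivity) (hα k)
  have hpK : (0 : ℝ) < p * K := by positivity
  have hpK1 : (1 : ℝ) ≤ p * K := one_le_mul_of_one_le_of_one_le hp1 hK'
  have hind0 : iIndepFun (fun i ω => e0 ω i) μ := hind.precomp Sum.inl_injective
  have hindS : iIndepFun (fun (q : Fin K × Fin nS) ω => e q.1 ω q.2) μ :=
    hind.precomp Sum.inr_injective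
  have hindk : ∀ k, iIndepFun (fun i ω => e k ω i) μ := fun k =>
    hindS.precomp (g := fun i : Fin nS => (k, i)) (Prod.mk_right_injective k)
  have hG0 : ∀ j, GaussianLE (fun ω => a0 j ⬝ᵥ e0 ω) (b / nT) μ := fun j => by
    obtain ⟨v, hv, h⟩ := gaussianLE_sum hind0 hlaw0 (a0 j)
    refine ⟨v, hv.trans ?_, h⟩
    refine (mul_le_mul_of_nonneg_left (ha0 j) V.2).trans ?_
    rw [← mul_div_assoc]
    exact div_le_div_of_nonneg_right hVB hnT'.le
  have hGk : ∀ k (c : Fin nS → ℝ), sqNorm c ≤ B / nS →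
      GaussianLE (fun ω => c ⬝ᵥ e k ω) (b / nS) μ := fun k c hc => by
    obtain ⟨v, hv, h⟩ := gaussianLE_sum (hindk k) (hlaw k) c
    refine ⟨v, hv.trans ?_, h⟩
    refine (mul_le_mul_of_nonneg_left hc V.2).trans ?_
    rw [← mul_div_assoc]
    exact div_le_div_of_nonneg_right hVB hnS'.le
  have hblock : ∀ j, iIndepFun (fun k ω => a k j ⬝ᵥ e k ω) μ := fun j =>
    iIndepFun_block hindS hlaw fun k => a k j
  have htail : ∀ {Y : Ω → ℝ} {n x : ℝ}, 0 < n → 0 ≤ x → GaussianLE Y (b / n) μ →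
      μ.real {ω | ¬ |Y ω| ≤ M * √(x / n)} ≤ 2 * Real.exp (-(3 * x)) := fun hn hx hY =>
    subgaussian_tail (hY.hasSubgaussianMGF (c := ⟨b / _, by positivity⟩) le_rfl) hn hb0 le_rfl hM
      hMb hx
  have hexp := exp_neg_mul_log hp' 3
  have hexpK := exp_neg_mul_log hpK 3
  push_cast at hexp hexpK
  have hl0 : 0 ≤ Real.log p := Real.log_natCast_nonneg p
  have hlK0 : 0 ≤ Real.log (p * K) := Real.log_nonneg hpK1
  have hfrac : ∀ {x : ℝ}, (p : ℝ) ≤ x → x * (2 * (1 / x ^ 3)) ≤ 2 / p := fun {x} hx => by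
    have hx0 : 0 < x := hp'.trans_le hx
    have e1 : x * (2 * (1 / x ^ 3)) = 2 / x ^ 2 := by field_simp
    rw [e1]
    refine div_le_div_of_nonneg_left zero_le_two hp' (hx.trans ?_)
    exact le_self_pow₀ (hp1.trans hx) two_ne_zero
  have hpKp : (p : ℝ) ≤ p * K := le_mul_of_one_le_right hp'.le hK'
  -- the six estimates
  have t1 : μ.real {ω | ¬ ∀ j, |a0 j ⬝ᵥ e0 ω| ≤ M * √(Real.log p / nT)} ≤ 2 / p := by
    have h1 : ∀ j, μ.real {ω | ¬ |a0 j ⬝ᵥ e0 ω| ≤ M * √(Real.log p / nT)}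
        ≤ 2 * (1 / (p : ℝ) ^ 3) := fun j => by
      rw [← hexp]; exact htail hnT' hl0 (hG0 j)
    refine (measureReal_not_forall_le
      (P := fun j ω => |a0 j ⬝ᵥ e0 ω| ≤ M * √(Real.log p / nT)) h1).trans ?_
    rw [Fintype.card_fin]
    exact hfrac le_rfl
  -- A bound uniform over all sources and coordinates is a union over pK events, hence the logarithm
  -- of pK.
  have tq : ∀ c : Fin K → Fin p → Fin nS → ℝ, (∀ k j, sqNorm (c k j) ≤ B / nS) →
      μ.real {ω | ¬ ∀ q : Fin K × Fin p, |c q.1 q.2 ⬝ᵥ e q.1 ω|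
        ≤ M * √(Real.log (p * K) / nS)} ≤ 2 / p := fun c hc => by
    have h1 : ∀ q : Fin K × Fin p, μ.real {ω | ¬ |c q.1 q.2 ⬝ᵥ e q.1 ω|
        ≤ M * √(Real.log (p * K) / nS)} ≤ 2 * (1 / ((p : ℝ) * K) ^ 3) := fun q => by
      rw [← hexpK]; exact htail hnS' hlK0 (hGk q.1 _ (hc q.1 q.2))
    refine (measureReal_not_forall_le (P := fun (q : Fin K × Fin p) ω =>
      |c q.1 q.2 ⬝ᵥ e q.1 ω| ≤ M * √(Real.log (p * K) / nS)) h1).trans ?_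
    rw [Fintype.card_prod, Fintype.card_fin, Fintype.card_fin, Nat.cast_mul, mul_comm (K : ℝ)]
    exact hfrac hpKp
  have t2 := tq z hz
  have t3 := tq a ha
  have t4 : μ.real {ω | ¬ ∀ j, |∑ k, clip (α k) ((nS : ℝ) / total K nT nS * (a k j ⬝ᵥ e k ω))|
      ≤ M * √(Real.log p / total K nT nS)} ≤ 2 / p := by
    have h1 := fun j => clipped_sum_tail (nT := nT) hK hp hnS hb0 hM hMb hα0
      (fun k => hGk k _ (ha k j)) (hblock j)
    refine (measureReal_not_forall_le
      (P := fun j ω => |∑ k, clip (α k) ((nS : ℝ) / total K nT nS * (a k j ⬝ᵥ e k ω))|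
      ≤ M * √(Real.log p / total K nT nS)) h1).trans ?_
    rw [Fintype.card_fin, div_eq_mul_one_div 2 ((p : ℝ) ^ 3)]
    exact hfrac le_rfl
  have t6 : μ.real {ω | ¬ ∀ j, |∑ k, ((nS : ℝ) / total K nT nS * (a k j ⬝ᵥ e k ω)
      - clip (α k) ((nS : ℝ) / total K nT nS * (a k j ⬝ᵥ e k ω)))|
      ≤ √(Real.log p / total K nT nS) / (2 * p)} ≤ 8 * b / Real.log 2 ^ 2 / p := by
    have h1 := fun j => excess_sum_tail (nT := nT) hK hp hnS hb0 hA hAb hα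
      (fun k => hGk k _ (ha k j)) (hblock j)
    refine (measureReal_not_forall_le
      (P := fun j ω => |∑ k, ((nS : ℝ) / total K nT nS * (a k j ⬝ᵥ e k ω)
        - clip (α k) ((nS : ℝ) / total K nT nS * (a k j ⬝ᵥ e k ω)))|
        ≤ √(Real.log p / total K nT nS) / (2 * p)) h1).trans (le_of_eq ?_)
    rw [Fintype.card_fin]
    field_simp
  have t5 := count_tail (μ := μ) (nT := nT) (Y := fun k j ω => a k j ⬝ᵥ e k ω)
    (x := M * √(Real.log p / nS)) hK hp hnS hη fun k j => by
      rw [show 2 / (p : ℝ) ^ 3 = 2 * (1 / (p : ℝ) ^ 3) by ring, ← hexp]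
      exact htail hnS' hl0 (hGk k _ (ha k j))
  have h := measureReal_not_and_le t1 (measureReal_not_and_le t2 (measureReal_not_and_le t3
    (measureReal_not_and_le t4 (measureReal_not_and_le t5 t6))))
  refine (measureReal_mono (fun ω hω => ?_) (measure_ne_top μ _)).trans (h.trans (le_of_eq ?_))
  · rw [Set.mem_ofPred_eq] at hω ⊢
    exact fun hh => hω ⟨hh.1, hh.2.1, hh.2.2.1, hh.2.2.2.1, hh.2.2.2.2.1, hh.2.2.2.2.2⟩
  · field_simp
    ring

end Noise

/-! ### Noise bounds for random directions -/

section RandomDirections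

variable {Ω : Type*} [MeasurableSpace Ω] {μ : Measure Ω} [IsProbabilityMeasure μ]

/-- A bound which holds conditionally on the second of two independent variables. -/
lemma measureReal_le_of_indepFun {E D : Type*} [MeasurableSpace E] [MeasurableSpace D]
    {X : Ω → E} {Y : Ω → D} (hX : Measurable X) (hY : Measurable Y) (h : IndepFun X Y μ)
    {B : Set (E × D)} (hB : MeasurableSet B) {q : ℝ} (hq : 0 ≤ q)
    (hle : ∀ d, μ.real {ω | (X ω, d) ∈ B} ≤ q) : μ.real {ω | (X ω, Y ω) ∈ B} ≤ q := by
  have h1 := (indepFun_iff_map_prod_eq_prod_map_map hX.aemeasurable hY.aemeasurable).1 h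
  have h2 : μ {ω | (X ω, Y ω) ∈ B} = (μ.map fun ω => (X ω, Y ω)) B :=
    (Measure.map_apply (hX.prodMk hY) hB).symm
  have : IsProbabilityMeasure (μ.map X) := Measure.isProbabilityMeasure_map hX.aemeasurable
  have : IsProbabilityMeasure (μ.map Y) := Measure.isProbabilityMeasure_map hY.aemeasurable
  refine ENNReal.toReal_le_of_le_ofReal hq ?_
  rw [h2, h1, Measure.prod_apply_symm hB]
  have h3 : ∀ d, (μ.map X) ((fun x => (x, d)) ⁻¹' B) ≤ ENNReal.ofReal q := fun d => by
    rw [Measure.map_apply hX (measurable_prodMk_right hB)]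
    have h4 := ENNReal.ofReal_le_ofReal (hle d)
    rw [ofReal_measureReal] at h4
    exact h4
  refine (lintegral_mono h3).trans ?_
  rw [lintegral_const, measure_univ, mul_one]

variable {K p nT nS : ℕ}

lemma measurableSet_noiseBound {D : Type*} [MeasurableSpace D] {M η : ℝ} {α : Fin K → ℝ}
    {a0 : D → Fin p → Fin nT → ℝ} {z a : D → Fin K → Fin p → Fin nS → ℝ} (ha0 : Measurable a0)
    (hz : Measurable z) (ha : Measurable a) :
    MeasurableSet {q : ((Fin nT → ℝ) × (Fin K → Fin nS → ℝ)) × D |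
      ¬ NoiseBound M η α (a0 q.2) (z q.2) (a q.2) q.1.1 q.1.2} := by
  have m0 : ∀ j, Measurable fun q : ((Fin nT → ℝ) × (Fin K → Fin nS → ℝ)) × D =>
      a0 q.2 j ⬝ᵥ q.1.1 := fun j => by
    have : ∀ i, Measurable fun d => a0 d j i := fun i => by fun_prop
    unfold dotProduct
    exact Finset.measurable_sum _ fun i _ => ((this i).comp measurable_snd).mul (by fun_prop)
  have mk : ∀ c : D → Fin K → Fin p → Fin nS → ℝ, Measurable c → ∀ k j,
      Measurable fun q : ((Fin nT → ℝ) × (Fin K → Fin nS → ℝ)) × D =>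
        c q.2 k j ⬝ᵥ q.1.2 k := fun c hc k j => by
    have : ∀ i, Measurable fun d => c d k j i := fun i => by fun_prop
    unfold dotProduct
    exact Finset.measurable_sum _ fun i _ => ((this i).comp measurable_snd).mul (by fun_prop)
  have h1 : MeasurableSet (⋂ j, {q : ((Fin nT → ℝ) × (Fin K → Fin nS → ℝ)) × D |
      |a0 q.2 j ⬝ᵥ q.1.1| ≤ M * √(Real.log p / nT)}) :=
    MeasurableSet.iInter fun j => measurableSet_le (m0 j).abs measurable_const
  have hk : ∀ c : D → Fin K → Fin p → Fin nS → ℝ, Measurable c →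
      MeasurableSet (⋂ r : Fin K × Fin p, {q : ((Fin nT → ℝ) × (Fin K → Fin nS → ℝ)) × D |
      |c q.2 r.1 r.2 ⬝ᵥ q.1.2 r.1| ≤ M * √(Real.log (p * K) / nS)}) := fun c hc =>
    MeasurableSet.iInter fun r => measurableSet_le (mk c hc r.1 r.2).abs measurable_const
  have h4 : MeasurableSet (⋂ j, {q : ((Fin nT → ℝ) × (Fin K → Fin nS → ℝ)) × D |
      |∑ k, clip (α k) ((nS : ℝ) / total K nT nS * (a q.2 k j ⬝ᵥ q.1.2 k))|
        ≤ M * √(Real.log p / total K nT nS)}) :=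
    MeasurableSet.iInter fun j => measurableSet_le (Finset.measurable_sum _ fun k _ =>
      (measurable_clip _).comp ((mk a ha k j).const_mul _)).abs measurable_const
  have h5 : MeasurableSet {q : ((Fin nT → ℝ) × (Fin K → Fin nS → ℝ)) × D |
      ∑ k, ∑ j, (nS : ℝ) / total K nT nS *
        (if |a q.2 k j ⬝ᵥ q.1.2 k| ≤ M * √(Real.log p / nS) then (0 : ℝ) else 1) ≤ η / 2} :=
    measurableSet_le (Finset.measurable_sum _ fun k _ => Finset.measurable_sum _ fun j _ =>
      (Measurable.ite (measurableSet_le (mk a ha k j).abs measurable_const) measurable_const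
        measurable_const).const_mul _) measurable_const
  have h6 : MeasurableSet (⋂ j, {q : ((Fin nT → ℝ) × (Fin K → Fin nS → ℝ)) × D |
      |∑ k, ((nS : ℝ) / total K nT nS * (a q.2 k j ⬝ᵥ q.1.2 k)
        - clip (α k) ((nS : ℝ) / total K nT nS * (a q.2 k j ⬝ᵥ q.1.2 k)))|
        ≤ √(Real.log p / total K nT nS) / (2 * p)}) :=
    MeasurableSet.iInter fun j => measurableSet_le (Finset.measurable_sum _ fun k _ =>
      ((mk a ha k j).const_mul _).sub
        ((measurable_clip _).comp ((mk a ha k j).const_mul _))).abs measurable_const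
  have h := ((((h1.inter (hk z hz)).inter (hk a ha)).inter h4).inter h5).inter h6
  refine (h.congr ?_).compl
  ext q
  simp only [Set.mem_inter_iff, Set.mem_iInter, Set.mem_ofPred_eq]
  exact ⟨fun ⟨⟨⟨⟨⟨g1, g2⟩, g3⟩, g4⟩, g5⟩, g6⟩ => ⟨g1, g2, g3, g4, g5, g6⟩,
    fun g => ⟨⟨⟨⟨⟨g.1, g.2⟩, g.3⟩, g.4⟩, g.5⟩, g.6⟩⟩

/-- The direction of the `j`-th entry of the score. -/
def scoreDir {n p : ℕ} (X : Matrix (Fin n) (Fin p) ℝ) (j : Fin p) : Fin n → ℝ :=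
  (1 / (n : ℝ)) • fun i => X i j

lemma scoreDir_dotProduct {n p : ℕ} (X : Matrix (Fin n) (Fin p) ℝ) (j : Fin p) (ε : Fin n → ℝ) :
    scoreDir X j ⬝ᵥ ε = score X ε j := by
  rw [scoreDir, score, smul_dotProduct, Pi.smul_apply]
  rfl

lemma sqNorm_scoreDir {n p : ℕ} (X : Matrix (Fin n) (Fin p) ℝ) (j : Fin p) :
    sqNorm (scoreDir X j) = sampleCov X j j / n := by
  rw [scoreDir, sqNorm_smul, sampleCov, Matrix.smul_apply, Matrix.mul_apply, sqNorm, smul_eq_mul]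
  simp only [Matrix.transpose_apply, ← sq]
  ring

/-- The vector `v` if it is small, and `0` otherwise. -/
def truncVec {n : ℕ} (B : ℝ) (v : Fin n → ℝ) : Fin n → ℝ :=
  if sqNorm v ≤ B / n then v else 0

lemma sqNorm_truncVec_le {n : ℕ} {B : ℝ} (hB : 0 ≤ B) (v : Fin n → ℝ) :
    sqNorm (truncVec B v) ≤ B / n := by
  unfold truncVec
  split_ifs with h
  · exact h
  · rw [sqNorm_eq_zero.2 rfl]; positivity

lemma truncVec_of_le {n : ℕ} {B : ℝ} {v : Fin n → ℝ} (h : sqNorm v ≤ B / n) :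
    truncVec B v = v := if_pos h

lemma measurable_truncVec {n : ℕ} (B : ℝ) : Measurable (truncVec B : (Fin n → ℝ) → Fin n → ℝ) :=
  Measurable.ite (measurableSet_le continuous_sqNorm.measurable measurable_const) measurable_id
    measurable_const

/-- The noise is well behaved with large probability in the directions which matter, as long as
these directions have small norms. -/
theorem noiseBound_random {x0 : Ω → Fin nT → Fin p → ℝ} {x : Fin K → Ω → Fin nS → Fin p → ℝ}
    {e0 : Ω → Fin nT → ℝ} {e : Fin K → Ω → Fin nS → ℝ} {V : ℝ≥0} {M η b A B mu : ℝ}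
    {α : Fin K → ℝ} (hx0 : Measurable x0) (hx : ∀ k, Measurable (x k))
    (hG : GaussianErrors μ x0 x e0 e V)
    (hK : 1 ≤ K) (hp : 2 ≤ p) (hnT : 0 < nT) (hnS : 0 < nS) (hB : 0 < B)
    (hb : b = (V + 1) * B) (hη : 0 < η) (hM : 0 ≤ M) (hMb : 6 * b ≤ M ^ 2) (hA : 0 < A)
    (hAb : 32 * b ≤ A ^ 2)
    (hα : ∀ k, (nS : ℝ) / total K nT nS * (A * √(Real.log p / nS)) ≤ α k) :
    μ.real {ω | ¬ NoiseBound M η α (fun j => truncVec B (scoreDir (Matrix.of (x0 ω)) j))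
      (fun k j => truncVec B (scoreDir (Matrix.of (x k ω)) j))
      (fun k j => truncVec B (debiasDir (Matrix.of (x k ω)) mu j)) (e0 ω) (fun k => e k ω)}
      ≤ (8 + 4 / η + 8 * b / Real.log 2 ^ 2) / p := by
  have hb0 : 0 < b := by rw [hb]; positivity
  have mscore : ∀ {n : ℕ} (j : Fin p), Measurable fun y : Fin n → Fin p → ℝ =>
      scoreDir (Matrix.of y) j := fun {n} j => by
    unfold scoreDir
    refine measurable_pi_lambda _ fun i => ?_
    have : Measurable fun y : Fin n → Fin p → ℝ => (1 / (n : ℝ)) * y i j := by fun_prop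
    exact this
  set a0 : (Fin nT → Fin p → ℝ) × (Fin K → Fin nS → Fin p → ℝ) → Fin p → Fin nT → ℝ :=
    fun d j => truncVec B (scoreDir (Matrix.of d.1) j) with ha0
  set z : (Fin nT → Fin p → ℝ) × (Fin K → Fin nS → Fin p → ℝ) → Fin K → Fin p → Fin nS → ℝ :=
    fun d k j => truncVec B (scoreDir (Matrix.of (d.2 k)) j) with hz
  set a : (Fin nT → Fin p → ℝ) × (Fin K → Fin nS → Fin p → ℝ) → Fin K → Fin p → Fin nS → ℝ :=
    fun d k j => truncVec B (debiasDir (Matrix.of (d.2 k)) mu j) with ha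
  have m0 : Measurable a0 := measurable_pi_lambda _ fun j =>
    (measurable_truncVec B).comp ((mscore j).comp measurable_fst)
  have mz : Measurable z := measurable_pi_lambda _ fun k => measurable_pi_lambda _ fun j =>
    (measurable_truncVec B).comp ((mscore j).comp ((measurable_pi_apply k).comp measurable_snd))
  have ma : Measurable a := measurable_pi_lambda _ fun k => measurable_pi_lambda _ fun j =>
    (measurable_truncVec B).comp ((measurable_debiasDir mu j).comp
      ((measurable_pi_apply k).comp measurable_snd))
  have hset := measurableSet_noiseBound (M := M) (η := η) (α := α) m0 mz ma
  -- Truncating the directions makes their norm bounds hold for every value d of the designs, as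
  -- conditioning requires. On good designs the truncation is inactive.
  have hfix : ∀ d, μ.real {ω | ¬ NoiseBound M η α (a0 d) (z d) (a d) (e0 ω) (fun k => e k ω)}
      ≤ (8 + 4 / η + 8 * b / Real.log 2 ^ 2) / p := fun d =>
    noiseBound_of_fixed hK hp hnT hnS hB hb hη hM hMb hA hAb hα
      (fun j => sqNorm_truncVec_le hB.le _) (fun k j => sqNorm_truncVec_le hB.le _)
      (fun k j => sqNorm_truncVec_le hB.le _) hG.law_target hG.law_source hG.indep
  have h := measureReal_le_of_indepFun
    (hG.measurable_target.prodMk (measurable_pi_lambda _ hG.measurable_source))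
    (hx0.prodMk (measurable_pi_lambda _ hx)) hG.indep_design hset
    (q := (8 + 4 / η + 8 * b / Real.log 2 ^ 2) / p) (by positivity)
    (fun d => by simp only [Set.mem_ofPred_eq]; exact hfix d)
  simp only [Set.mem_ofPred_eq] at h
  exact h

end RandomDirections

/-! ### Squares of sub-Gaussian variables -/

section Squares

lemma exp_le_one_add_add_sq_mul_exp (u : ℝ) :
    Real.exp u ≤ 1 + u + u ^ 2 * Real.exp |u| := by
  rcases le_or_gt |u| 1 with h | h
  · have h1 := (abs_le.1 (Real.abs_exp_sub_one_sub_id_le h)).2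
    have h2 : u ^ 2 * 1 ≤ u ^ 2 * Real.exp |u| :=
      mul_le_mul_of_nonneg_left (Real.one_le_exp (abs_nonneg u)) (sq_nonneg u)
    linarith
  · have hu2 : 1 ≤ u ^ 2 := by rw [← sq_abs]; exact one_le_pow₀ h.le
    have hexp : 1 ≤ Real.exp |u| := Real.one_le_exp (abs_nonneg u)
    rcases lt_abs.1 h with h1 | h1
    · rw [abs_of_pos (by linarith)] at hexp ⊢
      have := mul_le_mul_of_nonneg_right hu2 (Real.exp_pos u).le
      linarith
    · have h2 : Real.exp u ≤ 1 := Real.exp_le_one_iff.2 (by linarith)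
      have h3 : -u ≤ u ^ 2 := by
        have := mul_le_mul_of_nonneg_left h1.le (by linarith : 0 ≤ -u)
        linarith
      have h4 := mul_le_mul_of_nonneg_left hexp (sq_nonneg u)
      linarith

/-- With variance 1/(2L), the exponent of the density dominates Ls²/2 by a factor 2, so the product
is again a Gaussian kernel. -/
lemma lintegral_exp_sq_gaussianReal {L : ℝ} (hL : 0 < L) :
    ∫⁻ s, ENNReal.ofReal (Real.exp (L * s ^ 2 / 2))
      ∂(gaussianReal 0 ⟨1 / (2 * L), by positivity⟩) = ENNReal.ofReal √2 := by
  set v : ℝ≥0 := ⟨1 / (2 * L), by positivity⟩ with hv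
  have hvL : (v : ℝ) = 1 / (2 * L) := rfl
  have hv0 : v ≠ 0 := by
    intro h
    have : (v : ℝ) = 0 := by rw [h]; rfl
    rw [hvL] at this
    have h2 : 0 < 1 / (2 * L) := by positivity
    linarith
  have hpt : ∀ s, gaussianPDFReal 0 v s * Real.exp (L * s ^ 2 / 2)
      = √(L / Real.pi) * Real.exp (-(L / 2) * s ^ 2) := by
    intro s
    have e1 : (√(2 * Real.pi * v))⁻¹ = √(L / Real.pi) := by
      rw [← Real.sqrt_inv, hvL]; congr 1; field_simp
    rw [gaussianPDFReal, e1, mul_assoc, ← Real.exp_add]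
    congr 2
    rw [hvL]
    field_simp
    ring
  rw [gaussianReal_of_var_ne_zero _ hv0,
    lintegral_withDensity_eq_lintegral_mul _ (measurable_gaussianPDF 0 v) (by fun_prop)]
  have e : ∀ s, (gaussianPDF 0 v * fun s => ENNReal.ofReal (Real.exp (L * s ^ 2 / 2))) s
      = ENNReal.ofReal (√(L / Real.pi) * Real.exp (-(L / 2) * s ^ 2)) := fun s => by
    rw [Pi.mul_apply, gaussianPDF, ← ENNReal.ofReal_mul (gaussianPDFReal_nonneg 0 v s), hpt]
  simp only [e]
  rw [← ofReal_integral_eq_lintegral_ofReal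
    ((integrable_exp_neg_mul_sq (by positivity)).const_mul _)
    (ae_of_all _ fun s => by positivity), integral_const_mul, integral_gaussian,
    ← Real.sqrt_mul (by positivity)]
  congr 2
  have := Real.pi_pos
  field_simp

variable {Ω : Type*} [MeasurableSpace Ω] {μ : Measure Ω} [IsProbabilityMeasure μ]

/-- The square of a sub-Gaussian variable has exponential moments. -/
lemma lintegral_exp_sq_le {Y : Ω → ℝ} {c : ℝ≥0} {L : ℝ} (hY : HasSubgaussianMGF Y c μ)
    (hm : Measurable Y) (hL : 0 < L) (hc : (c : ℝ) ≤ L) :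
    ∫⁻ ω, ENNReal.ofReal (Real.exp (Y ω ^ 2 / (4 * L))) ∂μ ≤ ENNReal.ofReal √2 := by
  set v : ℝ≥0 := ⟨1 / (2 * L), by positivity⟩ with hv
  -- Linearization of the square by an auxiliary Gaussian variable s of variance 1/(2L): after
  -- exchanging the integrals, only the moment generating function of Y at s is needed.
  have h1 : ∀ y : ℝ, ENNReal.ofReal (Real.exp (y ^ 2 / (4 * L)))
      = ∫⁻ s, ENNReal.ofReal (Real.exp (y * s)) ∂(gaussianReal 0 v) := fun y => by
    rw [← ofReal_integral_eq_lintegral_ofReal (integrable_exp_mul_gaussianReal y)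
      (ae_of_all _ fun s => (Real.exp_pos _).le), integral_exp_gaussianReal]
    congr 2
    have : (v : ℝ) = 1 / (2 * L) := rfl
    rw [this]
    field_simp
    norm_num
  simp only [h1]
  rw [lintegral_lintegral_swap (by
    refine Measurable.aemeasurable ?_
    exact (((hm.comp measurable_fst).mul measurable_snd).exp).ennreal_ofReal),
    ← lintegral_exp_sq_gaussianReal hL]
  refine lintegral_mono fun s => ?_
  have h2 : ∀ ω, Real.exp (Y ω * s) = Real.exp (s * Y ω) := fun ω => by rw [mul_comm]
  simp only [h2]
  rw [← ofReal_integral_eq_lintegral_ofReal (hY.integrable_exp_mul s)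
    (ae_of_all _ fun s => (Real.exp_pos _).le)]
  refine ENNReal.ofReal_le_ofReal ((hY.mgf_le s).trans (Real.exp_le_exp.2 ?_))
  have := mul_le_mul_of_nonneg_right hc (sq_nonneg s)
  linarith

lemma integrable_exp_sq {Y : Ω → ℝ} {c : ℝ≥0} {L : ℝ} (hY : HasSubgaussianMGF Y c μ)
    (hm : Measurable Y) (hL : 0 < L) (hc : (c : ℝ) ≤ L) :
    Integrable (fun ω => Real.exp (Y ω ^ 2 / (4 * L))) μ := by
  refine ⟨by fun_prop, ?_⟩
  rw [hasFiniteIntegral_iff_ofReal (ae_of_all _ fun _ => (Real.exp_pos _).le)]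
  exact (lintegral_exp_sq_le hY hm hL hc).trans_lt ENNReal.ofReal_lt_top

lemma integral_exp_sq_le {Y : Ω → ℝ} {c : ℝ≥0} {L : ℝ} (hY : HasSubgaussianMGF Y c μ)
    (hm : Measurable Y) (hL : 0 < L) (hc : (c : ℝ) ≤ L) :
    ∫ ω, Real.exp (Y ω ^ 2 / (4 * L)) ∂μ ≤ √2 := by
  rw [integral_eq_lintegral_of_nonneg_ae (ae_of_all _ fun _ => (Real.exp_pos _).le)
    (by fun_prop)]
  exact ENNReal.toReal_le_of_le_ofReal (Real.sqrt_nonneg 2) (lintegral_exp_sq_le hY hm hL hc)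

lemma integral_sq_le {Y : Ω → ℝ} {c : ℝ≥0} {L : ℝ} (hY : HasSubgaussianMGF Y c μ)
    (hm : Measurable Y) (hL : 0 < L) (hc : (c : ℝ) ≤ L) : ∫ ω, Y ω ^ 2 ∂μ ≤ 2 * L := by
  have hi := (hY.memLp 2).integrable_sq
  have h1 : ∫ ω, (1 + Y ω ^ 2 / (4 * L)) ∂μ ≤ ∫ ω, Real.exp (Y ω ^ 2 / (4 * L)) ∂μ :=
    integral_mono ((integrable_const 1).add (hi.div_const _)) (integrable_exp_sq hY hm hL hc)
      fun ω => by
        have := Real.add_one_le_exp (Y ω ^ 2 / (4 * L))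
        dsimp only
        linarith
  rw [integral_add (integrable_const 1) (hi.div_const _), integral_const, integral_div] at h1
  have h2 := h1.trans (integral_exp_sq_le hY hm hL hc)
  have h3 : √2 ≤ 3 / 2 := Real.sqrt_le_iff.2 ⟨by norm_num, by norm_num⟩
  simp only [probReal_univ, one_smul] at h2
  have h4 : (∫ ω, Y ω ^ 2 ∂μ) / (4 * L) ≤ 1 / 2 := by linarith
  rw [div_le_iff₀ (by positivity)] at h4
  linarith

/-- The centered square of a sub-Gaussian variable is sub-exponential. -/
lemma mgf_sq_sub_le {Y : Ω → ℝ} {c : ℝ≥0} {L lam : ℝ} (hY : HasSubgaussianMGF Y c μ)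
    (hm : Measurable Y) (hL : 0 < L) (hc : (c : ℝ) ≤ L) (hlam : 8 * L * |lam| ≤ 1) :
    Integrable (fun ω => Real.exp (lam * (Y ω ^ 2 - ∫ ω, Y ω ^ 2 ∂μ))) μ ∧
    mgf (fun ω => Y ω ^ 2 - ∫ ω, Y ω ^ 2 ∂μ) μ lam ≤ Real.exp (300 * L ^ 2 * lam ^ 2) := by
  set m := ∫ ω, Y ω ^ 2 ∂μ with hmdef
  have hm0 : 0 ≤ m := integral_nonneg fun ω => sq_nonneg _
  have hm2 : m ≤ 2 * L := integral_sq_le hY hm hL hc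
  have hi := (hY.memLp 2).integrable_sq
  have hE := integrable_exp_sq hY hm hL hc
  have hZ : ∀ ω, |Y ω ^ 2 - m| ≤ Y ω ^ 2 + 2 * L := fun ω => by
    rw [abs_le]
    constructor <;> linarith [sq_nonneg (Y ω)]
  have hZe : ∀ ω, Real.exp (|Y ω ^ 2 - m| / (4 * L))
      ≤ Real.exp (1 / 2) * Real.exp (Y ω ^ 2 / (4 * L)) := fun ω => by
    rw [← Real.exp_add, Real.exp_le_exp]
    have h1 : 1 / 2 + Y ω ^ 2 / (4 * L) = (Y ω ^ 2 + 2 * L) / (4 * L) := by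
      field_simp; ring
    rw [h1]
    exact div_le_div_of_nonneg_right (hZ ω) (by positivity)
  have hlamZ : ∀ ω, |lam * (Y ω ^ 2 - m)| ≤ |Y ω ^ 2 - m| / (8 * L) := fun ω => by
    rw [abs_mul, le_div_iff₀ (by positivity)]
    have := mul_le_mul_of_nonneg_right hlam (abs_nonneg (Y ω ^ 2 - m))
    linarith
  have hint : Integrable (fun ω => Real.exp (lam * (Y ω ^ 2 - m))) μ := by
    refine (hE.const_mul (Real.exp (1 / 2))).mono' (by fun_prop) (ae_of_all _ fun ω => ?_)
    rw [Real.norm_eq_abs, Real.abs_exp]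
    refine le_trans (Real.exp_le_exp.2 ?_) (hZe ω)
    refine (le_abs_self _).trans ((hlamZ ω).trans ?_)
    exact div_le_div_of_nonneg_left (abs_nonneg _) (by positivity) (by linarith)
  refine ⟨hint, ?_⟩
  -- Second-order expansion with Z = Y² − m. The linear term integrates to zero; Z² is absorbed by
  -- one factor e^{|Z|/(8L)} and the exponential remainder by another, since |lam| ≤ 1/(8L).
  have hpt : ∀ ω, Real.exp (lam * (Y ω ^ 2 - m)) ≤ 1 + lam * (Y ω ^ 2 - m)
      + lam ^ 2 * (128 * L ^ 2 * Real.exp (1 / 2)) * Real.exp (Y ω ^ 2 / (4 * L)) := fun ω => by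
    refine (exp_le_one_add_add_sq_mul_exp _).trans ?_
    set Z := Y ω ^ 2 - m with hZdef
    set q := |Z| / (8 * L) with hq
    have hq0 : 0 ≤ q := by positivity
    have h1 : Real.exp |lam * Z| ≤ Real.exp q := Real.exp_le_exp.2 (hlamZ ω)
    have h2 : q ^ 2 ≤ 2 * Real.exp q := by
      have := Real.quadratic_le_exp_of_nonneg hq0
      linarith
    have h3 : Z ^ 2 = 64 * L ^ 2 * q ^ 2 := by
      rw [hq, div_pow, sq_abs]; field_simp; norm_num
    have h4 : Real.exp q * Real.exp q = Real.exp (|Z| / (4 * L)) := by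
      rw [← Real.exp_add, hq]; congr 1; field_simp; ring
    have h5 : (lam * Z) ^ 2 * Real.exp |lam * Z|
        ≤ lam ^ 2 * (64 * L ^ 2 * (2 * Real.exp q)) * Real.exp q := by
      rw [mul_pow, h3]
      gcongr
    have h6 := mul_le_mul_of_nonneg_left (hZe ω) (by positivity : 0 ≤ lam ^ 2 * (128 * L ^ 2))
    rw [← hZdef, ← h4] at h6
    linarith
  have i0 : Integrable (fun ω => Y ω ^ 2 - m) μ := hi.sub (integrable_const m)
  have i1 : Integrable (fun ω => lam * (Y ω ^ 2 - m)) μ := i0.const_mul lam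
  have i2 : Integrable (fun ω => 1 + lam * (Y ω ^ 2 - m)) μ := (integrable_const 1).add i1
  have i3 := hE.const_mul (lam ^ 2 * (128 * L ^ 2 * Real.exp (1 / 2)))
  have hmono := integral_mono hint (i2.add i3) hpt
  have e1 : ∫ ω, (1 + lam * (Y ω ^ 2 - m)
      + lam ^ 2 * (128 * L ^ 2 * Real.exp (1 / 2)) * Real.exp (Y ω ^ 2 / (4 * L))) ∂μ
      = 1 + lam * (m - m)
        + lam ^ 2 * (128 * L ^ 2 * Real.exp (1 / 2)) * ∫ ω, Real.exp (Y ω ^ 2 / (4 * L)) ∂μ := by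
    rw [integral_add i2 i3, integral_add (integrable_const 1) i1, integral_const_mul,
      integral_const_mul, integral_sub hi (integrable_const m)]
    simp only [integral_const, probReal_univ, one_smul, ← hmdef]
  replace hmono := hmono.trans_eq e1
  simp only [sub_self, mul_zero, add_zero] at hmono
  have h7 := mul_le_mul_of_nonneg_left (integral_exp_sq_le hY hm hL hc)
    (by positivity : 0 ≤ lam ^ 2 * (128 * L ^ 2 * Real.exp (1 / 2)))
  -- The constant 300 is an upper bound for 128 · 1.65 · 1.42.
  have h8 : Real.exp (1 / 2) ≤ 1.65 := by
    have h9 : Real.exp (1 / 2) ^ 2 ≤ 1.65 ^ 2 := by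
      rw [← Real.exp_nat_mul]
      norm_num
      linarith [Real.exp_one_lt_d9]
    exact (pow_le_pow_iff_left₀ (Real.exp_pos _).le (by norm_num) two_ne_zero).1 h9
  have h9 : √2 ≤ 1.42 := Real.sqrt_le_iff.2 ⟨by norm_num, by norm_num⟩
  have h10 : Real.exp (1 / 2) * √2 ≤ 1.65 * 1.42 :=
    mul_le_mul h8 h9 (Real.sqrt_nonneg 2) (by norm_num)
  have h11 := mul_le_mul_of_nonneg_left h10 (by positivity : 0 ≤ lam ^ 2 * (128 * L ^ 2))
  have h12 : 0 ≤ lam ^ 2 * L ^ 2 := by positivity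
  have h13 := Real.add_one_le_exp (300 * L ^ 2 * lam ^ 2)
  rw [mgf]
  linarith

variable {n : ℕ}

/-- Bernstein's inequality for the squares of independent sub-Gaussian variables. -/
lemma bernstein_sq {Y : Fin n → Ω → ℝ} {c : ℝ≥0} {L t : ℝ} (hind : iIndepFun Y μ)
    (hY : ∀ i, HasSubgaussianMGF (Y i) c μ) (hm : ∀ i, Measurable (Y i)) (hL : 0 < L)
    (hc : (c : ℝ) ≤ L) (ht : 0 ≤ t) (htL : t ≤ 75 * L) :
    μ.real {ω | ¬ |∑ i, (Y i ω ^ 2 - ∫ ω, Y i ω ^ 2 ∂μ)| ≤ n * t}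
      ≤ 2 * Real.exp (-(n * t ^ 2 / (1200 * L ^ 2))) := by
  set Z : Fin n → Ω → ℝ := fun i ω => Y i ω ^ 2 - ∫ ω, Y i ω ^ 2 ∂μ with hZ
  have hZm : ∀ i, Measurable (Z i) := fun i => ((hm i).pow_const 2).sub_const _
  have hZI : iIndepFun Z μ := hind.comp (fun i y => y ^ 2 - ∫ ω, Y i ω ^ 2 ∂μ) fun i => by fun_prop
  have hsum : ∀ lam : ℝ, 8 * L * |lam| ≤ 1 →
      Integrable (fun ω => Real.exp (lam * (∑ i, Z i) ω)) μ ∧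
      mgf (∑ i, Z i) μ lam ≤ Real.exp (n * (300 * L ^ 2 * lam ^ 2)) := fun lam hlam => by
    have h1 := fun i => mgf_sq_sub_le (hY i) (hm i) hL hc hlam
    refine ⟨hZI.integrable_exp_mul_sum hZm fun i _ => (h1 i).1, ?_⟩
    rw [hZI.mgf_sum hZm]
    refine (Finset.prod_le_prod (fun i _ => mgf_nonneg) fun i _ => (h1 i).2).trans (le_of_eq ?_)
    rw [Finset.prod_const, Finset.card_univ, Fintype.card_fin, Real.exp_nat_mul]
  -- The minimizer of −lam·t + 300L²lam²; the restriction t ≤ 75L keeps it in the admissible range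
  -- 8L·lam ≤ 1.
  set lam := t / (600 * L ^ 2) with hlam
  have hlam0 : 0 ≤ lam := by positivity
  have hlam8 : 8 * L * |lam| ≤ 1 := by
    rw [abs_of_nonneg hlam0, hlam, mul_div_assoc', div_le_one (by positivity)]
    have := mul_le_mul_of_nonneg_left htL (by positivity : 0 ≤ 8 * L)
    linarith
  have hval : -lam * (n * t) + n * (300 * L ^ 2 * lam ^ 2) = -(n * t ^ 2 / (1200 * L ^ 2)) := by
    rw [hlam]; field_simp; ring
  have up := measure_ge_le_exp_mul_mgf (μ := μ) (n * t) hlam0 (hsum lam hlam8).1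
  have lo := measure_le_le_exp_mul_mgf (μ := μ) (X := ∑ i, Z i) (t := -lam) (-(n * t)) (by linarith)
    (hsum (-lam) (by rwa [abs_neg])).1
  have up' := up.trans (mul_le_mul_of_nonneg_left (hsum lam hlam8).2 (Real.exp_pos _).le)
  have lo' := lo.trans (mul_le_mul_of_nonneg_left (hsum (-lam) (by rwa [abs_neg])).2
    (Real.exp_pos _).le)
  rw [← Real.exp_add] at up' lo'
  rw [hval] at up'
  rw [neg_sq, show -(-lam) * -(↑n * t) = -lam * (n * t) by ring, hval] at lo'
  have hsub : {ω | ¬ |∑ i, (Y i ω ^ 2 - ∫ ω, Y i ω ^ 2 ∂μ)| ≤ n * t}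
      ⊆ {ω | n * t ≤ (∑ i, Z i) ω} ∪ {ω | (∑ i, Z i) ω ≤ -(n * t)} := by
    intro ω hω
    rw [Set.mem_ofPred_eq, not_le] at hω
    rw [Set.mem_union, Set.mem_ofPred_eq, Set.mem_ofPred_eq, Finset.sum_apply]
    rcases lt_abs.1 hω with h | h
    · exact Or.inl h.le
    · exact Or.inr (by linarith)
  have h := (measureReal_mono hsub (measure_ne_top μ _)).trans (measureReal_union_le _ _)
  linarith

/-- A large deviation bound for sums of squares of sub-Gaussian variables. -/
lemma sum_sq_tail {Y : Fin n → Ω → ℝ} {c : ℝ≥0} {L a : ℝ} (hind : iIndepFun Y μ)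
    (hY : ∀ i, HasSubgaussianMGF (Y i) c μ) (hm : ∀ i, Measurable (Y i)) (hL : 0 < L)
    (hc : (c : ℝ) ≤ L) :
    μ.real {ω | ¬ ∑ i, Y i ω ^ 2 ≤ n * (4 * L * (1 + a))} ≤ Real.exp (-(n * a)) := by
  set Z : Fin n → Ω → ℝ := fun i ω => Y i ω ^ 2 with hZ
  have hZm : ∀ i, Measurable (Z i) := fun i => (hm i).pow_const 2
  have hZI : iIndepFun Z μ := hind.comp (fun i y => y ^ 2) fun i => by fun_prop
  set lam := 1 / (4 * L) with hlam
  have e1 : ∀ i ω, lam * Z i ω = Y i ω ^ 2 / (4 * L) := fun i ω => by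
    simp only [hZ, hlam]; ring
  have hint : ∀ i, Integrable (fun ω => Real.exp (lam * Z i ω)) μ := fun i => by
    simp only [e1]; exact integrable_exp_sq (hY i) (hm i) hL hc
  have hmgf : mgf (∑ i, Z i) μ lam ≤ Real.exp n := by
    rw [hZI.mgf_sum hZm]
    have h1 : ∀ i, mgf (Z i) μ lam ≤ Real.exp 1 := fun i => by
      simp only [mgf, e1]
      refine (integral_exp_sq_le (hY i) (hm i) hL hc).trans ?_
      have h9 : √2 ≤ 2 := Real.sqrt_le_iff.2 ⟨by norm_num, by norm_num⟩
      linarith [Real.add_one_le_exp (1 : ℝ)]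
    refine (Finset.prod_le_prod (fun i _ => mgf_nonneg) fun i _ => h1 i).trans (le_of_eq ?_)
    rw [Finset.prod_const, Finset.card_univ, Fintype.card_fin, ← Real.exp_nat_mul, mul_one]
  have up := measure_ge_le_exp_mul_mgf (μ := μ) (n * (4 * L * (1 + a)))
    (by positivity : 0 ≤ lam) (hZI.integrable_exp_mul_sum hZm fun i (_ : i ∈ Finset.univ) => hint i)
  have up' := up.trans (mul_le_mul_of_nonneg_left hmgf (Real.exp_pos _).le)
  rw [← Real.exp_add] at up'
  have hval : -lam * (n * (4 * L * (1 + a))) + n = -(n * a) := by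
    rw [hlam]; field_simp; ring
  rw [hval] at up'
  refine (measureReal_mono (fun ω hω => ?_) (measure_ne_top μ _)).trans up'
  rw [Set.mem_ofPred_eq, not_le] at hω
  rw [Set.mem_ofPred_eq, Finset.sum_apply]
  exact hω.le

end Squares

/-! ### Positive definite matrices -/

section Matrices

variable {p : ℕ}

/-- Shifting by scalar matrices moves the spectrum to the nonnegative half-line, where it
characterizes positive semidefiniteness. -/
lemma spectral_bounds {S : Matrix (Fin p) (Fin p) ℝ} {a b : ℝ} (hS : Sᵀ = S)
    (h : ∀ r ∈ spectrum ℝ S, a ≤ r ∧ r ≤ b) (v : Fin p → ℝ) :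
    a * sqNorm v ≤ v ⬝ᵥ (S *ᵥ v) ∧ v ⬝ᵥ (S *ᵥ v) ≤ b * sqNorm v := by
  have hS' : S.IsHermitian := by
    rw [Matrix.IsHermitian, Matrix.conjTranspose_eq_transpose_of_trivial, hS]
  have hsc : ∀ r : ℝ, (algebraMap ℝ (Matrix (Fin p) (Fin p) ℝ) r).IsHermitian := fun r => by
    rw [Matrix.IsHermitian, Matrix.conjTranspose_eq_transpose_of_trivial,
      Matrix.algebraMap_eq_diagonal, Matrix.diagonal_transpose]
  have hmul : ∀ r : ℝ, v ⬝ᵥ (algebraMap ℝ (Matrix (Fin p) (Fin p) ℝ) r *ᵥ v) = r * sqNorm v :=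
    fun r => by
      rw [Algebra.algebraMap_eq_smul_one, Matrix.smul_mulVec, Matrix.one_mulVec, dotProduct_smul,
        smul_eq_mul, sqNorm_eq_dotProduct]
  constructor
  · have h1 : (S - algebraMap ℝ _ a).PosSemidef := by
      rw [Matrix.posSemidef_iff_isHermitian_and_spectrum_nonneg]
      refine ⟨hS'.sub (hsc a), fun r hr => ?_⟩
      rw [← spectrum.sub_singleton_eq, Set.sub_singleton] at hr
      obtain ⟨q, hq, rfl⟩ := hr
      exact sub_nonneg.2 (h q hq).1
    have h2 := h1.dotProduct_mulVec_nonneg v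
    rw [star_trivial, Matrix.sub_mulVec, dotProduct_sub, hmul] at h2
    linarith
  · have h1 : (algebraMap ℝ _ b - S).PosSemidef := by
      rw [Matrix.posSemidef_iff_isHermitian_and_spectrum_nonneg]
      refine ⟨(hsc b).sub hS', fun r hr => ?_⟩
      rw [← spectrum.singleton_sub_eq, Set.singleton_sub] at hr
      obtain ⟨q, hq, rfl⟩ := hr
      exact sub_nonneg.2 (h q hq).2
    have h2 := h1.dotProduct_mulVec_nonneg v
    rw [star_trivial, Matrix.sub_mulVec, dotProduct_sub, hmul] at h2
    linarith

lemma sq_le_sqNorm (v : Fin p → ℝ) (j : Fin p) : v j ^ 2 ≤ sqNorm v :=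
  Finset.single_le_sum (f := fun j => v j ^ 2) (fun _ _ => sq_nonneg _) (Finset.mem_univ j)

lemma sqNorm_single (j : Fin p) : sqNorm (Pi.single j 1 : Fin p → ℝ) = 1 := by
  rw [sqNorm_eq_dotProduct, single_one_dotProduct, Pi.single_eq_same]

/-- The rows of the inverse of a positive definite matrix. -/
lemma exists_inverse_row {A : Matrix (Fin p) (Fin p) ℝ} {κ : ℝ} (hκ : 0 < κ)
    (h : ∀ v : Fin p → ℝ, κ * sqNorm v ≤ v ⬝ᵥ (A *ᵥ v)) (j : Fin p) :
    ∃ θ : Fin p → ℝ, A *ᵥ θ = Pi.single j 1 ∧ sqNorm θ ≤ 1 / κ ^ 2 ∧ θ ⬝ᵥ (A *ᵥ θ) ≤ 1 / κ := by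
  have hinj : Function.Injective A.mulVecLin := by
    rw [← LinearMap.ker_eq_bot, LinearMap.ker_eq_bot']
    intro v hv
    have h1 := h v
    rw [show A *ᵥ v = 0 from hv, dotProduct_zero] at h1
    have h2 := sqNorm_nonneg v
    have h3 : sqNorm v ≤ 0 := by
      by_contra hne
      have := mul_pos hκ (not_le.1 hne)
      linarith
    exact sqNorm_eq_zero.1 (le_antisymm h3 h2)
  obtain ⟨θ, hθ⟩ := (LinearMap.injective_iff_surjective.1 hinj) (Pi.single j 1)
  have hθ' : A *ᵥ θ = Pi.single j 1 := hθ
  have h1 := h θ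
  rw [hθ', dotProduct_single_one] at h1
  have h2 := sq_le_sqNorm θ j
  have h3 := mul_le_mul_of_nonneg_left h2 hκ.le
  -- From κθ_j² ≤ κ‖θ‖² ≤ θᵀAθ = θ_j.
  have h5 : θ j ≤ 1 / κ := by
    rw [le_div_iff₀ hκ]
    by_contra hne
    have h6 : 0 < θ j := by
      by_contra h7
      have := mul_nonpos_of_nonpos_of_nonneg (not_lt.1 h7) hκ.le
      linarith
    have h7 := mul_lt_mul_of_pos_left (not_le.1 hne) h6
    linarith
  refine ⟨θ, hθ', ?_, ?_⟩
  · rw [le_div_iff₀ (by positivity)]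
    have h6 := mul_le_mul_of_nonneg_right (h1.trans h5) hκ.le
    rw [div_mul_cancel₀ _ hκ.ne'] at h6
    linarith
  · rw [hθ', dotProduct_single_one]
    exact h5

lemma dotProduct_mulVec_single (D : Matrix (Fin p) (Fin p) ℝ) (i j : Fin p) :
    (Pi.single i 1 : Fin p → ℝ) ⬝ᵥ (D *ᵥ Pi.single j 1) = D i j := by
  rw [single_one_dotProduct, Matrix.mulVec_single_one, Matrix.col_apply]

lemma abs_quadForm_le {D : Matrix (Fin p) (Fin p) ℝ} {t : ℝ} (h : ∀ i j, |D i j| ≤ t)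
    (v : Fin p → ℝ) : |v ⬝ᵥ (D *ᵥ v)| ≤ t * l1 v ^ 2 := by
  have h1 : ∀ i, |(D *ᵥ v) i| ≤ t * l1 v := fun i => abs_dotProduct_le (h i)
  rw [dotProduct_comm]
  refine (abs_dotProduct_le h1).trans (le_of_eq (by ring))

lemma polarization {D : Matrix (Fin p) (Fin p) ℝ} (hD : Dᵀ = D) (u v : Fin p → ℝ) :
    4 * (u ⬝ᵥ (D *ᵥ v)) = (u + v) ⬝ᵥ (D *ᵥ (u + v)) - (u - v) ⬝ᵥ (D *ᵥ (u - v)) := by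
  have h1 : v ⬝ᵥ (D *ᵥ u) = u ⬝ᵥ (D *ᵥ v) := by
    rw [Matrix.dotProduct_mulVec, ← Matrix.mulVec_transpose, hD, dotProduct_comm]
  simp only [Matrix.mulVec_add, Matrix.mulVec_sub, dotProduct_add, add_dotProduct, dotProduct_sub,
    sub_dotProduct, h1]
  ring

lemma sampleCov_transpose {n : ℕ} (X : Matrix (Fin n) (Fin p) ℝ) :
    (sampleCov X)ᵀ = sampleCov X := by
  rw [sampleCov, Matrix.transpose_smul, Matrix.transpose_mul, Matrix.transpose_transpose]

end Matrices

/-! ### Sub-Gaussian designs -/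

section Designs

variable {Ω : Type*} [MeasurableSpace Ω] {μ : Measure Ω} [IsProbabilityMeasure μ] {n p : ℕ}
  {x : Ω → Fin n → Fin p → ℝ} {S : Matrix (Fin p) (Fin p) ℝ} {L : ℝ≥0} {c : ℝ}

lemma SubGaussianDesign.measurable_entry (hx : SubGaussianDesign μ x S L c) (i : Fin n)
    (j : Fin p) : Measurable fun ω => x ω i j :=
  (measurable_pi_apply j).comp ((measurable_pi_apply i).comp hx.measurable)

lemma SubGaussianDesign.measurable_dotProduct (hx : SubGaussianDesign μ x S L c) (i : Fin n)
    (v : Fin p → ℝ) : Measurable fun ω => x ω i ⬝ᵥ v := by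
  unfold dotProduct
  exact Finset.measurable_sum _ fun j _ => (hx.measurable_entry i j).mul_const _

lemma SubGaussianDesign.hasSubgaussianMGF (hx : SubGaussianDesign μ x S L c) (i : Fin n)
    (v : Fin p → ℝ) {d : ℝ≥0} (hd : L * sqNorm v ≤ d) :
    HasSubgaussianMGF (fun ω => x ω i ⬝ᵥ v) d μ := by
  rcases (sqNorm_nonneg v).eq_or_lt with h0 | h0
  · rw [sqNorm_eq_zero.1 h0.symm]
    simp only [dotProduct_zero]
    exact ⟨fun t => by simp, fun t => by
      simp only [mgf_const, mul_zero, Real.exp_zero]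
      exact Real.one_le_exp (by positivity)⟩
  · set r := √(sqNorm v) with hr
    have hr0 : 0 < r := Real.sqrt_pos.2 h0
    have hu : sqNorm (r⁻¹ • v) = 1 := by
      rw [sqNorm_smul, inv_pow, hr, Real.sq_sqrt h0.le, inv_mul_cancel₀ h0.ne']
    have h1 := hx.subGaussian i _ hu
    have e1 : ∀ t ω, t * (x ω i ⬝ᵥ v) = (t * r) * (x ω i ⬝ᵥ (r⁻¹ • v)) := fun t ω => by
      rw [dotProduct_smul, smul_eq_mul]
      field_simp
    refine ⟨fun t => ?_, fun t => ?_⟩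
    · simp only [e1]
      exact h1.integrable_exp_mul (t * r)
    · have h2 := h1.mgf_le (t * r)
      simp only [mgf, e1] at h2 ⊢
      refine h2.trans (Real.exp_le_exp.2 ?_)
      rw [mul_pow, hr, Real.sq_sqrt h0.le]
      have := mul_le_mul_of_nonneg_right hd (sq_nonneg t)
      linarith

lemma SubGaussianDesign.memLp_entry (hx : SubGaussianDesign μ x S L c) (i : Fin n) (j : Fin p) :
    MemLp (fun ω => x ω i j) 2 μ := by
  have h := (hx.hasSubgaussianMGF i (Pi.single j 1) (d := L) (by rw [sqNorm_single, mul_one])).memLp 2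
  simp only [dotProduct_single_one] at h
  exact_mod_cast h

lemma SubGaussianDesign.integral_mul (hx : SubGaussianDesign μ x S L c) (i : Fin n) (j l : Fin p) :
    ∫ ω, x ω i j * x ω i l ∂μ = S j l := by
  have h := covariance_eq_sub (hx.memLp_entry i j) (hx.memLp_entry i l)
  rw [hx.covariance_eq, hx.mean_zero, hx.mean_zero, mul_zero, sub_zero] at h
  exact h.symm

lemma SubGaussianDesign.integral_sq (hx : SubGaussianDesign μ x S L c) (i : Fin n)
    (v : Fin p → ℝ) : ∫ ω, (x ω i ⬝ᵥ v) ^ 2 ∂μ = v ⬝ᵥ (S *ᵥ v) := by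
  have e1 : ∀ ω, (x ω i ⬝ᵥ v) ^ 2 = ∑ j, ∑ l, v j * v l * (x ω i j * x ω i l) := fun ω => by
    rw [sq, dotProduct, Finset.sum_mul_sum]
    exact Finset.sum_congr rfl fun j _ => Finset.sum_congr rfl fun l _ => by ring
  have hi : ∀ j l, Integrable (fun ω => v j * v l * (x ω i j * x ω i l)) μ := fun j l =>
    ((hx.memLp_entry i j).integrable_mul (hx.memLp_entry i l)).const_mul _
  simp only [e1]
  rw [integral_finsetSum _ fun j _ => integrable_finsetSum _ fun l _ => hi j l]
  simp only [dotProduct, Matrix.mulVec, Finset.mul_sum]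
  refine Finset.sum_congr rfl fun j _ => ?_
  rw [integral_finsetSum _ fun l _ => hi j l]
  refine Finset.sum_congr rfl fun l _ => ?_
  rw [integral_const_mul, hx.integral_mul]
  ring

lemma SubGaussianDesign.transpose_eq (hx : SubGaussianDesign μ x S L c) (hn : 0 < n) :
    Sᵀ = S := by
  ext j l
  rw [Matrix.transpose_apply, ← hx.covariance_eq ⟨0, hn⟩, ← hx.covariance_eq ⟨0, hn⟩,
    covariance_comm]

lemma SubGaussianDesign.quadForm_bounds (hx : SubGaussianDesign μ x S L c) (hn : 0 < n)
    (v : Fin p → ℝ) : 1 / c * sqNorm v ≤ v ⬝ᵥ (S *ᵥ v) ∧ v ⬝ᵥ (S *ᵥ v) ≤ c * sqNorm v :=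
  spectral_bounds (hx.transpose_eq hn) hx.eigenvalues_mem v

lemma SubGaussianDesign.iIndepFun_dotProduct (hx : SubGaussianDesign μ x S L c) (v : Fin p → ℝ) :
    iIndepFun (fun i ω => x ω i ⬝ᵥ v) μ :=
  hx.indep.comp (fun _ y => y ⬝ᵥ v) fun i => by
    unfold dotProduct
    exact Finset.measurable_sum _ fun j _ => (measurable_pi_apply j).mul_const _

lemma quadForm_sampleCov_of {y : Fin n → Fin p → ℝ} (v : Fin p → ℝ) :
    v ⬝ᵥ (sampleCov (Matrix.of y) *ᵥ v) = 1 / (n : ℝ) * ∑ i, (y i ⬝ᵥ v) ^ 2 := by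
  rw [quadForm_sampleCov]
  rfl

/-- Concentration of the quadratic form of the sample covariance matrix. -/
lemma SubGaussianDesign.quadForm_tail (hx : SubGaussianDesign μ x S L c) (hn : 0 < n)
    {v : Fin p → ℝ} {r t : ℝ} (hr : 0 < r) (hv : sqNorm v ≤ r) (ht : 0 ≤ t)
    (htr : t ≤ 75 * ((L + 1) * r)) :
    μ.real {ω | ¬ |v ⬝ᵥ ((sampleCov (Matrix.of (x ω)) - S) *ᵥ v)| ≤ t}
      ≤ 2 * Real.exp (-(n * t ^ 2 / (1200 * ((L + 1) * r) ^ 2))) := by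
  have hn' : (0 : ℝ) < n := by exact_mod_cast hn
  have hLr : (L : ℝ) * sqNorm v ≤ (L + 1) * r :=
    mul_le_mul (by linarith) hv (sqNorm_nonneg v) (by positivity)
  have h := bernstein_sq (c := ⟨(L + 1) * r, by positivity⟩) (L := (L + 1) * r) (t := t)
    (hx.iIndepFun_dotProduct v) (fun i => hx.hasSubgaussianMGF i v hLr)
    (fun i => hx.measurable_dotProduct i v) (by positivity) le_rfl ht htr
  refine (measureReal_mono (fun ω hω => ?_) (measure_ne_top μ _)).trans h
  rw [Set.mem_ofPred_eq] at hω ⊢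
  refine fun hh => hω ?_
  simp only [hx.integral_sq] at hh
  rw [Finset.sum_sub_distrib, Finset.sum_const, Finset.card_univ, Fintype.card_fin,
    nsmul_eq_mul] at hh
  rw [Matrix.sub_mulVec, dotProduct_sub, quadForm_sampleCov_of]
  have e1 : 1 / (n : ℝ) * ∑ i, (x ω i ⬝ᵥ v) ^ 2 - v ⬝ᵥ (S *ᵥ v)
      = 1 / (n : ℝ) * (∑ i, (x ω i ⬝ᵥ v) ^ 2 - n * (v ⬝ᵥ (S *ᵥ v))) := by
    field_simp
  rw [e1, abs_mul, abs_of_pos (by positivity), one_div_mul_eq_div, div_le_iff₀ hn']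
  linarith

/-- Concentration of the bilinear form of the sample covariance matrix. -/
lemma SubGaussianDesign.bilinForm_tail (hx : SubGaussianDesign μ x S L c) (hn : 0 < n)
    {u v : Fin p → ℝ} {r t : ℝ} (hr : 0 < r) (hu : sqNorm u ≤ r) (hv : sqNorm v ≤ r) (ht : 0 ≤ t)
    (htr : t ≤ 75 * ((L + 1) * r)) :
    μ.real {ω | ¬ |u ⬝ᵥ ((sampleCov (Matrix.of (x ω)) - S) *ᵥ v)| ≤ t}
      ≤ 4 * Real.exp (-(n * t ^ 2 / (4800 * ((L + 1) * r) ^ 2))) := by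
  have h0 : (0 : ℝ) < (L + 1) * r := by positivity
  have hp : sqNorm (u + v) ≤ 4 * r := (sqNorm_add_le u v).trans (by linarith)
  have hm : sqNorm (u - v) ≤ 4 * r := by
    have := sqNorm_add_le u (-v)
    rw [sqNorm_neg, ← sub_eq_add_neg] at this
    linarith
  -- By polarization, four times the bilinear form is a difference of quadratic forms at u ± v, each
  -- allowed to deviate by 2t.
  have h1 := hx.quadForm_tail hn (by positivity) hp (t := 2 * t) (by positivity) (by linarith)
  have h2 := hx.quadForm_tail hn (by positivity) hm (t := 2 * t) (by positivity) (by linarith)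
  have h3 := measureReal_not_and_le h1 h2
  have e1 : (n : ℝ) * (2 * t) ^ 2 / (1200 * ((L + 1) * (4 * r)) ^ 2)
      = n * t ^ 2 / (4800 * ((L + 1) * r) ^ 2) := by
    field_simp; ring
  rw [e1] at h3
  refine (measureReal_mono (fun ω hω => ?_) (measure_ne_top μ _)).trans (h3.trans (by linarith))
  rw [Set.mem_ofPred_eq] at hω ⊢
  rintro ⟨g1, g2⟩
  refine hω ?_
  have hD : (sampleCov (Matrix.of (x ω)) - S)ᵀ = sampleCov (Matrix.of (x ω)) - S := by
    rw [Matrix.transpose_sub, sampleCov_transpose, hx.transpose_eq hn]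
  have hpol := polarization hD u v
  rw [abs_le] at g1 g2 ⊢
  constructor <;> linarith [g1.1, g1.2, g2.1, g2.2]

/-- Large deviations of the diagonal entries of the sample covariance matrix. -/
lemma SubGaussianDesign.diag_tail (hx : SubGaussianDesign μ x S L c) (hn : 0 < n) (j : Fin p)
    (a : ℝ) : μ.real {ω | ¬ sampleCov (Matrix.of (x ω)) j j ≤ 4 * (L + 1) * (1 + a)}
      ≤ Real.exp (-(n * a)) := by
  have hn' : (0 : ℝ) < n := by exact_mod_cast hn
  have h := sum_sq_tail (c := ⟨(L : ℝ) + 1, by positivity⟩) (L := L + 1) (a := a)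
    (hx.iIndepFun_dotProduct (Pi.single j 1)) (fun i => hx.hasSubgaussianMGF i _ (by
      rw [sqNorm_single, mul_one]; exact le_add_of_nonneg_right zero_le_one))
    (fun i => hx.measurable_dotProduct i _) (by positivity) le_rfl
  refine (measureReal_mono (fun ω hω => ?_) (measure_ne_top μ _)).trans h
  rw [Set.mem_ofPred_eq] at hω ⊢
  refine fun hh => hω ?_
  rw [← dotProduct_mulVec_single (sampleCov (Matrix.of (x ω))) j j, quadForm_sampleCov_of,
    one_div_mul_eq_div, div_le_iff₀ hn']
  linarith

end Designs

/-! ### Deviation of the source covariances -/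

/-- `sampleCov X` is entrywise `t`-close to `S`, also along the rows of the inverse of `S`. -/
def CovClose {n p : ℕ} (X : Matrix (Fin n) (Fin p) ℝ) (S : Matrix (Fin p) (Fin p) ℝ)
    (c t : ℝ) : Prop :=
  (∀ i j, |(sampleCov X - S) i j| ≤ t) ∧ ∀ j, ∃ θ : Fin p → ℝ, S *ᵥ θ = Pi.single j 1 ∧
    θ ⬝ᵥ (S *ᵥ θ) ≤ c ∧ (∀ i, |((sampleCov X - S) *ᵥ θ) i| ≤ t) ∧
    |θ ⬝ᵥ ((sampleCov X - S) *ᵥ θ)| ≤ t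

section

variable {n p : ℕ} {X : Matrix (Fin n) (Fin p) ℝ} {S : Matrix (Fin p) (Fin p) ℝ} {c t : ℝ}

lemma CovClose.lower (h : CovClose X S c t)
    (hS : ∀ v : Fin p → ℝ, 1 / c * sqNorm v ≤ v ⬝ᵥ (S *ᵥ v)) (v : Fin p → ℝ) :
    1 / c * sqNorm v - t * l1 v ^ 2 ≤ 1 / (n : ℝ) * sqNorm (X *ᵥ v) := by
  have h1 := abs_quadForm_le h.1 v
  rw [Matrix.sub_mulVec, dotProduct_sub, quadForm_sampleCov] at h1
  have h2 := (abs_le.1 h1).1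
  linarith [hS v]

lemma CovClose.diag_le (h : CovClose X S c t)
    (hS : ∀ v : Fin p → ℝ, v ⬝ᵥ (S *ᵥ v) ≤ c * sqNorm v) (j : Fin p) :
    sampleCov X j j ≤ c + t := by
  have h1 := (abs_le.1 (h.1 j j)).2
  have h2 := hS (Pi.single j 1)
  rw [dotProduct_mulVec_single, sqNorm_single] at h2
  rw [Matrix.sub_apply] at h1
  linarith

/-- The row of the population precision matrix is strictly feasible and has a bounded objective. -/
lemma CovClose.exists_feasible (h : CovClose X S c t) {mu : ℝ} (ht : t < mu) (j : Fin p) :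
    ∃ θ : Fin p → ℝ, (∀ i, |(sampleCov X *ᵥ θ) i - (Pi.single j 1 : Fin p → ℝ) i| < mu) ∧
      θ ⬝ᵥ (sampleCov X *ᵥ θ) ≤ c + t := by
  obtain ⟨θ, h1, h2, h3, h4⟩ := h.2 j
  refine ⟨θ, fun i => ?_, ?_⟩
  · have := h3 i
    rw [Matrix.sub_mulVec, h1, Pi.sub_apply] at this
    exact this.trans_lt ht
  · rw [Matrix.sub_mulVec, dotProduct_sub] at h4
    have := (abs_le.1 h4).2
    linarith

/-- Since ‖v‖₁² ≤ p‖v‖₂², an entrywise deviation below 1/(2cp) leaves a full, unrestricted,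
eigenvalue bound. -/
lemma CovClose.lower_of_mul_le (h : CovClose X S c t) (ht0 : 0 ≤ t)
    (hS : ∀ v : Fin p → ℝ, 1 / c * sqNorm v ≤ v ⬝ᵥ (S *ᵥ v)) (ht : p * t ≤ 1 / (2 * c))
    (v : Fin p → ℝ) : 1 / (2 * c) * sqNorm v ≤ 1 / (n : ℝ) * sqNorm (X *ᵥ v) := by
  have h1 := h.lower hS v
  have h2 := mul_le_mul_of_nonneg_left (sq_l1_le v) ht0
  have h3 := mul_le_mul_of_nonneg_right ht (sqNorm_nonneg v)
  have h4 : 1 / c = 2 * (1 / (2 * c)) := by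
    rw [one_div, one_div, mul_inv]; ring
  rw [h4] at h1
  linarith

end

/-- For an invertible sample covariance its own inverse satisfies the constraint exactly, so `mu`
may be smaller than the deviation from the population covariance. -/
lemma exists_feasible_of_lower {n p : ℕ} {X : Matrix (Fin n) (Fin p) ℝ} {κ mu : ℝ} (hκ : 0 < κ)
    (hmu : 0 < mu) (h : ∀ v : Fin p → ℝ, κ * sqNorm v ≤ 1 / (n : ℝ) * sqNorm (X *ᵥ v))
    (j : Fin p) :
    ∃ θ : Fin p → ℝ, (∀ i, |(sampleCov X *ᵥ θ) i - (Pi.single j 1 : Fin p → ℝ) i| < mu) ∧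
      θ ⬝ᵥ (sampleCov X *ᵥ θ) ≤ 1 / κ := by
  obtain ⟨θ, h1, -, h3⟩ := exists_inverse_row (A := sampleCov X) hκ
    (fun v => by rw [quadForm_sampleCov]; exact h v) j
  refine ⟨θ, fun i => ?_, h3⟩
  rw [h1, sub_self, abs_zero]
  exact hmu

section

variable {Ω : Type*} [MeasurableSpace Ω] {μ : Measure Ω} [IsProbabilityMeasure μ] {K n p : ℕ}
  {L : ℝ≥0} {c : ℝ}

lemma SubGaussianDesign.one_le {x : Ω → Fin n → Fin p → ℝ} {S : Matrix (Fin p) (Fin p) ℝ}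
    (hx : SubGaussianDesign μ x S L c) (hc : 0 < c) (hn : 0 < n) (hp : 0 < p) : 1 ≤ c := by
  have h := hx.quadForm_bounds hn (Pi.single ⟨0, hp⟩ 1)
  rw [sqNorm_single, mul_one, mul_one] at h
  have h1 := h.1.trans h.2
  rw [div_le_iff₀ hc] at h1
  by_contra hne
  have := mul_lt_mul_of_pos_right (not_le.1 hne) hc
  linarith

/-- Each required deviation is a bilinear form in basis vectors and rows of the precision matrix,
all of squared norm at most c². The choice of M gives each a failure probability of order (pK)⁻⁴,
enough for a union over K p² triples. -/
theorem covClose_tail {x : Fin K → Ω → Fin n → Fin p → ℝ}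
    {S : Fin K → Matrix (Fin p) (Fin p) ℝ} (hx : ∀ k, SubGaussianDesign μ (x k) (S k) L c)
    (hc : 1 ≤ c) (hK : 1 ≤ K) (hp : 1 ≤ p) (hn : 0 < n) {M : ℝ} (hM : 0 ≤ M)
    (hMb : 19200 * ((L + 1) * c ^ 2) ^ 2 ≤ M ^ 2)
    (ht : M * √(Real.log (p * K) / n) ≤ 75 * ((L + 1) * c ^ 2)) :
    μ.real {ω | ¬ ∀ k, CovClose (Matrix.of (x k ω)) (S k) c (M * √(Real.log (p * K) / n))}
      ≤ 12 / p := by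
  have hc0 : 0 < c := by linarith
  have hK' : (1 : ℝ) ≤ K := by exact_mod_cast hK
  have hp' : (1 : ℝ) ≤ p := by exact_mod_cast hp
  have hn' : (0 : ℝ) < n := by exact_mod_cast hn
  have hpK : 1 ≤ (p : ℝ) * K := one_le_mul_of_one_le_of_one_le hp' hK'
  set t := M * √(Real.log (p * K) / n) with htdef
  have ht0 : 0 ≤ t := by positivity
  have hrow : ∀ (k : Fin K) (j : Fin p), ∃ θ : Fin p → ℝ, S k *ᵥ θ = Pi.single j 1 ∧
      sqNorm θ ≤ c ^ 2 ∧ θ ⬝ᵥ (S k *ᵥ θ) ≤ c := by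
    intro k j
    have := exists_inverse_row (A := S k) (κ := 1 / c) (by positivity)
      (fun v => ((hx k).quadForm_bounds hn v).1) j
    simpa [one_div, inv_pow] using this
  choose θ hθ1 hθ2 hθ3 using hrow
  have he : ∀ j : Fin p, sqNorm (Pi.single j 1 : Fin p → ℝ) ≤ c ^ 2 := fun j => by
    rw [sqNorm_single]; exact one_le_pow₀ hc
  have hexp : Real.exp (-(n * t ^ 2 / (4800 * ((L + 1) * c ^ 2) ^ 2))) ≤ 1 / (p * K : ℝ) ^ 4 := by
    rw [← exp_neg_mul_log (by linarith : (0 : ℝ) < p * K) 4]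
    refine Real.exp_le_exp.2 (neg_le_neg ?_)
    have hl : 0 ≤ Real.log (p * K) := Real.log_nonneg hpK
    have e0 : t ^ 2 = M ^ 2 * (Real.log (p * K) / n) := by
      rw [htdef, mul_pow, Real.sq_sqrt (by positivity)]
    rw [le_div_iff₀ (by positivity), e0]
    have e1 : (n : ℝ) * (M ^ 2 * (Real.log (p * K) / n)) = M ^ 2 * Real.log (p * K) := by
      field_simp
    rw [e1]
    have := mul_le_mul_of_nonneg_right hMb hl
    push_cast
    linarith
  let P : Fin K × Fin p × Fin p → Ω → Prop := fun q ω =>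
    |(Pi.single q.2.1 1 : Fin p → ℝ) ⬝ᵥ ((sampleCov (Matrix.of (x q.1 ω)) - S q.1) *ᵥ
      Pi.single q.2.2 1)| ≤ t ∧
    |(Pi.single q.2.1 1 : Fin p → ℝ) ⬝ᵥ ((sampleCov (Matrix.of (x q.1 ω)) - S q.1) *ᵥ
      θ q.1 q.2.2)| ≤ t ∧
    |θ q.1 q.2.2 ⬝ᵥ ((sampleCov (Matrix.of (x q.1 ω)) - S q.1) *ᵥ θ q.1 q.2.2)| ≤ t
  have h1 : ∀ q, μ.real {ω | ¬ P q ω} ≤ 12 * (1 / (p * K : ℝ) ^ 4) := by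
    intro q
    have a1 := (hx q.1).bilinForm_tail hn (by positivity) (he q.2.1) (he q.2.2) ht0 ht
    have a2 := (hx q.1).bilinForm_tail hn (by positivity) (he q.2.1) (hθ2 q.1 q.2.2) ht0 ht
    have a3 := (hx q.1).bilinForm_tail hn (by positivity) (hθ2 q.1 q.2.2) (hθ2 q.1 q.2.2) ht0 ht
    exact (measureReal_not_and_le a1 (measureReal_not_and_le a2 a3)).trans (by linarith)
  have h2 := measureReal_not_forall_le (P := P) h1
  refine (measureReal_mono (fun ω hω => ?_) (measure_ne_top μ _)).trans (h2.trans ?_)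
  · rw [Set.mem_ofPred_eq] at hω ⊢
    intro hP
    refine hω fun k => ⟨fun i j => ?_, fun j => ⟨θ k j, hθ1 k j, hθ3 k j, fun i => ?_, ?_⟩⟩
    · have := (hP (k, i, j)).1
      rwa [dotProduct_mulVec_single] at this
    · have := (hP (k, i, j)).2.1
      rwa [single_one_dotProduct] at this
    · exact (hP (k, j, j)).2.2
  · rw [Fintype.card_prod, Fintype.card_prod, Fintype.card_fin, Fintype.card_fin]
    push_cast
    rw [mul_one_div, mul_div_assoc', div_le_div_iff₀ (by positivity) (by positivity)]
    have e2 : (p : ℝ) * K ≤ (p * K) ^ 4 / p ^ 2 := by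
      rw [le_div_iff₀ (by positivity)]
      have b1 : (1 : ℝ) ≤ p * K ^ 3 := one_le_mul_of_one_le_of_one_le hp' (one_le_pow₀ hK')
      have b2 : (0 : ℝ) ≤ p ^ 3 * K := by positivity
      have := mul_le_mul_of_nonneg_left b1 b2
      linarith
    rw [le_div_iff₀ (by positivity)] at e2
    linarith

end

/-! ### Restricted eigenvalues of the target design -/

section

variable {p : ℕ}

lemma quadForm_add {M : Matrix (Fin p) (Fin p) ℝ} (hM : Mᵀ = M) (u v : Fin p → ℝ) :
    (u + v) ⬝ᵥ (M *ᵥ (u + v)) = u ⬝ᵥ (M *ᵥ u) + 2 * (u ⬝ᵥ (M *ᵥ v)) + v ⬝ᵥ (M *ᵥ v) := by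
  have h1 : v ⬝ᵥ (M *ᵥ u) = u ⬝ᵥ (M *ᵥ v) := by
    rw [Matrix.dotProduct_mulVec, ← Matrix.mulVec_transpose, hM, dotProduct_comm]
  simp only [Matrix.mulVec_add, dotProduct_add, add_dotProduct, h1]
  ring

/-- Maurey's empirical method: a quadratic form that is nonnegative at all sums of `m` points of
a family is almost nonnegative on the convex hull of the family. -/
lemma quadForm_average_nonneg {J : Type*} [Fintype J] {M : Matrix (Fin p) (Fin p) ℝ}
    (hM : Mᵀ = M) {w : J → ℝ} (hw : ∀ j, 0 ≤ w j) (hw1 : ∑ j, w j = 1) (a : J → Fin p → ℝ)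
    (m : ℕ) : ∀ b : Fin p → ℝ,
    (∀ f : Fin m → J, 0 ≤ (b + ∑ i, a (f i)) ⬝ᵥ (M *ᵥ (b + ∑ i, a (f i)))) →
    0 ≤ b ⬝ᵥ (M *ᵥ b) + 2 * m * (b ⬝ᵥ (M *ᵥ ∑ j, w j • a j))
      + m * (m - 1) * ((∑ j, w j • a j) ⬝ᵥ (M *ᵥ ∑ j, w j • a j))
      + m * ∑ j, w j * (a j ⬝ᵥ (M *ᵥ a j)) := by
  induction m with
  | zero =>
    intro b h
    simpa using h Fin.elim0
  | succ m ih =>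
    intro b h
    set z := ∑ j, w j • a j with hz
    -- The claim says that the mean of the form at b plus m independent draws from the weights w is
    -- nonnegative; the induction conditions on the first draw.
    have h1 : ∀ j, 0 ≤ w j * ((b + a j) ⬝ᵥ (M *ᵥ (b + a j)) + 2 * m * ((b + a j) ⬝ᵥ (M *ᵥ z))
        + m * (m - 1) * (z ⬝ᵥ (M *ᵥ z)) + m * ∑ j, w j * (a j ⬝ᵥ (M *ᵥ a j))) := by
      intro j
      refine mul_nonneg (hw j) (ih (b + a j) fun f => ?_)
      have := h (Fin.cons j f)
      rw [Fin.sum_univ_succ] at this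
      simpa only [Fin.cons_zero, Fin.cons_succ, add_assoc] using this
    have h2 := Finset.sum_nonneg fun j (_ : j ∈ Finset.univ) => h1 j
    have e1 : ∑ j, w j * (b ⬝ᵥ (M *ᵥ a j)) = b ⬝ᵥ (M *ᵥ z) := by
      rw [hz, Matrix.mulVec_sum, dotProduct_sum]
      exact Finset.sum_congr rfl fun j _ => by rw [Matrix.mulVec_smul, dotProduct_smul, smul_eq_mul]
    have e2 : ∑ j, w j * (a j ⬝ᵥ (M *ᵥ z)) = z ⬝ᵥ (M *ᵥ z) := by
      conv_rhs => rw [hz, sum_dotProduct]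
      exact Finset.sum_congr rfl fun j _ => by rw [smul_dotProduct, smul_eq_mul]
    have e3 : ∀ j, w j * ((b + a j) ⬝ᵥ (M *ᵥ (b + a j)) + 2 * m * ((b + a j) ⬝ᵥ (M *ᵥ z))
        + m * (m - 1) * (z ⬝ᵥ (M *ᵥ z)) + m * ∑ j, w j * (a j ⬝ᵥ (M *ᵥ a j)))
        = w j * (b ⬝ᵥ (M *ᵥ b) + 2 * m * (b ⬝ᵥ (M *ᵥ z)) + m * (m - 1) * (z ⬝ᵥ (M *ᵥ z))
          + m * ∑ j, w j * (a j ⬝ᵥ (M *ᵥ a j))) + 2 * (w j * (b ⬝ᵥ (M *ᵥ a j)))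
          + w j * (a j ⬝ᵥ (M *ᵥ a j)) + 2 * m * (w j * (a j ⬝ᵥ (M *ᵥ z))) := fun j => by
      rw [quadForm_add hM, add_dotProduct]; ring
    simp only [e3] at h2
    rw [Finset.sum_add_distrib, Finset.sum_add_distrib, Finset.sum_add_distrib,
      ← Finset.sum_mul, ← Finset.mul_sum, ← Finset.mul_sum, hw1, e1, e2] at h2
    push_cast
    refine h2.trans (le_of_eq ?_)
    ring

/-- The signed basis vectors. -/
def signedSingle (q : Fin p × Bool) : Fin p → ℝ := Pi.single q.1 (if q.2 then 1 else -1)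

/-- Maurey's method for the form τI − Γ: v/‖v‖₁ is a convex combination of signed basis vectors. The
diagonal terms are at most 2τ and contribute only at relative order 1/(m − 1). -/
lemma quadForm_le_of_signedSingle {Γ : Matrix (Fin p) (Fin p) ℝ} (hΓ : Γᵀ = Γ) {τ : ℝ} {m : ℕ}
    (hm : 2 ≤ m)
    (h : ∀ f : Fin m → Fin p × Bool, (∑ i, signedSingle (f i)) ⬝ᵥ (Γ *ᵥ ∑ i, signedSingle (f i))
      ≤ τ * sqNorm (∑ i, signedSingle (f i))) (hτ : ∀ j, -Γ j j ≤ τ) (v : Fin p → ℝ) :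
    v ⬝ᵥ (Γ *ᵥ v) ≤ τ * sqNorm v + 2 * τ / (m - 1) * l1 v ^ 2 := by
  rcases (l1_nonneg v).eq_or_lt with h0 | h0
  · have hv : v = 0 := sqNorm_eq_zero.1
      (le_antisymm (by simpa [← h0] using sqNorm_le_l1_sq v) (sqNorm_nonneg v))
    simp [hv, sqNorm, l1]
  set M : Matrix (Fin p) (Fin p) ℝ := τ • (1 : Matrix (Fin p) (Fin p) ℝ) - Γ with hMdef
  have hM : Mᵀ = M := by
    rw [hMdef, Matrix.transpose_sub, Matrix.transpose_smul, Matrix.transpose_one, hΓ]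
  have hMq : ∀ z : Fin p → ℝ, z ⬝ᵥ (M *ᵥ z) = τ * sqNorm z - z ⬝ᵥ (Γ *ᵥ z) := fun z => by
    rw [hMdef, Matrix.sub_mulVec, Matrix.smul_mulVec, Matrix.one_mulVec, dotProduct_sub,
      dotProduct_smul, ← sqNorm_eq_dotProduct, smul_eq_mul]
  let a : Fin p → Fin p → ℝ := fun j => signedSingle (j, decide (0 ≤ v j))
  have ha : ∀ j, a j = (if 0 ≤ v j then (1 : ℝ) else -1) • Pi.single j 1 := fun j => by
    simp only [a, signedSingle, decide_eq_true_eq, ← Pi.single_smul, smul_eq_mul, mul_one]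
  have hsum : ∑ j, (|v j| / l1 v) • a j = (1 / l1 v) • v := by
    funext i
    rw [Finset.sum_apply, Finset.sum_eq_single i]
    · rw [ha, Pi.smul_apply, Pi.smul_apply, Pi.smul_apply, Pi.single_eq_same, smul_eq_mul,
        smul_eq_mul, smul_eq_mul]
      split_ifs with h1
      · rw [abs_of_nonneg h1]; ring
      · rw [abs_of_neg (not_le.1 h1)]; ring
    · intro j _ hj
      rw [ha, Pi.smul_apply, Pi.smul_apply, Pi.single_eq_of_ne (Ne.symm hj), smul_zero, smul_zero]
    · simp
  have hdiag : ∀ j, a j ⬝ᵥ (M *ᵥ a j) ≤ 2 * τ := by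
    intro j
    have e1 : (if 0 ≤ v j then (1 : ℝ) else -1) * (if 0 ≤ v j then (1 : ℝ) else -1) = 1 := by
      split_ifs <;> norm_num
    rw [ha, Matrix.mulVec_smul, dotProduct_smul, smul_dotProduct, smul_eq_mul, smul_eq_mul,
      ← mul_assoc, e1, one_mul, hMq, sqNorm_single, dotProduct_mulVec_single]
    linarith [hτ j]
  have h1 := quadForm_average_nonneg hM (w := fun j => |v j| / l1 v) (fun j => by positivity)
    (by rw [← Finset.sum_div]; exact div_self h0.ne') a m 0 (fun f => by
      rw [zero_add, hMq]
      have := h fun i => (f i, decide (0 ≤ v (f i)))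
      linarith)
  rw [hsum, zero_dotProduct, zero_dotProduct, mul_zero, zero_add, zero_add, Matrix.mulVec_smul,
    dotProduct_smul, smul_dotProduct, hMq, smul_eq_mul, smul_eq_mul] at h1
  have h2 : ∑ j, |v j| / l1 v * (a j ⬝ᵥ (M *ᵥ a j)) ≤ 2 * τ := by
    calc _ ≤ ∑ j, |v j| / l1 v * (2 * τ) :=
          Finset.sum_le_sum fun j _ => mul_le_mul_of_nonneg_left (hdiag j) (by positivity)
      _ = 2 * τ := by
          rw [← Finset.sum_mul, ← Finset.sum_div]
          exact (congrArg (· * (2 * τ)) (div_self h0.ne')).trans (one_mul _)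
  have hm' : (2 : ℝ) ≤ m := by exact_mod_cast hm
  have h3 : 0 ≤ (m : ℝ) * ((m - 1) * (1 / l1 v * (1 / l1 v * (τ * sqNorm v - v ⬝ᵥ (Γ *ᵥ v))))
      + 2 * τ) := by
    have := mul_le_mul_of_nonneg_left h2 (by linarith : (0 : ℝ) ≤ m)
    linarith
  have h4 := nonneg_of_mul_nonneg_right h3 (by linarith : (0 : ℝ) < m)
  have h5 := mul_nonneg h4 (sq_nonneg (l1 v))
  have e2 : ((m - 1 : ℝ) * (1 / l1 v * (1 / l1 v * (τ * sqNorm v - v ⬝ᵥ (Γ *ᵥ v)))) + 2 * τ)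
      * l1 v ^ 2 = (m - 1) * (τ * sqNorm v - v ⬝ᵥ (Γ *ᵥ v)) + 2 * τ * l1 v ^ 2 := by
    field_simp
  rw [e2] at h5
  have hm1 : (0 : ℝ) < m - 1 := by linarith
  have h6 : v ⬝ᵥ (Γ *ᵥ v) - τ * sqNorm v ≤ 2 * τ * l1 v ^ 2 / (m - 1) := by
    rw [le_div_iff₀ hm1]; linarith
  have e3 : 2 * τ * l1 v ^ 2 / ((m : ℝ) - 1) = 2 * τ / (m - 1) * l1 v ^ 2 := by ring
  linarith

/-- Sparsified deviation bound from the deviations at the sums of `m` signed basis vectors. -/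
lemma abs_quadForm_le_of_signedSingle {Γ : Matrix (Fin p) (Fin p) ℝ} (hΓ : Γᵀ = Γ) {τ : ℝ}
    {m : ℕ} (hm : 2 ≤ m)
    (h : ∀ f : Fin m → Fin p × Bool,
      |(∑ i, signedSingle (f i)) ⬝ᵥ (Γ *ᵥ ∑ i, signedSingle (f i))|
        ≤ τ * sqNorm (∑ i, signedSingle (f i))) (v : Fin p → ℝ) :
    |v ⬝ᵥ (Γ *ᵥ v)| ≤ τ * sqNorm v + 2 * τ / (m - 1) * l1 v ^ 2 := by
  have hm' : (0 : ℝ) < m := by exact_mod_cast (by omega : 0 < m)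
  -- The constant choice f = (j, +) evaluates the form at m e_j.
  have hd : ∀ j, |Γ j j| ≤ τ := by
    intro j
    have h1 := h fun _ => (j, true)
    rw [Finset.sum_const, Finset.card_univ, Fintype.card_fin, ← Nat.cast_smul_eq_nsmul ℝ,
      Matrix.mulVec_smul, dotProduct_smul, smul_dotProduct, sqNorm_smul] at h1
    simp only [signedSingle, if_true, smul_eq_mul] at h1
    rw [dotProduct_mulVec_single, sqNorm_single, abs_mul, abs_mul, abs_of_pos hm'] at h1
    have h2 : (m : ℝ) * m * |Γ j j| ≤ m * m * τ := by linarith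
    exact le_of_mul_le_mul_left h2 (by positivity)
  refine abs_le'.2 ⟨?_, ?_⟩
  · exact quadForm_le_of_signedSingle hΓ hm (fun f => (le_abs_self _).trans (h f))
      (fun j => (neg_le_abs _).trans (hd j)) v
  · have := quadForm_le_of_signedSingle (Γ := -Γ) (by rw [Matrix.transpose_neg, hΓ]) (τ := τ) hm
      (fun f => by
        rw [Matrix.neg_mulVec, dotProduct_neg]
        exact (neg_le_abs _).trans (h f))
      (fun j => by
        rw [Matrix.neg_apply, neg_neg]
        exact (le_abs_self _).trans (hd j)) v
    rwa [Matrix.neg_mulVec, dotProduct_neg] at this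

/-- Positivity of the form at e_i ± e_j bounds every entry by the largest diagonal entry. -/
lemma quadForm_sampleCov_le_of_diag {n : ℕ} {X : Matrix (Fin n) (Fin p) ℝ} {B : ℝ}
    (h : ∀ j, sampleCov X j j ≤ B) (v : Fin p → ℝ) :
    1 / (n : ℝ) * sqNorm (X *ᵥ v) ≤ B * l1 v ^ 2 := by
  rw [← quadForm_sampleCov]
  refine (le_abs_self _).trans (abs_quadForm_le (fun i j => ?_) v)
  have hs := sampleCov_transpose X
  have hnn : ∀ v : Fin p → ℝ, 0 ≤ v ⬝ᵥ (sampleCov X *ᵥ v) := fun v => by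
    rw [quadForm_sampleCov]; exact mul_nonneg (by positivity) (sqNorm_nonneg _)
  have h1 := hnn (Pi.single i 1 + Pi.single j 1)
  have h2 := hnn (Pi.single i 1 + -Pi.single j 1)
  rw [quadForm_add hs] at h1 h2
  simp only [Matrix.mulVec_neg, dotProduct_neg, neg_dotProduct, neg_neg,
    dotProduct_mulVec_single] at h1 h2
  exact abs_le.2 ⟨by linarith [h i, h j], by linarith [h i, h j]⟩

end

/-- Two-sided restricted eigenvalue bounds for a design, and a bound on the diagonal of its
sample covariance. -/
structure RestrictedBound {n p : ℕ} (X : Matrix (Fin n) (Fin p) ℝ) (κ Cu Cr B : ℝ) : Prop where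
  lower : ∀ v : Fin p → ℝ, κ * sqNorm v - Cr * (Real.log p / n) * l1 v ^ 2
    ≤ 1 / (n : ℝ) * sqNorm (X *ᵥ v)
  upper : ∀ v : Fin p → ℝ, 1 / (n : ℝ) * sqNorm (X *ᵥ v)
    ≤ Cu * sqNorm v + Cr * (Real.log p / n) * l1 v ^ 2
  diag : ∀ j, sampleCov X j j ≤ B

section

variable {Ω : Type*} [MeasurableSpace Ω] {μ : Measure Ω} [IsProbabilityMeasure μ] {n p : ℕ}
  {L : ℝ≥0} {c : ℝ} {x : Ω → Fin n → Fin p → ℝ} {S : Matrix (Fin p) (Fin p) ℝ}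

/-- Union bound over the (2p)^m ≤ p^{2m} choices, each failing with probability at most 2
p^{−(2m+1)}. The deviation scales with the norm of the sum, so the exponent is the same for all of
them. -/
lemma SubGaussianDesign.signedSingle_tail (hx : SubGaussianDesign μ x S L c) (hn : 0 < n)
    (hp : 2 ≤ p) {τ : ℝ} (hτ : 0 < τ) (hτL : τ ≤ 75 * (L + 1)) {m : ℕ}
    (hm : (2 * m + 1) * Real.log p ≤ n * τ ^ 2 / (1200 * (L + 1) ^ 2)) :
    μ.real {ω | ¬ ∀ f : Fin m → Fin p × Bool, |(∑ i, signedSingle (f i)) ⬝ᵥ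
      ((sampleCov (Matrix.of (x ω)) - S) *ᵥ ∑ i, signedSingle (f i))|
      ≤ τ * sqNorm (∑ i, signedSingle (f i))} ≤ 2 / p := by
  have hp' : (2 : ℝ) ≤ p := by exact_mod_cast hp
  have hp0 : (0 : ℝ) < p := by linarith
  have h1 : ∀ f : Fin m → Fin p × Bool, μ.real {ω | ¬ |(∑ i, signedSingle (f i)) ⬝ᵥ
      ((sampleCov (Matrix.of (x ω)) - S) *ᵥ ∑ i, signedSingle (f i))|
      ≤ τ * sqNorm (∑ i, signedSingle (f i))} ≤ 2 * (1 / (p : ℝ) ^ (2 * m + 1)) := by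
    intro f
    set z := ∑ i, signedSingle (f i) with hz
    have hexp : Real.exp (-(n * τ ^ 2 / (1200 * (L + 1) ^ 2))) ≤ 1 / (p : ℝ) ^ (2 * m + 1) := by
      rw [← exp_neg_mul_log hp0 (2 * m + 1)]
      refine Real.exp_le_exp.2 (neg_le_neg ?_)
      push_cast
      exact hm
    rcases (sqNorm_nonneg z).eq_or_lt with h0 | h0
    · have hz0 : z = 0 := sqNorm_eq_zero.1 h0.symm
      have : {ω | ¬ |z ⬝ᵥ ((sampleCov (Matrix.of (x ω)) - S) *ᵥ z)| ≤ τ * sqNorm z} = ∅ := by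
        ext ω
        simp [hz0, sqNorm]
      rw [this, measureReal_empty]
      positivity
    · have h2 := hx.quadForm_tail hn h0 le_rfl (t := τ * sqNorm z) (by positivity)
        (by have := mul_le_mul_of_nonneg_right hτL h0.le; linarith)
      refine h2.trans (mul_le_mul_of_nonneg_left (le_trans (le_of_eq ?_) hexp) (by norm_num))
      congr 2
      field_simp
  have h2 := measureReal_not_forall_le (P := fun (f : Fin m → Fin p × Bool) ω =>
    |(∑ i, signedSingle (f i)) ⬝ᵥ
      ((sampleCov (Matrix.of (x ω)) - S) *ᵥ ∑ i, signedSingle (f i))|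
      ≤ τ * sqNorm (∑ i, signedSingle (f i))) h1
  refine h2.trans ?_
  rw [Fintype.card_fun, Fintype.card_prod, Fintype.card_fin, Fintype.card_bool, Fintype.card_fin]
  push_cast
  have h3 : ((p : ℝ) * 2) ^ m ≤ (p ^ 2) ^ m := by
    refine pow_le_pow_left₀ (by positivity) ?_ m
    rw [sq]
    exact mul_le_mul_of_nonneg_left hp' hp0.le
  rw [← mul_assoc, mul_one_div, div_le_div_iff₀ (by positivity) hp0, pow_succ, pow_mul]
  have := mul_le_mul_of_nonneg_right h3 hp0.le
  linarith

/-- Choosing m of order n / log p turns Maurey's error into (log p / n) ‖v‖₁², whereas entrywise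
deviations would only give √(log p / n) ‖v‖₁². -/
theorem SubGaussianDesign.restrictedBound_tail (hx : SubGaussianDesign μ x S L c) (hc : 1 ≤ c)
    (hn : 0 < n) (hp : 2 ≤ p) {κ₃ B Cr : ℝ} (hκ₃ : 0 < κ₃) (hκn : κ₃ * Real.log p ≤ n)
    (hB : B = 4 * (L + 1) * (1 + 2 / κ₃))
    (hCr : Cr = 1200 * (L + 1) ^ 2 * (36 * c + 24 * c ^ 2 * B)) :
    μ.real {ω | ¬ RestrictedBound (Matrix.of (x ω)) (1 / (2 * c)) (2 * c) Cr B} ≤ 3 / p := by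
  have hp' : (2 : ℝ) ≤ p := by exact_mod_cast hp
  have hp0 : (0 : ℝ) < p := by linarith
  have hn' : (0 : ℝ) < n := by exact_mod_cast hn
  have hl : 0 < Real.log p := Real.log_pos (by linarith)
  have hB0 : 0 < B := by rw [hB]; positivity
  set D : ℝ := 1200 * (L + 1) ^ 2 with hD
  have hD0 : 0 < D := by positivity
  set τ : ℝ := 1 / (2 * c) with hτ
  have hτ0 : 0 < τ := by positivity
  have hτ1 : τ ≤ 1 := by rw [hτ, div_le_one (by linarith)]; linarith
  have hcτ : c = 1 / (2 * τ) := by rw [hτ]; field_simp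
  have hL : (0 : ℝ) ≤ L := L.coe_nonneg
  have hdiag : μ.real {ω | ¬ ∀ j, sampleCov (Matrix.of (x ω)) j j ≤ B} ≤ 1 / p := by
    have h1 : ∀ j, μ.real {ω | ¬ sampleCov (Matrix.of (x ω)) j j ≤ B} ≤ 1 / (p : ℝ) ^ 2 := by
      intro j
      rw [hB]
      refine (hx.diag_tail hn j (2 / κ₃)).trans ?_
      rw [← exp_neg_mul_log hp0 2]
      refine Real.exp_le_exp.2 (neg_le_neg ?_)
      rw [mul_div_assoc', le_div_iff₀ hκ₃]
      push_cast
      linarith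
    refine (measureReal_not_forall_le (P := fun j ω => sampleCov (Matrix.of (x ω)) j j ≤ B)
      h1).trans (le_of_eq ?_)
    rw [Fintype.card_fin]
    field_simp
  set X := n * τ ^ 2 / (3 * (D * Real.log p)) with hX
  have hX0 : 0 < X := by positivity
  -- Maurey's method needs m ≥ 2. If X < 2, then log p / n is bounded below, and `Cr` is large
  -- enough for both bounds to follow from the diagonal alone.
  rcases le_or_gt 2 X with hX2 | hX2
  · set m := ⌊X⌋₊ with hm
    have hm2 : 2 ≤ m := Nat.le_floor (by exact_mod_cast hX2)
    have hmX : (m : ℝ) ≤ X := Nat.floor_le hX0.le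
    have hXm : X < m + 1 := Nat.lt_floor_add_one X
    have hm2' : (2 : ℝ) ≤ m := by exact_mod_cast hm2
    have h1 := hx.signedSingle_tail hn hp hτ0 (by linarith) (m := m) (by
      have e1 : n * τ ^ 2 / D = 3 * X * Real.log p := by rw [hX]; field_simp
      rw [← hD, e1]
      exact mul_le_mul_of_nonneg_right (by linarith) hl.le)
    refine (measureReal_mono (fun ω hω => ?_) (measure_ne_top μ _)).trans
      ((measureReal_not_and_le h1 hdiag).trans (le_of_eq (by ring)))
    rw [Set.mem_ofPred_eq] at hω ⊢
    rintro ⟨g1, g2⟩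
    refine hω ?_
    have hΓ : (sampleCov (Matrix.of (x ω)) - S)ᵀ = sampleCov (Matrix.of (x ω)) - S := by
      rw [Matrix.transpose_sub, sampleCov_transpose, hx.transpose_eq hn]
    have hdev := abs_quadForm_le_of_signedSingle hΓ hm2 g1
    have hcoef : 2 * τ / ((m : ℝ) - 1) ≤ Cr * (Real.log p / n) := by
      have h3 : X ≤ 3 * (m - 1) := by linarith
      have h4 : 2 * τ / ((m : ℝ) - 1) ≤ 6 * τ / X := by
        rw [div_le_div_iff₀ (by linarith) hX0]
        have := mul_le_mul_of_nonneg_left h3 (by positivity : 0 ≤ 2 * τ)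
        linarith
      have h5 : 6 * τ / X = D * (36 * c) * (Real.log p / n) := by
        rw [hX, hcτ]; field_simp; ring
      refine h4.trans (h5.le.trans (mul_le_mul_of_nonneg_right ?_ (by positivity)))
      rw [hCr]
      refine mul_le_mul_of_nonneg_left ?_ hD0.le
      have : 0 ≤ 24 * c ^ 2 * B := by positivity
      linarith
    have hdev' : ∀ v : Fin p → ℝ, |1 / (n : ℝ) * sqNorm (Matrix.of (x ω) *ᵥ v) - v ⬝ᵥ (S *ᵥ v)|
        ≤ τ * sqNorm v + Cr * (Real.log p / n) * l1 v ^ 2 := by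
      intro v
      have h3 := hdev v
      rw [Matrix.sub_mulVec, dotProduct_sub, quadForm_sampleCov] at h3
      exact h3.trans (add_le_add_right (mul_le_mul_of_nonneg_right hcoef (sq_nonneg _)) _)
    have e4 : 1 / c = 2 * τ := by rw [hτ]; field_simp
    refine ⟨fun v => ?_, fun v => ?_, g2⟩
    · have h3 := (abs_le.1 (hdev' v)).1
      have h4 := (hx.quadForm_bounds hn v).1
      rw [e4] at h4
      linarith
    · have h3 := (abs_le.1 (hdev' v)).2
      have h4 := (hx.quadForm_bounds hn v).2
      have h5 := mul_le_mul_of_nonneg_right (hτ1.trans hc) (sqNorm_nonneg v)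
      linarith
  · have hle : 1 / (p : ℝ) ≤ 3 / p := div_le_div_of_nonneg_right (by norm_num) hp0.le
    refine (measureReal_mono (fun ω hω => ?_) (measure_ne_top μ _)).trans (hdiag.trans hle)
    rw [Set.mem_ofPred_eq] at hω ⊢
    intro g2
    refine hω ?_
    have hln : τ ^ 2 / (6 * D) ≤ Real.log p / n := by
      rw [hX, div_lt_iff₀ (by positivity)] at hX2
      rw [div_le_div_iff₀ (by positivity) hn']
      linarith
    have hCr0 : 0 ≤ Cr := by rw [hCr]; positivity
    have hCrl : 3 * τ + B ≤ Cr * (Real.log p / n) := by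
      refine le_trans (le_of_eq ?_) (mul_le_mul_of_nonneg_left hln hCr0)
      rw [hCr, hcτ]
      field_simp
      ring
    refine ⟨fun v => ?_, fun v => ?_, g2⟩
    · have h3 := mul_le_mul_of_nonneg_right (by linarith : τ ≤ Cr * (Real.log p / n))
        (sq_nonneg (l1 v))
      have h4 := mul_le_mul_of_nonneg_left (sqNorm_le_l1_sq v) hτ0.le
      have h5 : 0 ≤ 1 / (n : ℝ) * sqNorm (Matrix.of (x ω) *ᵥ v) :=
        mul_nonneg (by positivity) (sqNorm_nonneg _)
      linarith
    · have h3 := quadForm_sampleCov_le_of_diag g2 v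
      have h4 := mul_le_mul_of_nonneg_right (by linarith : B ≤ Cr * (Real.log p / n))
        (sq_nonneg (l1 v))
      have h5 : 0 ≤ 2 * c * sqNorm v := mul_nonneg (by linarith) (sqNorm_nonneg v)
      linarith

end

/-! ### Debiased estimators on well-behaved source designs -/

/-- A source design satisfying a restricted eigenvalue bound, for which the debiasing program has
strictly feasible points with bounded objective. -/
structure SourceDesign {n p : ℕ} (X : Matrix (Fin n) (Fin p) ℝ) (κ t mu B : ℝ) : Prop where
  lower : ∀ v : Fin p → ℝ, κ * sqNorm v - t * l1 v ^ 2 ≤ 1 / (n : ℝ) * sqNorm (X *ᵥ v)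
  diag : ∀ j, sampleCov X j j ≤ B
  feasible : ∀ j, ∃ θ : Fin p → ℝ,
    (∀ i, |(sampleCov X *ᵥ θ) i - (Pi.single j 1 : Fin p → ℝ) i| < mu) ∧
      θ ⬝ᵥ (sampleCov X *ᵥ θ) ≤ B

section

variable {n p : ℕ} {X : Matrix (Fin n) (Fin p) ℝ} {S : Matrix (Fin p) (Fin p) ℝ}
  {c t κ mu B : ℝ}

lemma CovClose.sourceDesign (h : CovClose X S c t)
    (hS : ∀ v : Fin p → ℝ, 1 / c * sqNorm v ≤ v ⬝ᵥ (S *ᵥ v) ∧ v ⬝ᵥ (S *ᵥ v) ≤ c * sqNorm v)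
    (ht : t < mu) (hB : c + t ≤ B) : SourceDesign X (1 / c) t mu B where
  lower := h.lower fun v => (hS v).1
  diag := fun j => (h.diag_le (fun v => (hS v).2) j).trans hB
  feasible := fun j => by
    obtain ⟨θ, h1, h2⟩ := h.exists_feasible ht j
    exact ⟨θ, h1, h2.trans hB⟩

lemma CovClose.sourceDesign_of_mul_le (h : CovClose X S c t)
    (hS : ∀ v : Fin p → ℝ, 1 / c * sqNorm v ≤ v ⬝ᵥ (S *ᵥ v) ∧ v ⬝ᵥ (S *ᵥ v) ≤ c * sqNorm v)
    (hc : 0 < c) (ht : 0 ≤ t) (hmu : 0 < mu) (hpt : p * t ≤ 1 / (2 * c)) (hB : c + t ≤ B)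
    (hB' : 2 * c ≤ B) : SourceDesign X (1 / (2 * c)) 0 mu B where
  lower := fun v => by
    rw [zero_mul, sub_zero]
    exact h.lower_of_mul_le ht (fun v => (hS v).1) hpt v
  diag := fun j => (h.diag_le (fun v => (hS v).2) j).trans hB
  feasible := fun j => by
    obtain ⟨θ, h1, h2⟩ := exists_feasible_of_lower (X := X) (κ := 1 / (2 * c)) (by positivity) hmu
      (h.lower_of_mul_le ht (fun v => (hS v).1) hpt) j
    rw [one_div_one_div] at h2
    exact ⟨θ, h1, h2.trans hB'⟩

lemma SourceDesign.strictlyFeasible (h : SourceDesign X κ t mu B) (j : Fin p) :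
    StrictlyFeasible (sampleCov X) mu j := by
  obtain ⟨θ, h1, -⟩ := h.feasible j
  exact ⟨θ, h1⟩

lemma truncVec_scoreDir (h : ∀ j, sampleCov X j j ≤ B) (j : Fin p) :
    truncVec B (scoreDir X j) = scoreDir X j :=
  truncVec_of_le (by
    rw [sqNorm_scoreDir]
    exact div_le_div_of_nonneg_right (h j) (Nat.cast_nonneg n))

lemma SourceDesign.truncVec_debiasDir (h : SourceDesign X κ t mu B) (j : Fin p) :
    truncVec B (debiasDir X mu j) = debiasDir X mu j := by
  obtain ⟨θ, h1, h2⟩ := h.feasible j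
  exact truncVec_of_le (sqNorm_debiasDir_le h1 h2)

lemma SourceDesign.exists_isDebiasedLasso (h : SourceDesign X κ t mu B) (y : Fin n → ℝ) {lam : ℝ}
    (hlam : 0 < lam) : ∃ bt, IsDebiasedLasso X y lam mu bt := by
  obtain ⟨bL, hbL⟩ := exists_isLasso X y hlam
  have h1 : ∀ j, ∃ θ, IsDebiasRow (sampleCov X) mu j θ := fun j => by
    obtain ⟨θ, hθ⟩ := h.strictlyFeasible j
    exact exists_isDebiasRow X ⟨θ, fun i => (hθ i).le⟩
  choose Θ hΘ using h1
  exact ⟨_, bL, Θ, hbL, hΘ, rfl⟩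

/-- The noise direction depends only on the design, not on the version of the approximate inverse:
this makes the final bound hold for every choice of minimizers. -/
lemma SourceDesign.debiased_error (h : SourceDesign X κ t mu B) {β bt : Fin p → ℝ}
    {ε : Fin n → ℝ} {lam : ℝ} (hbt : IsDebiasedLasso X (X *ᵥ β + ε) lam mu bt) :
    ∃ bL, IsLasso X (X *ᵥ β + ε) lam bL ∧
      ∀ j, |(bt - β) j - debiasDir X mu j ⬝ᵥ ε| ≤ mu * l1 (bL - β) := by
  obtain ⟨bL, Θ, h1, h2, rfl⟩ := hbt
  refine ⟨bL, h1, fun j => ?_⟩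
  have h3 := DTransFusion.debiased_error (X := X) (β := β) (ε := ε) (bL := bL)
    (fun j => (h2 j).1) j
  rwa [debiasNoise, ← debiasDir_eq (h.strictlyFeasible j) (h2 j)] at h3

end

/-! ### Noise conditions of the fused step -/

/-- The conditions on the errors `ζ` of the source estimators under which the fused step succeeds,
where `g` is the score of the target sample and `α k` the weight of the `k`-th fusion penalty. -/
def FusedNoise {K p : ℕ} (η lam w A : ℝ) (α : Fin K → ℝ) (g : Fin p → ℝ)
    (ζ : Fin K → Fin p → ℝ) : Prop :=
  (∀ j, |g j + ∑ k, clip (α k) (w * ζ k j)| ≤ η * lam) ∧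
  (∃ γ : Fin K → Fin p → ℝ,
    (∀ k j, (γ k j = 1 ∧ |clip (α k) (w * ζ k j)| ≤ η * α k) ∨ γ k j = 0) ∧
    ∑ k, ∑ j, w * (1 - γ k j) ≤ η / 2) ∧
  ∑ j, |∑ k, (w * ζ k j - clip (α k) (w * ζ k j))| ≤ A

/-- Soft thresholding is 1-Lipschitz, so the debiasing bias passes to the excess without
amplification. -/
lemma abs_soft_sub_soft_le {a : ℝ} (ha : 0 ≤ a) (x y : ℝ) :
    |(x - clip a x) - (y - clip a y)| ≤ |x - y| := by
  unfold clip
  rcases le_total a x with h1 | h1 <;> rcases le_total a y with h2 | h2 <;>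
    rcases le_total (-a) x with h3 | h3 <;> rcases le_total (-a) y with h4 | h4 <;>
    simp only [min_eq_left, min_eq_right, max_eq_right, max_eq_left, h1, h2, h3, h4,
      neg_le_self ha] <;>
    rw [abs_le'] <;> constructor <;> cases abs_cases (x - y) <;> linarith

section

variable {K p : ℕ} {η lam w A a a' : ℝ} {α r : Fin K → ℝ} {g : Fin p → ℝ}
  {ξ ζ : Fin K → Fin p → ℝ}

lemma abs_add_sum_clip_le (hw : 0 ≤ w) (hg : ∀ j, |g j| ≤ a)
    (hclip : ∀ j, |∑ k, clip (α k) (w * ξ k j)| ≤ a') (hr : ∀ k j, |ζ k j - ξ k j| ≤ r k)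
    (hsum : a + a' + ∑ k, w * r k ≤ η * lam) (j : Fin p) :
    |g j + ∑ k, clip (α k) (w * ζ k j)| ≤ η * lam := by
  have h1 : |∑ k, clip (α k) (w * ζ k j) - ∑ k, clip (α k) (w * ξ k j)| ≤ ∑ k, w * r k := by
    rw [← Finset.sum_sub_distrib]
    refine (Finset.abs_sum_le_sum_abs _ _).trans (Finset.sum_le_sum fun k _ => ?_)
    refine (abs_clip_sub_clip_le _ _ _).trans ?_
    rw [← mul_sub, abs_mul, abs_of_nonneg hw]
    exact mul_le_mul_of_nonneg_left (hr k j) hw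
  have h2 := abs_le.1 h1
  have h3 := abs_le.1 (hg j)
  have h4 := abs_le.1 (hclip j)
  exact abs_le.2 ⟨by linarith, by linarith⟩

/-- When every error is below the margin, nothing is clipped: all pairs are good and the excess is
zero. -/
lemma fusedNoise_of_small (hw : 0 ≤ w) (hη : 0 ≤ η) (hη1 : η ≤ 1) (hα : ∀ k, 0 ≤ α k) (hA : 0 ≤ A)
    (hg : ∀ j, |g j| ≤ a) (hclip : ∀ j, |∑ k, clip (α k) (w * ξ k j)| ≤ a')
    (hr : ∀ k j, |ζ k j - ξ k j| ≤ r k) (hsum : a + a' + ∑ k, w * r k ≤ η * lam)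
    (hsmall : ∀ k j, |w * ζ k j| ≤ η * α k) : FusedNoise η lam w A α g ζ := by
  refine ⟨abs_add_sum_clip_le hw hg hclip hr hsum, ⟨fun _ _ => 1, fun k j => Or.inl ⟨rfl, ?_⟩, ?_⟩,
    ?_⟩
  · exact (abs_clip_le_abs (hα k) _).trans (hsmall k j)
  · simp only [sub_self, mul_zero, Finset.sum_const_zero]
    positivity
  · refine (le_of_eq (Finset.sum_eq_zero fun j _ => ?_)).trans hA
    rw [abs_eq_zero]
    refine Finset.sum_eq_zero fun k _ => ?_
    rw [clip_of_abs_le ((hsmall k j).trans (mul_le_of_le_one_left (hα k) hη1)), sub_self]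

/-- A pair is declared good when its noise part is below x. The excess of ζ differs from that of the
noise by at most the bias, and summing over p coordinates yields `A`. -/
lemma fusedNoise_of_count {x : ℝ} (hw : 0 ≤ w) (hα : ∀ k, 0 ≤ α k) (hp : 0 < p)
    (hg : ∀ j, |g j| ≤ a) (hclip : ∀ j, |∑ k, clip (α k) (w * ξ k j)| ≤ a')
    (hr : ∀ k j, |ζ k j - ξ k j| ≤ r k) (hsum : a + a' + ∑ k, w * r k ≤ η * lam)
    (hgood : ∀ k j, |ξ k j| ≤ x → |w * ζ k j| ≤ η * α k)
    (hcount : ∑ k, ∑ j, w * (if |ξ k j| ≤ x then 0 else 1) ≤ η / 2)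
    (hexc : ∀ j, |∑ k, (w * ξ k j - clip (α k) (w * ξ k j))| ≤ A / (2 * p))
    (hrA : ∑ k, w * r k ≤ A / (2 * p)) : FusedNoise η lam w A α g ζ := by
  refine ⟨abs_add_sum_clip_le hw hg hclip hr hsum,
    ⟨fun k j => if |ξ k j| ≤ x then 1 else 0, fun k j => ?_, ?_⟩, ?_⟩
  · by_cases h : |ξ k j| ≤ x
    · exact Or.inl ⟨if_pos h, (abs_clip_le_abs (hα k) _).trans (hgood k j h)⟩
    · exact Or.inr (if_neg h)
  · refine (le_of_eq (Finset.sum_congr rfl fun k _ => Finset.sum_congr rfl fun j _ => ?_)).trans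
      hcount
    by_cases h : |ξ k j| ≤ x
    · simp only [if_pos h, sub_self]
    · simp only [if_neg h, sub_zero]
  · have hp' : (0 : ℝ) < p := by exact_mod_cast hp
    have h1 : ∀ j, |∑ k, (w * ζ k j - clip (α k) (w * ζ k j))| ≤ A / p := by
      intro j
      have h2 : |∑ k, (w * ζ k j - clip (α k) (w * ζ k j))
          - ∑ k, (w * ξ k j - clip (α k) (w * ξ k j))| ≤ ∑ k, w * r k := by
        rw [← Finset.sum_sub_distrib]
        refine (Finset.abs_sum_le_sum_abs _ _).trans (Finset.sum_le_sum fun k _ => ?_)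
        refine (abs_soft_sub_soft_le (hα k) _ _).trans ?_
        rw [← mul_sub, abs_mul, abs_of_nonneg hw]
        exact mul_le_mul_of_nonneg_left (hr k j) hw
      have h3 := abs_le.1 (h2.trans hrA)
      have h4 := abs_le.1 (hexc j)
      have e : A / p = A / (2 * p) + A / (2 * p) := by field_simp; ring
      rw [e]
      exact abs_le.2 ⟨by linarith, by linarith⟩
    refine (Finset.sum_le_sum fun j _ => h1 j).trans (le_of_eq ?_)
    rw [Finset.sum_const, Finset.card_univ, Fintype.card_fin, nsmul_eq_mul]
    field_simp

end

/-! ### Few sources and many sources -/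

section

variable {K p nT nS s : ℕ} {h : Fin K → ℝ} {c₀ c₁ κ₂ M η c : ℝ}
  {X0 : Matrix (Fin nT) (Fin p) ℝ} {ε0 : Fin nT → ℝ}
  {X : Fin K → Matrix (Fin nS) (Fin p) ℝ} {ε : Fin K → Fin nS → ℝ} {β0 : Fin p → ℝ}
  {β bt : Fin K → Fin p → ℝ} {B : ℝ}

lemma weight_mul_sq_sqrt (hnS : 0 < nS) (hp : 1 ≤ p) :
    (nS : ℝ) / total K nT nS * √(Real.log p / nS) ^ 2 = √(Real.log p / total K nT nS) ^ 2 := by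
  have hl : 0 ≤ Real.log p := Real.log_nonneg (by exact_mod_cast hp)
  have hn : (0 : ℝ) < nS := by exact_mod_cast hnS
  rw [Real.sq_sqrt (by positivity), Real.sq_sqrt (div_nonneg hl (total_nonneg _ _ _))]
  field_simp

/-- The weight n_T/N rescales √(log p / n_T) to √(n_T/N) √(log p / N), and n_T ≤ N. -/
lemma abs_target_score_le (hN : 0 < total K nT nS) (hnT : 0 < nT) (hp : 1 ≤ p) (hM : 0 ≤ M)
    (h : ∀ j, |score X0 ε0 j| ≤ M * √(Real.log p / nT)) (j : Fin p) :
    |((1 / total K nT nS) • (X0ᵀ *ᵥ ε0)) j| ≤ M * √(Real.log p / total K nT nS) := by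
  have hl : 0 ≤ Real.log p := Real.log_nonneg (by exact_mod_cast hp)
  have hn : (0 : ℝ) < nT := by exact_mod_cast hnT
  have e1 : ((1 / total K nT nS) • (X0ᵀ *ᵥ ε0)) j = (nT : ℝ) / total K nT nS * score X0 ε0 j := by
    rw [score, Pi.smul_apply, Pi.smul_apply, smul_eq_mul, smul_eq_mul]
    field_simp
  have h1 : (nT : ℝ) / total K nT nS ≤ 1 := by
    rw [div_le_one hN, total]
    have : (0 : ℝ) ≤ (K : ℝ) * nS := by positivity
    linarith
  have h2 : (nT : ℝ) / total K nT nS * √(Real.log p / nT) ≤ √(Real.log p / total K nT nS) := by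
    refine Real.le_sqrt_of_sq_le ?_
    rw [mul_pow, Real.sq_sqrt (by positivity)]
    have e2 : ((nT : ℝ) / total K nT nS) ^ 2 * (Real.log p / nT)
        = nT / total K nT nS * (Real.log p / total K nT nS) := by field_simp
    rw [e2]
    exact mul_le_of_le_one_left (by positivity) h1
  rw [e1, abs_mul, abs_of_nonneg (by positivity)]
  have h3 := mul_le_mul_of_nonneg_left (h j) (by positivity : 0 ≤ (nT : ℝ) / total K nT nS)
  have h4 := mul_le_mul_of_nonneg_left h2 hM
  linarith

/-- The bias is c₁√(log p / n_S) times the lasso's ℓ₁ error. Multiplied by n_S/N it has the order of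
δ_k, and its sum over k that of δ₀; these are the terms built into a_kλ₀ and λ₀, so a large c₀
dominates everything. -/
lemma fusedNoise_of_few_sources (hK : 1 ≤ K) (hp : 2 ≤ p) (hs : 1 ≤ s) (hnT : 0 < nT)
    (hnS : 0 < nS)
    (hh : ∀ k, h k ≤ κ₂ * hbar nT nS h ∧ hbar nT nS h ≤ κ₂ * h k) (hc : 1 ≤ c) (hM : 1 ≤ M)
    (hc₁ : c₁ = 8 * M) (hη : 0 < η) (hη1 : η ≤ 1)
    (hc₀ : 112 * c * c₁ ^ 2 + 8 * c₁ + 4 * M ≤ η * c₀)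
    (hsM : 128 * (s * (4 * M * √(Real.log p / nS))) ≤ 1 / c)
    (hX : ∀ k, SourceDesign (X k) (1 / c) (4 * M * √(Real.log p / nS))
      (c₁ * √(Real.log p / nS)) B)
    (hz0 : ∀ j, |score X0 ε0 j| ≤ M * √(Real.log p / nT))
    (hz : ∀ k j, |score (X k) (ε k) j| ≤ 4 * M * √(Real.log p / nS))
    (hξ : ∀ k j, |debiasDir (X k) (c₁ * √(Real.log p / nS)) j ⬝ᵥ ε k|
      ≤ 4 * M * √(Real.log p / nS))
    (hclip : ∀ j, |∑ k, clip (tuneLam c₀ p nT nS s h * tuneWeight c₀ p nT nS s h k)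
      ((nS : ℝ) / total K nT nS * (debiasDir (X k) (c₁ * √(Real.log p / nS)) j ⬝ᵥ ε k))|
      ≤ M * √(Real.log p / total K nT nS))
    (hβ0 : l0 β0 ≤ s) (hβ : ∀ k, l1 (β k - β0) ≤ h k)
    (hbt : ∀ k, IsDebiasedLasso (X k) (X k *ᵥ β k + ε k) (c₁ * √(Real.log p / nS))
      (c₁ * √(Real.log p / nS)) (bt k)) :
    FusedNoise η (tuneLam c₀ p nT nS s h) ((nS : ℝ) / total K nT nS)
      √(Real.log p / total K nT nS)
      (fun k => tuneLam c₀ p nT nS s h * tuneWeight c₀ p nT nS s h k)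
      ((1 / total K nT nS) • (X0ᵀ *ᵥ ε0)) (fun k => bt k - β k) := by
  have hh0 : ∀ k, 0 ≤ h k := fun k => (l1_nonneg _).trans (hβ k)
  have hN : 0 < total K nT nS := total_pos hK hnS
  have hc₁0 : 0 < c₁ := by linarith
  have hR : 0 ≤ 112 * c * c₁ ^ 2 + 8 * c₁ := by positivity
  have hc₀0 : 0 < c₀ := pos_of_mul_pos_right (by linarith : 0 < η * c₀) hη.le
  have hlam := tuneLam_pos (nT := nT) (s := s) hK hp hnS hc₀0 hh0
  have hlamge := le_tuneLam (p := p) (nT := nT) (s := s) (h := h) hK hnS hc₀0.le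
  have hl : 0 < Real.log p := Real.log_pos (by exact_mod_cast hp)
  have hn : (0 : ℝ) < nS := by exact_mod_cast hnS
  have hα := fun k => (le_tuneLam_mul_tuneWeight hlam hc₀0.le hh0 k (hh k).2).1
  have hW := weight_mul_sq_sqrt (K := K) (nT := nT) hnS (by omega : 1 ≤ p)
  rw [deltaT_eq] at hlamge
  have hhb : hbar nT nS h = ∑ k, (nS : ℝ) / total K nT nS * h k := by
    rw [hbar, Finset.mul_sum]
  set w := (nS : ℝ) / total K nT nS with hw
  set T := √(Real.log p / nS) with hT
  set A := √(Real.log p / total K nT nS) with hA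
  set R := 112 * c * c₁ ^ 2 + 8 * c₁ with hRdef
  have hw0 : 0 ≤ w := by positivity
  have hT0 : 0 < T := by positivity
  have hA0 : 0 ≤ A := Real.sqrt_nonneg _
  have hα0 : ∀ k, 0 ≤ tuneLam c₀ p nT nS s h * tuneWeight c₀ p nT nS s h k := fun k =>
    (mul_pos hlam (tuneWeight_pos hK hp hnS hc₀0 hh0 k)).le
  have hr : ∀ k j, |(bt k - β k) j - debiasDir (X k) (c₁ * T) j ⬝ᵥ ε k|
      ≤ c₁ * T * (112 * (s * (c₁ * T)) / (1 / c) + 8 * h k) := by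
    intro k j
    obtain ⟨bL, hbL, herr⟩ := (hX k).debiased_error (hbt k)
    refine (herr j).trans (mul_le_mul_of_nonneg_left ?_ (by positivity))
    refine lasso_l1_error hbL (by positivity) (by positivity) (by positivity) (fun j => ?_)
      (hX k).lower hsM hβ0 (hβ k)
    refine (hz k j).trans (le_of_eq ?_)
    rw [hc₁]; ring
  have hwr : ∀ k, w * (c₁ * T * (112 * (s * (c₁ * T)) / (1 / c) + 8 * h k))
      ≤ R * (s * A ^ 2 + w * T * h k) := by
    intro k
    have e1 : w * (c₁ * T * (112 * (s * (c₁ * T)) / (1 / c) + 8 * h k))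
        = 112 * c * c₁ ^ 2 * (s * (w * T ^ 2)) + 8 * c₁ * (w * T * h k) := by
      field_simp
    have h1 : 0 ≤ s * A ^ 2 := by positivity
    have h2 : 0 ≤ w * T * h k := mul_nonneg (by positivity) (hh0 k)
    have h3 : 0 ≤ 112 * c * c₁ ^ 2 * (w * T * h k) := mul_nonneg (by positivity) h2
    have h4 : 0 ≤ 8 * c₁ * (s * A ^ 2) := mul_nonneg (by positivity) h1
    rw [e1, hW, hRdef]
    linarith
  refine fusedNoise_of_small (ξ := fun k j => debiasDir (X k) (c₁ * T) j ⬝ᵥ ε k) (a := M * A)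
    (a' := M * A) hw0 hη.le hη1 hα0 hA0
    (abs_target_score_le hN hnT (by omega) (by linarith) hz0) hclip hr ?_ fun k j => ?_
  · have h1 : ∑ k, w * (c₁ * T * (112 * (s * (c₁ * T)) / (1 / c) + 8 * h k))
        ≤ R * (K * s * A ^ 2 + T * hbar nT nS h) := by
      refine (Finset.sum_le_sum fun k _ => hwr k).trans (le_of_eq ?_)
      rw [← Finset.mul_sum, Finset.sum_add_distrib, Finset.sum_const, Finset.card_univ,
        Fintype.card_fin, nsmul_eq_mul, hhb, Finset.mul_sum]
      congr 1
      congr 1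
      · ring
      · exact Finset.sum_congr rfl fun k _ => by ring
    have h2 : 0 ≤ K * s * A ^ 2 + T * hbar nT nS h :=
      add_nonneg (by positivity) (mul_nonneg hT0.le (hbar_nonneg hh0))
    have h3 := mul_le_mul_of_nonneg_left hlamge hη.le
    have h4 := mul_le_mul_of_nonneg_right (by linarith : 2 * M ≤ η * c₀) hA0
    have h5 := mul_le_mul_of_nonneg_right (by linarith : R ≤ η * c₀) h2
    linarith
  · have h1 : |w * (bt k - β k) j - w * (debiasDir (X k) (c₁ * T) j ⬝ᵥ ε k)|
        ≤ R * (s * A ^ 2 + w * T * h k) := by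
      rw [← mul_sub, abs_mul, abs_of_nonneg hw0]
      exact (mul_le_mul_of_nonneg_left (hr k j) hw0).trans (hwr k)
    have h2 : |w * (debiasDir (X k) (c₁ * T) j ⬝ᵥ ε k)| ≤ 4 * M * (w * T) := by
      rw [abs_mul, abs_of_nonneg hw0]
      have := mul_le_mul_of_nonneg_left (hξ k j) hw0
      linarith
    have h3 := abs_sub_abs_le_abs_sub (w * (bt k - β k) j)
      (w * (debiasDir (X k) (c₁ * T) j ⬝ᵥ ε k))
    have h4 := mul_le_mul_of_nonneg_left (hα k) hη.le
    have g1 : 0 ≤ w * T := by positivity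
    have g2 : 0 ≤ s * A ^ 2 := by positivity
    have g3 : 0 ≤ w * T * h k := mul_nonneg g1 (hh0 k)
    have h5 := mul_le_mul_of_nonneg_right (by linarith : 4 * M ≤ η * c₀) g1
    have h6 := mul_le_mul_of_nonneg_right (by linarith : R ≤ η * c₀) g2
    have h7 := mul_le_mul_of_nonneg_right (by linarith : R ≤ η * c₀) g3
    have g1' := mul_nonneg (by linarith : 0 ≤ η * c₀) g1
    have g2' := mul_nonneg (by linarith : 0 ≤ η * c₀) g2
    have g3' := mul_nonneg (by linarith : 0 ≤ η * c₀) g3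
    linarith

/-- The crude lasso bound makes each bias at most √(log p / n_S) G p y, and `hGy` makes G p y ≤
1/(4p√K). The factor √K pays for passing from √(log p / n_S) to √(log p / N), and the remaining 1/p
for summing over coordinates. -/
lemma fusedNoise_of_many_sources (hK : 1 ≤ K) (hp : 2 ≤ p) (hnT : 0 < nT)
    (hTS : nT ≤ nS)
    (hh : ∀ k, h k ≤ κ₂ * hbar nT nS h ∧ hbar nT nS h ≤ κ₂ * h k) (hc : 1 ≤ c) (hM : 1 ≤ M)
    (hc₁ : 0 < c₁) (hη : 0 < η) (hc₀ : 2 * M + 1 ≤ η * c₀) {y G : ℝ} (hy : √(Real.log p / nS) ≤ y)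
    (hG : G = 4 * c * c₁ * (M + c₁)) (hGy : 4 * G * (p ^ 2 * √K * y) ≤ 1)
    (hX : ∀ k, SourceDesign (X k) (1 / (2 * c)) 0 (c₁ * √(Real.log p / nS)) B)
    (hz0 : ∀ j, |score X0 ε0 j| ≤ M * √(Real.log p / nT))
    (hz : ∀ k j, |score (X k) (ε k) j| ≤ M * y)
    (hclip : ∀ j, |∑ k, clip (tuneLam c₀ p nT nS s h * tuneWeight c₀ p nT nS s h k)
      ((nS : ℝ) / total K nT nS * (debiasDir (X k) (c₁ * √(Real.log p / nS)) j ⬝ᵥ ε k))|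
      ≤ M * √(Real.log p / total K nT nS))
    (hcount : ∑ k, ∑ j, (nS : ℝ) / total K nT nS *
      (if |debiasDir (X k) (c₁ * √(Real.log p / nS)) j ⬝ᵥ ε k| ≤ M * √(Real.log p / nS)
        then 0 else 1) ≤ η / 2)
    (hexc : ∀ j, |∑ k, ((nS : ℝ) / total K nT nS *
        (debiasDir (X k) (c₁ * √(Real.log p / nS)) j ⬝ᵥ ε k)
      - clip (tuneLam c₀ p nT nS s h * tuneWeight c₀ p nT nS s h k)
        ((nS : ℝ) / total K nT nS * (debiasDir (X k) (c₁ * √(Real.log p / nS)) j ⬝ᵥ ε k)))|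
      ≤ √(Real.log p / total K nT nS) / (2 * p))
    (hβ : ∀ k, l1 (β k - β0) ≤ h k)
    (hbt : ∀ k, IsDebiasedLasso (X k) (X k *ᵥ β k + ε k) (c₁ * √(Real.log p / nS))
      (c₁ * √(Real.log p / nS)) (bt k)) :
    FusedNoise η (tuneLam c₀ p nT nS s h) ((nS : ℝ) / total K nT nS)
      √(Real.log p / total K nT nS)
      (fun k => tuneLam c₀ p nT nS s h * tuneWeight c₀ p nT nS s h k)
      ((1 / total K nT nS) • (X0ᵀ *ᵥ ε0)) (fun k => bt k - β k) := by
  have hnS : 0 < nS := hnT.trans_le hTS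
  have hh0 : ∀ k, 0 ≤ h k := fun k => (l1_nonneg _).trans (hβ k)
  have hN : 0 < total K nT nS := total_pos hK hnS
  have hc₀0 : 0 < c₀ := pos_of_mul_pos_right (by linarith : 0 < η * c₀) hη.le
  have hlam := tuneLam_pos (nT := nT) (s := s) hK hp hnS hc₀0 hh0
  have hlamge := le_tuneLam (p := p) (nT := nT) (s := s) (h := h) hK hnS hc₀0.le
  have hdT : 0 ≤ deltaT p nT nS s h := deltaT_nonneg hh0
  have hl : 0 < Real.log p := Real.log_pos (by exact_mod_cast hp)
  have hn : (0 : ℝ) < nS := by exact_mod_cast hnS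
  have hp' : (2 : ℝ) ≤ p := by exact_mod_cast hp
  have hK' : (1 : ℝ) ≤ K := by exact_mod_cast hK
  have hα := fun k => (le_tuneLam_mul_tuneWeight hlam hc₀0.le hh0 k (hh k).2).1
  have hTA : √(Real.log p / nS) ≤ 2 * √K * √(Real.log p / total K nT nS) := by
    have e1 : 2 * √(K : ℝ) * √(Real.log p / total K nT nS)
        = √(2 ^ 2 * K * (Real.log p / total K nT nS)) := by
      rw [Real.sqrt_mul (by positivity), Real.sqrt_mul (by positivity),
        Real.sqrt_sq (by norm_num)]
    rw [e1]
    refine Real.sqrt_le_sqrt ?_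
    rw [mul_div_assoc', div_le_div_iff₀ hn hN]
    have h1 : total K nT nS ≤ 2 ^ 2 * K * nS := by
      have h2 : (nT : ℝ) ≤ nS := by exact_mod_cast hTS
      have h3 := mul_le_mul_of_nonneg_right hK' hn.le
      have h4 : 0 ≤ (K : ℝ) * nS := by positivity
      unfold total
      linarith
    have := mul_le_mul_of_nonneg_left h1 hl.le
    linarith
  have hw1 : (K : ℝ) * ((nS : ℝ) / total K nT nS) ≤ 1 := by
    have h1 := weights_sum (K := K) (nT := nT) (nS := nS) hN
    have h2 : 0 ≤ (nT : ℝ) / total K nT nS := by positivity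
    linarith
  set w := (nS : ℝ) / total K nT nS with hw
  set T := √(Real.log p / nS) with hT
  set A := √(Real.log p / total K nT nS) with hA
  have hw0 : 0 ≤ w := by positivity
  have hT0 : 0 < T := by positivity
  have hA0 : 0 ≤ A := Real.sqrt_nonneg _
  have hy0 : 0 < y := hT0.trans_le hy
  have hG0 : 0 < G := by rw [hG]; positivity
  have hKs : 1 ≤ √(K : ℝ) := Real.one_le_sqrt.2 hK'
  have hα0 : ∀ k, 0 ≤ tuneLam c₀ p nT nS s h * tuneWeight c₀ p nT nS s h k := fun k =>
    (mul_pos hlam (tuneWeight_pos hK hp hnS hc₀0 hh0 k)).le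
  have hr : ∀ k j, |(bt k - β k) j - debiasDir (X k) (c₁ * T) j ⬝ᵥ ε k| ≤ T * (G * (p * y)) := by
    intro k j
    obtain ⟨bL, hbL, herr⟩ := (hX k).debiased_error (hbt k)
    have h1 := lasso_l1_error_crude (M := M * y) hbL (by positivity)
      (by positivity : 0 < 1 / (2 * c)) (by positivity) (hz k) (fun v => by
        have := (hX k).lower v
        rwa [zero_mul, sub_zero] at this)
    refine (herr j).trans ((mul_le_mul_of_nonneg_left h1 (by positivity)).trans ?_)
    have h2 : 2 * (p : ℝ) * (M * y + c₁ * T) / (1 / (2 * c))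
        ≤ 2 * (p : ℝ) * (M * y + c₁ * y) / (1 / (2 * c)) := by gcongr
    refine (mul_le_mul_of_nonneg_left h2 (by positivity)).trans (le_of_eq ?_)
    rw [hG]
    field_simp
    ring
  have hpy : G * (p * y) * (4 * (p * √K)) ≤ 1 := by
    have e1 : G * (p * y) * (4 * (p * √(K : ℝ))) = 4 * G * (p ^ 2 * √K * y) := by ring
    rw [e1]; exact hGy
  have hGpy0 : 0 ≤ G * (p * y) := by positivity
  have hGpy1 : G * (p * y) ≤ 1 := by
    have h1 : (1 : ℝ) ≤ 4 * (p * √K) := by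
      have := one_le_mul_of_one_le_of_one_le (by linarith : (1 : ℝ) ≤ p) hKs
      linarith
    exact (le_mul_of_one_le_right hGpy0 h1).trans hpy
  have hsum : ∑ k : Fin K, w * (T * (G * (p * y))) ≤ A / (2 * p) := by
    rw [Finset.sum_const, Finset.card_univ, Fintype.card_fin, nsmul_eq_mul, ← mul_assoc]
    have h1 : 0 ≤ T * (G * (p * y)) := by positivity
    refine (mul_le_of_le_one_left h1 hw1).trans ?_
    rw [le_div_iff₀ (by positivity)]
    have h2 := mul_le_mul_of_nonneg_right hTA (by positivity : 0 ≤ G * (p * y) * (2 * p))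
    have h3 := mul_le_mul_of_nonneg_left hpy hA0
    linarith
  refine fusedNoise_of_count (ξ := fun k j => debiasDir (X k) (c₁ * T) j ⬝ᵥ ε k) (a := M * A)
    (a' := M * A) (x := M * T) (r := fun _ => T * (G * (p * y))) hw0 hα0 (by omega)
    (abs_target_score_le hN hnT (by omega) (by linarith) hz0) hclip hr ?_ (fun k j hkj => ?_)
    hcount hexc hsum
  · have h1 : A / (2 * p) ≤ A := div_le_self hA0 (by linarith)
    have h2 := mul_le_mul_of_nonneg_left hlamge hη.le
    have h3 := mul_le_mul_of_nonneg_right hc₀ hA0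
    have h4 := mul_nonneg (by linarith : 0 ≤ η * c₀) hdT
    linarith
  · have h1 : |w * (bt k - β k) j - w * (debiasDir (X k) (c₁ * T) j ⬝ᵥ ε k)| ≤ w * T := by
      rw [← mul_sub, abs_mul, abs_of_nonneg hw0]
      exact mul_le_mul_of_nonneg_left ((hr k j).trans (mul_le_of_le_one_right hT0.le hGpy1)) hw0
    have h2 : |w * (debiasDir (X k) (c₁ * T) j ⬝ᵥ ε k)| ≤ M * (w * T) := by
      rw [abs_mul, abs_of_nonneg hw0]
      have := mul_le_mul_of_nonneg_left hkj hw0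
      linarith
    have h3 := abs_sub_abs_le_abs_sub (w * (bt k - β k) j)
      (w * (debiasDir (X k) (c₁ * T) j ⬝ᵥ ε k))
    have h4 := mul_le_mul_of_nonneg_left (hα k) hη.le
    have g1 : 0 ≤ w * T := by positivity
    have h5 := mul_le_mul_of_nonneg_right hc₀ g1
    have g1' := mul_nonneg (by linarith : 0 ≤ η * c₀) g1
    have g2' := mul_nonneg (by linarith : 0 ≤ η * c₀) (by positivity : 0 ≤ s * A ^ 2)
    have g3' := mul_nonneg (by linarith : 0 ≤ η * c₀) (mul_nonneg g1 (hh0 k))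
    have g4 := mul_nonneg (by linarith : 0 ≤ M) g1
    linarith

end

/-! ### The two-step estimator on a good event -/

section

variable {K p nT nS s : ℕ}

lemma sqrt_log_mul_le_of_few (hp : 2 ≤ p) (hK : 1 ≤ K) (hKp : K ≤ p ^ 10) :
    √(Real.log (p * K) / nS) ≤ 4 * √(Real.log p / nS) := by
  have hp' : (0 : ℝ) < p := by exact_mod_cast (by omega : 0 < p)
  have hK' : (0 : ℝ) < K := by exact_mod_cast hK
  have hl : 0 < Real.log p := Real.log_pos (by exact_mod_cast hp)
  have h1 : Real.log K ≤ 10 * Real.log p := by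
    have : Real.log K ≤ Real.log ((p : ℝ) ^ 10) :=
      Real.log_le_log hK' (by exact_mod_cast hKp)
    rw [Real.log_pow] at this
    exact_mod_cast this
  have e1 : 4 * √(Real.log p / nS) = √(4 ^ 2 * (Real.log p / nS)) := by
    rw [Real.sqrt_mul (by positivity), Real.sqrt_sq (by norm_num)]
  rw [e1, mul_div_assoc']
  refine Real.sqrt_le_sqrt (div_le_div_of_nonneg_right ?_ (Nat.cast_nonneg _))
  rw [Real.log_mul hp'.ne' hK'.ne']
  linarith

/-- Since p ≤ K, log(pK) ≤ 4√K, and n_S ≥ κ₁K²/2. So the square of the left side is at most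
128G²p⁴/(κ₁√K); as √K ≥ p⁵, one factor p is left to absorb 128G²/κ₁. This is where the exponent 10
comes from. -/
lemma many_sources_bound {κ₁ G : ℝ} (hκ₁ : 0 < κ₁) (hp : 2 ≤ p) (hKp : p ^ 10 < K) (hnS : 0 < nS)
    (hn : κ₁ * ((K : ℝ) ^ 2 * Real.log p) ≤ nS) (hG : 0 ≤ G)
    (hpG : 128 * G ^ 2 / κ₁ ≤ p) : 4 * G * (p ^ 2 * √K * √(Real.log (p * K) / nS)) ≤ 1 := by
  have hp2 : (2 : ℝ) ≤ p := by exact_mod_cast hp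
  have hp' : (0 : ℝ) < p := by linarith
  have hn0 : (0 : ℝ) < nS := by exact_mod_cast hnS
  have hKp' : (p : ℝ) ^ 10 ≤ K := by exact_mod_cast hKp.le
  have hpK : (p : ℝ) ≤ K := (le_self_pow₀ (by linarith) (by norm_num)).trans hKp'
  have hK' : (0 : ℝ) < K := by linarith
  have hl : 1 / 2 ≤ Real.log p := by
    have h1 := Real.log_le_log (by norm_num) hp2
    have h2 := Real.log_two_gt_d9
    linarith
  set q := √(K : ℝ) with hq
  have hq2 : q ^ 2 = K := Real.sq_sqrt hK'.le
  have hqp : (p : ℝ) ^ 5 ≤ q := by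
    refine Real.le_sqrt_of_sq_le ?_
    rw [← pow_mul]; exact hKp'
  have hq0 : 0 < q := Real.sqrt_pos.2 hK'
  have hlog : Real.log (p * K) ≤ 4 * q := by
    rw [Real.log_mul hp'.ne' hK'.ne']
    have h1 := Real.log_le_log hp' hpK
    have h2 : Real.log K = 2 * Real.log q := by rw [← hq2, Real.log_pow]; norm_num
    have h3 := Real.log_le_self hq0.le
    linarith
  have hlog0 : 0 ≤ Real.log (p * K) := Real.log_nonneg (by
    have := one_le_mul_of_one_le_of_one_le (by linarith : (1 : ℝ) ≤ p) (by linarith : (1 : ℝ) ≤ K)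
    exact this)
  refine (sq_le_one_iff₀ (by positivity)).1 ?_
  have e1 : (4 * G * (p ^ 2 * q * √(Real.log (p * K) / nS))) ^ 2
      = 16 * G ^ 2 * p ^ 4 * q ^ 2 * Real.log (p * K) / nS := by
    have e0 : √(Real.log (p * K) / nS) ^ 2 = Real.log (p * K) / nS :=
      Real.sq_sqrt (by positivity)
    rw [mul_pow, mul_pow, mul_pow, mul_pow, e0]
    ring
  rw [e1, div_le_one hn0]
  rw [div_le_iff₀ hκ₁] at hpG
  have h1 : 16 * G ^ 2 * p ^ 4 * q ^ 2 * Real.log (p * K)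
      ≤ 16 * G ^ 2 * p ^ 4 * q ^ 2 * (4 * q) :=
    mul_le_mul_of_nonneg_left hlog (by positivity)
  have h2 : 128 * G ^ 2 * (p ^ 4 * q ^ 3 / 2) ≤ p * κ₁ * (p ^ 4 * q ^ 3 / 2) :=
    mul_le_mul_of_nonneg_right hpG (by positivity)
  have h3 : (p : ℝ) ^ 5 * (κ₁ * q ^ 3 / 2) ≤ q * (κ₁ * q ^ 3 / 2) :=
    mul_le_mul_of_nonneg_right hqp (by positivity)
  have h4 : κ₁ * ((K : ℝ) ^ 2 * (1 / 2)) ≤ κ₁ * ((K : ℝ) ^ 2 * Real.log p) := by gcongr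
  rw [← hq2] at h4 hn
  have e2 : κ₁ * ((q ^ 2) ^ 2 * (1 / 2)) = q * (κ₁ * q ^ 3 / 2) := by ring
  linarith

variable {h : Fin K → ℝ} {c₀ c₁ κ₂ M η c G B : ℝ}

/-- The two regimes in which the source estimators are controlled: either few sources, or so many
that the source samples are large. -/
def SourceRegime (K p nS s : ℕ) (M c G : ℝ) : Prop :=
  (K ≤ p ^ 10 ∧ 128 * (s * (4 * M * √(Real.log p / nS))) ≤ 1 / c) ∨
    4 * G * (p ^ 2 * √K * √(Real.log (p * K) / nS)) ≤ 1

lemma mul_sqrt_log_le (hc : 1 ≤ c) (hM : 1 ≤ M) (hc₁ : c₁ = 8 * M)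
    (hG : G = 4 * c * c₁ * (M + c₁)) (hp : 1 ≤ p) (hK : 1 ≤ K)
    (h2 : 4 * G * (p ^ 2 * √K * √(Real.log (p * K) / nS)) ≤ 1) :
    p * (M * √(Real.log (p * K) / nS)) ≤ 1 / (2 * c) := by
  have hp' : (1 : ℝ) ≤ p := by exact_mod_cast hp
  have hKs : 1 ≤ √(K : ℝ) := Real.one_le_sqrt.2 (by exact_mod_cast hK)
  set y := √(Real.log (p * K) / nS) with hy
  have hy0 : 0 ≤ y := Real.sqrt_nonneg _
  rw [le_div_iff₀ (by linarith)]
  refine le_trans ?_ h2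
  have h3 : M * (2 * c) ≤ 4 * G := by
    have h4 : (1 : ℝ) ≤ M + c₁ := by linarith
    have h5 : M ≤ c₁ * (M + c₁) := by
      have := mul_le_mul_of_nonneg_left h4 (by linarith : 0 ≤ c₁)
      linarith
    have h6 := mul_le_mul_of_nonneg_left h5 (by linarith : 0 ≤ c)
    have h7 : 0 ≤ c * M := by positivity
    rw [hG]
    linarith
  have h4 : (p : ℝ) * 1 ≤ p ^ 2 * √K := by
    refine mul_le_mul ?_ hKs zero_le_one (by positivity)
    exact le_self_pow₀ hp' (by norm_num)
  calc p * (M * y) * (2 * c) = M * (2 * c) * (p * 1 * y) := by ring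
    _ ≤ 4 * G * (p ^ 2 * √K * y) := by
        refine mul_le_mul h3 (mul_le_mul_of_nonneg_right h4 hy0) (by positivity) ?_
        rw [hG]
        have : 0 ≤ c₁ := by linarith
        positivity

/-- Either regime puts the covariance deviation in the range where Bernstein's inequality is
Gaussian. -/
lemma SourceRegime.mul_sqrt_le_one (h : SourceRegime K p nS s M c G) (hc : 1 ≤ c) (hM : 1 ≤ M)
    (hc₁ : c₁ = 8 * M) (hG : G = 4 * c * c₁ * (M + c₁)) (hp : 2 ≤ p) (hK : 1 ≤ K) (hs : 1 ≤ s) :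
    M * √(Real.log (p * K) / nS) ≤ 1 := by
  have hM0 : 0 ≤ M := by linarith
  have hp' : (2 : ℝ) ≤ p := by exact_mod_cast hp
  have hs' : (1 : ℝ) ≤ s := by exact_mod_cast hs
  rcases h with ⟨h1, h2⟩ | h2
  · have h3 := mul_le_mul_of_nonneg_left (sqrt_log_mul_le_of_few (nS := nS) hp hK h1) hM0
    have h4 : 1 / c ≤ 1 := by rw [div_le_one (by linarith)]; exact hc
    have h5 : 4 * M * √(Real.log p / nS) ≤ s * (4 * M * √(Real.log p / nS)) :=
      le_mul_of_one_le_left (by positivity) hs'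
    have h6 : 0 ≤ s * (4 * M * √(Real.log p / nS)) := by positivity
    linarith
  · have h3 := mul_sqrt_log_le hc hM hc₁ hG (by omega) hK h2
    have h4 : 1 / (2 * c) ≤ 1 := by rw [div_le_one (by linarith)]; linarith
    have h5 : M * √(Real.log (p * K) / nS) ≤ p * (M * √(Real.log (p * K) / nS)) :=
      le_mul_of_one_le_left (by positivity) (by linarith)
    linarith

/-- On a good event, the source designs are well behaved and the debiased estimators satisfy the
noise conditions of the fused step. -/
lemma SourceRegime.fusedNoise (hreg : SourceRegime K p nS s M c G)
    {X0 : Matrix (Fin nT) (Fin p) ℝ} {ε0 : Fin nT → ℝ}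
    {X : Fin K → Matrix (Fin nS) (Fin p) ℝ} {S : Fin K → Matrix (Fin p) (Fin p) ℝ}
    {ε : Fin K → Fin nS → ℝ} {β0 : Fin p → ℝ} {β : Fin K → Fin p → ℝ}
    (hK : 1 ≤ K) (hp : 2 ≤ p) (hs : 1 ≤ s) (hnT : 0 < nT) (hTS : nT ≤ nS)
    (hh : ∀ k, h k ≤ κ₂ * hbar nT nS h ∧ hbar nT nS h ≤ κ₂ * h k) (hc : 1 ≤ c) (hM : 1 ≤ M)
    (hc₁ : c₁ = 8 * M) (hη : 0 < η) (hη1 : η ≤ 1)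
    (hc₀ : 112 * c * c₁ ^ 2 + 8 * c₁ + 4 * M + 1 ≤ η * c₀) (hG : G = 4 * c * c₁ * (M + c₁))
    (hB : 2 * c ≤ B) (hX0 : ∀ j, sampleCov X0 j j ≤ B)
    (hS : ∀ k, ∀ v : Fin p → ℝ, 1 / c * sqNorm v ≤ v ⬝ᵥ (S k *ᵥ v) ∧
      v ⬝ᵥ (S k *ᵥ v) ≤ c * sqNorm v)
    (hX : ∀ k, CovClose (X k) (S k) c (M * √(Real.log (p * K) / nS)))
    (hnoise : NoiseBound M η
      (fun k => tuneLam c₀ p nT nS s h * tuneWeight c₀ p nT nS s h k)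
      (fun j => truncVec B (scoreDir X0 j)) (fun k j => truncVec B (scoreDir (X k) j))
      (fun k j => truncVec B (debiasDir (X k) (c₁ * √(Real.log p / nS)) j)) ε0 ε)
    (hβ0 : l0 β0 ≤ s) (hβ : ∀ k, l1 (β k - β0) ≤ h k) :
    (∃ κ t, ∀ k, SourceDesign (X k) κ t (c₁ * √(Real.log p / nS)) B) ∧
    (∀ j, |score X0 ε0 j| ≤ M * √(Real.log p / nT)) ∧
    ∀ bt : Fin K → Fin p → ℝ,
      (∀ k, IsDebiasedLasso (X k) (X k *ᵥ β k + ε k) (c₁ * √(Real.log p / nS))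
        (c₁ * √(Real.log p / nS)) (bt k)) →
      FusedNoise η (tuneLam c₀ p nT nS s h) ((nS : ℝ) / total K nT nS)
        √(Real.log p / total K nT nS)
        (fun k => tuneLam c₀ p nT nS s h * tuneWeight c₀ p nT nS s h k)
        ((1 / total K nT nS) • (X0ᵀ *ᵥ ε0)) (fun k => bt k - β k) := by
  have hnS : 0 < nS := hnT.trans_le hTS
  have hc0 : 0 < c := by linarith
  have hn : (0 : ℝ) < nS := by exact_mod_cast hnS
  have hl : 0 < Real.log p := Real.log_pos (by exact_mod_cast hp)
  have hT0 : 0 < √(Real.log p / nS) := by positivity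
  have hc₁0 : 0 < c₁ := by linarith
  have ht1 := hreg.mul_sqrt_le_one hc hM hc₁ hG hp hK hs
  have hR : 0 ≤ 112 * c * c₁ ^ 2 + 8 * c₁ := by positivity
  obtain ⟨n1, n2, n3, n4, n5, n6⟩ := hnoise
  simp only [truncVec_scoreDir hX0, scoreDir_dotProduct] at n1
  have design : ∀ κ t, (∀ k, SourceDesign (X k) κ t (c₁ * √(Real.log p / nS)) B) →
      (∀ k j, |score (X k) (ε k) j| ≤ M * √(Real.log (p * K) / nS)) ∧
      ∀ k j, truncVec B (debiasDir (X k) (c₁ * √(Real.log p / nS)) j)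
        = debiasDir (X k) (c₁ * √(Real.log p / nS)) j := by
    refine fun κ t hd => ⟨fun k j => ?_, fun k j => (hd k).truncVec_debiasDir j⟩
    have := n2 (k, j)
    simp only [truncVec_scoreDir (hd k).diag, scoreDir_dotProduct] at this
    exact this
  rcases hreg with ⟨h1, h2⟩ | h2
  · have hfew := mul_le_mul_of_nonneg_left (sqrt_log_mul_le_of_few (nS := nS) hp hK h1)
      (by linarith : 0 ≤ M)
    have e1 : M * (4 * √(Real.log p / nS)) = 4 * M * √(Real.log p / nS) := by ring
    rw [e1] at hfew
    have hlt : M * √(Real.log (p * K) / nS) < c₁ * √(Real.log p / nS) := by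
      refine hfew.trans_lt ?_
      rw [hc₁]
      exact mul_lt_mul_of_pos_right (by linarith) hT0
    have hd : ∀ k, SourceDesign (X k) (1 / c) (4 * M * √(Real.log p / nS))
        (c₁ * √(Real.log p / nS)) B := by
      intro k
      have hk := (hX k).sourceDesign (hS k) hlt (B := B) (by linarith)
      refine ⟨fun v => le_trans ?_ (hk.lower v), hk.diag, hk.feasible⟩
      have := mul_le_mul_of_nonneg_right hfew (sq_nonneg (l1 v))
      linarith
    obtain ⟨d1, d2⟩ := design _ _ hd
    simp only [d2] at n3 n4
    exact ⟨⟨_, _, hd⟩, n1, fun bt hbt => fusedNoise_of_few_sources hK hp hs hnT hnS hh hc hM hc₁ hη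
      hη1 (by linarith) h2 hd n1 (fun k j => (d1 k j).trans hfew)
      (fun k j => (n3 (k, j)).trans hfew) n4 hβ0 hβ hbt⟩
  · have hpt := mul_sqrt_log_le hc hM hc₁ hG (by omega) hK h2
    have hd : ∀ k, SourceDesign (X k) (1 / (2 * c)) 0 (c₁ * √(Real.log p / nS)) B := fun k =>
      (hX k).sourceDesign_of_mul_le (hS k) hc0 (by positivity) (by positivity) hpt (by linarith) hB
    obtain ⟨d1, d2⟩ := design _ _ hd
    simp only [d2] at n4 n5 n6
    have hy : √(Real.log p / nS) ≤ √(Real.log (p * K) / nS) := by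
      have hp0 : (0 : ℝ) < p := by exact_mod_cast (by omega : 0 < p)
      have hK' : (1 : ℝ) ≤ K := by exact_mod_cast hK
      exact Real.sqrt_le_sqrt (div_le_div_of_nonneg_right
        (Real.log_le_log hp0 (le_mul_of_one_le_right hp0.le hK')) hn.le)
    exact ⟨⟨_, _, hd⟩, n1, fun bt hbt => fusedNoise_of_many_sources hK hp hnT hTS hh hc hM hc₁0 hη
      (by linarith) hy hG h2 hd n1 d1 n4 n5 n6 hβ hbt⟩

end

lemma exists_isOutput {K p nT nS s : ℕ} {h : Fin K → ℝ} {c₀ lamT lamS mu : ℝ} (hK : 1 ≤ K)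
    (hp : 2 ≤ p) (hnS : 0 < nS) (hc₀ : 0 < c₀) (hh : ∀ k, 0 ≤ h k) (hlamS : 0 < lamS)
    (hlamT : 0 < lamT) {X : Fin K → Matrix (Fin nS) (Fin p) ℝ} {κ t B : ℝ}
    (hX : ∀ k, SourceDesign (X k) κ t mu B) (X0 : Matrix (Fin nT) (Fin p) ℝ) (y0 : Fin nT → ℝ)
    (y : Fin K → Fin nS → ℝ) :
    ∃ b, IsOutput X0 y0 X y lamS mu (tuneLam c₀ p nT nS s h) (tuneWeight c₀ p nT nS s h) lamT b := by
  have : Nonempty (Fin K) := ⟨⟨0, by omega⟩⟩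
  choose bt hbt using fun k => (hX k).exists_isDebiasedLasso (y k) hlamS
  obtain ⟨b, hb⟩ := exists_isMinOn_fusedObj nS X0 y0 bt
    (tuneLam_pos (nT := nT) (s := s) hK hp hnS hc₀ hh)
    (fun k => tuneWeight_pos (nT := nT) (s := s) hK hp hnS hc₀ hh k)
  obtain ⟨δ, hδ⟩ := exists_isLasso X0 (y0 - X0 *ᵥ weightedAvg nT nS b) hlamT
  exact ⟨_, bt, b, δ, hbt, hb, hδ, rfl⟩

/-! ### Assembling the good event -/

section

variable {Ω : Type*} [MeasurableSpace Ω] {μ : Measure Ω} [IsProbabilityMeasure μ]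
  {K p nT nS s : ℕ} {h : Fin K → ℝ} {c₀ c₁ κ₂ κ₃ M η c G B b Cr : ℝ} {L V : ℝ≥0}

lemma measure_not_le_of_imp {P Q : Ω → Prop} {q c₂ : ℝ} (hPQ : ∀ ω, P ω → Q ω)
    (hP : μ.real {ω | ¬ P ω} ≤ q / p) (hq : q ≤ c₂) (hp : 0 < p) :
    μ {ω | ¬ Q ω} ≤ ENNReal.ofReal (c₂ * Real.exp (-(1 * Real.log p))) := by
  have hp' : (0 : ℝ) < p := by exact_mod_cast hp
  rw [one_mul, Real.exp_neg, Real.exp_log hp', ← div_eq_mul_inv]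
  rw [← ofReal_measureReal (measure_ne_top μ _)]
  refine ENNReal.ofReal_le_ofReal ?_
  refine (measureReal_mono (fun ω hω => ?_) (measure_ne_top μ _)).trans
    (hP.trans (div_le_div_of_nonneg_right hq hp'.le))
  rw [Set.mem_ofPred_eq] at hω ⊢
  exact fun h => hω (hPQ ω h)

lemma measure_le_of_le {E : Set Ω} {c₂ : ℝ} (hp : 0 < p) (hc₂ : p ≤ c₂) :
    μ E ≤ ENNReal.ofReal (c₂ * Real.exp (-(1 * Real.log p))) := by
  have hp' : (0 : ℝ) < p := by exact_mod_cast hp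
  rw [one_mul, Real.exp_neg, Real.exp_log hp', ← div_eq_mul_inv]
  refine prob_le_one.trans ?_
  rw [ENNReal.one_le_ofReal, le_div_iff₀ hp', one_mul]
  exact hc₂

theorem goodEvent_tail {S0 : Matrix (Fin p) (Fin p) ℝ} {S : Fin K → Matrix (Fin p) (Fin p) ℝ}
    {x0 : Ω → Fin nT → Fin p → ℝ} {x : Fin K → Ω → Fin nS → Fin p → ℝ}
    {e0 : Ω → Fin nT → ℝ} {e : Fin K → Ω → Fin nS → ℝ}
    (hx0 : SubGaussianDesign μ x0 S0 L c) (hx : ∀ k, SubGaussianDesign μ (x k) (S k) L c)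
    (he : GaussianErrors μ x0 x e0 e V) (hK : 1 ≤ K) (hp : 2 ≤ p) (hnT : 0 < nT) (hTS : nT ≤ nS)
    (hh0 : ∀ k, 0 ≤ h k) (hh : ∀ k, hbar nT nS h ≤ κ₂ * h k) (hc : 1 ≤ c) (hM : 1 ≤ M)
    (hη : 0 < η) (hc₀ : 0 < c₀) (hκ₃ : 0 < κ₃) (hκn : κ₃ * Real.log p ≤ nT)
    (hB : B = 2 * c + 4 * (L + 1) * (1 + 2 / κ₃)) (hb : b = (V + 1) * B)
    (hMb : 6 * b ≤ M ^ 2) (hML : 19200 * ((L + 1) * c ^ 2) ^ 2 ≤ M ^ 2) (hbc₀ : b ≤ c₀ ^ 2)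
    (hCr : Cr = 1200 * (L + 1) ^ 2 * (36 * c + 24 * c ^ 2 * (4 * (L + 1) * (1 + 2 / κ₃))))
    (hM1 : M * √(Real.log (p * K) / nS) ≤ 1) (mu : ℝ) :
    μ.real {ω | ¬ (RestrictedBound (Matrix.of (x0 ω)) (1 / (2 * c)) (2 * c) Cr B ∧
      (∀ k, CovClose (Matrix.of (x k ω)) (S k) c (M * √(Real.log (p * K) / nS))) ∧
      NoiseBound M η (fun k => tuneLam c₀ p nT nS s h * tuneWeight c₀ p nT nS s h k)
        (fun j => truncVec B (scoreDir (Matrix.of (x0 ω)) j))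
        (fun k j => truncVec B (scoreDir (Matrix.of (x k ω)) j))
        (fun k j => truncVec B (debiasDir (Matrix.of (x k ω)) mu j)) (e0 ω) (fun k => e k ω))}
      ≤ (23 + 4 / η + 8 * b / Real.log 2 ^ 2) / p := by
  have hnS : 0 < nS := hnT.trans_le hTS
  have hL : (0 : ℝ) ≤ L := L.coe_nonneg
  have hB0 : 0 < B := by rw [hB]; positivity
  have hlam := tuneLam_pos (nT := nT) (s := s) hK hp hnS hc₀ hh0
  have h1 := hx0.restrictedBound_tail hc hnT hp hκ₃ hκn rfl hCr
  have h1' : μ.real {ω | ¬ RestrictedBound (Matrix.of (x0 ω)) (1 / (2 * c)) (2 * c) Cr B}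
      ≤ 3 / p := by
    refine (measureReal_mono (fun ω hω => ?_) (measure_ne_top μ _)).trans h1
    rw [Set.mem_ofPred_eq] at hω ⊢
    exact fun hr => hω ⟨hr.lower, hr.upper, fun j => (hr.diag j).trans (by linarith)⟩
  have hLc : (1 : ℝ) ≤ (L + 1) * c ^ 2 :=
    one_le_mul_of_one_le_of_one_le (by linarith) (one_le_pow₀ hc)
  have h2 := covClose_tail hx hc hK (by omega) hnS (by linarith) hML (by linarith)
  -- The clipping level is at least 8c₀ times the noise scale (n_S/N)√(log p / n_S); b ≤ c₀² then
  -- gives 32b ≤ (8c₀)².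
  have h3 := noiseBound_random (mu := mu) (α := fun k =>
      tuneLam c₀ p nT nS s h * tuneWeight c₀ p nT nS s h k) (A := 8 * c₀) hx0.measurable
    (fun k => (hx k).measurable) he hK hp hnT hnS hB0 hb hη (by linarith) hMb (by linarith)
    (by rw [mul_pow]; linarith [sq_nonneg c₀]) (fun k => by
      have g := (le_tuneLam_mul_tuneWeight hlam hc₀.le hh0 k (hh k)).1
      have g1 : 0 ≤ c₀ * (8 * (s * √(Real.log p / total K nT nS) ^ 2)) := by positivity
      have g2 : 0 ≤ c₀ * (8 * ((nS : ℝ) / total K nT nS * √(Real.log p / nS) * h k)) := by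
        have := hh0 k
        have := total_nonneg K nT nS
        positivity
      linarith)
  refine (measureReal_not_and_le h1' (measureReal_not_and_le h2 h3)).trans (le_of_eq ?_)
  rw [← add_div, ← add_div]
  ring

end

end DTransFusion

end

/-! ### Choice of the constants and proof of the theorem -/

theorem theorem4 (c : ℝ) (hc : 0 < c) (L V : ℝ≥0) (κ₁ κ₂ κ₃ : ℝ)
    (hκ₁ : 0 < κ₁) (hκ₂ : 0 < κ₂) (hκ₃ : 0 < κ₃) :
    ∃ ε c₀ c₁ C c₂ c₃ : ℝ, 0 < ε ∧ 0 < c₀ ∧ 0 < c₁ ∧ 0 < C ∧ 0 < c₂ ∧ 0 < c₃ ∧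
      ∀ (K p nT nS s : ℕ) (h : Fin K → ℝ),
        1 ≤ K → 2 ≤ p → 1 ≤ s → nT ≤ nS →
        -- `n_S ≫ K s² log p`
        K * (s : ℝ) ^ 2 * Real.log p ≤ ε * nS →
        -- `n_S ≳ (h̄² ∨ K²) s log p`
        κ₁ * (max (DTransFusion.hbar nT nS h ^ 2) ((K : ℝ) ^ 2) * s * Real.log p) ≤ nS →
        -- `hₖ ≍ h̄`
        (∀ k, h k ≤ κ₂ * DTransFusion.hbar nT nS h ∧ DTransFusion.hbar nT nS h ≤ κ₂ * h k) →
        -- `n_T ≳ s log p`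
        κ₃ * (s * Real.log p) ≤ nT →
        -- `h̄ √(log p / n_T) = o(1)`
        DTransFusion.hbar nT nS h * √(Real.log p / nT) ≤ ε →
        ∀ (Ω : Type*) [MeasurableSpace Ω] (μ : Measure Ω) [IsProbabilityMeasure μ]
          (S0 : Matrix (Fin p) (Fin p) ℝ) (S : Fin K → Matrix (Fin p) (Fin p) ℝ)
          (x0 : Ω → Fin nT → Fin p → ℝ) (x : Fin K → Ω → Fin nS → Fin p → ℝ)
          (e0 : Ω → Fin nT → ℝ) (e : Fin K → Ω → Fin nS → ℝ)
          (β0 : Fin p → ℝ) (β : Fin K → Fin p → ℝ),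
          DTransFusion.SubGaussianDesign μ x0 S0 L c →
          (∀ k, DTransFusion.SubGaussianDesign μ (x k) (S k) L c) →
          DTransFusion.GaussianErrors μ x0 x e0 e V →
          DTransFusion.l0 β0 ≤ s →
          (∀ k, DTransFusion.l1 (β k - β0) ≤ h k) →
          let out : Ω → (Fin p → ℝ) → Prop := fun ω =>
            DTransFusion.IsOutput
              (Matrix.of (x0 ω)) (Matrix.of (x0 ω) *ᵥ β0 + e0 ω)
              (fun k => Matrix.of (x k ω)) (fun k => Matrix.of (x k ω) *ᵥ β k + e k ω)
              (c₁ * √(Real.log p / nS)) (c₁ * √(Real.log p / nS))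
              (DTransFusion.tuneLam c₀ p nT nS s h) (DTransFusion.tuneWeight c₀ p nT nS s h)
              (c₁ * √(Real.log p / nT))
          μ {ω | ¬ ((∃ b, out ω b) ∧ ∀ b, out ω b →
              DTransFusion.sqNorm (b - β0)
                ≤ C * (s * Real.log p / DTransFusion.total K nT nS
                    + √(Real.log p / nT) * DTransFusion.hbar nT nS h))}
            ≤ ENNReal.ofReal (c₂ * Real.exp (-(c₃ * Real.log p))) := by
  -- Constants must be fixed before any design is given. Once there is a design, its eigenvalues
  -- force c ≥ 1 and c' = c.
  obtain ⟨c', hc'⟩ : ∃ r : ℝ, r = max c 1 := ⟨_, rfl⟩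
  have hc1 : 1 ≤ c' := hc' ▸ le_max_right _ _
  have hc'0 : 0 < c' := by linarith
  obtain ⟨κ', hκ'⟩ : ∃ r : ℝ, r = max κ₂ 1 := ⟨_, rfl⟩
  have hκ1 : 1 ≤ κ' := hκ' ▸ le_max_right _ _
  have hκle : κ₂ ≤ κ' := hκ' ▸ le_max_left _ _
  have hL : (0 : ℝ) ≤ L := L.coe_nonneg
  have hV : (0 : ℝ) ≤ V := V.coe_nonneg
  obtain ⟨B₀, hB₀⟩ : ∃ r : ℝ, r = 4 * (L + 1) * (1 + 2 / κ₃) := ⟨_, rfl⟩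
  have hB₀0 : 0 < B₀ := by rw [hB₀]; positivity
  obtain ⟨B, hB⟩ : ∃ r : ℝ, r = 2 * c' + B₀ := ⟨_, rfl⟩
  obtain ⟨b, hb⟩ : ∃ r : ℝ, r = (V + 1) * B := ⟨_, rfl⟩
  have hb1 : 1 ≤ b := hb ▸ one_le_mul_of_one_le_of_one_le (by linarith) (by linarith)
  obtain ⟨M, hM⟩ : ∃ r : ℝ, r = 6 * b + 200 * ((L + 1) * c' ^ 2) := ⟨_, rfl⟩
  have hLc : (1 : ℝ) ≤ (L + 1) * c' ^ 2 :=
    one_le_mul_of_one_le_of_one_le (by linarith) (one_le_pow₀ hc1)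
  have hM1 : 1 ≤ M := by linarith
  have hM0 : 0 < M := by linarith
  have hMb : 6 * b ≤ M ^ 2 := by
    have := mul_le_mul_of_nonneg_right hM1 (by linarith : 0 ≤ M)
    linarith
  have hML : 19200 * ((L + 1) * c' ^ 2) ^ 2 ≤ M ^ 2 := by
    have h1 : (200 * ((L + 1) * c' ^ 2)) ^ 2 ≤ M ^ 2 :=
      pow_le_pow_left₀ (by positivity) (by linarith) 2
    have h2 := sq_nonneg ((L + 1) * c' ^ 2)
    rw [mul_pow] at h1
    linarith
  -- For K ≤ p¹⁰ the scores and covariance deviations are at most 4M√(log p / n_S); the lasso needs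
  -- twice that.
  obtain ⟨c₁, hc₁⟩ : ∃ r : ℝ, r = 8 * M := ⟨_, rfl⟩
  have hc₁0 : 0 < c₁ := by linarith
  obtain ⟨η, hη⟩ : ∃ r : ℝ, r = DTransFusion.margin κ' := ⟨_, rfl⟩
  have hη0 : 0 < η := hη ▸ DTransFusion.margin_pos hκ1
  have hη1 : η ≤ 1 := hη ▸ (DTransFusion.margin_le hκ1).trans (by norm_num)
  obtain ⟨c₀, hc₀⟩ : ∃ r : ℝ, r = (112 * c' * c₁ ^ 2 + 8 * c₁ + 4 * M + 1) / η + b := ⟨_, rfl⟩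
  have hc₀b : b ≤ c₀ := by
    have : 0 ≤ (112 * c' * c₁ ^ 2 + 8 * c₁ + 4 * M + 1) / η := by positivity
    linarith
  have hc₀0 : 0 < c₀ := by linarith
  have hbc₀ : b ≤ c₀ ^ 2 := by
    have := mul_le_mul_of_nonneg_right (hb1.trans hc₀b) hc₀0.le
    linarith
  have hηc₀ : 112 * c' * c₁ ^ 2 + 8 * c₁ + 4 * M + 1 ≤ η * c₀ := by
    rw [hc₀, mul_add, mul_div_cancel₀ _ hη0.ne']
    have : 0 ≤ η * b := by positivity
    linarith
  obtain ⟨G, hG⟩ : ∃ r : ℝ, r = 4 * c' * c₁ * (M + c₁) := ⟨_, rfl⟩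
  have hG0 : 0 ≤ G := by rw [hG]; positivity
  obtain ⟨Cr, hCr⟩ : ∃ r : ℝ, r = 1200 * (L + 1) ^ 2 * (36 * c' + 24 * c' ^ 2 * B₀) := ⟨_, rfl⟩
  have hCr0 : 0 ≤ Cr := by rw [hCr]; positivity
  obtain ⟨ε₁, C, hε₁, -, hC, hmain⟩ := DTransFusion.two_step_error (κ₂ := κ') (κ₃ := κ₃)
    (κ := 1 / (2 * c')) (Cr := Cr) (Cu := 2 * c') (c₀ := c₀) (c₁ := c₁) hκ1 hκ₃ (by positivity)
    (by rw [div_le_one (by positivity)]; linarith) hCr0 (by positivity) hc₀0 hc₁0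
  rw [← hη] at hmain
  obtain ⟨q, hq⟩ : ∃ r : ℝ, r = 23 + 4 / η + 8 * b / Real.log 2 ^ 2 := ⟨_, rfl⟩
  have hq0 : 0 < q := by rw [hq]; positivity
  obtain ⟨p₀, hp₀⟩ : ∃ r : ℝ, r = 128 * G ^ 2 / κ₁ := ⟨_, rfl⟩
  have hp₀0 : 0 ≤ p₀ := by rw [hp₀]; positivity
  -- The second entry of the minimum is the sparsity condition 128·s·4M√(log p / n_S) ≤ 1/c' of the
  -- regime with few sources, squared.
  refine ⟨min ε₁ (1 / (512 * M * c') ^ 2), c₀, c₁, C, q + p₀, 1,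
    lt_min hε₁ (by positivity), hc₀0, hc₁0, hC,
    by positivity, one_pos, ?_⟩
  intro K p nT nS s h hK hp hs hTS hKs hκn hhb hTn hgε Ω _ μ _ S0 S x0 x e0 e β0 β hx0 hx he hβ0
    hβ out
  have hp0 : 0 < p := by omega
  have hl : 0 < Real.log p := Real.log_pos (by exact_mod_cast hp)
  have hs' : (1 : ℝ) ≤ s := by exact_mod_cast hs
  have hK' : (1 : ℝ) ≤ K := by exact_mod_cast hK
  -- For p < p₀ the bound c₂/p is at least 1, because c₂ ≥ p₀.
  rcases le_or_gt p₀ p with hpp | hpp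
  swap
  · exact DTransFusion.measure_le_of_le hp0 (by linarith)
  -- An empty target sample is excluded by κ₃ s log p ≤ n_T.
  have hnT : 0 < nT := by
    have h1 : (0 : ℝ) < nT := lt_of_lt_of_le (by positivity) hTn
    exact_mod_cast h1
  have hnS : 0 < nS := hnT.trans_le hTS
  have hnS' : (0 : ℝ) < nS := by exact_mod_cast hnS
  have hcc : c' = c := hc' ▸ max_eq_left (hx0.one_le hc hnT hp0)
  have hh0 : ∀ k, 0 ≤ h k := fun k => (DTransFusion.l1_nonneg _).trans (hβ k)
  have hhbar : 0 ≤ DTransFusion.hbar nT nS h := DTransFusion.hbar_nonneg hh0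
  have hh : ∀ k, h k ≤ κ' * DTransFusion.hbar nT nS h ∧ DTransFusion.hbar nT nS h ≤ κ' * h k :=
    fun k => ⟨(hhb k).1.trans (mul_le_mul_of_nonneg_right hκle hhbar),
      (hhb k).2.trans (mul_le_mul_of_nonneg_right hκle (hh0 k))⟩
  have hls : Real.log p ≤ s * Real.log p := le_mul_of_one_le_left hl.le hs'
  have hreg : DTransFusion.SourceRegime K p nS s M c' G := by
    rcases le_or_gt K (p ^ 10) with hKp | hKp
    · refine Or.inl ⟨hKp, ?_⟩
      have h1 : (s : ℝ) ^ 2 * Real.log p ≤ 1 / (512 * M * c') ^ 2 * nS := by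
        have h2 : (1 : ℝ) * ((s : ℝ) ^ 2 * Real.log p) ≤ K * ((s : ℝ) ^ 2 * Real.log p) :=
          mul_le_mul_of_nonneg_right hK' (by positivity)
        have h3 := mul_le_mul_of_nonneg_right (min_le_right ε₁ (1 / (512 * M * c') ^ 2)) hnS'.le
        linarith
      have h4 : s * √(Real.log p / nS) ≤ 1 / (512 * M * c') := by
        refine (Real.abs_le_sqrt (le_refl _)).trans' (le_abs_self _) |>.trans ?_
        refine Real.sqrt_le_iff.2 ⟨by positivity, ?_⟩
        rw [mul_pow, Real.sq_sqrt (by positivity), mul_div_assoc', div_le_iff₀ hnS', div_pow,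
          one_pow]
        exact h1
      have h5 := mul_le_mul_of_nonneg_left h4 (by positivity : 0 ≤ 512 * M)
      have e1 : 512 * M * (1 / (512 * M * c')) = 1 / c' := by field_simp
      rw [e1] at h5
      linarith
    · refine Or.inr (DTransFusion.many_sources_bound hκ₁ hp hKp hnS ?_ hG0 (hp₀ ▸ hpp))
      refine le_trans (mul_le_mul_of_nonneg_left ?_ hκ₁.le) hκn
      rw [mul_assoc]
      exact mul_le_mul (le_max_right _ _) hls hl.le (by positivity)
  have hgood := DTransFusion.goodEvent_tail (c := c') (κ₂ := κ') (κ₃ := κ₃) (M := M) (η := η)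
    (c₀ := c₀) (B := B) (b := b) (Cr := Cr) (hcc ▸ hx0) (fun k => hcc ▸ hx k) he hK hp hnT hTS hh0
    (fun k => (hh k).2) hc1 hM1 hη0 hc₀0 hκ₃
    ((mul_le_mul_of_nonneg_left hls hκ₃.le).trans hTn) (hB₀ ▸ hB) hb hMb hML hbc₀ (hB₀ ▸ hCr)
    (hreg.mul_sqrt_le_one hc1 hM1 hc₁ hG hp hK hs) (c₁ * √(Real.log p / nS)) (s := s)
  refine DTransFusion.measure_not_le_of_imp (fun ω hω => ?_) hgood (by linarith) hp0
  obtain ⟨g1, g2, g3⟩ := hω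
  obtain ⟨⟨κ, t, d1⟩, d2, d3⟩ := hreg.fusedNoise hK hp hs hnT hTS hh hc1 hM1 hc₁ hη0 hη1 hηc₀ hG
    (by linarith) g1.diag (fun k v => by rw [hcc]; exact (hx k).quadForm_bounds hnS v) g2 g3 hβ0 hβ
  have hlT : 0 < √(Real.log p / nT) := by
    have : (0 : ℝ) < nT := by exact_mod_cast hnT
    positivity
  have hlS : 0 < √(Real.log p / nS) := by positivity
  refine ⟨DTransFusion.exists_isOutput hK hp hnS hc₀0 hh0 (by positivity) (by positivity) d1 _ _ _,
    ?_⟩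
  rintro _ ⟨bt, b', δ, hbt, hb', hδ, rfl⟩
  obtain ⟨f1, ⟨γ, f2, f3⟩, f4⟩ := d3 bt hbt
  refine hmain K p nT nS s h hK hp hs hnT hTS
    (hKs.trans (mul_le_mul_of_nonneg_right (min_le_left _ _) hnS'.le)) hh hTn
    (hgε.trans (min_le_left _ _)) (Matrix.of (x0 ω)) (e0 ω) β0 (fun k => β k - β0)
    (fun k => bt k - β k) bt _ γ b' δ hβ0 hβ g1.lower g1.upper (fun j => ?_)
    (fun k => by abel) (fun k j => rfl) (fun j => ?_) f2 f3 ?_ hb' hδ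
  · refine (d2 j).trans ?_
    rw [hc₁]
    have := mul_nonneg (by linarith : 0 ≤ M) hlT.le
    linarith
  · rw [Pi.add_apply, Finset.sum_apply]
    exact f1 j
  · refine le_trans (le_of_eq ?_) f4
    refine Finset.sum_congr rfl fun j _ => ?_
    rw [Finset.sum_apply]
    rfl
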